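/- For $\alpha>0$ let $\mathbb H^3(\alpha)$ be the hyperbolic cone with metric $dr^2+\sinh^2 r\,d\theta^2+\cosh^2 r\,ds^2$, $s\in\mathbb R$, $r\ge 0$, $\theta\in\mathbb R/\alpha\mathbb Z$. A compact hyperbolic cone-manifold without vertices is a compact connected Hausdorff space $M$ with an atlas in which every point $x$ has a neighbourhood modelled on a neighbourhood of a point of the axis $r=0$ of $\mathbb H^3(\alpha_x)$ for some cone angle $\alpha_x>0$ at $x$, and all changes of charts are local isometries; its singular locus is $\{x : \alpha_x\neq 2\pi\}$. An infinitesimal deformation of $M$ preserving the cone angles is a first-order variation of the charts, with fixed models $\mathbb H^3(\alpha_x)$, such that the changes of charts remain local isometries to first order; it is trivial if the first-order variation of the local distances that it induces is that of moving the points of $M$ along a vector field on $M$. $M$ is infinitesimally flexible if it has a non-trivial infinitesimal deformation preserving the cone angles. A twisted octahedron is the polyhedron in $\mathbb R^3$ bounded by the triangles $ABC$, $A'B'C'$, $ABC'$, $AB'C$, $A'BC$, $AB'C'$, $A'BC'$, $A'B'C$, where $ABC$ is equilateral and $A'B'C'$ is its image under a screw motion with rotation angle $\pi/2$ whose axis is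 orthogonal to the plane of $ABC$ and passes through its centre. If, for a ball with the same centre regarded as the Klein model of $\mathbb H^3$, all vertices lie outside the closed ball and all edges meet the open ball, then the part of the octahedron in the open ball, truncated by the polar planes of the vertices, is a truncated hyperideal twisted octahedron. Theorem. (i) There is a compact non-orientable infinitesimally flexible hyperbolic cone-manifold without vertices (of dimension $3$) whose singular locus has exactly three connected components. (ii) There is a compact orientable infinitesimally flexible hyperbolic cone-manifold without vertices (of dimension $3$) whose singular locus has exactly four connected components. In both cases exactly one component of the singular locus has cone angle larger than $2\pi$, and the cone-manifold can be chosen to be glued from finitely many copies of a truncated hyperideal twisted octahedron by isometries between their faces. -/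

import Mathlib

open Filter Topology

noncomputable section

/-!  ## The model spaces

The hyperbolic cone `ℍ³(α)` of cone angle `α` is the space with metric
`dr² + sinh² r dθ² + cosh² r ds²`, where `s ∈ ℝ`, `r ≥ 0` and `θ ∈ ℝ / αℤ`.  It is the hyperbolic
cone over the spherical suspension of a circle of length `α`, a spherical cone surface with two
cone points if `α ≠ 2π` and the round sphere if `α = 2π`.  The point `(s, r, θ)` is written as
`(s, w) : ℝ × ℂ` with `w = sinh r * exp (i * 2πθ/α)`; the axis is `w = 0`, and `ℍ³(2π) = ℍ³`. -/

/-- `cosh` of the distance of two points of `ℍ³(α)`.  (If the two points are seen from the axis at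
an angle `≥ π`, a shortest path between them meets the axis.) -/
def coneCosh (α : ℝ) (p q : ℝ × ℂ) : ℝ :=
  √(1 + ‖p.2‖ ^ 2) * √(1 + ‖q.2‖ ^ 2) * Real.cosh (p.1 - q.1)
    - ‖p.2‖ * ‖q.2‖ *
      Real.cos (min Real.pi (α / (2 * Real.pi) * InnerProductGeometry.angle p.2 q.2))

/-! ## Hyperbolic cone-manifolds without vertices -/

/-- A structure of a three-dimensional hyperbolic cone-manifold without vertices on `M`: every
point `x` has a neighbourhood modelled on a neighbourhood of a point of the axis of `ℍ³(α)`, for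
some `α = angle x > 0`, and the changes of charts are local isometries.  A compact connected
Hausdorff `M` carries a unique length metric for which all charts are local isometries. -/
structure HypConeStructure (M : Type) [TopologicalSpace M] where
  angle : M → ℝ
  angle_pos : ∀ x, 0 < angle x
  chart : M → OpenPartialHomeomorph M (ℝ × ℂ)
  mem_source : ∀ x, x ∈ (chart x).source
  chart_self : ∀ x, chart x x = 0
  isometric : ∀ x y p, p ∈ (chart x).source → p ∈ (chart y).source →
    ∀ᶠ ab : M × M in 𝓝 (p, p),
      coneCosh (angle x) (chart x ab.1) (chart x ab.2)
        = coneCosh (angle y) (chart y ab.1) (chart y ab.2)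

namespace HypConeStructure

variable {M : Type} [TopologicalSpace M] (C : HypConeStructure M)

/-- The singular locus: the points at which the cone angle is not `2π`. -/
def singularLocus : Set M := {x | C.angle x ≠ 2 * Real.pi}

/-- The set of points of `M` with cone angle larger than `2π` is one connected component of the
singular locus (the cone angle is constant along each component). -/
def ExactlyOneLargeComponent : Prop :=
  ∃ c : ConnectedComponents C.singularLocus, ∀ x : C.singularLocus,
    2 * Real.pi < C.angle x ↔ (x : ConnectedComponents C.singularLocus) = c

/-- Change of coordinates from the chart centred at `x` to the chart centred at `y`. -/
def change (x y : M) : ℝ × ℂ → ℝ × ℂ := fun p => C.chart y ((C.chart x).symm p)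

/-- `M` is orientable: one can choose an orientation (a sign relative to the chart centred at `x`)
at every point `x`, coherently for nearby points.  Changes of charts `x → y` are differentiable at
the coordinates of `y`, with invertible derivative. -/
def Orientable : Prop :=
  ∃ o : M → ℝ, (∀ x, o x = 1 ∨ o x = -1) ∧
    ∀ x, ∀ᶠ y in 𝓝 x, 0 < o x * o y * (fderiv ℝ (C.change x y) (C.chart x y)).det

/-- `c` is the rate of change of `cosh` of the distance of the points `a` and `b`, measured in the
chart centred at `x`, when the coordinates of `a` and `b` move with velocities `ξ a` and `ξ b`. -/
def HasRate (x : M) (ξ : M → ℝ × ℂ) (a b : M) (c : ℝ) : Prop :=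
  HasDerivAt (fun t : ℝ => coneCosh (C.angle x) (C.chart x a + t • ξ a) (C.chart x b + t • ξ b)) c 0

/-- The chart variations `ξ` (in the chart centred at `x`) and `η` (in the chart centred at `y`)
induce the same first-order variation of the metric of `M` near the point `y`.
Points opposite to each other with respect to the axis are not compared: for `α < 2π` they are cut
points of each other, where the distance function of `ℍ³(α)` is not differentiable. -/
def SameRatesNear (x : M) (ξ : M → ℝ × ℂ) (y : M) (η : M → ℝ × ℂ) : Prop :=
  ∀ᶠ ab : M × M in 𝓝 (y, y),
    InnerProductGeometry.angle (C.chart y ab.1).2 (C.chart y ab.2).2 ≠ Real.pi →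
      ∃ c, C.HasRate x ξ ab.1 ab.2 c ∧ C.HasRate y η ab.1 ab.2 c

/-- An infinitesimal deformation of the cone-manifold `M` that preserves the cone angles: a
first-order variation `C.chart x + t • ξ x` of the chart centred at `x`, for every `x`, with fixed
models `ℍ³(angle x)`, such that the changes of charts remain local isometries to first order. -/
def IsInfDeformation (ξ : M → M → ℝ × ℂ) : Prop :=
  ∀ x, ∀ᶠ y in 𝓝 x, C.SameRatesNear x (ξ x) y (ξ y)

/-- The coordinates, in the chart centred at `x`, of the vector field `v` on `M`; here `v a` is
given by its coordinates in the chart centred at `a`. -/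
def fieldInChart (v : M → ℝ × ℂ) (x : M) : M → ℝ × ℂ :=
  fun a => fderiv ℝ (C.change a x) (C.chart a a) (v a)

/-- An infinitesimal deformation is trivial if its effect on the metric of `M` is that of moving
the points of `M` along a vector field on `M`. -/
def IsTrivialDeformation (ξ : M → M → ℝ × ℂ) : Prop :=
  ∃ v : M → ℝ × ℂ, ∀ x, C.SameRatesNear x (ξ x) x (C.fieldInChart v x)

/-- Infinitesimal flexibility: there is a non-trivial infinitesimal deformation that preserves the
cone angles.  (No regularity is imposed on the fields `ξ x` and `v`: local infinitesimal
isometries are smooth, and modulo these the quotient does not depend on the class of fields; it is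
the first cohomology of `M` with values in the sheaf of local infinitesimal isometries.) -/
def InfinitesimallyFlexible : Prop :=
  ∃ ξ : M → M → ℝ × ℂ, C.IsInfDeformation ξ ∧ ¬ C.IsTrivialDeformation ξ

end HypConeStructure

/-! ## The truncated hyperideal twisted octahedron -/

/-- The scalar product of Minkowski space. -/
def mink (x y : Fin 4 → ℝ) : ℝ := -(x 0 * y 0) + x 1 * y 1 + x 2 * y 2 + x 3 * y 3

/-- The vertices `A, B, C` (for `b = false`) and `A', B', C'` (for `b = true`) of the twisted
octahedron in the affine hyperplane `x₀ = 1` of Minkowski space.  The open unit ball of this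
hyperplane is the Klein model.  The triangle `ABC` is equilateral, and `A'B'C'` is its image under a
screw motion about the third coordinate axis with rotation angle `π / 2`. -/
def octVertex (a h : ℝ) (b : Bool) (k : Fin 3) : Fin 4 → ℝ :=
  let φ : ℝ := 2 * Real.pi * (k : ℕ) / 3 + if b then Real.pi / 2 else 0
  ![1, a * Real.cos φ, a * Real.sin φ, if b then h else -h]

/-- The vertices of the twisted octahedron lie outside the closed unit ball, and its edges meet the
open unit ball. -/
def OctHyperideal (a h : ℝ) : Prop :=
  0 < a ∧ 0 < h ∧
  (∀ b k, 0 < mink (octVertex a h b k) (octVertex a h b k)) ∧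
  ∀ b k b' k', k ≠ k' → ∃ y ∈ segment ℝ (octVertex a h b k) (octVertex a h b' k'), mink y y < 0

/-- The truncated hyperideal twisted octahedron in the hyperboloid model of `ℍ³`.  The eight
triangles of the octahedron are obtained by choosing one vertex of each of the pairs `AA'`, `BB'`,
`CC'`; the octahedron is the union of their joins with its centre, and it is truncated by the
polar planes of its vertices. -/
def truncOct (a h : ℝ) : Set (Fin 4 → ℝ) :=
  {x | mink x x = -1 ∧ 0 < x 0 ∧
    (∃ (σ : Fin 3 → Bool) (c₀ : ℝ) (c : Fin 3 → ℝ), 0 ≤ c₀ ∧ (∀ k, 0 ≤ c k) ∧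
      x = c₀ • ![1, 0, 0, 0] + ∑ k, c k • octVertex a h (σ k) k) ∧
    ∀ b k, mink x (octVertex a h b k) ≤ 0}

/-- The faces of the truncated octahedron: the eight truncated triangles and the six faces created
by the truncation. -/
def truncOctFace (a h : ℝ) : (Fin 3 → Bool) ⊕ (Bool × Fin 3) → Set (Fin 4 → ℝ)
  | Sum.inl σ => {x ∈ truncOct a h | ∃ c : Fin 3 → ℝ, (∀ k, 0 ≤ c k) ∧
      x = ∑ k, c k • octVertex a h (σ k) k}
  | Sum.inr v => {x ∈ truncOct a h | mink x (octVertex a h v.1 v.2) = 0}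

/-- The interior of the truncated octahedron. -/
def truncOctInterior (a h : ℝ) : Set (Fin 4 → ℝ) := truncOct a h \ ⋃ F, truncOctFace a h F

/-- The cone-manifold `M` is obtained from finitely many copies of a truncated hyperideal twisted
octahedron by gluing their faces isometrically in pairs: `f i` maps the `i`-th copy to `M`. -/
def HypConeStructure.IsGluedFromTruncOct {M : Type} [TopologicalSpace M]
    (C : HypConeStructure M) : Prop :=
  ∃ (a h : ℝ) (n : ℕ) (f : Fin n → (Fin 4 → ℝ) → M),
    OctHyperideal a h ∧
    (∀ i, ContinuousOn (f i) (truncOct a h)) ∧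
    (⋃ i, f i '' truncOct a h) = Set.univ ∧
    (∀ i j, ∀ x ∈ truncOctInterior a h, ∀ y ∈ truncOctInterior a h,
      f i x = f j y → i = j ∧ x = y) ∧
    (∀ i, ∀ x ∈ truncOctInterior a h,
      ∃ U ∈ 𝓝 x, ∀ y ∈ U ∩ truncOctInterior a h, ∀ z ∈ U ∩ truncOctInterior a h,
        coneCosh (C.angle (f i x)) (C.chart (f i x) (f i y)) (C.chart (f i x) (f i z))
          = -mink y z) ∧
    (∀ i F, ∃ j F', (i, F) ≠ (j, F') ∧ ∃ g : (Fin 4 → ℝ) →ₗ[ℝ] (Fin 4 → ℝ),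
      (∀ y z, mink (g y) (g z) = mink y z) ∧ g '' truncOctFace a h F = truncOctFace a h F' ∧
      ∀ x ∈ truncOctFace a h F, f j (g x) = f i x)

end

/-!
Take the twisted octahedron of which the triangles `ABC` and `A'B'C'` have circumradius `1` and lie
at the heights `-1 / 2` and `1 / 2`. Its edges from a vertex of `ABC` to the next vertex of `A'B'C'`
are concave, the others are convex. Two copies of the truncated octahedron, glued along their eight
triangles by the identity, form a double `D`, with a boundary that consists of doubled truncation
faces. For each of the three pairs of opposite vertices, the half-turn of the octahedron that
exchanges them maps one truncation face to the opposite one. The cone-manifold `Mfd n` consists of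
`n` copies of `D`, and these half-turns glue each truncation face to the opposite one in the copy
with the reversed index. The cases needed are `n = 1`, where a gluing map identifies points of the
same copy of `D` and reverses the orientation, and `n = 2`, its orientation cover.

*Charts.* The octahedron is the union of the simplicial cones with apex its centre over its
triangles. The coordinates with respect to these cones define a homeomorphism `Th`
(`Th_antilipschitz`, `Th_surjective`), and a point of `D` is given by such coordinates, with a sign
on the coordinate on the centre that tells the copy. The polar planes of different vertices are
disjoint, so that the double can be thickened to a space `Q` with collars beyond the truncation
faces, and `Mfd n` is a quotient of copies of `Q` by gluing maps `gl b k` of open collars. The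
singular points are those on edges of the octahedron: an edge with dihedral angle `θ` has the cone
angle `2 * θ`, which is never `2 * π` (`Edge.theta_lt_pi_iff`). Charts are obtained by opening a
wedge of angle `θ` to a half-plane and its second copy to the opposite half-plane. Off the edges,
all charts are compared by developing maps to `ℍ³` (`DevAt`), and on the edges they agree up to
isometries of the model space (`EdgeAt`).

*The flex.* The octahedron is infinitesimally flexible: if `ABC` and `A'B'C'` perform opposite
infinitesimal screw motions `∓ kap` about the axis of the octahedron, then each of the eight
triangles moves by an infinitesimal isometry `Kf s` (`Kf_vx`), and two triangles at an edge move
relative to each other by a rotation about this edge (`Edge.relMotion_apply`). If the two copies of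
the octahedron in `D` move oppositely, then the two dihedral angles at an edge vary oppositely, and
their sum, the cone angle, is preserved. In the chart at the edge, the flex consists of rotations
about the axis. The half-turns exchange the two screw motions, hence they respect the flex up to
infinitesimal isometries (`DevAt.glue`, `EdgeAt.glue`), and `isInfDeformation` follows.

*Non-triviality.* If the flex is induced by a vector field, then the field and the flex differ by an
infinitesimal isometry near every point off the edges (`local_killing`), and hence on the whole
interior of each copy of the octahedron (`global_motion`). The difference of the infinitesimal
isometries of the two copies is a skew map that agrees on the vertices with twice the screw motions,
because these are the relative motions of the two copies along each triangle. This is impossible,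
since the flex changes the distance of opposite vertices (`mink_kap_vx_zero`).

*Components.* An edge is continued beyond a truncation face by its image under the half-turn.
Following the edges, the components of the singular locus are counted by labels
(`exists_components`): the concave edges form one component, and so do the convex edges that join
vertices of different triangles; the edges of the triangles `ABC` and `A'B'C'` form one component if
`n = 1`, and two if `n = 2`.
-/

noncomputable section

namespace TwOct

/-! ### Minkowski space -/

/-- Minkowski space, with the scalar product `mink`. -/
abbrev V4 := Fin 4 → ℝ

theorem mink_comm (x y : V4) : mink x y = mink y x := by simp only [mink]; ring

theorem mink_add_left (x y z : V4) : mink (x + y) z = mink x z + mink y z := by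
  simp only [mink, Pi.add_apply]; ring

theorem mink_add_right (x y z : V4) : mink x (y + z) = mink x y + mink x z := by
  simp only [mink, Pi.add_apply]; ring

theorem mink_sub_left (x y z : V4) : mink (x - y) z = mink x z - mink y z := by
  simp only [mink, Pi.sub_apply]; ring

theorem mink_sub_right (x y z : V4) : mink x (y - z) = mink x y - mink x z := by
  simp only [mink, Pi.sub_apply]; ring

theorem mink_neg_left (x y : V4) : mink (-x) y = -mink x y := by
  simp only [mink, Pi.neg_apply]; ring

theorem mink_neg_right (x y : V4) : mink x (-y) = -mink x y := by
  simp only [mink, Pi.neg_apply]; ring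

theorem mink_smul_left (c : ℝ) (x y : V4) : mink (c • x) y = c * mink x y := by
  simp only [mink, Pi.smul_apply, smul_eq_mul]; ring

theorem mink_smul_right (c : ℝ) (x y : V4) : mink x (c • y) = c * mink x y := by
  simp only [mink, Pi.smul_apply, smul_eq_mul]; ring

theorem mink_zero_left (y : V4) : mink 0 y = 0 := by simp [mink]

theorem mink_zero_right (y : V4) : mink y 0 = 0 := by simp [mink]

@[fun_prop]
theorem continuous_mink {X : Type*} [TopologicalSpace X] {f g : X → V4} (hf : Continuous f)
    (hg : Continuous g) : Continuous fun x => mink (f x) (g x) := by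
  unfold mink; fun_prop

/-- The scalar product with a fixed vector, as a linear form. -/
def minkL (x : V4) : V4 →ₗ[ℝ] ℝ where
  toFun := mink x
  map_add' := mink_add_right x
  map_smul' c y := mink_smul_right c x y

theorem mink_nondeg {x : V4} (h : ∀ y, mink x y = 0) : x = 0 := by
  funext i
  have := h (Pi.single i 1)
  fin_cases i <;> simpa [mink, Pi.single_apply] using this

/-- A linear isometry of Minkowski space. -/
def IsIso (g : V4 →ₗ[ℝ] V4) : Prop := ∀ x y, mink (g x) (g y) = mink x y

theorem IsIso.injective {g : V4 →ₗ[ℝ] V4} (hg : IsIso g) : Function.Injective g := by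
  rw [← LinearMap.ker_eq_bot, LinearMap.ker_eq_bot']
  intro x hx
  refine mink_nondeg fun y => ?_
  rw [← hg x y, hx, mink_zero_left]

theorem IsIso.exists_inverse {g : V4 →ₗ[ℝ] V4} (hg : IsIso g) :
    ∃ h : V4 →ₗ[ℝ] V4, IsIso h ∧ (∀ x, h (g x) = x) ∧ ∀ x, g (h x) = x := by
  let e := LinearEquiv.ofInjectiveEndo g hg.injective
  have h1 : ∀ x, e.symm (g x) = x := fun x => e.symm_apply_apply x
  have h2 : ∀ x, g (e.symm x) = x := fun x => e.apply_symm_apply x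
  refine ⟨e.symm.toLinearMap, fun x y => ?_, h1, h2⟩
  rw [← hg]
  simp only [LinearEquiv.coe_coe, h2]

theorem IsIso.comp {g h : V4 →ₗ[ℝ] V4} (hg : IsIso g) (hh : IsIso h) : IsIso (g ∘ₗ h) :=
  fun x y => by rw [LinearMap.comp_apply, LinearMap.comp_apply, hg, hh]

/-- The reflection in the hyperplane orthogonal to `n`. -/
def refl (n : V4) : V4 →ₗ[ℝ] V4 where
  toFun x := x - (2 * mink x n / mink n n) • n
  map_add' x y := by
    rw [mink_add_left, mul_add, add_div, add_smul]; abel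
  map_smul' c x := by
    rw [mink_smul_left, smul_sub, smul_smul]
    simp only [RingHom.id_apply]
    congr 2; ring

theorem refl_apply (n x : V4) : refl n x = x - (2 * mink x n / mink n n) • n := rfl

theorem refl_isIso {n : V4} (hn : mink n n ≠ 0) : IsIso (refl n) := by
  intro x y
  simp only [refl_apply, mink_sub_left, mink_sub_right, mink_smul_left, mink_smul_right,
    mink_comm n y]
  field_simp
  ring

theorem refl_refl {n : V4} (hn : mink n n ≠ 0) (x : V4) : refl n (refl n x) = x := by
  simp only [refl_apply, mink_sub_left, mink_smul_left]
  rw [sub_sub, ← add_smul]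
  convert sub_zero x
  rw [smul_eq_zero]; left
  field_simp
  ring

theorem refl_of_orth {n x : V4} (h : mink x n = 0) : refl n x = x := by
  simp [refl_apply, h]

theorem refl_smul {n : V4} {c : ℝ} (hc : c ≠ 0) (x : V4) : refl (c • n) x = refl n x := by
  simp only [refl_apply, mink_smul_left, mink_smul_right, smul_smul]
  congr 2
  by_cases h : mink n n = 0
  · simp [h]
  field_simp

/-- An isometry conjugates the reflection in `n` to the reflection in the image of `n`. -/
theorem refl_conj {g : V4 →ₗ[ℝ] V4} (hg : IsIso g) (n x : V4) :
    refl (g n) (g x) = g (refl n x) := by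
  simp only [refl_apply, hg x n, hg n n, map_sub, map_smul]

/-- The reversed Cauchy–Schwarz inequality in its simplest form: a vector orthogonal to a timelike
vector is spacelike. -/
theorem mink_pos_of_orth {x n : V4} (hx : mink x x < 0) (h : mink x n = 0) (hn : n ≠ 0) :
    0 < mink n n := by
  have hx0 : x 0 ≠ 0 := by
    intro h0
    simp only [mink, h0] at hx
    nlinarith [sq_nonneg (x 1), sq_nonneg (x 2), sq_nonneg (x 3)]
  by_contra hc
  push Not at hc
  apply hn
  simp only [mink] at hx h hc
  have h0 : x 0 * n 0 = x 1 * n 1 + x 2 * n 2 + x 3 * n 3 := by linarith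
  have hcs : (x 0 * n 0) ^ 2 ≤ (x 1 ^ 2 + x 2 ^ 2 + x 3 ^ 2) * (n 1 ^ 2 + n 2 ^ 2 + n 3 ^ 2) := by
    rw [h0]
    nlinarith [sq_nonneg (x 1 * n 2 - x 2 * n 1), sq_nonneg (x 1 * n 3 - x 3 * n 1),
      sq_nonneg (x 2 * n 3 - x 3 * n 2)]
  have hn2 : n 1 ^ 2 + n 2 ^ 2 + n 3 ^ 2 ≤ n 0 ^ 2 := by nlinarith
  have hx2 : x 1 ^ 2 + x 2 ^ 2 + x 3 ^ 2 < x 0 ^ 2 := by nlinarith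
  have hs : n 1 ^ 2 + n 2 ^ 2 + n 3 ^ 2 = 0 := by
    by_contra hne
    have hp : 0 < n 1 ^ 2 + n 2 ^ 2 + n 3 ^ 2 := lt_of_le_of_ne (by positivity) (Ne.symm hne)
    nlinarith [mul_lt_mul_of_pos_right hx2 hp, mul_le_mul_of_nonneg_left hn2 (sq_nonneg (x 0))]
  have h1 : n 1 = 0 := by nlinarith [sq_nonneg (n 1), sq_nonneg (n 2), sq_nonneg (n 3)]
  have h2 : n 2 = 0 := by nlinarith [sq_nonneg (n 1), sq_nonneg (n 2), sq_nonneg (n 3)]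
  have h3 : n 3 = 0 := by nlinarith [sq_nonneg (n 1), sq_nonneg (n 2), sq_nonneg (n 3)]
  have h4 : n 0 = 0 := by
    rw [h1, h2, h3] at h0
    have : x 0 * n 0 = 0 := by linarith
    exact (mul_eq_zero.mp this).resolve_left hx0
  funext i
  fin_cases i <;> simp [h1, h2, h3, h4]

/-- Membership in the hyperboloid model of `ℍ³`. -/
def InH (x : V4) : Prop := mink x x = -1 ∧ 0 < x 0

theorem InH.one_le {x : V4} (h : InH x) : 1 ≤ x 0 := by
  obtain ⟨h1, h2⟩ := h
  simp only [mink] at h1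
  nlinarith [sq_nonneg (x 1), sq_nonneg (x 2), sq_nonneg (x 3)]

/-- Future pointing timelike vectors have negative scalar products, quantitatively. -/
theorem mink_le_of_timelike {x n : V4} (hx : InH x) {d : ℝ} (hn : mink n n ≤ -d ^ 2)
    (hn0 : 0 < n 0) : mink x n ≤ -d := by
  obtain ⟨h1, h2⟩ := hx
  simp only [mink] at *
  have hn1 : n 1 ^ 2 + n 2 ^ 2 + n 3 ^ 2 + d ^ 2 ≤ n 0 ^ 2 := by nlinarith
  have hx1 : x 1 ^ 2 + x 2 ^ 2 + x 3 ^ 2 + 1 = x 0 ^ 2 := by nlinarith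
  have hcs : (x 1 * n 1 + x 2 * n 2 + x 3 * n 3 + d) ^ 2 ≤ (x 0 * n 0) ^ 2 := by
    have : (x 1 * n 1 + x 2 * n 2 + x 3 * n 3 + 1 * d) ^ 2
      ≤ (x 1 ^ 2 + x 2 ^ 2 + x 3 ^ 2 + 1) * (n 1 ^ 2 + n 2 ^ 2 + n 3 ^ 2 + d ^ 2) := by
      nlinarith [sq_nonneg (x 1 * n 2 - x 2 * n 1), sq_nonneg (x 1 * n 3 - x 3 * n 1),
        sq_nonneg (x 2 * n 3 - x 3 * n 2), sq_nonneg (x 1 * d - n 1), sq_nonneg (x 2 * d - n 2),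
        sq_nonneg (x 3 * d - n 3)]
    rw [one_mul, hx1] at this
    nlinarith [mul_le_mul_of_nonneg_left hn1 (sq_nonneg (x 0))]
  have := abs_le_of_sq_le_sq hcs (by positivity)
  linarith [(abs_le.mp this).2]

/-- An isometry of Minkowski space that maps one point of `ℍ³` into the upper half space is an
isometry of `ℍ³`. -/
theorem InH.of_mink_neg {x y : V4} (hx : InH x) (hy : mink y y = -1) (h : mink x y < 0) :
    InH y := by
  refine ⟨hy, ?_⟩
  by_contra hc
  push Not at hc
  have hy0 : y 0 ≠ 0 := by
    intro h0
    simp only [mink, h0] at hy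
    nlinarith [sq_nonneg (y 1), sq_nonneg (y 2), sq_nonneg (y 3)]
  have := mink_le_of_timelike hx (d := 1) (n := -y)
    (by rw [mink_neg_left, mink_neg_right]; linarith)
    (by simpa using lt_of_le_of_ne hc hy0)
  rw [mink_neg_right] at this
  linarith

/-- This is `cosh (dist x y) ≥ 1`. -/
theorem InH.mink_le {x y : V4} (hx : InH x) (hy : InH y) : mink x y ≤ -1 :=
  mink_le_of_timelike hx (by rw [hy.1]; norm_num) hy.2

/-! ### Volume form and vector product -/

/-- The determinant of four vectors. -/
def det4 (a b c d : V4) : ℝ :=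
  a 0 * (b 1 * (c 2 * d 3 - c 3 * d 2) - b 2 * (c 1 * d 3 - c 3 * d 1)
      + b 3 * (c 1 * d 2 - c 2 * d 1))
  - a 1 * (b 0 * (c 2 * d 3 - c 3 * d 2) - b 2 * (c 0 * d 3 - c 3 * d 0)
      + b 3 * (c 0 * d 2 - c 2 * d 0))
  + a 2 * (b 0 * (c 1 * d 3 - c 3 * d 1) - b 1 * (c 0 * d 3 - c 3 * d 0)
      + b 3 * (c 0 * d 1 - c 1 * d 0))
  - a 3 * (b 0 * (c 1 * d 2 - c 2 * d 1) - b 1 * (c 0 * d 2 - c 2 * d 0)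
      + b 2 * (c 0 * d 1 - c 1 * d 0))

/-- The vector product of three vectors of Minkowski space. -/
def cross (a b c : V4) : V4 :=
  ![(a 1 * (b 2 * c 3 - b 3 * c 2) - a 2 * (b 1 * c 3 - b 3 * c 1)
      + a 3 * (b 1 * c 2 - b 2 * c 1)),
    (a 0 * (b 2 * c 3 - b 3 * c 2) - a 2 * (b 0 * c 3 - b 3 * c 0)
      + a 3 * (b 0 * c 2 - b 2 * c 0)),
    -(a 0 * (b 1 * c 3 - b 3 * c 1) - a 1 * (b 0 * c 3 - b 3 * c 0)
      + a 3 * (b 0 * c 1 - b 1 * c 0)),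
    (a 0 * (b 1 * c 2 - b 2 * c 1) - a 1 * (b 0 * c 2 - b 2 * c 0)
      + a 2 * (b 0 * c 1 - b 1 * c 0))]

theorem mink_cross (a b c d : V4) : mink (cross a b c) d = det4 a b c d := by
  simp only [mink, cross, det4, Matrix.cons_val]
  ring

theorem mink_cross_self (a b c : V4) : mink (cross a b c) (cross a b c) =
    -(mink a a * (mink b b * mink c c - mink b c ^ 2)
      - mink a b * (mink a b * mink c c - mink b c * mink a c)
      + mink a c * (mink a b * mink b c - mink b b * mink a c)) := by
  simp only [mink, cross, Matrix.cons_val]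
  ring

theorem det4_swap34 (a b c d : V4) : det4 a b d c = -det4 a b c d := by
  simp only [det4]; ring

theorem mink_cross_1 (a b c : V4) : mink (cross a b c) a = 0 := by
  rw [mink_cross]; simp only [det4]; ring

theorem mink_cross_2 (a b c : V4) : mink (cross a b c) b = 0 := by
  rw [mink_cross]; simp only [det4]; ring

theorem mink_cross_3 (a b c : V4) : mink (cross a b c) c = 0 := by
  rw [mink_cross]; simp only [det4]; ring

/-- The effect of a linear map on the volume form, in a form sufficient for isometries. -/
def HasDet (g : V4 →ₗ[ℝ] V4) (d : ℝ) : Prop :=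
  ∀ x a b c, det4 (g x) (g a) (g b) (g c) = d * det4 x a b c

theorem HasDet.comp {g h : V4 →ₗ[ℝ] V4} {d e : ℝ} (hg : HasDet g d) (hh : HasDet h e) :
    HasDet (g ∘ₗ h) (d * e) := fun x a b c => by
  simp only [LinearMap.comp_apply]; rw [hg, hh, mul_assoc]

theorem refl_hasDet {n : V4} (hn : mink n n ≠ 0) : HasDet (refl n) (-1) := by
  intro x a b c
  have key : mink x n * det4 n a b c + mink a n * det4 x n b c + mink b n * det4 x a n c
      + mink c n * det4 x a b n = mink n n * det4 x a b c := by
    simp only [mink, det4]; ring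
  have expand : ∀ t s u v : ℝ, det4 (x - t • n) (a - s • n) (b - u • n) (c - v • n)
      = det4 x a b c - (t * det4 n a b c + s * det4 x n b c + u * det4 x a n c
        + v * det4 x a b n) := by
    intro t s u v
    simp only [det4, Pi.sub_apply, Pi.smul_apply, smul_eq_mul]; ring
  simp only [refl_apply, expand]
  have : 2 * mink x n / mink n n * det4 n a b c + 2 * mink a n / mink n n * det4 x n b c
      + 2 * mink b n / mink n n * det4 x a n c + 2 * mink c n / mink n n * det4 x a b n
      = 2 / mink n n * (mink n n * det4 x a b c) := by rw [← key]; ring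
  rw [this]
  field_simp
  ring

/-! ### Orthonormal frames and cylindrical coordinates -/

/-- A Lorentz orthonormal frame, with `T` a point of `ℍ³`. -/
structure Frame where
  T : V4
  A : V4
  N : V4
  B : V4
  TT : mink T T = -1
  AA : mink A A = 1
  NN : mink N N = 1
  BB : mink B B = 1
  TA : mink T A = 0
  TN : mink T N = 0
  TB : mink T B = 0
  AN : mink A N = 0
  AB : mink A B = 0
  NB : mink N B = 0
  hT : 0 < T 0

namespace Frame

variable (F : Frame)

theorem inH : InH F.T := ⟨F.TT, F.hT⟩

theorem expand (x : V4) :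
    x = -(mink x F.T) • F.T + mink x F.A • F.A + mink x F.N • F.N + mink x F.B • F.B := by
  let η : Fin 4 → ℝ := ![-1, 1, 1, 1]
  let e : Fin 4 → V4 := ![F.T, F.A, F.N, F.B]
  let M : Matrix (Fin 4) (Fin 4) ℝ := Matrix.of fun i j => e j i
  let P : Matrix (Fin 4) (Fin 4) ℝ := Matrix.of fun i j => η i * e i j * η j
  have h1 : P * M = 1 := by
    have hAT := mink_comm F.T F.A ▸ F.TA
    have hNT := mink_comm F.T F.N ▸ F.TN
    have hBT := mink_comm F.T F.B ▸ F.TB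
    have hNA := mink_comm F.A F.N ▸ F.AN
    have hBA := mink_comm F.A F.B ▸ F.AB
    have hBN := mink_comm F.N F.B ▸ F.NB
    have := F.TT; have := F.AA; have := F.NN; have := F.BB
    have := F.TA; have := F.TN; have := F.TB; have := F.AN; have := F.AB; have := F.NB
    simp only [mink] at *
    ext i j
    rw [Matrix.mul_apply, Fin.sum_univ_four]
    fin_cases i <;> fin_cases j <;>
      simp [P, M, η, e] <;> linarith
  have h2 : M * P = 1 := mul_eq_one_comm.mp h1
  have h3 : M.mulVec (P.mulVec x) = x := by rw [Matrix.mulVec_mulVec, h2, Matrix.one_mulVec]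
  funext i
  have h4 := congrFun h3 i
  simp only [Matrix.mulVec, dotProduct, Fin.sum_univ_four, M, P, η, e, Matrix.of_apply,
    Matrix.cons_val] at h4
  simp only [Pi.add_apply, Pi.smul_apply, smul_eq_mul, mink]
  linarith

theorem ext_mink {x y : V4} (hT : mink x F.T = mink y F.T) (hA : mink x F.A = mink y F.A)
    (hN : mink x F.N = mink y F.N) (hB : mink x F.B = mink y F.B) : x = y := by
  rw [F.expand x, F.expand y, hT, hA, hN, hB]

/-- The complex coordinate of a vector in the plane orthogonal to `T` and `A`. -/
def zc (x : V4) : ℂ := ⟨mink x F.N, mink x F.B⟩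

theorem zc_add (x y : V4) : F.zc (x + y) = F.zc x + F.zc y := by
  apply Complex.ext <;> simp [zc, mink_add_left]

theorem zc_smul (c : ℝ) (x : V4) : F.zc (c • x) = c * F.zc x := by
  apply Complex.ext <;> simp [zc, mink_smul_left]

@[fun_prop]
theorem continuous_zc : Continuous F.zc := by
  have h : F.zc = fun x => (mink x F.N : ℂ) + mink x F.B * Complex.I := by
    funext x; apply Complex.ext <;> simp [zc]
  rw [h]; fun_prop

/-- The norm of a point in terms of the frame. -/
theorem mink_eq (x y : V4) : mink x y = -(mink x F.T * mink y F.T) + mink x F.A * mink y F.A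
    + (F.zc x * (starRingEnd ℂ) (F.zc y)).re := by
  conv_lhs => rw [F.expand x]
  simp only [mink_add_left, mink_smul_left, mink_comm F.T y, mink_comm F.A y, mink_comm F.N y,
    mink_comm F.B y, zc, Complex.mul_re, Complex.conj_re, Complex.conj_im]
  ring

/-- `cosh` of the distance from the axis, `sinh` of this distance being `‖z‖`. -/
def cn (z : ℂ) : ℝ := √(1 + ‖z‖ ^ 2)

theorem _root_.TwOct.cn_pos (z : ℂ) : 0 < cn z := Real.sqrt_pos.mpr (by positivity)

theorem _root_.TwOct.cn_sq (z : ℂ) : cn z ^ 2 = 1 + ‖z‖ ^ 2 := Real.sq_sqrt (by positivity)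

theorem _root_.TwOct.norm_sq_eq (z : ℂ) : ‖z‖ ^ 2 = z.re ^ 2 + z.im ^ 2 := by
  rw [← Complex.normSq_eq_norm_sq, Complex.normSq_apply]; ring

/-- The point with cylindrical coordinates `p` about the axis of the frame. -/
def pt (p : ℝ × ℂ) : V4 :=
  (cn p.2 * Real.cosh p.1) • F.T + (cn p.2 * Real.sinh p.1) • F.A + p.2.re • F.N + p.2.im • F.B

/-- Cylindrical coordinates of a point of `ℍ³`. -/
def co (x : V4) : ℝ × ℂ := (Real.arsinh (mink x F.A / cn (F.zc x)), F.zc x)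

theorem mink_pt_T (p : ℝ × ℂ) : mink (F.pt p) F.T = -(cn p.2 * Real.cosh p.1) := by
  simp only [pt, mink_add_left, mink_smul_left, F.TT, mink_comm F.A F.T, mink_comm F.N F.T,
    mink_comm F.B F.T, F.TA, F.TN, F.TB]; ring

theorem mink_pt_A (p : ℝ × ℂ) : mink (F.pt p) F.A = cn p.2 * Real.sinh p.1 := by
  simp only [pt, mink_add_left, mink_smul_left, F.TA, mink_comm F.N F.A,
    mink_comm F.B F.A, F.AA, F.AN, F.AB]; ring

theorem mink_pt_N (p : ℝ × ℂ) : mink (F.pt p) F.N = p.2.re := by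
  simp only [pt, mink_add_left, mink_smul_left, F.TN, F.AN,
    mink_comm F.B F.N, F.NN, F.NB]; ring

theorem mink_pt_B (p : ℝ × ℂ) : mink (F.pt p) F.B = p.2.im := by
  simp only [pt, mink_add_left, mink_smul_left, F.TB, F.AB, F.BB, F.NB]; ring

theorem zc_pt (p : ℝ × ℂ) : F.zc (F.pt p) = p.2 := by
  apply Complex.ext
  · exact F.mink_pt_N p
  · exact F.mink_pt_B p

theorem mink_pt_pt (p q : ℝ × ℂ) : mink (F.pt p) (F.pt q) =
    -(cn p.2 * cn q.2 * Real.cosh (p.1 - q.1)) + (p.2 * (starRingEnd ℂ) q.2).re := by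
  rw [F.mink_eq, mink_pt_T, mink_pt_T, mink_pt_A, mink_pt_A, zc_pt, zc_pt, Real.cosh_sub]
  ring

theorem pt_inH (p : ℝ × ℂ) : InH (F.pt p) := by
  have h1 : mink (F.pt p) (F.pt p) = -1 := by
    rw [mink_pt_pt, sub_self, Real.cosh_zero, Complex.mul_conj, Complex.ofReal_re,
      Complex.normSq_eq_norm_sq]
    have := cn_sq p.2
    linarith
  refine F.inH.of_mink_neg h1 ?_
  rw [mink_comm, mink_pt_T]
  have := mul_pos (cn_pos p.2) (Real.cosh_pos p.1)
  linarith

theorem co_pt (p : ℝ × ℂ) : F.co (F.pt p) = p := by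
  simp only [co, zc_pt, mink_pt_A]
  rw [mul_div_cancel_left₀ _ (cn_pos p.2).ne', Real.arsinh_sinh]

theorem pt_co {x : V4} (hx : InH x) : F.pt (F.co x) = x := by
  have hc := cn_pos (F.zc x)
  have hA : mink x F.A = cn (F.zc x) * Real.sinh (F.co x).1 := by
    simp only [co, Real.sinh_arsinh]; field_simp
  have hT : -mink x F.T = cn (F.zc x) * Real.cosh (F.co x).1 := by
    have h1 : mink x F.T ≤ -1 := by rw [mink_comm]; exact F.inH.mink_le hx
    have h2 := F.mink_eq x x
    rw [hx.1, Complex.mul_conj, Complex.ofReal_re, Complex.normSq_eq_norm_sq, hA] at h2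
    have h3 := cn_sq (F.zc x)
    have h4 := Real.cosh_sq (F.co x).1
    have h5 : (-mink x F.T) ^ 2 = (cn (F.zc x) * Real.cosh (F.co x).1) ^ 2 := by
      rw [mul_pow, h4]; nlinarith
    exact (pow_left_inj₀ (by linarith) (mul_pos hc (Real.cosh_pos _)).le two_ne_zero).mp h5
  apply F.ext_mink
  · rw [mink_pt_T]; change -(cn (F.zc x) * _) = _; linarith
  · rw [mink_pt_A]; exact hA.symm
  · rw [mink_pt_N]; rfl
  · rw [mink_pt_B]; rfl

@[fun_prop]
theorem _root_.TwOct.continuous_cn : Continuous cn := by unfold cn; fun_prop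

@[fun_prop]
theorem continuous_pt : Continuous F.pt := by unfold pt; fun_prop

@[fun_prop]
theorem continuous_co : Continuous F.co := by
  unfold co
  refine Continuous.prodMk ?_ F.continuous_zc
  refine Real.continuous_arsinh.comp (Continuous.div ?_ ?_ fun x => (cn_pos _).ne')
  · fun_prop
  · fun_prop

/-- The derivative of `pt`. -/
def dpt (p : ℝ × ℂ) (v : ℝ × ℂ) : V4 :=
  ((p.2.re * v.2.re + p.2.im * v.2.im) / cn p.2) • (Real.cosh p.1 • F.T + Real.sinh p.1 • F.A)
    + (cn p.2 * v.1) • (Real.sinh p.1 • F.T + Real.cosh p.1 • F.A) + v.2.re • F.N + v.2.im • F.B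

theorem hasFDerivAt_pt (p : ℝ × ℂ) :
    ∃ D : ℝ × ℂ →L[ℝ] V4, HasFDerivAt F.pt D p ∧ ∀ v, D v = F.dpt p v := by
  have hre : HasFDerivAt (fun p : ℝ × ℂ => p.2.re)
      (Complex.reCLM.comp (ContinuousLinearMap.snd ℝ ℝ ℂ)) p :=
    (Complex.reCLM.comp (ContinuousLinearMap.snd ℝ ℝ ℂ)).hasFDerivAt
  have him : HasFDerivAt (fun p : ℝ × ℂ => p.2.im)
      (Complex.imCLM.comp (ContinuousLinearMap.snd ℝ ℝ ℂ)) p :=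
    (Complex.imCLM.comp (ContinuousLinearMap.snd ℝ ℝ ℂ)).hasFDerivAt
  have hs : HasFDerivAt (fun p : ℝ × ℂ => p.1) (ContinuousLinearMap.fst ℝ ℝ ℂ) p :=
    (ContinuousLinearMap.fst ℝ ℝ ℂ).hasFDerivAt
  have hpos : 0 < 1 + (p.2.re * p.2.re + p.2.im * p.2.im) := by
    linarith [mul_self_nonneg p.2.re, mul_self_nonneg p.2.im]
  have hcn : ∀ z : ℂ, cn z = √(1 + (z.re * z.re + z.im * z.im)) := fun z => by
    rw [cn, norm_sq_eq, sq, sq]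
  have hc := ((((hre.mul hre).add (him.mul him)).const_add 1)).sqrt hpos.ne'
  have hc' : HasFDerivAt (fun p : ℝ × ℂ => cn p.2) _ p :=
    hc.congr_of_eventuallyEq (Eventually.of_forall fun q => hcn q.2)
  have h := ((((hc'.mul hs.cosh).smul_const F.T).add ((hc'.mul hs.sinh).smul_const F.A)).add
    (hre.smul_const F.N)).add (him.smul_const F.B)
  refine ⟨_, h, fun v => ?_⟩
  have h0 := cn_pos p.2
  have h1 := hcn p.2
  funext i
  simp [dpt, ← h1]
  field_simp
  ring

/-- Every vector tangent to `ℍ³` at `pt p` is in the image of the derivative of `pt`. -/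
theorem exists_dpt {p : ℝ × ℂ} {Y : V4} (hY : mink Y (F.pt p) = 0) : ∃ v, F.dpt p v = Y := by
  have hc := cn_pos p.2
  have hq := Real.cosh_sq p.1
  refine ⟨((mink Y F.A * Real.cosh p.1 + mink Y F.T * Real.sinh p.1) / cn p.2, F.zc Y), ?_⟩
  have h1 : -(cn p.2 * (mink Y F.T * -Real.cosh p.1 - mink Y F.A * Real.sinh p.1))
      + (p.2.re * mink Y F.N + p.2.im * mink Y F.B) = 0 := by
    rw [pt, mink_add_right, mink_add_right, mink_add_right, mink_smul_right, mink_smul_right,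
      mink_smul_right, mink_smul_right] at hY
    linarith
  have h2 : (p.2.re * mink Y F.N + p.2.im * mink Y F.B) / cn p.2
      = -(mink Y F.T * Real.cosh p.1) - mink Y F.A * Real.sinh p.1 := by
    rw [div_eq_iff hc.ne']; linarith
  conv_rhs => rw [F.expand Y]
  simp only [dpt, zc]
  rw [h2, mul_div_cancel₀ _ hc.ne']
  funext i
  simp only [Pi.add_apply, Pi.smul_apply, smul_eq_mul]
  linear_combination ((- mink Y F.T * F.T i) + mink Y F.A * F.A i) * hq

theorem det4_dpt (p : ℝ × ℂ) :
    det4 (F.pt p) (F.dpt p (1, 0)) (F.dpt p (0, 1)) (F.dpt p (0, Complex.I))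
      = det4 F.T F.A F.N F.B := by
  have hc := cn_pos p.2
  have hc2 := cn_sq p.2
  rw [norm_sq_eq] at hc2
  have hq := Real.cosh_sq p.1
  have key : ∀ c ch sh x y X Y : ℝ,
      det4 ((c * ch) • F.T + (c * sh) • F.A + x • F.N + y • F.B)
        (c • (sh • F.T + ch • F.A))
        (X • (ch • F.T + sh • F.A) + F.N)
        (Y • (ch • F.T + sh • F.A) + F.B)
      = (c ^ 2 - c * x * X - c * y * Y) * (ch ^ 2 - sh ^ 2) * det4 F.T F.A F.N F.B := by
    intro c ch sh x y X Y
    simp only [det4, Pi.add_apply, Pi.smul_apply, smul_eq_mul]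
    ring
  have e1 : F.dpt p (1, 0) = cn p.2 • (Real.sinh p.1 • F.T + Real.cosh p.1 • F.A) := by
    simp [dpt]
  have e2 : F.dpt p (0, 1) = (p.2.re / cn p.2) • (Real.cosh p.1 • F.T + Real.sinh p.1 • F.A)
      + F.N := by simp [dpt]
  have e3 : F.dpt p (0, Complex.I)
      = (p.2.im / cn p.2) • (Real.cosh p.1 • F.T + Real.sinh p.1 • F.A) + F.B := by simp [dpt]
  rw [e1, e2, e3, pt, key]
  have : cn p.2 ^ 2 - cn p.2 * p.2.re * (p.2.re / cn p.2) - cn p.2 * p.2.im * (p.2.im / cn p.2)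
      = 1 := by
    field_simp; linarith
  rw [this, hq]
  ring

theorem det4_sq : det4 F.T F.A F.N F.B = 1 ∨ det4 F.T F.A F.N F.B = -1 := by
  have h1 : mink (cross F.T F.A F.N) F.T = 0 := mink_cross_1 _ _ _
  have h2 : mink (cross F.T F.A F.N) F.A = 0 := mink_cross_2 _ _ _
  have h3 : mink (cross F.T F.A F.N) F.N = 0 := mink_cross_3 _ _ _
  have h4 : mink (cross F.T F.A F.N) (cross F.T F.A F.N) = 1 := by
    rw [mink_cross_self, F.TT, F.AA, F.NN, F.TA, F.AN, F.TN]; norm_num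
  have h5 := F.mink_eq (cross F.T F.A F.N) (cross F.T F.A F.N)
  rw [h4, h1, h2] at h5
  simp only [zc, h3, mink_cross, Complex.mul_re, Complex.conj_re, Complex.conj_im] at h5
  refine mul_self_eq_one_iff.mp ?_
  linarith

end Frame

/-! ### The vertices of the octahedron -/

/-- The vertices of the twisted octahedron used here. -/
def vx (b : Bool) (k : Fin 3) : V4 := octVertex 1 (1 / 2) b k

/-- The centre of the octahedron. -/
def e0 : V4 := ![1, 0, 0, 0]

/-- The cosines of the directions of the vertices `A`, `B`, `C`. -/
def cs : Fin 3 → ℝ := ![1, -1 / 2, -1 / 2]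

/-- The sines of the directions of the vertices `A`, `B`, `C`. -/
def sn : Fin 3 → ℝ := ![0, √3 / 2, -√3 / 2]

theorem sqrt3_sq : √3 * √3 = (3 : ℝ) := Real.mul_self_sqrt (by norm_num)

theorem sqrt3_lb : (17 / 10 : ℝ) < √3 := Real.lt_sqrt_of_sq_lt (by norm_num)

theorem sqrt3_ub : √3 < (7 / 4 : ℝ) := (Real.sqrt_lt' (by norm_num)).mpr (by norm_num)

theorem cos_cs (k : Fin 3) : Real.cos (2 * Real.pi * (k : ℕ) / 3) = cs k := by
  fin_cases k
  · simp [cs]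
  · have : 2 * Real.pi * ((1 : ℕ) : ℝ) / 3 = Real.pi - Real.pi / 3 := by push_cast; ring
    simp only [cs, Fin.mk_one, Matrix.cons_val]
    rw [this, Real.cos_pi_sub, Real.cos_pi_div_three]; norm_num
  · have : 2 * Real.pi * ((2 : ℕ) : ℝ) / 3 = Real.pi / 3 + Real.pi := by push_cast; ring
    simp only [cs, Fin.reduceFinMk, Matrix.cons_val]
    rw [this, Real.cos_add_pi, Real.cos_pi_div_three]; norm_num

theorem sin_sn (k : Fin 3) : Real.sin (2 * Real.pi * (k : ℕ) / 3) = sn k := by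
  fin_cases k
  · simp [sn]
  · have : 2 * Real.pi * ((1 : ℕ) : ℝ) / 3 = Real.pi - Real.pi / 3 := by push_cast; ring
    simp only [sn, Fin.mk_one, Matrix.cons_val]
    rw [this, Real.sin_pi_sub, Real.sin_pi_div_three]
  · have : 2 * Real.pi * ((2 : ℕ) : ℝ) / 3 = Real.pi / 3 + Real.pi := by push_cast; ring
    simp only [sn, Fin.reduceFinMk, Matrix.cons_val]
    rw [this, Real.sin_add_pi, Real.sin_pi_div_three]; ring

theorem vx_false (k : Fin 3) : vx false k = ![1, cs k, sn k, -1 / 2] := by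
  simp only [vx, octVertex, Bool.false_eq_true, if_false, add_zero, cos_cs, sin_sn, one_mul]
  norm_num

theorem vx_true (k : Fin 3) : vx true k = ![1, -sn k, cs k, 1 / 2] := by
  simp only [vx, octVertex, if_true, Real.cos_add_pi_div_two, Real.sin_add_pi_div_two,
    cos_cs, sin_sn, one_mul]

/-! ### The piecewise linear coordinates defined by the octahedron -/

/-- The increments of the positive and the negative part between two real numbers are complementary
fractions of the difference. Thus differences of `Th`, which is not linear, are images under linear
maps that interpolate between those of the eight simplicial cones. -/
theorem parts_interp (x y : ℝ) : ∃ t : ℝ, 0 ≤ t ∧ t ≤ 1 ∧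
    max x 0 - max y 0 = t * (x - y) ∧ max (-x) 0 - max (-y) 0 = -((1 - t) * (x - y)) := by
  have key : ∀ x y : ℝ, y < x → ∃ t : ℝ, 0 ≤ t ∧ t ≤ 1 ∧
    max x 0 - max y 0 = t * (x - y) ∧ max (-x) 0 - max (-y) 0 = -((1 - t) * (x - y)) := by
    intro x y h
    have h0 : 0 < x - y := by linarith
    refine ⟨(max x 0 - max y 0) / (x - y), ?_, ?_, ?_, ?_⟩
    · exact div_nonneg (by linarith [max_le_max_right 0 h.le]) h0.le
    · rw [div_le_one h0]
      rcases max_cases x 0 with h1 | h1 <;> rcases max_cases y 0 with h2 | h2 <;> linarith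
    · field_simp
    · rw [sub_mul, div_mul_cancel₀ _ h0.ne']
      rcases max_cases x 0 with h1 | h1 <;> rcases max_cases y 0 with h2 | h2 <;>
        rcases max_cases (-x) 0 with h3 | h3 <;> rcases max_cases (-y) 0 with h4 | h4 <;> linarith
  rcases lt_trichotomy x y with h | h | h
  · obtain ⟨t, h1, h2, h3, h4⟩ := key y x h
    exact ⟨t, h1, h2, by linarith, by linarith⟩
  · exact ⟨0, le_rfl, zero_le_one, by simp [h], by simp [h]⟩
  · exact key x y h

/-- The point with coordinate `c` on the centre and coordinates `y` on the vertices: `y k` is the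
coordinate on the `k`-th vertex of `ABC` if it is positive, and minus that on the `k`-th vertex of
`A'B'C'` if it is negative. -/
def Th (p : ℝ × (Fin 3 → ℝ)) : V4 :=
  p.1 • e0 + ∑ k, (max (p.2 k) 0 • vx false k + max (-p.2 k) 0 • vx true k)

theorem Th_apply (p : ℝ × (Fin 3 → ℝ)) : Th p = p.1 • e0
    + ((max (p.2 0) 0 • vx false 0 + max (-p.2 0) 0 • vx true 0)
    + (max (p.2 1) 0 • vx false 1 + max (-p.2 1) 0 • vx true 1)
    + (max (p.2 2) 0 • vx false 2 + max (-p.2 2) 0 • vx true 2)) := by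
  rw [Th, Fin.sum_univ_three]

@[fun_prop]
theorem continuous_Th : Continuous Th := by unfold Th; fun_prop

theorem Th_coords (p : ℝ × (Fin 3 → ℝ)) :
    Th p 0 = p.1 + (max (p.2 0) 0 + max (-p.2 0) 0) + (max (p.2 1) 0 + max (-p.2 1) 0)
      + (max (p.2 2) 0 + max (-p.2 2) 0) ∧
    Th p 1 = max (p.2 0) 0 + (-max (p.2 1) 0 / 2 - √3 / 2 * max (-p.2 1) 0)
      + (-max (p.2 2) 0 / 2 + √3 / 2 * max (-p.2 2) 0) ∧
    Th p 2 = max (-p.2 0) 0 + (√3 / 2 * max (p.2 1) 0 - max (-p.2 1) 0 / 2)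
      + (-√3 / 2 * max (p.2 2) 0 - max (-p.2 2) 0 / 2) ∧
    Th p 3 = (max (-p.2 0) 0 - max (p.2 0) 0) / 2 + (max (-p.2 1) 0 - max (p.2 1) 0) / 2
      + (max (-p.2 2) 0 - max (p.2 2) 0) / 2 := by
  simp only [Th_apply, vx_false, vx_true, e0, cs, sn, Pi.add_apply, Pi.smul_apply, smul_eq_mul,
    Matrix.cons_val]
  refine ⟨?_, ?_, ?_, ?_⟩ <;> ring

/-- The eight simplicial cones with apex the centre over the triangles of the octahedron are
equally oriented; here this is the positivity of all convex combinations of their determinants. -/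
theorem orient_pos {t0 t1 t2 : ℝ} (h0 : 0 ≤ t0) (h0' : t0 ≤ 1) (h1 : 0 ≤ t1) (h1' : t1 ≤ 1)
    (h2 : 0 ≤ t2) (h2' : t2 ≤ 1) :
    1 ≤ t0 * t1 + (1 - t0) * (1 - t1) + (t1 * t2 + (1 - t1) * (1 - t2))
      + (t2 * t0 + (1 - t2) * (1 - t0)) := by
  nlinarith [mul_nonneg (mul_nonneg h0 h1) h2,
    mul_nonneg (mul_nonneg (sub_nonneg.mpr h0') (sub_nonneg.mpr h1')) (sub_nonneg.mpr h2')]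

/-- The planar determinant of three interpolated vertices. -/
theorem orient_eq (t0 t1 t2 r : ℝ) (hr : r * r = 3) :
    (t0 * (t1 * (r / 2) + (1 - t1) / 2) - (-(1 - t0)) * (-t1 / 2 + (1 - t1) * (r / 2)))
    + ((-t1 / 2 + (1 - t1) * (r / 2)) * (-t2 * (r / 2) + (1 - t2) / 2)
      - (t1 * (r / 2) + (1 - t1) / 2) * (-t2 / 2 - (1 - t2) * (r / 2)))
    + ((-t2 / 2 - (1 - t2) * (r / 2)) * (-(1 - t0)) - (-t2 * (r / 2) + (1 - t2) / 2) * t0)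
    = r / 2 * (t0 * t1 + (1 - t0) * (1 - t1) + (t1 * t2 + (1 - t1) * (1 - t2))
      + (t2 * t0 + (1 - t2) * (1 - t0))) := by
  linear_combination ((t1 - t2) / 4) * hr

/-- Cramer's rule for three linear equations with coefficients bounded by `1` and with a determinant
that is bounded from below. The equations are those satisfied by the differences of the coordinates
on the three pairs of vertices, and the coefficients are coordinates of interpolated vertices. -/
theorem cramer_bound {a0 a1 a2 b0 b1 b2 d0 d1 d2 D1 D2 D3 M : ℝ} (_ha0 : |a0| ≤ 1) (ha1 : |a1| ≤ 1)
    (ha2 : |a2| ≤ 1) (_hb0 : |b0| ≤ 1) (hb1 : |b1| ≤ 1) (hb2 : |b2| ≤ 1)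
    (hS : 1 / 2 ≤ (a0 * b1 - b0 * a1) + (a1 * b2 - b1 * a2) + (a2 * b0 - b2 * a0))
    (e1 : D1 = d0 * a0 + d1 * a1 + d2 * a2) (e2 : D2 = d0 * b0 + d1 * b1 + d2 * b2)
    (e3 : D3 = -(d0 + d1 + d2) / 2) (h1 : |D1| ≤ M) (h2 : |D2| ≤ M) (h3 : |D3| ≤ M) :
    |d0| ≤ 16 * M := by
  set S := (a0 * b1 - b0 * a1) + (a1 * b2 - b1 * a2) + (a2 * b0 - b2 * a0) with hSdef
  have hM : 0 ≤ M := (abs_nonneg _).trans h1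
  have key : d0 * S = -2 * D3 * (a1 * b2 - a2 * b1) + D1 * (b1 - b2) + D2 * (a2 - a1) := by
    rw [e1, e2, e3, hSdef]; ring
  have p1 : |a1 * b2 - a2 * b1| ≤ 2 := by
    calc |a1 * b2 - a2 * b1| ≤ |a1 * b2| + |a2 * b1| := abs_sub _ _
      _ ≤ 1 * 1 + 1 * 1 := by
          rw [abs_mul, abs_mul]
          gcongr
      _ = 2 := by norm_num
  have p2 : |b1 - b2| ≤ 2 := (abs_sub _ _).trans (by linarith)
  have p3 : |a2 - a1| ≤ 2 := (abs_sub _ _).trans (by linarith)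
  have hb : |d0 * S| ≤ 8 * M := by
    rw [key]
    calc _ ≤ |-2 * D3 * (a1 * b2 - a2 * b1)| + |D1 * (b1 - b2)| + |D2 * (a2 - a1)| :=
          abs_add_three _ _ _
      _ ≤ 2 * M * 2 + M * 2 + M * 2 := by
          simp only [abs_mul, abs_neg, abs_two]
          gcongr
      _ = 8 * M := by ring
  rw [abs_mul, abs_of_nonneg (by linarith : 0 ≤ S)] at hb
  nlinarith [abs_nonneg d0]

theorem abs_interp {t u v : ℝ} (h : 0 ≤ t) (h' : t ≤ 1) (hu : |u| ≤ 1) (hv : |v| ≤ 1) :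
    |t * u + (1 - t) * v| ≤ 1 := by
  rw [abs_le] at *
  constructor <;> nlinarith

set_option maxHeartbeats 1000000 in
/-- The simplicial cones over the triangles do not overlap, quantitatively: differences of `Th` are
images under interpolated linear maps, of which the determinants are bounded from below because the
eight cones are equally oriented. Cramer's rule gives `16` for the coordinates on the vertices, and
`1 + 3 * 16 = 49` for the coordinate on the centre. -/
theorem Th_antilipschitz : AntilipschitzWith 49 Th := by
  refine AntilipschitzWith.of_le_mul_dist fun p q => ?_
  rw [dist_eq_norm (Th p)]
  set M := ‖Th p - Th q‖ with hMdef
  have hM : ∀ i, |Th p i - Th q i| ≤ M := fun i => by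
    simpa using norm_le_pi_norm (Th p - Th q) i
  have hM0 : 0 ≤ M := norm_nonneg _
  obtain ⟨t0, l0, u0, m0, n0⟩ := parts_interp (p.2 0) (q.2 0)
  obtain ⟨t1, l1, u1, m1, n1⟩ := parts_interp (p.2 1) (q.2 1)
  obtain ⟨t2, l2, u2, m2, n2⟩ := parts_interp (p.2 2) (q.2 2)
  obtain ⟨c0, c1, c2, c3⟩ := Th_coords p
  obtain ⟨c0', c1', c2', c3'⟩ := Th_coords q
  have hr := sqrt3_sq
  have hr1 := sqrt3_lb
  have hr2 := sqrt3_ub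
  have hS := orient_eq t0 t1 t2 _ hr
  have hS' := orient_pos l0 u0 l1 u1 l2 u2
  have hS1 : 1 / 2 ≤ √3 / 2 * (t0 * t1 + (1 - t0) * (1 - t1) + (t1 * t2 + (1 - t1) * (1 - t2))
      + (t2 * t0 + (1 - t2) * (1 - t0))) := by nlinarith
  rw [← hS] at hS1
  have habs : ∀ x : ℝ, -1 ≤ x → x ≤ 1 → |x| ≤ 1 := fun x h h' => abs_le.mpr ⟨h, h'⟩
  have a0 : |t0| ≤ 1 := habs _ (by linarith) u0
  have b0 : |-(1 - t0)| ≤ 1 := habs _ (by linarith) (by linarith)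
  have hh : |(1 / 2 : ℝ)| ≤ 1 := habs _ (by norm_num) (by norm_num)
  have hh' : |(-1 / 2 : ℝ)| ≤ 1 := habs _ (by norm_num) (by norm_num)
  have hr3 : |√3 / 2| ≤ 1 := habs _ (by linarith) (by linarith)
  have hr3' : |-√3 / 2| ≤ 1 := habs _ (by linarith) (by linarith)
  have a1 : |-t1 / 2 + (1 - t1) * (√3 / 2)| ≤ 1 := by
    convert abs_interp l1 u1 hh' hr3 using 2; ring
  have b1 : |t1 * (√3 / 2) + (1 - t1) / 2| ≤ 1 := by
    convert abs_interp l1 u1 hr3 hh using 2; ring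
  have a2 : |-t2 / 2 - (1 - t2) * (√3 / 2)| ≤ 1 := by
    convert abs_interp l2 u2 hh' hr3' using 2; ring
  have b2 : |-t2 * (√3 / 2) + (1 - t2) / 2| ≤ 1 := by
    convert abs_interp l2 u2 hr3' hh using 2; ring
  have E1 : Th p 1 - Th q 1 = (p.2 0 - q.2 0) * t0
      + (p.2 1 - q.2 1) * (-t1 / 2 + (1 - t1) * (√3 / 2))
      + (p.2 2 - q.2 2) * (-t2 / 2 - (1 - t2) * (√3 / 2)) := by
    rw [c1, c1']
    linear_combination m0 - (1 / 2) * m1 - √3 / 2 * n1 - (1 / 2) * m2 + √3 / 2 * n2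
  have E2 : Th p 2 - Th q 2 = (p.2 0 - q.2 0) * (-(1 - t0))
      + (p.2 1 - q.2 1) * (t1 * (√3 / 2) + (1 - t1) / 2)
      + (p.2 2 - q.2 2) * (-t2 * (√3 / 2) + (1 - t2) / 2) := by
    rw [c2, c2']
    linear_combination n0 + √3 / 2 * m1 - (1 / 2) * n1 - √3 / 2 * m2 - (1 / 2) * n2
  have E3 : Th p 3 - Th q 3 = -((p.2 0 - q.2 0) + (p.2 1 - q.2 1) + (p.2 2 - q.2 2)) / 2 := by
    rw [c3, c3']
    linear_combination (n0 - m0) / 2 + (n1 - m1) / 2 + (n2 - m2) / 2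
  have d0 : |p.2 0 - q.2 0| ≤ 16 * M :=
    cramer_bound a0 a1 a2 b0 b1 b2 hS1 E1 E2 E3 (hM 1) (hM 2) (hM 3)
  have d1 : |p.2 1 - q.2 1| ≤ 16 * M :=
    cramer_bound (d0 := p.2 1 - q.2 1) (d1 := p.2 2 - q.2 2) (d2 :=
      p.2 0 - q.2 0) a1 a2 a0 b1 b2 b0 (hS1.trans_eq (by ring)) (E1.trans (by ring))
      (E2.trans (by ring)) (E3.trans (by ring)) (hM 1) (hM 2) (hM 3)
  have d2 : |p.2 2 - q.2 2| ≤ 16 * M :=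
    cramer_bound (d0 := p.2 2 - q.2 2) (d1 := p.2 0 - q.2 0) (d2 :=
      p.2 1 - q.2 1) a2 a0 a1 b2 b0 b1 (hS1.trans_eq (by ring)) (E1.trans (by ring))
      (E2.trans (by ring)) (E3.trans (by ring)) (hM 1) (hM 2) (hM 3)
  have hc : |p.1 - q.1| ≤ 49 * M := by
    have E0 : p.1 - q.1 = (Th p 0 - Th q 0) - (2 * t0 - 1) * (p.2 0 - q.2 0)
        - (2 * t1 - 1) * (p.2 1 - q.2 1) - (2 * t2 - 1) * (p.2 2 - q.2 2) := by
      rw [c0, c0']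
      linear_combination -m0 - n0 - m1 - n1 - m2 - n2
    have hk : ∀ t d : ℝ, 0 ≤ t → t ≤ 1 → |d| ≤ 16 * M → |(2 * t - 1) * d| ≤ 16 * M := by
      intro t d h h' hd
      rw [abs_mul]
      have : |2 * t - 1| ≤ 1 := habs _ (by linarith) (by linarith)
      nlinarith [abs_nonneg d]
    have g0 := abs_le.mp (hk _ _ l0 u0 d0)
    have g1 := abs_le.mp (hk _ _ l1 u1 d1)
    have g2 := abs_le.mp (hk _ _ l2 u2 d2)
    have g3 := abs_le.mp (hM 0)
    rw [E0, abs_le]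
    clear_value M
    clear E0 E1 E2 E3 c0 c1 c2 c3 c0' c1' c2' c3' hS hS' hS1 m0 m1 m2 n0 n1 n2
    constructor <;> linarith [g0.1, g1.1, g2.1, g3.1, g0.2, g1.2, g2.2, g3.2]
  rw [Prod.dist_eq]
  refine max_le (by simpa [Real.dist_eq] using hc) ?_
  refine (dist_pi_le_iff (by positivity)).mpr fun k => ?_
  rw [Real.dist_eq]
  have h49 : (16 : ℝ) * M ≤ ((49 : NNReal) : ℝ) * M := by
    have h49' : ((49 : NNReal) : ℝ) = 49 := by norm_num
    rw [h49']
    exact mul_le_mul_of_nonneg_right (by norm_num) hM0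
  fin_cases k
  · exact d0.trans h49
  · exact d1.trans h49
  · exact d2.trans h49

/-- The Euclidean scalar product. -/
def euc (x y : V4) : ℝ := x 0 * y 0 + x 1 * y 1 + x 2 * y 2 + x 3 * y 3

/-- The first variation of the distance at a minimum, in the direction `u`: if `r` cannot be
shortened by moving along `u`, then the angle between `r` and `u` is not acute. -/
theorem euc_le_zero {r u : V4} {ε : ℝ} (hε : 0 < ε)
    (h : ∀ τ : ℝ, 0 ≤ τ → τ ≤ ε → euc r r ≤ euc (r - τ • u) (r - τ • u)) : euc r u ≤ 0 := by
  by_contra hc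
  push Not at hc
  have hexp : ∀ τ : ℝ, euc (r - τ • u) (r - τ • u)
      = euc r r - 2 * τ * euc r u + τ ^ 2 * euc u u := by
    intro τ
    simp only [euc, Pi.sub_apply, Pi.smul_apply, smul_eq_mul]; ring
  have hu : 0 ≤ euc u u := by
    simp only [euc]; nlinarith [mul_self_nonneg (u 0), mul_self_nonneg (u 1),
      mul_self_nonneg (u 2), mul_self_nonneg (u 3)]
  set τ := min ε (euc r u / (euc u u + 1)) with hτ
  have hτ0 : 0 < τ := lt_min hε (by positivity)
  have h1 := h τ hτ0.le (min_le_left _ _)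
  rw [hexp] at h1
  have h2 : τ * (euc u u + 1) ≤ euc r u := by
    rw [← le_div_iff₀ (by positivity)]; exact min_le_right _ _
  nlinarith

theorem Th_update (p : ℝ × (Fin 3 → ℝ)) (k : Fin 3) (z : ℝ) :
    Th (p.1, Function.update p.2 k z) = Th p + (max z 0 - max (p.2 k) 0) • vx false k
      + (max (-z) 0 - max (-p.2 k) 0) • vx true k := by
  fin_cases k <;> simp [Th_apply, sub_smul] <;> abel

/-- The octahedral fan is complete: a point of the image of `Th` closest to a given point `x` is
`x`, because the residual is orthogonal to vectors that interpolate between the opposite vertices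
of each of the three pairs, and those are linearly independent. -/
theorem Th_surjective : Function.Surjective Th := by
  intro x
  let f : ℝ × (Fin 3 → ℝ) → ℝ := fun p => euc (x - Th p) (x - Th p)
  have hfc : Continuous f := by
    have : Continuous fun p => x - Th p := by fun_prop
    simp only [f, euc]; fun_prop
  have hlow : ∀ p, ‖x - Th p‖ ^ 2 ≤ f p := by
    intro p
    have hf0 : 0 ≤ f p := by
      simp only [f, euc]
      nlinarith [mul_self_nonneg ((x - Th p) 0), mul_self_nonneg ((x - Th p) 1),
        mul_self_nonneg ((x - Th p) 2), mul_self_nonneg ((x - Th p) 3)]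
    have : ‖x - Th p‖ ≤ √(f p) := by
      refine (pi_norm_le_iff_of_nonneg (Real.sqrt_nonneg _)).mpr fun i => ?_
      refine Real.le_sqrt_of_sq_le ?_
      rw [Real.norm_eq_abs, sq_abs]
      simp only [f, euc]
      fin_cases i <;> simp only [Fin.zero_eta, Fin.mk_one, Fin.reduceFinMk] <;>
      nlinarith [mul_self_nonneg ((x - Th p) 0), mul_self_nonneg ((x - Th p) 1),
        mul_self_nonneg ((x - Th p) 2), mul_self_nonneg ((x - Th p) 3)]
    calc ‖x - Th p‖ ^ 2 ≤ √(f p) ^ 2 := by gcongr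
      _ = f p := Real.sq_sqrt hf0
  have hmin : ∃ p, ∀ q, f p ≤ f q := by
    refine hfc.exists_forall_le' 0 ?_
    have ht : Tendsto (fun p => ‖x - Th p‖) (cocompact (ℝ × (Fin 3 → ℝ))) atTop := by
      have h1 := Th_antilipschitz.tendsto_cobounded
      rw [Metric.cobounded_eq_cocompact] at h1
      have h2 := tendsto_norm_cobounded_atTop.comp h1
      have h3 := tendsto_atTop_add_const_right (cocompact (ℝ × (Fin 3 → ℝ))) (-‖x‖) h2
      refine tendsto_atTop_mono (fun p => ?_) h3
      have := norm_sub_norm_le (Th p) x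
      rw [norm_sub_rev] at this
      simp only [Function.comp_apply]
      linarith
    filter_upwards [ht.eventually_ge_atTop (f 0 + 1)] with p hp
    have hf0 : 0 ≤ f 0 := (sq_nonneg _).trans (hlow 0)
    nlinarith [hlow p]
  obtain ⟨p, hp⟩ := hmin
  set r := x - Th p with hr
  have vary : ∀ (q : ℝ × (Fin 3 → ℝ)) (u : V4), Th q = Th p + u → euc r r ≤ euc (r - u) (r - u) :=
    by
    intro q u hq
    have := hp q
    simp only [f, hq, sub_add_eq_sub_sub] at this
    exact this
  -- the coordinate on the centre can be varied in both directions, so that `r` is orthogonal to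
  -- `e0`
  have hr0 : r 0 = 0 := by
    have h1 : euc r e0 ≤ 0 := euc_le_zero one_pos fun τ _ _ => vary (p.1 + τ, p.2) _ (by
      simp only [Th_apply, add_smul]; abel)
    have h2 : euc r (-e0) ≤ 0 := euc_le_zero one_pos fun τ _ _ => vary (p.1 - τ, p.2) _ (by
      simp only [Th_apply, sub_smul, smul_neg]; abel)
    simp [euc, e0] at h1 h2
    linarith
  -- the residual is orthogonal to a vector `t • vx false k - (1 - t) • vx true k`: if the
  -- coordinate does not vanish, to the vertex in use; if it vanishes, `r` makes no acute angle with
  -- either vertex, and a suitable combination annihilates `r`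
  have hk : ∀ k, ∃ t : ℝ, 0 ≤ t ∧ t ≤ 1 ∧
    t * euc r (vx false k) - (1 - t) * euc r (vx true k) = 0 := by
    intro k
    have up : 0 ≤ p.2 k → euc r (vx false k) ≤ 0 := fun h =>
      euc_le_zero one_pos fun τ hτ _ => vary (p.1, Function.update p.2 k (p.2 k + τ)) _ (by
        rw [Th_update, max_eq_left h, max_eq_left (by linarith), max_eq_right (by linarith),
          max_eq_right (by linarith), add_sub_cancel_left, sub_self, zero_smul, add_zero])
    have up' : 0 < p.2 k → -euc r (vx false k) ≤ 0 := fun h => by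
      have : euc r (-vx false k) ≤ 0 :=
        euc_le_zero h fun τ hτ hτ' => vary (p.1, Function.update p.2 k (p.2 k - τ)) _ (by
          rw [Th_update, max_eq_left h.le, max_eq_left (by linarith), max_eq_right (by linarith),
            max_eq_right (by linarith), sub_self, zero_smul, add_zero, smul_neg, ← neg_smul]
          congr 2; ring)
      simpa [euc, neg_add, add_comm, sub_eq_add_neg] using this
    have dn : p.2 k ≤ 0 → euc r (vx true k) ≤ 0 := fun h =>
      euc_le_zero one_pos fun τ hτ _ => vary (p.1, Function.update p.2 k (p.2 k - τ)) _ (by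
        rw [Th_update, max_eq_right h, max_eq_right (by linarith), max_eq_left (by linarith),
          max_eq_left (by linarith), sub_self, zero_smul, add_zero]
        congr 2; ring)
    have dn' : p.2 k < 0 → -euc r (vx true k) ≤ 0 := fun h => by
      have : euc r (-vx true k) ≤ 0 :=
        euc_le_zero (neg_pos.mpr h) fun τ hτ hτ' =>
          vary (p.1, Function.update p.2 k (p.2 k + τ)) _ (by
          rw [Th_update, max_eq_right h.le, max_eq_right (by linarith), max_eq_left (by linarith),
            max_eq_left (by linarith), sub_self, zero_smul, add_zero, smul_neg, ← neg_smul]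
          congr 2; ring)
      simpa [euc, neg_add, add_comm, sub_eq_add_neg] using this
    rcases lt_trichotomy (p.2 k) 0 with h | h | h
    · exact ⟨0, le_rfl, zero_le_one, by linarith [dn h.le, dn' h]⟩
    · have h1 := up h.ge
      have h2 := dn h.le
      rcases h1.lt_or_eq with h1 | h1
      · have hs : euc r (vx false k) + euc r (vx true k) < 0 := by linarith
        refine ⟨euc r (vx true k) / (euc r (vx false k) + euc r (vx true k)), ?_, ?_, ?_⟩
        · exact div_nonneg_of_nonpos h2 hs.le
        · rw [div_le_one_of_neg hs]; linarith
        · have := hs.ne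
          field_simp; ring
      · exact ⟨1, zero_le_one, le_rfl, by linarith⟩
    · exact ⟨1, zero_le_one, le_rfl, by linarith [up h.le, up' h]⟩
  obtain ⟨t0, l0, u0, m0⟩ := hk 0
  obtain ⟨t1, l1, u1, m1⟩ := hk 1
  obtain ⟨t2, l2, u2, m2⟩ := hk 2
  have hq := sqrt3_sq
  have hS := orient_eq t0 t1 t2 _ hq
  have hS' := orient_pos l0 u0 l1 u1 l2 u2
  have hS1 : 0 < √3 / 2 * (t0 * t1 + (1 - t0) * (1 - t1) + (t1 * t2 + (1 - t1) * (1 - t2))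
      + (t2 * t0 + (1 - t2) * (1 - t0))) :=
    mul_pos (by linarith [sqrt3_lb]) (by linarith)
  rw [← hS] at hS1
  simp only [euc, vx_false, vx_true, hr0, cs, sn, Matrix.cons_val] at m0 m1 m2
  set a1 := -t1 / 2 + (1 - t1) * (√3 / 2)
  set b1 := t1 * (√3 / 2) + (1 - t1) / 2
  set a2 := -t2 / 2 - (1 - t2) * (√3 / 2)
  set b2 := -t2 * (√3 / 2) + (1 - t2) / 2
  have e0' : r 1 * t0 + r 2 * (-(1 - t0)) = r 3 / 2 := by linarith
  have e1' : r 1 * a1 + r 2 * b1 = r 3 / 2 := by simp only [a1, b1]; linarith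
  have e2' : r 1 * a2 + r 2 * b2 = r 3 / 2 := by simp only [a2, b2]; linarith
  have hr1 : r 1 = 0 := by
    refine (mul_eq_zero.mp (?_ : r 1 * _ = 0)).resolve_right hS1.ne'
    linear_combination (b1 - b2) * e0' + (b2 - -(1 - t0)) * e1' + (-(1 - t0) - b1) * e2'
  have hr2 : r 2 = 0 := by
    refine (mul_eq_zero.mp (?_ : r 2 * _ = 0)).resolve_right hS1.ne'
    linear_combination (a2 - a1) * e0' + (t0 - a2) * e1' + (a1 - t0) * e2'
  have hr3 : r 3 = 0 := by rw [hr1, hr2] at e0'; linarith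
  refine ⟨p, (sub_eq_zero.mp (?_ : x - Th p = 0)).symm⟩
  rw [← hr]
  funext i
  fin_cases i <;> simp [hr0, hr1, hr2, hr3]

/-- `Th` as a homeomorphism. -/
def ThH : ℝ × (Fin 3 → ℝ) ≃ₜ V4 where
  toEquiv := Equiv.ofBijective Th ⟨Th_antilipschitz.injective, Th_surjective⟩
  continuous_toFun := continuous_Th
  continuous_invFun :=
    (Th_antilipschitz.to_rightInverse (Equiv.ofBijective_apply_symm_apply Th
      ⟨Th_antilipschitz.injective, Th_surjective⟩)).continuous

/-- The coordinate on the centre. The octahedron is `0 ≤ c0 x`. -/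
def c0 (x : V4) : ℝ := (ThH.symm x).1

/-- The coordinates on the three pairs of vertices. -/
def yc (x : V4) : Fin 3 → ℝ := (ThH.symm x).2

@[fun_prop]
theorem continuous_c0 : Continuous c0 := continuous_fst.comp ThH.symm.continuous

@[fun_prop]
theorem continuous_yc : Continuous yc := continuous_snd.comp ThH.symm.continuous

theorem Th_c0_yc (x : V4) : Th (c0 x, yc x) = x := ThH.apply_symm_apply x

theorem c0_Th (p : ℝ × (Fin 3 → ℝ)) : c0 (Th p) = p.1 := by
  change (ThH.symm (ThH p)).1 = _
  rw [ThH.symm_apply_apply]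

theorem yc_Th (p : ℝ × (Fin 3 → ℝ)) : yc (Th p) = p.2 := by
  change (ThH.symm (ThH p)).2 = _
  rw [ThH.symm_apply_apply]

/-! ### Symmetries of the octahedron -/

theorem mink_e0_e0 : mink e0 e0 = -1 := by simp [mink, e0]

theorem vx_zero (b : Bool) (k : Fin 3) : vx b k 0 = 1 := by
  cases b
  · simp [vx_false]
  · simp [vx_true]

theorem mink_e0 (x : V4) : mink e0 x = -x 0 := by simp [mink, e0]

theorem mink_vx_self (b : Bool) (k : Fin 3) : mink (vx b k) (vx b k) = 1 / 4 := by
  have := sqrt3_sq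
  cases b <;> fin_cases k <;> simp [vx_false, vx_true, mink, cs, sn] <;> linarith

theorem mink_vx_ne (b : Bool) (k : Fin 3) : mink (vx b k) (vx b k) ≠ 0 := by
  rw [mink_vx_self]; norm_num

/-- The Gram matrix of the vertices. The upper bound shows that the polar planes of different
vertices are disjoint, as `1 / 4 < 3 / 8`. -/
theorem mink_vx_bounds {b b' : Bool} {k k' : Fin 3} (h : (b, k) ≠ (b', k')) :
    mink (vx b k) (vx b' k') ≤ -3 / 8 ∧ -5 / 2 ≤ mink (vx b k) (vx b' k') := by
  have h1 := sqrt3_sq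
  have h2 := sqrt3_lb
  have h3 := sqrt3_ub
  constructor <;> cases b <;> fin_cases k <;> cases b' <;> fin_cases k' <;>
    simp [vx_false, vx_true, mink, cs, sn] at h ⊢ <;> linarith

/-- The polar planes of two different vertices are disjoint, quantitatively. -/
theorem mink_add_le {x : V4} (hx : InH x) {b b' : Bool} {k k' : Fin 3} (h : (b, k) ≠ (b', k')) :
    mink x (vx b k) + mink x (vx b' k') ≤ -(1 / 2) := by
  rw [← mink_add_right]
  refine mink_le_of_timelike hx ?_ ?_
  · rw [mink_add_left, mink_add_right, mink_add_right, mink_vx_self, mink_vx_self,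
      mink_comm (vx b' k')]
    linarith [(mink_vx_bounds h).1]
  · rw [Pi.add_apply, vx_zero, vx_zero]; norm_num

/-- The half-turn of the octahedron that exchanges the `j`-th vertices of the two triangles. -/
def tj (j : Fin 3) : V4 →ₗ[ℝ] V4 where
  toFun x := ![x 0, sn j * x 1 + cs j * x 2, cs j * x 1 - sn j * x 2, -x 3]
  map_add' x y := by
    funext i; fin_cases i <;> simp <;> ring
  map_smul' c x := by
    funext i; fin_cases i <;> simp <;> ring

theorem tj_apply (j : Fin 3) (x : V4) :
    tj j x = ![x 0, sn j * x 1 + cs j * x 2, cs j * x 1 - sn j * x 2, -x 3] := rfl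

theorem cs_sn_sq (j : Fin 3) : cs j * cs j + sn j * sn j = 1 := by
  have := sqrt3_sq
  fin_cases j <;> simp [cs, sn] <;> linarith

theorem tj_isIso (j : Fin 3) : IsIso (tj j) := by
  intro x y
  have := cs_sn_sq j
  simp only [mink, tj_apply, Matrix.cons_val]
  linear_combination (x 1 * y 1 + x 2 * y 2) * this

theorem tj_hasDet (j : Fin 3) : HasDet (tj j) 1 := by
  intro x a b c
  have h : ∀ C S : ℝ, det4 ![x 0, S * x 1 + C * x 2, C * x 1 - S * x 2, -x 3]
      ![a 0, S * a 1 + C * a 2, C * a 1 - S * a 2, -a 3]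
      ![b 0, S * b 1 + C * b 2, C * b 1 - S * b 2, -b 3]
      ![c 0, S * c 1 + C * c 2, C * c 1 - S * c 2, -c 3] = (C * C + S * S) * det4 x a b c := by
    intro C S
    simp only [det4, Matrix.cons_val]
    ring
  simp only [tj_apply]
  rw [h, cs_sn_sq]

theorem tj_tj (j : Fin 3) (x : V4) : tj j (tj j x) = x := by
  have := cs_sn_sq j
  funext i
  fin_cases i
  · simp [tj_apply]
  · simp [tj_apply]; linear_combination x 1 * this
  · simp [tj_apply]; linear_combination x 2 * this
  · simp [tj_apply]

theorem tj_e0 (j : Fin 3) : tj j e0 = e0 := by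
  funext i
  fin_cases i <;> simp [tj_apply, e0]

/-- The permutation of the three pairs of opposite vertices induced by a half-turn. -/
def tau (j k : Fin 3) : Fin 3 := -(j + k)

theorem tau_tau (j k : Fin 3) : tau j (tau j k) = k := by
  simp [tau]

theorem tau_self (j : Fin 3) : tau j j = j := by
  fin_cases j <;> rfl

theorem tau_eval : tau 0 0 = 0 ∧ tau 0 1 = 2 ∧ tau 0 2 = 1 ∧ tau 1 0 = 2 ∧ tau 1 1 = 1 ∧
    tau 1 2 = 0 ∧ tau 2 0 = 1 ∧ tau 2 1 = 0 ∧ tau 2 2 = 2 := by decide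

theorem tj_vx (j : Fin 3) (b : Bool) (k : Fin 3) : tj j (vx b k) = vx (!b) (tau j k) := by
  have h1 := sqrt3_sq
  have key : cs (tau j k) = cs j * cs k - sn j * sn k ∧
      sn (tau j k) = -(sn j * cs k + cs j * sn k) := by
    fin_cases j <;> fin_cases k <;> constructor <;>
      simp [tau, cs, sn] <;> linarith
  cases b <;> simp only [Bool.not_false, Bool.not_true, vx_false, vx_true, tj_apply, key.1, key.2]
    <;> funext i <;> fin_cases i <;> simp <;> ring

/-- The gluing isometry from the truncation face of the vertex `(b, k)` to that of the vertex
`(!b, k)`: it maps the octahedron to the side of the latter face opposite to the octahedron. -/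
def gl (b : Bool) (k : Fin 3) : V4 →ₗ[ℝ] V4 := tj k ∘ₗ refl (vx b k)

theorem gl_apply (b : Bool) (k : Fin 3) (x : V4) : gl b k x = tj k (refl (vx b k) x) := rfl

theorem gl_isIso (b : Bool) (k : Fin 3) : IsIso (gl b k) :=
  (tj_isIso k).comp (refl_isIso (mink_vx_ne b k))

theorem gl_hasDet (b : Bool) (k : Fin 3) : HasDet (gl b k) (-1) := by
  have := (tj_hasDet k).comp (refl_hasDet (mink_vx_ne b k))
  rwa [one_mul] at this

theorem tj_vx_self (b : Bool) (k : Fin 3) : tj k (vx b k) = vx (!b) k := by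
  rw [tj_vx, tau_self]

theorem gl_gl (b : Bool) (k : Fin 3) (x : V4) : gl (!b) k (gl b k x) = x := by
  rw [gl_apply, gl_apply, ← tj_vx_self, refl_conj (tj_isIso k), tj_tj,
    refl_refl (mink_vx_ne b k)]

theorem refl_vx (b : Bool) (k : Fin 3) : refl (vx b k) (vx b k) = -vx b k := by
  have := mink_vx_ne b k
  rw [refl_apply, mul_div_assoc, div_self this, mul_one, two_smul]; abel

theorem mink_gl (b : Bool) (k : Fin 3) (x : V4) :
    mink (gl b k x) (vx (!b) k) = -mink x (vx b k) := by
  rw [gl_apply, ← tj_vx_self, tj_isIso, ← refl_isIso (mink_vx_ne b k),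
    refl_refl (mink_vx_ne b k), refl_vx, mink_neg_right]

theorem gl_of_orth {b : Bool} {k : Fin 3} {x : V4} (h : mink x (vx b k) = 0) :
    gl b k x = tj k x := by
  rw [gl_apply, refl_of_orth h]

/-! ### The octahedron in piecewise linear coordinates -/

/-- The sign of the coordinate on the vertices of `ABC` and of `A'B'C'`. -/
def sg (b : Bool) : ℝ := if b then -1 else 1

theorem sg_not (b : Bool) : sg (!b) = -sg b := by cases b <;> simp [sg]

theorem sg_mul_self (b : Bool) : sg b * sg b = 1 := by cases b <;> simp [sg]

/-- The nonnegative coordinate on the vertex `(b, k)`. -/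
def pp (b : Bool) (t : ℝ) : ℝ := max (sg b * t) 0

theorem pp_nonneg (b : Bool) (t : ℝ) : 0 ≤ pp b t := le_max_right _ _

theorem Th_eq (p : ℝ × (Fin 3 → ℝ)) :
    Th p = p.1 • e0 + ∑ k, (pp false (p.2 k) • vx false k + pp true (p.2 k) • vx true k) := by
  simp [Th, pp, sg]

/-- Here `1 / 4 = 5 / 8 - 3 / 8` is the norm of a vertex, and `-3 / 8` bounds the other entries of
the Gram matrix. -/
theorem mink_Th_vx_le {p : ℝ × (Fin 3 → ℝ)} (hp : 0 ≤ p.1) (b : Bool) (k : Fin 3) :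
    mink (Th p) (vx b k) ≤ 5 / 8 * pp b (p.2 k) - 3 / 8 * Th p 0 := by
  have key : ∀ (b' : Bool) (k' : Fin 3), (b', k') ≠ (b, k) →
      pp b' (p.2 k') * mink (vx b' k') (vx b k) ≤ -(3 / 8) * pp b' (p.2 k') := by
    intro b' k' h
    nlinarith [(mink_vx_bounds h).1, pp_nonneg b' (p.2 k')]
  have hs : pp b (p.2 k) * mink (vx b k) (vx b k) = pp b (p.2 k) / 4 := by
    rw [mink_vx_self]; ring
  have he : mink e0 (vx b k) = -1 := by rw [mink_e0, vx_zero]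
  have he0 : e0 0 = 1 := rfl
  rw [Th_eq, Fin.sum_univ_three]
  simp only [mink_add_left, mink_smul_left, Pi.add_apply, Pi.smul_apply, smul_eq_mul, vx_zero,
    he, he0]
  have k1 := key (!b) k (by simp)
  have k2 := fun b' => key b' (k + 1) (by simp)
  have k3 := fun b' => key b' (k + 2) (by simp)
  have l2 := k2 false
  have l2' := k2 true
  have l3 := k3 false
  have l3' := k3 true
  clear k2 k3 key
  fin_cases k <;> cases b <;>
    simp only [Bool.not_false, Bool.not_true, Fin.zero_eta, Fin.mk_one, Fin.reduceFinMk,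
      Fin.reduceAdd, zero_add] at * <;>
    linarith

/-- Near the truncation face of a vertex, the coordinate on this vertex is large. -/
theorem pp_of_collar {x : V4} (hx : InH x) (h0 : 0 ≤ c0 x) {b : Bool} {k : Fin 3}
    (h : -(1 / 100) < mink x (vx b k)) : 1 / 2 < sg b * yc x k := by
  have h1 := mink_Th_vx_le (p := (c0 x, yc x)) h0 b k
  rw [Th_c0_yc] at h1
  have h2 := hx.one_le
  have h3 : 1 / 2 < pp b (yc x k) := by linarith
  rw [pp, lt_max_iff] at h3
  exact h3.resolve_right (by norm_num)

/-- A half-turn exchanges the triangles `ABC` and `A'B'C'`, so that it reverses the signs of the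
coordinates. -/
theorem tj_Th (j : Fin 3) (p : ℝ × (Fin 3 → ℝ)) :
    tj j (Th p) = Th (p.1, fun k => -p.2 (tau j k)) := by
  rw [Th, Th, map_add, map_smul, tj_e0, map_sum]
  congr 1
  refine Fintype.sum_equiv ⟨tau j, tau j, tau_tau j, tau_tau j⟩ _ _ fun k => ?_
  simp only [map_add, map_smul, tj_vx, Bool.not_false, Bool.not_true, Equiv.coe_fn_mk, tau_tau,
    neg_neg]
  rw [add_comm]

/-- The reflection in the polar plane of a vertex only changes the coordinate on this vertex, as
long as this coordinate remains nonnegative; `8 = 2 / (1 / 4)` is twice the reciprocal of the norm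
of the vertex. -/
theorem refl_Th {p : ℝ × (Fin 3 → ℝ)} {b : Bool} {k : Fin 3} {z : ℝ} (h0 : 0 ≤ sg b * p.2 k)
    (h1 : 0 ≤ sg b * z) (hz : z = p.2 k - 8 * sg b * mink (Th p) (vx b k)) :
    refl (vx b k) (Th p) = Th (p.1, Function.update p.2 k z) := by
  rw [Th_update, refl_apply, mink_vx_self]
  cases b
  · simp only [sg, Bool.false_eq_true, if_false, one_mul, mul_one] at h0 h1 hz
    rw [max_eq_left h0, max_eq_left h1, max_eq_right (by linarith), max_eq_right (by linarith),
      sub_self, zero_smul, add_zero, sub_eq_add_neg, ← neg_smul]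
    congr 2
    rw [hz]; ring
  · simp only [sg, if_true] at h0 h1 hz
    rw [max_eq_right (by linarith), max_eq_right (by linarith), max_eq_left (by linarith),
      max_eq_left (by linarith), sub_self, zero_smul, add_zero, sub_eq_add_neg, ← neg_smul]
    congr 2
    rw [hz]; ring

theorem sg_mul_update {b : Bool} {x t c : ℝ} :
    sg b * (x - 8 * sg b * c - t) = sg b * x - 8 * c - sg b * t := by
  have := sg_mul_self b
  linear_combination (-8 * c) * this

/-- In the collar of a truncation face, the gluing isometry preserves the coordinate on the
centre, and it changes the signs of the coordinates on the pairs of vertices like the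
half-turn. -/
theorem gl_coords {x : V4} (hx : InH x) (h0 : 0 ≤ c0 x) {b : Bool} {k : Fin 3}
    (h : |mink x (vx b k)| < 1 / 100) :
    c0 (gl b k x) = c0 x ∧ (∀ m, m ≠ k → yc (gl b k x) m = -yc x (tau k m)) ∧
      sg b * yc (gl b k x) k < 0 := by
  rw [abs_lt] at h
  have h1 := pp_of_collar hx h0 h.1
  set z := yc x k - 8 * sg b * mink x (vx b k) with hz
  have hz1 : 0 < sg b * z := by
    have := sg_mul_update (b := b) (x := yc x k) (t := 0) (c := mink x (vx b k))
    rw [mul_zero, sub_zero, sub_zero, ← hz] at this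
    linarith
  have h2 : gl b k x = Th (c0 x, fun m => -Function.update (yc x) k z (tau k m)) := by
    have h3 := refl_Th (p := (c0 x, yc x)) (b := b) (k := k) (z := z) (by linarith) hz1.le
      (by rw [Th_c0_yc])
    rw [Th_c0_yc] at h3
    rw [gl_apply, h3, tj_Th]
  rw [h2, c0_Th, yc_Th]
  refine ⟨rfl, fun m hm => ?_, ?_⟩
  · have : tau k m ≠ k := fun h => hm (by rw [← tau_tau k m, h, tau_self])
    simp only [Function.update_of_ne this]
  · simp only [tau_self, Function.update_self]
    linarith

/-! ### The infinitesimal flex of the octahedron -/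

/-- The infinitesimal isometry by which the triangle `A'B'C'` moves under the flex: a screw motion
about the axis of the octahedron. The triangle `ABC` moves by the opposite screw motion. -/
def kap : V4 →ₗ[ℝ] V4 where
  toFun x := ![x 3, -2 * x 2, 2 * x 1, x 0]
  map_add' x y := by
    funext i; fin_cases i <;> simp <;> ring
  map_smul' c x := by
    funext i; fin_cases i <;> simp <;> ring

/-- The hyperbolic part of the motion of a triangle of the octahedron. -/
def flexBoost (s : Fin 3 → ℝ) : Fin 3 → ℝ :=
  ![s 2 * ((-1 - √3) / 4) + s 1 * ((-1 + √3) / 4) + s 0 / 2 - s 1 * s 2 / 2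
      + s 0 * s 2 * ((1 + √3) / 4) + s 0 * s 1 * ((1 - √3) / 4),
    s 2 * ((1 - √3) / 4) + s 1 * ((1 + √3) / 4) - s 0 / 2 - s 1 * s 2 / 2
      + s 0 * s 2 * ((1 - √3) / 4) + s 0 * s 1 * ((1 + √3) / 4),
    -(s 0 * s 1 * s 2)]

/-- The rotational part of the motion of a triangle of the octahedron. -/
def flexRot (s : Fin 3 → ℝ) : Fin 3 → ℝ :=
  ![s 2 * ((1 + √3) / 2) + s 1 * ((1 - √3) / 2) - s 0 - s 1 * s 2
      + s 0 * s 2 * ((1 + √3) / 2) + s 0 * s 1 * ((1 - √3) / 2),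
    s 2 * ((-1 + √3) / 2) + s 1 * ((-1 - √3) / 2) + s 0 - s 1 * s 2
      + s 0 * s 2 * ((1 - √3) / 2) + s 0 * s 1 * ((1 + √3) / 2),
    -(s 0 + s 1 + s 2) + s 0 * s 1 * s 2]

/-- For `s : Fin 3 → {1, -1}`, the infinitesimal isometry by which the triangle with vertices of
signs `s` moves under the flex. The formula is affine in each of the `s k`, so that `s k = 0`
stands for the mean of the values at `1` and `-1`. The motion is determined by the condition that it
agrees with `- s k • kap` on the vertices, which is possible because this condition preserves the
lengths of the edges to first order: that is the infinitesimal flexibility of the octahedron. -/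
def Kf (s : Fin 3 → ℝ) : V4 →ₗ[ℝ] V4 where
  toFun x := ![flexBoost s 0 * x 1 + flexBoost s 1 * x 2 + flexBoost s 2 * x 3,
    flexBoost s 0 * x 0 + flexRot s 1 * x 3 - flexRot s 2 * x 2,
    flexBoost s 1 * x 0 + flexRot s 2 * x 1 - flexRot s 0 * x 3,
    flexBoost s 2 * x 0 + flexRot s 0 * x 2 - flexRot s 1 * x 1]
  map_add' x y := by
    funext i; fin_cases i <;> simp <;> ring
  map_smul' c x := by
    funext i; fin_cases i <;> simp <;> ring

/-- An infinitesimal isometry of Minkowski space. -/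
def IsSkew (K : V4 →ₗ[ℝ] V4) : Prop := ∀ x y, mink (K x) y = -mink x (K y)

theorem kap_skew : IsSkew kap := by
  intro x y; simp [mink, kap]; ring

theorem Kf_skew (s : Fin 3 → ℝ) : IsSkew (Kf s) := by
  intro x y; simp [mink, Kf]; ring

/-- The triangles that share a vertex move this vertex in the same way. -/
theorem Kf_vx {s : Fin 3 → ℝ} {b : Bool} {k : Fin 3} (h : s k = sg b) :
    Kf s (vx b k) = -sg b • kap (vx b k) := by
  have h1 := sqrt3_sq
  cases b <;> fin_cases k <;>
    simp only [sg, if_true, Bool.false_eq_true, if_false, Fin.zero_eta, Fin.mk_one,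
      Fin.reduceFinMk] at h <;>
    funext i <;> fin_cases i <;>
    simp [Kf, kap, vx_false, vx_true, flexBoost, flexRot, cs, sn, sg, h] <;>
    ring_nf <;> simp only [pow_two, sqrt3_sq] <;> ring

theorem Kf_tj (j : Fin 3) (s : Fin 3 → ℝ) (x : V4) :
    Kf (fun k => -s (tau j k)) (tj j x) = tj j (Kf s x) := by
  obtain ⟨t1, t2, t3, t4, t5, t6, t7, t8, t9⟩ := tau_eval
  fin_cases j <;> funext i <;> fin_cases i <;>
    simp [Kf, tj_apply, flexBoost, flexRot, cs, sn, t1, t2, t3, t4, t5, t6, t7, t8, t9] <;>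
    ring_nf <;> (try simp only [pow_two, sqrt3_sq]) <;> ring

/-- The flex changes the distance of two opposite vertices, so that it is not an infinitesimal
isometry of the octahedron. -/
theorem mink_kap_vx_zero : mink (vx false 0) (kap (vx true 0)) = -3 := by
  simp [mink, kap, vx_false, vx_true, cs, sn]; norm_num

/-! ### The double of the truncated octahedron, with collars -/

/-- Coordinates of the double of the octahedron along its triangles, truncated slightly beyond
the polar planes of the vertices. The sign of the first coordinate tells the copy, and its
absolute value is the coordinate on the centre; the triangles are given by `q.1 = 0`. -/
def Qset : Set (ℝ × (Fin 3 → ℝ)) :=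
  {q | InH (Th (|q.1|, q.2)) ∧ ∀ b k, mink (Th (|q.1|, q.2)) (vx b k) < 1 / 100}

/-- The double of the octahedron, truncated slightly beyond the polar planes of the vertices. -/
abbrev Q : Type := Qset

namespace Q

/-- The coordinate on the centre, with the sign of the copy. -/
def u (q : Q) : ℝ := q.1.1

/-- The coordinates on the pairs of vertices. -/
def y (q : Q) : Fin 3 → ℝ := q.1.2

/-- The folding map from the double of the octahedron to the octahedron. -/
def fold (q : Q) : V4 := Th (|q.u|, q.y)

@[fun_prop]
theorem continuous_u : Continuous u := continuous_fst.comp continuous_subtype_val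

@[fun_prop]
theorem continuous_y : Continuous y := continuous_snd.comp continuous_subtype_val

@[fun_prop]
theorem continuous_fold : Continuous fold := by unfold fold; fun_prop

theorem inH (q : Q) : InH q.fold := q.2.1

theorem lt (q : Q) (b : Bool) (k : Fin 3) : mink q.fold (vx b k) < 1 / 100 := q.2.2 b k

theorem c0_fold (q : Q) : c0 q.fold = |q.u| := c0_Th _

theorem yc_fold (q : Q) : yc q.fold = q.y := yc_Th _

theorem c0_nonneg (q : Q) : 0 ≤ c0 q.fold := by rw [c0_fold]; positivity

theorem ext_fold {p q : Q} (hu : p.u = q.u) (hf : p.fold = q.fold) : p = q := by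
  refine Subtype.ext (Prod.ext hu ?_)
  change p.y = q.y
  rw [← yc_fold, hf, yc_fold]

theorem fold_mk (u : ℝ) (x : V4) (hu : |u| = c0 x) : Th (|u|, yc x) = x := by
  rw [hu, Th_c0_yc]

/-- The point over `x` with signed coordinate `u` on the centre. -/
def mk (u : ℝ) (x : V4) (hu : |u| = c0 x) (hx : InH x) (h : ∀ b k, mink x (vx b k) < 1 / 100) :
    Q :=
  ⟨(u, yc x), by
    rw [Qset, Set.mem_ofPred_eq, fold_mk u x hu]
    exact ⟨hx, h⟩⟩

theorem mk_u {u : ℝ} {x : V4} (hu : |u| = c0 x) (hx : InH x)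
    (h : ∀ b k, mink x (vx b k) < 1 / 100) : (mk u x hu hx h).u = u := rfl

theorem mk_fold {u : ℝ} {x : V4} (hu : |u| = c0 x) (hx : InH x)
    (h : ∀ b k, mink x (vx b k) < 1 / 100) : (mk u x hu hx h).fold = x := fold_mk u x hu

/-- The collar of the truncation face of a vertex. -/
def Collar (b : Bool) (k : Fin 3) (q : Q) : Prop := |mink q.fold (vx b k)| < 1 / 100

theorem isOpen_collar (b : Bool) (k : Fin 3) : IsOpen {q : Q | Collar b k q} :=
  isOpen_lt (by fun_prop) continuous_const

/-- The collars of different truncation faces are disjoint. -/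
theorem Collar.unique {q : Q} {b b' : Bool} {k k' : Fin 3} (h : Collar b k q)
    (h' : Collar b' k' q) : b = b' ∧ k = k' := by
  by_contra hne
  have := mink_add_le q.inH (b := b) (b' := b') (k := k) (k' := k') (by simpa using hne)
  rw [Collar, abs_lt] at h h'
  linarith [h.1, h'.1]

/-- Two points of the double that are identified by the gluing isometry `gl b k`. -/
def GlueBy (b : Bool) (k : Fin 3) (p q : Q) : Prop := q.u = p.u ∧ q.fold = gl b k p.fold

theorem GlueBy.symm {b : Bool} {k : Fin 3} {p q : Q} (h : GlueBy b k p q) :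
    GlueBy (!b) k q p := ⟨h.1.symm, by rw [h.2, gl_gl]⟩

theorem GlueBy.collar_right {b : Bool} {k : Fin 3} {p q : Q} (h : GlueBy b k p q) :
    Collar (!b) k q := by
  have h1 := q.lt (!b) k
  have h2 := p.lt b k
  have h3 := mink_gl b k p.fold
  rw [← h.2] at h3
  rw [Collar, abs_lt]
  constructor <;> linarith

theorem GlueBy.collar_left {b : Bool} {k : Fin 3} {p q : Q} (h : GlueBy b k p q) :
    Collar b k p := by
  simpa using h.symm.collar_right

theorem gl_inH {x : V4} (hx : InH x) {b : Bool} {k : Fin 3}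
    (h : |mink x (vx b k)| < 1 / 100) : InH (gl b k x) := by
  refine ⟨by rw [gl_isIso, hx.1], ?_⟩
  rw [abs_lt] at h
  have := hx.one_le
  simp only [gl_apply, tj_apply, refl_apply, Matrix.cons_val, Pi.sub_apply, Pi.smul_apply,
    smul_eq_mul, vx_zero, mink_vx_self]
  linarith [h.2]

theorem gl_lt {x : V4} (hx : InH x) {b : Bool} {k : Fin 3}
    (h : |mink x (vx b k)| < 1 / 100) (b' : Bool) (k' : Fin 3) :
    mink (gl b k x) (vx b' k') < 1 / 100 := by
  have h1 := mink_gl b k x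
  rw [abs_lt] at h
  by_cases he : (b', k') = (!b, k)
  · obtain ⟨rfl, rfl⟩ := Prod.mk.inj he
    linarith [h.1]
  · have := mink_add_le (gl_inH hx (abs_lt.mpr h)) he
    linarith [h.2]

open Classical in
/-- The gluing map of a collar. -/
def glue (b : Bool) (k : Fin 3) (q : Q) : Q :=
  if h : Collar b k q then
    mk q.u (gl b k q.fold) (by rw [(gl_coords q.inH q.c0_nonneg h).1, c0_fold]) (gl_inH q.inH h)
      (gl_lt q.inH h)
  else q

theorem glueBy_glue {b : Bool} {k : Fin 3} {q : Q} (h : Collar b k q) :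
    GlueBy b k q (glue b k q) := by
  rw [glue, dif_pos h]
  exact ⟨mk_u _ _ _, mk_fold _ _ _⟩

theorem GlueBy.eq_glue {b : Bool} {k : Fin 3} {p q : Q} (h : GlueBy b k p q) :
    q = glue b k p := by
  have := glueBy_glue h.collar_left
  exact ext_fold (h.1.trans this.1.symm) (h.2.trans this.2.symm)

theorem continuousOn_glue (b : Bool) (k : Fin 3) :
    ContinuousOn (glue b k) {q | Collar b k q} := by
  rw [Topology.IsEmbedding.subtypeVal.continuousOn_iff]
  have hc : Continuous fun q : Q => (q.u, yc (gl b k q.fold)) := by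
    have : Continuous (gl b k) := LinearMap.continuous_of_finiteDimensional _
    fun_prop
  refine hc.continuousOn.congr fun q hq => ?_
  have h : Collar b k q := hq
  simp only [Function.comp_apply, glue, dif_pos h]
  rfl

end Q

/-! ### The cone-manifold -/

/-- Points of `n` copies of the double that are identified in the cone-manifold: the collar of a
truncation face in one copy is glued to the collar of the opposite truncation face in the copy
with the reversed index. -/
def Rel (n : ℕ) (p q : Fin n × Q) : Prop :=
  p = q ∨ ∃ b k, q.1 = p.1.rev ∧ Q.GlueBy b k p.2 q.2

theorem rel_equivalence (n : ℕ) : Equivalence (Rel n) where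
  refl p := Or.inl rfl
  symm := by
    rintro p q (h | ⟨b, k, h1, h2⟩)
    · exact Or.inl h.symm
    · exact Or.inr ⟨!b, k, by rw [h1, Fin.rev_rev], h2.symm⟩
  trans := by
    rintro p q r (h | ⟨b, k, h1, h2⟩) (h' | ⟨b', k', h1', h2'⟩)
    · exact Or.inl (h.trans h')
    · rw [h]; exact Or.inr ⟨b', k', h1', h2'⟩
    · rw [← h']; exact Or.inr ⟨b, k, h1, h2⟩
    · obtain ⟨rfl, rfl⟩ := h2.collar_right.unique h2'.collar_left
      refine Or.inl (Prod.ext (by rw [h1', h1, Fin.rev_rev]) (Q.ext_fold ?_ ?_))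
      · rw [h2'.1, h2.1]
      · rw [h2'.2, h2.2, gl_gl]

/-- The equivalence relation defining the cone-manifold. -/
def relSetoid (n : ℕ) : Setoid (Fin n × Q) := ⟨Rel n, rel_equivalence n⟩

/-- The cone-manifold glued from `n` copies of the double of the truncated octahedron. -/
def Mfd (n : ℕ) : Type := Quotient (relSetoid n)

instance (n : ℕ) : TopologicalSpace (Mfd n) := inferInstanceAs (TopologicalSpace (Quotient _))

/-- The projection to the cone-manifold. -/
def proj (n : ℕ) (p : Fin n × Q) : Mfd n := Quotient.mk (relSetoid n) p

/-- The projection of the `i`-th copy of the double. -/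
def pr {n : ℕ} (i : Fin n) (q : Q) : Mfd n := proj n (i, q)

theorem proj_eq_iff {n : ℕ} {p q : Fin n × Q} : proj n p = proj n q ↔ Rel n p q :=
  Quotient.eq (r := relSetoid n)

theorem pr_eq_iff {n : ℕ} {i j : Fin n} {p q : Q} : pr i p = pr j q ↔
    (i = j ∧ p = q) ∨ ∃ b k, j = i.rev ∧ Q.GlueBy b k p q := by
  rw [pr, pr, proj_eq_iff, Rel, Prod.mk.injEq]

theorem pr_surj {n : ℕ} (m : Mfd n) : ∃ (i : Fin n) (q : Q), pr i q = m := by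
  obtain ⟨p, rfl⟩ := Quotient.exists_rep m
  exact ⟨p.1, p.2, rfl⟩

/-- The saturation of an open set is its union with its images under the gluing maps of the open
collars. -/
theorem isOpenQuotientMap_proj (n : ℕ) : IsOpenQuotientMap (proj n) where
  surjective := Quotient.mk_surjective
  continuous := continuous_quotient_mk'
  isOpenMap := by
    intro U hU
    refine isOpen_coinduced.mpr ?_
    have : proj n ⁻¹' (proj n '' U) = U ∪ ⋃ (b : Bool) (k : Fin 3),
        {p : Fin n × Q | Q.Collar b k p.2} ∩ (fun p => (p.1.rev, Q.glue b k p.2)) ⁻¹' U := by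
      ext p
      simp only [Set.mem_preimage, Set.mem_image, Set.mem_union, Set.mem_iUnion, Set.mem_inter_iff,
        Set.mem_ofPred_eq]
      constructor
      · rintro ⟨q, hq, hqp⟩
        rcases proj_eq_iff.mp hqp.symm with h | ⟨b, k, h1, h2⟩
        · left; rwa [h]
        · right
          refine ⟨b, k, h2.collar_left, ?_⟩
          rw [← h2.eq_glue, ← h1]; exact hq
      · rintro (h | ⟨b, k, h1, h2⟩)
        · exact ⟨p, h, rfl⟩
        · exact ⟨_, h2, (proj_eq_iff.mpr (Or.inr ⟨b, k, rfl, Q.glueBy_glue h1⟩)).symm⟩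
    change IsOpen (proj n ⁻¹' (proj n '' U))
    rw [this]
    refine hU.union (isOpen_iUnion fun b => isOpen_iUnion fun k => ?_)
    refine ContinuousOn.isOpen_inter_preimage ?_ ((Q.isOpen_collar b k).preimage continuous_snd) hU
    refine ContinuousOn.prodMk
      ((continuous_of_discreteTopology (f := Fin.rev)).comp continuous_fst).continuousOn ?_
    exact (Q.continuousOn_glue b k).comp continuous_snd.continuousOn fun p hp => hp

instance (n : ℕ) : T2Space (Mfd n) := by
  -- the equivalence relation is closed, because it is given by equations between continuous
  -- functions: the condition `GlueBy` does not refer to the collars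
  rw [t2Space_iff_of_isOpenQuotientMap (isOpenQuotientMap_proj n)]
  have : {q : (Fin n × Q) × (Fin n × Q) | proj n q.1 = proj n q.2}
      = {q | q.1 = q.2} ∪ ⋃ (b : Bool) (k : Fin 3), {q | q.2.1 = q.1.1.rev} ∩
        ({q | q.2.2.u = q.1.2.u} ∩ {q | q.2.2.fold = gl b k q.1.2.fold}) := by
    ext q
    simp only [Set.mem_ofPred_eq, proj_eq_iff, Rel, Set.mem_union, Set.mem_iUnion,
      Set.mem_inter_iff, Q.GlueBy]
  rw [this]
  refine (isClosed_eq continuous_fst continuous_snd).union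
    (isClosed_iUnion_of_finite fun b => isClosed_iUnion_of_finite fun k => ?_)
  have hg : Continuous (gl b k) := LinearMap.continuous_of_finiteDimensional _
  exact (isClosed_eq (by fun_prop) (by fun_prop)).inter
    ((isClosed_eq (by fun_prop) (by fun_prop)).inter (isClosed_eq (by fun_prop) (by fun_prop)))

@[fun_prop]
theorem continuous_pr {n : ℕ} (i : Fin n) : Continuous (pr i) :=
  (isOpenQuotientMap_proj n).continuous.comp (by fun_prop)

theorem isOpenMap_pr {n : ℕ} (i : Fin n) : IsOpenMap (pr i) := by
  refine (isOpenQuotientMap_proj n).isOpenMap.comp fun U hU => ?_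
  convert (isOpen_discrete {i}).prod hU using 1
  ext ⟨j, p⟩
  constructor
  · rintro ⟨q, hq, h⟩
    obtain ⟨rfl, rfl⟩ := Prod.mk.inj h
    exact ⟨rfl, hq⟩
  · rintro ⟨rfl, hq⟩
    exact ⟨p, hq, rfl⟩

/-- Two points of one sheet that are glued to each other lie near the polar planes of two different
vertices, so that they are not close to each other. -/
theorem isLocalHomeomorph_pr {n : ℕ} (i : Fin n) : IsLocalHomeomorph (pr i) := by
  rw [isLocalHomeomorph_iff_isOpenEmbedding_restrict]
  intro q
  -- `1 / 200` fits: if `p` and its image both lie in `U`, then the scalar products of `q` with the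
  -- two vertices have a sum `> -1 / 100`, and it is at most `-1 / 2`
  let U : Set Q := {p | ∀ b k, |mink p.fold (vx b k) - mink q.fold (vx b k)| < 1 / 200}
  have hU : IsOpen U := by
    simp only [U, Set.ofPred_forall]
    exact isOpen_iInter_of_finite fun b => isOpen_iInter_of_finite fun k =>
      isOpen_lt (by fun_prop) continuous_const
  refine ⟨U, hU.mem_nhds (by simp [U]), ?_⟩
  refine Topology.IsOpenEmbedding.of_continuous_injective_isOpenMap
    ((continuous_pr i).comp continuous_subtype_val) ?_ ((isOpenMap_pr i).domRestrict hU)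
  rintro ⟨p, hp⟩ ⟨p', hp'⟩ h
  rcases pr_eq_iff.mp h with h | ⟨b, k, -, h⟩
  · exact Subtype.ext h.2
  · exfalso
    have h1 := abs_lt.mp (hp b k)
    have h2 := abs_lt.mp (hp' (!b) k)
    have h3 := mink_gl b k p.fold
    rw [← h.2] at h3
    have := mink_add_le q.inH (b := b) (b' := !b) (k := k) (k' := k) (by simp)
    linarith [h1.2, h2.2]

/-! ### Compactness -/

/-- Here `1 / 4 = 11 / 4 - 5 / 2` is the norm of a vertex, and `-5 / 2` bounds the other entries of
the Gram matrix. -/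
theorem mink_Th_vx_ge {p : ℝ × (Fin 3 → ℝ)} (hp : 0 ≤ p.1) (b : Bool) (k : Fin 3) :
    11 / 4 * pp b (p.2 k) - 5 / 2 * Th p 0 ≤ mink (Th p) (vx b k) := by
  have key : ∀ (b' : Bool) (k' : Fin 3), (b', k') ≠ (b, k) →
      -(5 / 2) * pp b' (p.2 k') ≤ pp b' (p.2 k') * mink (vx b' k') (vx b k) := by
    intro b' k' h
    nlinarith [(mink_vx_bounds h).2, pp_nonneg b' (p.2 k')]
  have hs : pp b (p.2 k) * mink (vx b k) (vx b k) = pp b (p.2 k) / 4 := by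
    rw [mink_vx_self]; ring
  have he : mink e0 (vx b k) = -1 := by rw [mink_e0, vx_zero]
  have he0 : e0 0 = 1 := rfl
  rw [Th_eq, Fin.sum_univ_three]
  simp only [mink_add_left, mink_smul_left, Pi.add_apply, Pi.smul_apply, smul_eq_mul, vx_zero,
    he, he0]
  have k1 := key (!b) k (by simp)
  have k2 := fun b' => key b' (k + 1) (by simp)
  have k3 := fun b' => key b' (k + 2) (by simp)
  have l2 := k2 false
  have l2' := k2 true
  have l3 := k3 false
  have l3' := k3 true
  clear k2 k3 key
  fin_cases k <;> cases b <;>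
    simp only [Bool.not_false, Bool.not_true, Fin.zero_eta, Fin.mk_one, Fin.reduceFinMk,
      Fin.reduceAdd, zero_add] at * <;>
    linarith

theorem Th_zero_eq (p : ℝ × (Fin 3 → ℝ)) : Th p 0 = p.1 + |p.2 0| + |p.2 1| + |p.2 2| := by
  have h : ∀ t : ℝ, max t 0 + max (-t) 0 = |t| := fun t => by
    rcases le_total 0 t with h | h
    · rw [max_eq_left h, max_eq_right (by linarith), abs_of_nonneg h, add_zero]
    · rw [max_eq_right h, max_eq_left (by linarith), abs_of_nonpos h, zero_add]
  rw [(Th_coords p).1, h, h, h]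

theorem pp_add_pp (t : ℝ) : pp false t + pp true t = |t| := by
  simp only [pp, sg, Bool.false_eq_true, if_false, if_true]
  rcases le_total 0 t with h | h
  · rw [max_eq_left (by linarith), max_eq_right (by linarith), abs_of_nonneg h]; ring
  · rw [max_eq_right (by linarith), max_eq_left (by linarith), abs_of_nonpos h]; ring

/-- The truncated octahedron is bounded. -/
theorem Th_bound {p : ℝ × (Fin 3 → ℝ)} (hp : 0 ≤ p.1) (hH : InH (Th p))
    (h : ∀ b k, mink (Th p) (vx b k) ≤ 0) : Th p 0 ≤ 300 := by
  have hx0 := hH.one_le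
  have hsum : -1 = p.1 * -Th p 0 + ∑ k, (pp false (p.2 k) * mink (Th p) (vx false k)
      + pp true (p.2 k) * mink (Th p) (vx true k)) := by
    conv_lhs => rw [← hH.1]
    have h2 : ∀ x, mink (Th p) x = mink x (Th p) := mink_comm _
    simp only [h2]
    conv_lhs => enter [1]; rw [Th_eq]
    rw [Fin.sum_univ_three, Fin.sum_univ_three]
    simp only [mink_add_left, mink_smul_left, mink_e0]
  have hterm : ∀ b k, 0 ≤ -(pp b (p.2 k) * mink (Th p) (vx b k)) := fun b k => by
    have := mul_nonneg (pp_nonneg b (p.2 k)) (neg_nonneg.mpr (h b k)); linarith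
  rw [Fin.sum_univ_three] at hsum
  have hc0 : 0 ≤ p.1 * Th p 0 := by positivity
  have hle : ∀ b k, -(pp b (p.2 k) * mink (Th p) (vx b k)) ≤ 1 := by
    intro b k
    cases b <;> fin_cases k <;> simp only [Fin.zero_eta, Fin.mk_one, Fin.reduceFinMk] <;>
      linarith [hterm false 0, hterm false 1, hterm false 2, hterm true 0, hterm true 1,
        hterm true 2]
  have hc : p.1 ≤ 1 := by
    have : p.1 * Th p 0 ≤ 1 := by
      linarith [hterm false 0, hterm false 1, hterm false 2, hterm true 0, hterm true 1,
        hterm true 2]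
    nlinarith
  -- two large coordinates would put the point close to two disjoint polar planes
  have hpair : ∀ (b b' : Bool) (k k' : Fin 3), k ≠ k' → 5 < pp b (p.2 k) →
      pp b' (p.2 k') ≤ 5 := by
    intro b b' k k' hk h1
    by_contra h2
    push Not at h2
    have h3 := mink_add_le hH (b := b) (b' := b') (k := k) (k' := k') (by simp [hk])
    nlinarith [hle b k, hle b' k', h b k, h b' k']
  by_contra hbig
  push Not at hbig
  have hex : ∃ b k, 90 < pp b (p.2 k) ∧ ∀ b' k', k' ≠ k → pp b' (p.2 k') ≤ 5 := by
    have : ∃ b k, 90 < pp b (p.2 k) := by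
      by_contra hcon
      push Not at hcon
      rw [Th_zero_eq] at hbig
      have hk : ∀ k, |p.2 k| ≤ 90 := by
        intro k
        rcases le_total 0 (p.2 k) with h0 | h0
        · have := hcon false k
          simp only [pp, sg, Bool.false_eq_true, if_false, one_mul, max_eq_left h0] at this
          rwa [abs_of_nonneg h0]
        · have := hcon true k
          simp only [pp, sg, if_true, neg_one_mul, max_eq_left (neg_nonneg.mpr h0)] at this
          rwa [abs_of_nonpos h0]
      linarith [hk 0, hk 1, hk 2]
    obtain ⟨b, k, hb⟩ := this
    exact ⟨b, k, hb, fun b' k' hk' => hpair b b' k k' hk'.symm (by linarith)⟩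
  obtain ⟨b, k, h1, h2⟩ := hex
  have h3 := mink_Th_vx_ge hp b k
  have h4 := h b k
  have h5 : Th p 0 ≤ 1 + pp b (p.2 k) + 10 + 10 := by
    have hother : pp (!b) (p.2 k) = 0 := by
      have : 0 < sg b * p.2 k := by
        have := h1
        rw [pp, lt_max_iff] at this
        rcases this with h | h <;> linarith
      rw [pp, sg_not]
      exact max_eq_right (by linarith)
    rw [Th_zero_eq, ← pp_add_pp, ← pp_add_pp, ← pp_add_pp]
    have l2 := fun b' => h2 b' (k + 1) (by simp)
    have l3 := fun b' => h2 b' (k + 2) (by simp)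
    have m2 := l2 false
    have m2' := l2 true
    have m3 := l3 false
    have m3' := l3 true
    clear hpair hle hterm hsum h2 l2 l3 hc0 hbig h3 h4 h
    fin_cases k <;> cases b <;>
      simp only [Bool.not_false, Bool.not_true, Fin.zero_eta, Fin.mk_one, Fin.reduceFinMk,
        Fin.reduceAdd, zero_add] at * <;>
      linarith
  linarith

/-- The double of the truncated octahedron. -/
def Qcore : Set Q := {q | ∀ b k, mink q.fold (vx b k) ≤ 0}

theorem isCompact_Qcore : IsCompact Qcore := by
  rw [Subtype.isCompact_iff]
  have himg : Subtype.val '' Qcore = {p : ℝ × (Fin 3 → ℝ) | mink (Th (|p.1|, p.2)) (Th (|p.1|,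
    p.2)) = -1
      ∧ 0 ≤ Th (|p.1|, p.2) 0 ∧ ∀ b k, mink (Th (|p.1|, p.2)) (vx b k) ≤ 0} := by
    ext p
    constructor
    · rintro ⟨q, hq, rfl⟩
      exact ⟨q.2.1.1, q.2.1.2.le, hq⟩
    · rintro ⟨h1, h2, h3⟩
      have hH : InH (Th (|p.1|, p.2)) := by
        refine ⟨h1, lt_of_le_of_ne h2 fun h => ?_⟩
        simp only [mink, ← h] at h1
        nlinarith [sq_nonneg (Th (|p.1|, p.2) 1), sq_nonneg (Th (|p.1|, p.2) 2),
          sq_nonneg (Th (|p.1|, p.2) 3)]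
      exact ⟨⟨p, hH, fun b k => (h3 b k).trans_lt (by norm_num)⟩, h3, rfl⟩
  have hclosed : IsClosed (Subtype.val '' Qcore) := by
    rw [himg]
    simp only [Set.ofPred_and, Set.ofPred_forall]
    refine (isClosed_eq (by fun_prop) continuous_const).inter
      ((isClosed_le continuous_const (by fun_prop)).inter
      (isClosed_iInter fun b => isClosed_iInter fun k =>
        isClosed_le (by fun_prop) continuous_const))
  refine Metric.isCompact_of_isClosed_isBounded hclosed ?_
  refine (Metric.isBounded_closedBall (x := (0 : ℝ × (Fin 3 → ℝ))) (r := 300)).subset ?_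
  rintro _ ⟨q, hq, rfl⟩
  have h1 := Th_bound (p := (|q.1.1|, q.1.2)) (abs_nonneg _) q.2.1 hq
  rw [Th_zero_eq] at h1
  rw [mem_closedBall_zero_iff, Prod.norm_def]
  have h2 := abs_nonneg q.1.1
  have h3 := fun k => abs_nonneg (q.1.2 k)
  refine max_le ?_ ?_
  · rw [Real.norm_eq_abs]; linarith [h3 0, h3 1, h3 2]
  · refine (pi_norm_le_iff_of_nonneg (by norm_num)).mpr fun k => ?_
    rw [Real.norm_eq_abs]
    fin_cases k
    · change |q.1.2 0| ≤ 300; linarith [h3 0, h3 1, h3 2]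
    · change |q.1.2 1| ≤ 300; linarith [h3 0, h3 1, h3 2]
    · change |q.1.2 2| ≤ 300; linarith [h3 0, h3 1, h3 2]

/-- A point beyond a truncation face is identified with a point of the truncated octahedron in the
glued copy. -/
theorem exists_core {n : ℕ} (m : Mfd n) : ∃ (i : Fin n) (q : Q), q ∈ Qcore ∧ pr i q = m := by
  obtain ⟨i, q, rfl⟩ := pr_surj m
  by_cases h : q ∈ Qcore
  · exact ⟨i, q, h, rfl⟩
  · simp only [Qcore, Set.mem_ofPred_eq, not_forall, not_le] at h
    obtain ⟨b, k, h⟩ := h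
    have hc : Q.Collar b k q := by
      rw [Q.Collar, abs_of_pos h]; exact q.lt b k
    have hg := Q.glueBy_glue hc
    refine ⟨i.rev, Q.glue b k q, fun b' k' => ?_, (pr_eq_iff.mpr (Or.inr ⟨b, k, rfl, hg⟩)).symm⟩
    have h3 := mink_gl b k q.fold
    rw [← hg.2] at h3
    by_cases he : (b', k') = (!b, k)
    · obtain ⟨rfl, rfl⟩ := Prod.mk.inj he
      linarith
    · have := mink_add_le (Q.glue b k q).inH he
      linarith [q.lt b k]

instance (n : ℕ) : CompactSpace (Mfd n) := by
  refine ⟨?_⟩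
  have : (Set.univ : Set (Mfd n)) = ⋃ i : Fin n, pr i '' Qcore := by
    refine (Set.eq_univ_of_forall fun m => ?_).symm
    obtain ⟨i, q, hq, rfl⟩ := exists_core m
    exact Set.mem_iUnion.mpr ⟨i, q, hq, rfl⟩
  rw [this]
  exact isCompact_iUnion fun i => isCompact_Qcore.image (continuous_pr i)

/-! ### Model spaces and their developing maps -/

/-- The map `r * exp (i φ) ↦ r * exp (i κ φ)`, for `φ ∈ (-π, π]`. -/
def pw (κ : ℝ) (z : ℂ) : ℂ := ‖z‖ * Complex.exp ((κ * z.arg : ℝ) * Complex.I)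

theorem norm_pw (κ : ℝ) (z : ℂ) : ‖pw κ z‖ = ‖z‖ := by
  rw [pw, norm_mul, Complex.norm_exp_ofReal_mul_I, mul_one, Complex.norm_real, norm_norm]

theorem pw_zero (κ : ℝ) : pw κ 0 = 0 := by simp [pw]

theorem pw_ne_zero {κ : ℝ} {z : ℂ} (hz : z ≠ 0) : pw κ z ≠ 0 := by
  rw [← norm_ne_zero_iff, norm_pw]; exact norm_ne_zero_iff.mpr hz

theorem pw_one (z : ℂ) : pw 1 z = z := by
  rw [pw, one_mul, Complex.norm_mul_exp_arg_mul_I]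

theorem arg_pw {κ : ℝ} {z : ℂ} (hz : z ≠ 0) (h : κ * z.arg ∈ Set.Ioc (-Real.pi) Real.pi) :
    (pw κ z).arg = κ * z.arg := by
  rw [pw, Complex.exp_mul_I, Complex.arg_mul_cos_add_sin_mul_I (norm_pos_iff.mpr hz) h]

theorem pw_pw {κ κ' : ℝ} (hκ : κ' * κ = 1) {z : ℂ}
    (h : κ * z.arg ∈ Set.Ioc (-Real.pi) Real.pi) : pw κ' (pw κ z) = z := by
  rcases eq_or_ne z 0 with rfl | hz
  · rw [pw_zero, pw_zero]
  · rw [pw, norm_pw, arg_pw hz h, ← mul_assoc, hκ, one_mul, Complex.norm_mul_exp_arg_mul_I]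

theorem pw_conj (κ : ℝ) {z : ℂ} (h : z.arg ≠ Real.pi) :
    pw κ ((starRingEnd ℂ) z) = (starRingEnd ℂ) (pw κ z) := by
  rw [pw, pw, Complex.arg_conj, if_neg h, map_mul, ← Complex.exp_conj, Complex.norm_conj]
  simp

theorem pw_re (κ : ℝ) (z : ℂ) : (pw κ z).re = ‖z‖ * Real.cos (κ * z.arg) := by
  rw [pw, Complex.re_ofReal_mul, Complex.exp_ofReal_mul_I_re]

theorem pw_im (κ : ℝ) (z : ℂ) : (pw κ z).im = ‖z‖ * Real.sin (κ * z.arg) := by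
  rw [pw, Complex.im_ofReal_mul, Complex.exp_ofReal_mul_I_im]

/-- The real linear map underlying the derivative of `pw κ`. -/
def argScale (κ : ℝ) : ℂ →L[ℝ] ℂ :=
  Complex.ofRealCLM.comp Complex.reCLM
    + (κ • (Complex.I • (Complex.ofRealCLM.comp Complex.imCLM)))

theorem argScale_apply (κ : ℝ) (z : ℂ) : argScale κ z = z.re + κ * z.im * Complex.I := by
  simp [argScale]; ring

theorem pw_eq_exp (κ : ℝ) {z : ℂ} (hz : z ≠ 0) :
    pw κ z = Complex.exp (argScale κ (Complex.log z)) := by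
  rw [argScale_apply, Complex.log_re, Complex.log_im, Complex.exp_add, ← Complex.ofReal_exp,
    Real.exp_log (norm_pos_iff.mpr hz), pw]
  push_cast
  ring_nf

theorem hasFDerivAt_pw (κ : ℝ) {z : ℂ} (hz : z ∈ Complex.slitPlane) :
    ∃ D : ℂ →L[ℝ] ℂ, HasFDerivAt (pw κ) D z ∧ ∀ v, D v = pw κ z * argScale κ (v / z) := by
  have h0 := Complex.slitPlane_ne_zero hz
  have h1 : HasFDerivAt Complex.log _ z :=
    (Complex.hasStrictDerivAt_log hz).hasDerivAt.hasFDerivAt.restrictScalars ℝ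
  have h2 := (argScale κ).hasFDerivAt.comp z h1
  have h3 := ((Complex.hasDerivAt_exp (argScale κ (Complex.log z))).hasFDerivAt.restrictScalars
    ℝ).comp z h2
  refine ⟨_, h3.congr_of_eventuallyEq ?_, fun v => ?_⟩
  · filter_upwards [isOpen_ne.mem_nhds h0] with w hw
    exact pw_eq_exp κ hw
  · simp [pw_eq_exp κ h0, div_eq_mul_inv, mul_comm]

theorem continuousAt_pw (κ : ℝ) {z : ℂ} (hz : z = 0 ∨ z.arg ≠ Real.pi) : ContinuousAt (pw κ) z := by
  rcases eq_or_ne z 0 with rfl | h0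
  · rw [ContinuousAt, pw_zero, tendsto_zero_iff_norm_tendsto_zero]
    simp only [norm_pw]
    simpa using (continuous_norm (E := ℂ)).tendsto 0
  · have hs : z ∈ Complex.slitPlane :=
      Complex.mem_slitPlane_iff_arg.mpr ⟨hz.resolve_left h0, h0⟩
    obtain ⟨D, hD, -⟩ := hasFDerivAt_pw κ hs
    exact hD.continuousAt

/-- The value of the volume form of `ℍ³` at `x` on the images of the standard basis. -/
def vol (x : V4) (D : ℝ × ℂ →L[ℝ] V4) : ℝ := det4 x (D (1, 0)) (D (0, 1)) (D (0, Complex.I))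

/-- The standard basis of `ℝ × ℂ`. -/
def stdB : Module.Basis (Fin 3) ℝ (ℝ × ℂ) :=
  Module.Basis.ofEquivFun
    { toFun := fun p => ![p.1, p.2.re, p.2.im]
      invFun := fun f => (f 0, ⟨f 1, f 2⟩)
      map_add' := fun p q => by funext i; fin_cases i <;> simp
      map_smul' := fun c p => by funext i; fin_cases i <;> simp
      left_inv := fun p => by simp
      right_inv := fun f => by funext i; fin_cases i <;> simp }

theorem stdB_apply : stdB 0 = (1, 0) ∧ stdB 1 = (0, 1) ∧ stdB 2 = (0, Complex.I) := by
  refine ⟨?_, ?_, ?_⟩ <;> refine Prod.ext ?_ (Complex.ext ?_ ?_) <;> simp [stdB]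

theorem stdB_repr (p : ℝ × ℂ) : stdB.repr p 0 = p.1 ∧ stdB.repr p 1 = p.2.re ∧
    stdB.repr p 2 = p.2.im := ⟨rfl, rfl, rfl⟩

theorem vol_comp (x : V4) (D : ℝ × ℂ →L[ℝ] V4) (L : ℝ × ℂ →L[ℝ] ℝ × ℂ) :
    vol x (D.comp L) = L.det * vol x D := by
  have hexp : ∀ p : ℝ × ℂ, D p = p.1 • D (1, 0) + p.2.re • D (0, 1) + p.2.im • D (0, Complex.I) :=
    by
    intro p
    rw [← map_smul, ← map_smul, ← map_smul, ← map_add, ← map_add]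
    congr 1
    refine Prod.ext ?_ (Complex.ext ?_ ?_) <;> simp
  have hdet : L.det = Matrix.det (LinearMap.toMatrix stdB stdB (L : ℝ × ℂ →ₗ[ℝ] ℝ × ℂ)) :=
    (LinearMap.det_toMatrix _ _).symm
  rw [hdet, Matrix.det_fin_three]
  simp only [LinearMap.toMatrix_apply, stdB_repr, stdB_apply, ContinuousLinearMap.coe_coe]
  simp only [vol, ContinuousLinearMap.comp_apply]
  rw [hexp (L (1, 0)), hexp (L (0, 1)), hexp (L (0, Complex.I))]
  simp only [det4, Pi.add_apply, Pi.smul_apply, smul_eq_mul]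
  ring

/-- A local isometry `Φ` from the model space `ℍ³(α)` near `x₀` to `ℍ³`, with a differentiable left
inverse `Ψ`. Only the sign of `o` matters: it is the orientation of `Φ`. -/
def LocDev (α : ℝ) (Φ : ℝ × ℂ → V4) (x₀ : ℝ × ℂ) (o : ℝ) : Prop :=
  ∃ (Ψ : V4 → ℝ × ℂ) (O : Set (ℝ × ℂ)), IsOpen O ∧ x₀ ∈ O ∧
    (∀ x ∈ O, DifferentiableAt ℝ Φ x ∧ Ψ (Φ x) = x ∧ DifferentiableAt ℝ Ψ (Φ x) ∧
      0 < o * vol (Φ x) (fderiv ℝ Φ x)) ∧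
    ∀ x ∈ O, ∀ y ∈ O, coneCosh α x y = -mink (Φ x) (Φ y)

theorem LocDev.eventually {α : ℝ} {Φ : ℝ × ℂ → V4} {x₀ : ℝ × ℂ} {o : ℝ} (h : LocDev α Φ x₀ o) :
    ∀ᶠ x in 𝓝 x₀, LocDev α Φ x o := by
  obtain ⟨Ψ, O, hO, hx, h⟩ := h
  filter_upwards [hO.mem_nhds hx] with y hy
  exact ⟨Ψ, O, hO, hy, h⟩

/-- Two local isometries to `ℍ³` determine the change of coordinates. -/
theorem LocDev.change {α α' : ℝ} {Φ Φ' : ℝ × ℂ → V4} {x₀ : ℝ × ℂ} {o o' : ℝ}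
    {f : ℝ × ℂ → ℝ × ℂ} (h : LocDev α Φ x₀ o) (h' : LocDev α' Φ' (f x₀) o')
    (hf : ContinuousAt f x₀) (hc : ∀ᶠ x in 𝓝 x₀, Φ' (f x) = Φ x) :
    DifferentiableAt ℝ f x₀ ∧
    (fderiv ℝ Φ' (f x₀)).comp (fderiv ℝ f x₀) = fderiv ℝ Φ x₀ ∧
    0 < o * o' * (fderiv ℝ f x₀).det := by
  obtain ⟨Ψ, O, hO, hx, h1, h2⟩ := h
  obtain ⟨Ψ', O', hO', hx', h1', h2'⟩ := h'
  have hd := h1 x₀ hx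
  have hd' := h1' (f x₀) hx'
  have hc0 := hc.self_of_nhds
  have hfd : DifferentiableAt ℝ f x₀ := by
    have h3 : DifferentiableAt ℝ (Ψ' ∘ Φ) x₀ := by
      refine DifferentiableAt.comp x₀ ?_ hd.1
      rw [← hc0]; exact hd'.2.2.1
    refine h3.congr_of_eventuallyEq ?_
    filter_upwards [hc, hf.preimage_mem_nhds (hO'.mem_nhds hx')] with x h4 h5
    rw [Function.comp_apply, ← h4, (h1' (f x) h5).2.1]
  have hcomp : (fderiv ℝ Φ' (f x₀)).comp (fderiv ℝ f x₀) = fderiv ℝ Φ x₀ := by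
    rw [← fderiv_comp x₀ hd'.1 hfd]
    exact Filter.EventuallyEq.fderiv_eq hc
  refine ⟨hfd, hcomp, ?_⟩
  have h6 := hd.2.2.2
  have h7 := hd'.2.2.2
  rw [← hcomp, vol_comp, ← hc0] at h6
  by_contra hcon
  push Not at hcon
  have h8 := mul_pos h6 h7
  have : o * ((fderiv ℝ f x₀).det * vol (Φ' (f x₀)) (fderiv ℝ Φ' (f x₀))) *
      (o' * vol (Φ' (f x₀)) (fderiv ℝ Φ' (f x₀)))
      = o * o' * (fderiv ℝ f x₀).det * (vol (Φ' (f x₀)) (fderiv ℝ Φ' (f x₀))) ^ 2 := by ring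
  rw [this] at h8
  nlinarith [sq_nonneg (vol (Φ' (f x₀)) (fderiv ℝ Φ' (f x₀)))]

theorem hasDerivAt_mink {f g : ℝ → V4} {f' g' : V4} {t : ℝ} (hf : HasDerivAt f f' t)
    (hg : HasDerivAt g g' t) :
    HasDerivAt (fun t => mink (f t) (g t)) (mink f' (g t) + mink (f t) g') t := by
  have hf := hasDerivAt_pi.mp hf
  have hg := hasDerivAt_pi.mp hg
  unfold mink
  refine HasDerivAt.congr_deriv (((((hf 0).mul (hg 0)).neg.add ((hf 1).mul (hg 1))).add
    ((hf 2).mul (hg 2))).add ((hf 3).mul (hg 3))) ?_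
  ring

/-- The first variation formula for the distance in the model space. -/
theorem LocDev.hasRate {α : ℝ} {Φ : ℝ × ℂ → V4} {x₀ : ℝ × ℂ} {o : ℝ} (h : LocDev α Φ x₀ o) :
    ∀ᶠ xy in 𝓝 (x₀, x₀), ∀ ξ η : ℝ × ℂ,
      HasDerivAt (fun t : ℝ => coneCosh α (xy.1 + t • ξ) (xy.2 + t • η))
        (-(mink (fderiv ℝ Φ xy.1 ξ) (Φ xy.2) + mink (Φ xy.1) (fderiv ℝ Φ xy.2 η))) 0 := by
  obtain ⟨Ψ, O, hO, hx, h1, h2⟩ := h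
  filter_upwards [(hO.prod hO).mem_nhds ⟨hx, hx⟩]
  rintro ⟨x, y⟩ ⟨hx, hy⟩ ξ η
  have hline : ∀ x ξ : ℝ × ℂ, HasDerivAt (fun t : ℝ => x + t • ξ) ξ 0 := by
    intro x ξ
    simpa using ((hasDerivAt_id (0 : ℝ)).smul_const ξ).const_add x
  have hΦ : ∀ x ξ, x ∈ O → HasDerivAt (fun t : ℝ => Φ (x + t • ξ)) (fderiv ℝ Φ x ξ) 0 := by
    intro x ξ hx
    have h3 := (h1 x hx).1.hasFDerivAt
    have h4 : HasFDerivAt Φ (fderiv ℝ Φ x) (x + (0 : ℝ) • ξ) := by simpa using h3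
    exact h4.comp_hasDerivAt 0 (hline x ξ)
  have h5 := (hasDerivAt_mink (hΦ x ξ hx) (hΦ y η hy)).neg
  simp only [zero_smul, add_zero] at h5
  refine h5.congr_of_eventuallyEq ?_
  have hmem : ∀ x ξ, x ∈ O → ∀ᶠ t : ℝ in 𝓝 0, x + t • ξ ∈ O := by
    intro x ξ hx
    have hc : ContinuousAt (fun t : ℝ => x + t • ξ) 0 := (hline x ξ).continuousAt
    exact hc.preimage_mem_nhds (hO.mem_nhds (by simpa using hx))
  filter_upwards [hmem x ξ hx, hmem y η hy] with t h6 h7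
  exact h2 _ h6 _ h7

/-- A local isometry can be composed with an isometry of `ℍ³`. -/
theorem LocDev.iso {α : ℝ} {Φ : ℝ × ℂ → V4} {x₀ : ℝ × ℂ} {o d : ℝ} (h : LocDev α Φ x₀ o)
    {g : V4 →ₗ[ℝ] V4} (hg : IsIso g) (hd : HasDet g d) (hd2 : d = 1 ∨ d = -1) :
    LocDev α (fun x => g (Φ x)) x₀ (o * d) := by
  obtain ⟨Ψ, O, hO, hx, h1, h2⟩ := h
  obtain ⟨k, -, hkg, hgk⟩ := hg.exists_inverse
  have hgc : ∀ x, HasFDerivAt g (LinearMap.toContinuousLinearMap g) x := fun x =>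
    (LinearMap.toContinuousLinearMap g).hasFDerivAt
  have hkc : Differentiable ℝ k := (LinearMap.toContinuousLinearMap k).differentiable
  refine ⟨fun y => Ψ (k y), O, hO, hx, fun x hx => ⟨?_, ?_, ?_, ?_⟩, fun x hx y hy => ?_⟩
  · exact (hgc _).differentiableAt.comp x (h1 x hx).1
  · simp only [hkg]; exact (h1 x hx).2.1
  · refine DifferentiableAt.comp (g (Φ x)) ?_ (hkc _)
    rw [hkg]; exact (h1 x hx).2.2.1
  · have hf : fderiv ℝ (fun x => g (Φ x)) x
        = (LinearMap.toContinuousLinearMap g).comp (fderiv ℝ Φ x) :=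
      ((hgc (Φ x)).comp x (h1 x hx).1.hasFDerivAt).fderiv
    have hv : vol (g (Φ x)) ((LinearMap.toContinuousLinearMap g).comp (fderiv ℝ Φ x))
        = d * vol (Φ x) (fderiv ℝ Φ x) := hd _ _ _ _
    rw [hf, hv]
    have hdd : d * d = 1 := by rcases hd2 with rfl | rfl <;> norm_num
    have := (h1 x hx).2.2.2
    have h3 : o * d * (d * vol (Φ x) (fderiv ℝ Φ x))
        = d * d * (o * vol (Φ x) (fderiv ℝ Φ x)) := by ring
    rw [h3, hdd, one_mul]; exact this
  · rw [h2 x hx y hy, hg]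

theorem angle_eq {w w' : ℂ} (hw : w ≠ 0) (hw' : w' ≠ 0) (h : |w.arg - w'.arg| < Real.pi) :
    InnerProductGeometry.angle w w' = |w.arg - w'.arg| := by
  rw [Complex.angle_eq_abs_arg hw hw', div_eq_mul_inv]
  rw [abs_lt] at h
  by_cases hpi : w'.arg = Real.pi
  · have h1 : (w'⁻¹).arg = Real.pi := by rw [Complex.arg_inv, if_pos hpi]
    have h2 : w / w' = (‖w‖ / ‖w'‖ : ℝ) * (Complex.cos (w.arg - w'.arg :
      ℝ) + Complex.sin (w.arg - w'.arg : ℝ) * Complex.I) := by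
      conv_lhs => rw [← Complex.norm_mul_exp_arg_mul_I w, ← Complex.norm_mul_exp_arg_mul_I w']
      rw [← Complex.exp_mul_I, mul_div_mul_comm, ← Complex.exp_sub]
      push_cast
      ring_nf
    rw [← div_eq_mul_inv, h2, Complex.arg_mul_cos_add_sin_mul_I (by positivity) ⟨h.1, h.2.le⟩]
  · have h1 : (w'⁻¹).arg = -w'.arg := by rw [Complex.arg_inv, if_neg hpi]
    rw [(Complex.arg_mul_eq_add_arg_iff hw (inv_ne_zero hw')).mpr, h1, sub_eq_add_neg]
    rw [h1]; exact ⟨by linarith [h.1], by linarith [h.2]⟩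

theorem norm_mul_cos_angle (z z' : ℂ) :
    ‖z‖ * ‖z'‖ * Real.cos (InnerProductGeometry.angle z z') = (z * (starRingEnd ℂ) z').re := by
  have h1 : (inner ℝ z z' : ℝ) = (z * (starRingEnd ℂ) z').re := by
    rw [Complex.inner]; simp [Complex.mul_re]; ring
  rw [← h1, ← InnerProductGeometry.cos_angle_mul_norm_mul_norm]; ring

theorem coneCosh_two_pi (p q : ℝ × ℂ) : coneCosh (2 * Real.pi) p q =
    Frame.cn p.2 * Frame.cn q.2 * Real.cosh (p.1 - q.1) - (p.2 * (starRingEnd ℂ) q.2).re := by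
  have h0 : (2 * Real.pi) / (2 * Real.pi) = 1 := div_self (by positivity)
  rw [coneCosh, h0, one_mul, min_eq_right (InnerProductGeometry.angle_le_pi _ _),
    norm_mul_cos_angle]
  rfl

theorem pw_mul_conj_re (κ : ℝ) (z z' : ℂ) : (pw κ z * (starRingEnd ℂ) (pw κ z')).re =
    ‖z‖ * ‖z'‖ * Real.cos (κ * (z.arg - z'.arg)) := by
  rw [Complex.mul_re, Complex.conj_re, Complex.conj_im, pw_re, pw_re, pw_im, pw_im, mul_sub,
    Real.cos_sub]
  ring

namespace Frame

variable (F : Frame)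

/-- The generator of the rotation about the axis of the frame. -/
def rot : V4 →ₗ[ℝ] V4 where
  toFun x := mink x F.N • F.B - mink x F.B • F.N
  map_add' x y := by rw [mink_add_left, mink_add_left]; module
  map_smul' c x := by rw [mink_smul_left, mink_smul_left]; simp only [RingHom.id_apply]; module

theorem rot_apply (x : V4) : F.rot x = mink x F.N • F.B - mink x F.B • F.N := rfl

theorem rot_skew : IsSkew F.rot := by
  intro x y
  simp only [rot_apply, mink_sub_left, mink_sub_right, mink_smul_left, mink_smul_right,
    mink_comm F.B y, mink_comm F.N y]
  ring

theorem dpt_rot (p : ℝ × ℂ) (t : ℝ) : F.dpt p (0, t * Complex.I * p.2) = t • F.rot (F.pt p) := by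
  rw [dpt, rot_apply, mink_pt_N, mink_pt_B]
  simp only [Complex.mul_re, Complex.mul_im, Complex.ofReal_re, Complex.ofReal_im, Complex.I_re,
    Complex.I_im]
  have : (p.2.re * ((t * 0 - 0 * 1) * p.2.re - (t * 1 + 0 * 0) * p.2.im)
    + p.2.im * ((t * 0 - 0 * 1) * p.2.im + (t * 1 + 0 * 0) * p.2.re)) = 0 := by ring
  rw [this]
  module

theorem differentiable_co : Differentiable ℝ F.co := by
  have hm : ∀ y : V4, Differentiable ℝ fun x => mink x y := fun y => by unfold mink; fun_prop
  have hz : F.zc = fun x => (mink x F.N : ℂ) + mink x F.B * Complex.I := by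
    funext x; apply Complex.ext <;> simp [zc]
  have hzd : Differentiable ℝ F.zc := by
    rw [hz]
    have h1 := hm F.N
    have h2 := hm F.B
    have h3 : ∀ f : V4 → ℝ, Differentiable ℝ f → Differentiable ℝ fun x => (f x : ℂ) :=
      fun f hf => Complex.ofRealCLM.differentiable.comp hf
    exact (h3 _ h1).add ((h3 _ h2).mul_const _)
  have hcn : Differentiable ℝ fun x => cn (F.zc x) := by
    have : ∀ x, cn (F.zc x) = √(1 + (mink x F.N ^ 2 + mink x F.B ^ 2)) := fun x => by
      rw [cn, norm_sq_eq]; rfl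
    simp only [this]
    have h1 := hm F.N
    have h2 := hm F.B
    refine Differentiable.sqrt (by fun_prop) fun x => by positivity
  unfold co
  have hq : Differentiable ℝ fun x => mink x F.A / cn (F.zc x) := by
    simp only [div_eq_mul_inv]
    exact (hm F.A).mul (hcn.inv fun x => (cn_pos _).ne')
  exact hq.arsinh.prodMk hzd

/-- The developing map of the model space of cone angle `2 * π * κ`. -/
def Dv (s₀ κ : ℝ) (p : ℝ × ℂ) : V4 := F.pt (p.1 + s₀, pw κ p.2)

theorem vol_dpt {p : ℝ × ℂ} {D : ℝ × ℂ →L[ℝ] V4} (hD : ∀ v, D v = F.dpt p v) :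
    vol (F.pt p) D = det4 F.T F.A F.N F.B := by
  rw [vol, hD, hD, hD, det4_dpt]

theorem det4_mul_self : det4 F.T F.A F.N F.B * det4 F.T F.A F.N F.B = 1 := by
  rcases F.det4_sq with h | h <;> rw [h] <;> norm_num

theorem hasFDerivAt_Dv_one (s₀ : ℝ) (p : ℝ × ℂ) :
    ∃ D : ℝ × ℂ →L[ℝ] V4, HasFDerivAt (F.Dv s₀ 1) D p ∧
      ∀ v, D v = F.dpt (p.1 + s₀, p.2) v := by
  obtain ⟨D, hD, hDv⟩ := F.hasFDerivAt_pt (p.1 + s₀, p.2)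
  refine ⟨D, ?_, hDv⟩
  have h1 : HasFDerivAt (fun p : ℝ × ℂ => (p.1 + s₀, p.2)) (ContinuousLinearMap.id ℝ (ℝ × ℂ)) p :=
    by
    have := (hasFDerivAt_id (𝕜 := ℝ) p).add_const (s₀, (0 : ℂ))
    refine this.congr_of_eventuallyEq (Eventually.of_forall fun q => ?_)
    refine Prod.ext ?_ ?_ <;> simp
  have h2 : F.Dv s₀ 1 = fun p => F.pt (p.1 + s₀, p.2) := by funext q; rw [Dv, pw_one]
  rw [h2]
  exact HasFDerivAt.comp p hD h1

/-- The model space of cone angle `2 * π` is `ℍ³`. -/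
theorem locDev_one (s₀ : ℝ) (p : ℝ × ℂ) :
    LocDev (2 * Real.pi) (F.Dv s₀ 1) p (det4 F.T F.A F.N F.B) := by
  refine ⟨fun x => ((F.co x).1 - s₀, (F.co x).2), Set.univ, isOpen_univ, trivial,
    fun x _ => ⟨?_, ?_, ?_, ?_⟩, fun x _ y _ => ?_⟩
  · obtain ⟨D, hD, -⟩ := F.hasFDerivAt_Dv_one s₀ x
    exact hD.differentiableAt
  · simp [Dv, co_pt, pw_one]
  · have := F.differentiable_co (F.Dv s₀ 1 x)
    exact (this.fst.sub_const s₀).prodMk this.snd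
  · obtain ⟨D, hD, hDv⟩ := F.hasFDerivAt_Dv_one s₀ x
    rw [hD.fderiv, Dv, pw_one, F.vol_dpt hDv, det4_mul_self]
    norm_num
  · rw [coneCosh_two_pi, Dv, Dv, pw_one, pw_one, mink_pt_pt]
    simp only [add_sub_add_right_eq_sub]
    ring

theorem hasFDerivAt_Dv (s₀ κ : ℝ) {p : ℝ × ℂ} (hp : p.2 ∈ Complex.slitPlane) :
    ∃ D : ℝ × ℂ →L[ℝ] V4, HasFDerivAt (F.Dv s₀ κ) D p ∧
      ∀ v, D v = F.dpt (p.1 + s₀, pw κ p.2) (v.1, pw κ p.2 * argScale κ (v.2 / p.2)) := by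
  obtain ⟨D, hD, hDv⟩ := F.hasFDerivAt_pt (p.1 + s₀, pw κ p.2)
  obtain ⟨E, hE, hEv⟩ := hasFDerivAt_pw κ hp
  have h1 : HasFDerivAt (fun p : ℝ × ℂ => (p.1 + s₀, pw κ p.2))
      ((ContinuousLinearMap.fst ℝ ℝ ℂ).prod (E.comp (ContinuousLinearMap.snd ℝ ℝ ℂ))) p :=
    (hasFDerivAt_fst.add_const s₀).prodMk (hE.comp p hasFDerivAt_snd)
  refine ⟨_, HasFDerivAt.comp p hD h1, fun v => ?_⟩
  rw [ContinuousLinearMap.comp_apply, hDv]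
  simp [hEv]

theorem dpt_add_smul (p : ℝ × ℂ) (a b : ℝ) : F.dpt p (0, ⟨a, b⟩)
    = a • F.dpt p (0, 1) + b • F.dpt p (0, Complex.I) := by
  simp only [dpt]
  funext i
  simp
  ring

/-- Off the axis, multiplication of the arguments by `κ = θ / π` is a local isometry from the model
space of cone angle `2 * θ = 2 * π * κ` to `ℍ³`. The cut of the argument does not interfere, because
the images of points close to the right half-plane have arguments in `(-π, π)`, as `θ < 2 * π`. -/
theorem locDev_pow (s₀ : ℝ) {θ : ℝ} (h0 : 0 < θ) (h2 : θ < 2 * Real.pi) {p : ℝ × ℂ}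
    (hp : p.2 ≠ 0) (harg : |p.2.arg| ≤ Real.pi / 2) :
    LocDev (2 * θ) (F.Dv s₀ (θ / Real.pi)) p (det4 F.T F.A F.N F.B) := by
  have hpi := Real.pi_pos
  set κ := θ / Real.pi with hκ
  have hκ0 : 0 < κ := by positivity
  have hκ2 : κ * Real.pi = θ := by rw [hκ]; field_simp
  have hslit : ∀ {w : ℂ}, w ≠ 0 → |w.arg| < Real.pi → w ∈ Complex.slitPlane := fun h0 h1 =>
    Complex.mem_slitPlane_iff_arg.mpr ⟨fun h => by rw [h, abs_of_pos hpi] at h1; exact h1.false, h0⟩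
  have hslitp : p.2 ∈ Complex.slitPlane := hslit hp (by linarith)
  -- the angle by which arguments may deviate from that of `p.2`, such that `κ` times the arguments
  -- and `κ` times their differences remain smaller than `π`
  set d := min (Real.pi / 4) ((2 * Real.pi - θ) / (4 * κ)) with hd
  have hd0 : 0 < d := lt_min (by positivity) (div_pos (by linarith) (by positivity))
  have hd1 : d ≤ Real.pi / 4 := min_le_left _ _
  have hd2 : κ * d ≤ (2 * Real.pi - θ) / 4 := by
    have := min_le_right (Real.pi / 4) ((2 * Real.pi - θ) / (4 * κ))
    rw [← hd, le_div_iff₀ (by positivity)] at this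
    linarith
  let O : Set (ℝ × ℂ) := {x | x.2 ∈ Complex.slitPlane ∧ |x.2.arg - p.2.arg| < d}
  have hOarg : ∀ x ∈ O, |κ * x.2.arg| < Real.pi := by
    intro x hx
    have h3 := abs_lt.mp hx.2
    have h4 := abs_le.mp harg
    rw [abs_lt]
    constructor <;> nlinarith
  have hO : IsOpen O := by
    have h3 : ContinuousOn (fun x : ℝ × ℂ => |x.2.arg - p.2.arg|)
        {x | x.2 ∈ Complex.slitPlane} := by
      intro x hx
      have h4 : ContinuousAt (fun x : ℝ × ℂ => x.2.arg) x :=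
        ContinuousAt.comp (f := Prod.snd) (Complex.continuousAt_arg hx) continuousAt_snd
      exact (h4.sub continuousAt_const).abs.continuousWithinAt
    exact h3.isOpen_inter_preimage (Complex.isOpen_slitPlane.preimage continuous_snd) isOpen_Iio
  refine ⟨fun x => ((F.co x).1 - s₀, pw κ⁻¹ (F.co x).2), O, hO, ⟨hslitp, by simpa using hd0⟩,
    fun x hx => ⟨?_, ?_, ?_, ?_⟩, fun x hx y hy => ?_⟩
  · obtain ⟨D, hD, -⟩ := F.hasFDerivAt_Dv s₀ κ hx.1
    exact hD.differentiableAt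
  · have h3 := abs_lt.mp (hOarg x hx)
    simp only [Dv, co_pt, add_sub_cancel_right]
    rw [pw_pw (inv_mul_cancel₀ hκ0.ne') ⟨h3.1, h3.2.le⟩]
  · have h3 := F.differentiable_co (F.Dv s₀ κ x)
    refine (h3.fst.sub_const s₀).prodMk ?_
    have h4 : (F.co (F.Dv s₀ κ x)).2 = pw κ x.2 := by rw [Dv, co_pt]
    have h5 := abs_lt.mp (hOarg x hx)
    have h6 : pw κ x.2 ∈ Complex.slitPlane := by
      refine hslit (pw_ne_zero (Complex.slitPlane_ne_zero hx.1)) ?_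
      rw [arg_pw (Complex.slitPlane_ne_zero hx.1) ⟨h5.1, h5.2.le⟩]
      exact hOarg x hx
    obtain ⟨E, hE, -⟩ := hasFDerivAt_pw κ⁻¹ h6
    rw [← h4] at hE
    exact DifferentiableAt.comp (F.Dv s₀ κ x) (g := pw κ⁻¹) hE.differentiableAt h3.snd
  · obtain ⟨D, hD, hDv⟩ := F.hasFDerivAt_Dv s₀ κ hx.1
    have hx0 := Complex.slitPlane_ne_zero hx.1
    rw [hD.fderiv, vol, hDv, hDv, hDv]
    simp only [zero_div, map_zero, mul_zero]
    set c1 := pw κ x.2 * argScale κ (1 / x.2) with hc1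
    set c2 := pw κ x.2 * argScale κ (Complex.I / x.2) with hc2
    have e1 : c1 = ⟨c1.re, c1.im⟩ := rfl
    have e2 : c2 = ⟨c2.re, c2.im⟩ := rfl
    rw [e1, e2, F.dpt_add_smul _ c1.re, F.dpt_add_smul _ c2.re, Dv]
    have key : ∀ a b c d : V4, ∀ t u v w : ℝ,
        det4 a b (t • c + u • d) (v • c + w • d) = (t * w - u * v) * det4 a b c d := by
      intro a b c d t u v w
      simp only [det4, Pi.add_apply, Pi.smul_apply, smul_eq_mul]; ring
    rw [key, det4_dpt]
    have hpos : 0 < c1.re * c2.im - c1.im * c2.re := by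
      have h3 : c1.re * c2.im - c1.im * c2.re
          = κ * ((pw κ x.2).re ^ 2 + (pw κ x.2).im ^ 2)
            * ((x.2⁻¹).re ^ 2 + (x.2⁻¹).im ^ 2) := by
        rw [hc1, hc2, one_div, argScale_apply, argScale_apply, div_eq_mul_inv]
        simp only [Complex.mul_re, Complex.mul_im, Complex.add_re, Complex.add_im,
          Complex.ofReal_re, Complex.ofReal_im, Complex.I_re, Complex.I_im]
        ring
      rw [h3, ← norm_sq_eq, ← norm_sq_eq, norm_pw]
      have := norm_pos_iff.mpr hx0
      have := norm_pos_iff.mpr (inv_ne_zero hx0)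
      positivity
    rcases F.det4_sq with h | h <;> rw [h] <;> linarith
  · have hx0 := Complex.slitPlane_ne_zero hx.1
    have hy0 := Complex.slitPlane_ne_zero hy.1
    have h3 : |x.2.arg - y.2.arg| < 2 * d := by
      have := abs_lt.mp hx.2
      have := abs_lt.mp hy.2
      rw [abs_lt]; constructor <;> linarith
    rw [coneCosh, angle_eq hx0 hy0 (by linarith), Dv, Dv, mink_pt_pt, pw_mul_conj_re]
    have h4 : 2 * θ / (2 * Real.pi) = κ := by rw [hκ]; field_simp
    rw [h4, min_eq_right (by nlinarith), ← Real.cos_abs (κ * (x.2.arg - y.2.arg)), abs_mul,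
      abs_of_pos hκ0]
    simp only [add_sub_add_right_eq_sub, cn, norm_pw]
    ring

/-- The derivative of the developing map along a rotation about the axis. -/
theorem fderiv_Dv_rot (s₀ κ : ℝ) {p : ℝ × ℂ} (h : κ = 1 ∨ p.2 ∈ Complex.slitPlane) (t : ℝ) :
    fderiv ℝ (F.Dv s₀ κ) p (0, t * Complex.I * p.2) = (t * κ) • F.rot (F.Dv s₀ κ p) := by
  rcases h with rfl | h
  · obtain ⟨D, hD, hDv⟩ := F.hasFDerivAt_Dv_one s₀ p
    rw [hD.fderiv, hDv, Dv, pw_one, mul_one]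
    exact F.dpt_rot (p.1 + s₀, p.2) t
  · obtain ⟨D, hD, hDv⟩ := F.hasFDerivAt_Dv s₀ κ h
    have h0 := Complex.slitPlane_ne_zero h
    rw [hD.fderiv, hDv, Dv, ← dpt_rot, mul_div_cancel_right₀ _ h0, argScale_apply]
    congr 2
    simp
    ring

end Frame

/-- The reflection of the model space in a half-plane bounded by the axis. -/
def mir (p : ℝ × ℂ) : ℝ × ℂ := (p.1, -(starRingEnd ℂ) p.2)

theorem mir_mir (p : ℝ × ℂ) : mir (mir p) = p := by simp [mir]

/-- `mir` as a continuous linear map. -/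
def mirL : ℝ × ℂ →L[ℝ] ℝ × ℂ :=
  (ContinuousLinearMap.fst ℝ ℝ ℂ).prod
    (-((Complex.conjCLE : ℂ →L[ℝ] ℂ).comp (ContinuousLinearMap.snd ℝ ℝ ℂ)))

theorem mirL_apply (p : ℝ × ℂ) : mirL p = mir p := rfl

theorem hasFDerivAt_mir (p : ℝ × ℂ) : HasFDerivAt mir mirL p := mirL.hasFDerivAt

theorem angle_mir (w w' : ℂ) : InnerProductGeometry.angle (-(starRingEnd ℂ) w)
    (-(starRingEnd ℂ) w') = InnerProductGeometry.angle w w' := by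
  rw [InnerProductGeometry.angle_neg_neg]
  exact Complex.conjLIE.toLinearIsometry.angle_map w w'

theorem coneCosh_mir (α : ℝ) (p q : ℝ × ℂ) : coneCosh α (mir p) (mir q) = coneCosh α p q := by
  simp only [coneCosh, mir, norm_neg, Complex.norm_conj, angle_mir]

/-- A local isometry can be composed with a reflection of the model space. -/
theorem LocDev.mirror {α : ℝ} {Φ : ℝ × ℂ → V4} {x₀ : ℝ × ℂ} {o : ℝ}
    (h : LocDev α Φ (mir x₀) o) : LocDev α (fun x => Φ (mir x)) x₀ (-o) := by
  obtain ⟨Ψ, O, hO, hx, h1, h2⟩ := h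
  have hmc : Continuous mir := mirL.continuous
  refine ⟨fun y => mir (Ψ y), mir ⁻¹' O, hO.preimage hmc, hx, fun x hx => ⟨?_, ?_, ?_, ?_⟩,
    fun x hx y hy => ?_⟩
  · exact (h1 _ hx).1.comp x (hasFDerivAt_mir x).differentiableAt
  · simp only [(h1 _ hx).2.1, mir_mir]
  · exact (hasFDerivAt_mir _).differentiableAt.comp _ (h1 _ hx).2.2.1
  · have hf : fderiv ℝ (fun x => Φ (mir x)) x = (fderiv ℝ Φ (mir x)).comp mirL :=
      (HasFDerivAt.comp x (h1 _ hx).1.hasFDerivAt (hasFDerivAt_mir x)).fderiv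
    have hv : vol (Φ (mir x)) ((fderiv ℝ Φ (mir x)).comp mirL)
        = -vol (Φ (mir x)) (fderiv ℝ Φ (mir x)) := by
      simp only [vol, ContinuousLinearMap.comp_apply, mirL_apply]
      have e1 : mir (1, 0) = (1, 0) := by simp [mir]
      have e2 : mir (0, 1) = -(0, 1) := by simp [mir]
      have e3 : mir (0, Complex.I) = (0, Complex.I) := by simp [mir]
      rw [e1, e2, e3, map_neg]
      simp only [det4, Pi.neg_apply]
      ring
    rw [hf, hv, neg_mul_neg]
    exact (h1 _ hx).2.2.2
  · rw [← coneCosh_mir, h2 _ hx _ hy]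

/-! ### Developing maps and velocities on the double -/

/-- The vertices of which the coordinates have the sign of `t`. -/
def bs (t : ℝ) : Bool := decide (t < 0)

theorem sg_bs {t : ℝ} (ht : t ≠ 0) : 0 < sg (bs t) * t := by
  rcases lt_or_gt_of_ne ht with h | h
  · simp [bs, sg, h]
  · have : ¬ t < 0 := h.le.not_gt
    simp [bs, sg, this, h]

theorem bs_of_pos {b : Bool} {t : ℝ} (h : 0 < sg b * t) : bs t = b := by
  cases b
  · simp [sg] at h; simp [bs, h.le]
  · simp [sg] at h; simp [bs, h]

theorem sign_of_pos {b : Bool} {t : ℝ} (h : 0 < sg b * t) : Real.sign t = sg b := by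
  cases b
  · simp [sg] at h ⊢; exact Real.sign_of_pos h
  · simp [sg] at h ⊢; exact Real.sign_of_neg h

/-- The normal vector of the triangle with vertices of given signs, up to length; it points to
the side of the centre of the octahedron. -/
def faceNormal (σ : Fin 3 → Bool) : V4 :=
  (sg (σ 0) * sg (σ 1) * sg (σ 2)) • cross (vx (σ 0) 0) (vx (σ 1) 1) (vx (σ 2) 2)

/-- The infinitesimal isometry that moves the triangle over which `x` lies. -/
def Kx (x : V4) : V4 →ₗ[ℝ] V4 := Kf fun k => Real.sign (yc x k)

namespace Q

/-- The points on the edges of the octahedron. -/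
def IsEdge (p : Q) : Prop := p.u = 0 ∧ ∃ k, p.y k = 0

/-- The reflection in the triangle over which `p` lies. -/
def S (p : Q) : V4 →ₗ[ℝ] V4 := refl (faceNormal fun k => bs (p.y k))

open Classical in
/-- The developing map near `p`. It unfolds the double if `p` is on a triangle. -/
def dev (p a : Q) : V4 := if p.u = 0 ∧ a.u < 0 then p.S a.fold else a.fold

/-- The velocities of the flex near `p`, in terms of the developing map. The two copies of the
octahedron move oppositely. Velocities matter only modulo infinitesimal isometries; near a point of
a triangle they are zero, because all points nearby lie over this triangle and move with it. -/
def vel (p a : Q) : V4 := Real.sign p.u • Kx a.fold a.fold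

/-- The orientation of the folding map. -/
def wt (p : Q) : ℝ := if p.u < 0 then -1 else 1

end Q

/-- The coordinates `φ` near `p` are isometric to the model space of angle `α`, with orientation
`o`, and `ξ` is a lift of the velocities of the flex to the coordinates, up to an infinitesimal
isometry `J`. The orientation refers to that of the double, and hence it is corrected by `p.wt`; on
a triangle, the developing map extends the embedding of the copy with `0 ≤ u`, for which `p.wt = 1`.
-/
def DevAt (α : ℝ) (φ ξ : Q → ℝ × ℂ) (p : Q) (o : ℝ) : Prop :=
  ∃ (Φ : ℝ × ℂ → V4) (J : V4 →ₗ[ℝ] V4), LocDev α Φ (φ p) (o * p.wt) ∧ IsSkew J ∧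
    ∀ᶠ a in 𝓝 p, Φ (φ a) = p.dev a ∧ fderiv ℝ Φ (φ a) (ξ a) = p.vel a + J (p.dev a)

theorem IsSkew.add {J K : V4 →ₗ[ℝ] V4} (hJ : IsSkew J) (hK : IsSkew K) : IsSkew (J + K) :=
  fun x y => by
    rw [LinearMap.add_apply, LinearMap.add_apply, mink_add_left, mink_add_right, hJ, hK]; ring

theorem IsSkew.smul {J : V4 →ₗ[ℝ] V4} (hJ : IsSkew J) (c : ℝ) : IsSkew (c • J) :=
  fun x y => by
    rw [LinearMap.smul_apply, LinearMap.smul_apply, mink_smul_left, mink_smul_right, hJ]; ring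

theorem isSkew_zero : IsSkew 0 := fun x y => by
  simp [mink_zero_left, mink_zero_right]

theorem Kx_skew (x : V4) : IsSkew (Kx x) := Kf_skew _

/-! ### Charts at boundary points of the octahedron -/

/-- A part of the octahedron in which it is a wedge with dihedral angle `θ` about the axis of the
frame `F`; the axis may be an edge of the octahedron, or a geodesic on a triangle if `θ = π`. The
triangles that bound the wedge move infinitesimally with angular velocity `± c * θ / π` about the
axis, relative to their mean. -/
structure Wedge where
  F : Frame
  θ : ℝ
  c : ℝ
  k : Fin 3
  W : Set V4
  pos : 0 < θ
  lt : θ < 2 * Real.pi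
  isOpen : IsOpen W
  nonneg_iff : ∀ x ∈ W, 0 ≤ c0 x ↔ |(F.zc x).arg| ≤ θ / 2
  zero_iff : ∀ x ∈ W, c0 x = 0 ↔ F.zc x = 0 ∨ |(F.zc x).arg| = θ / 2
  -- the reflection in the triangle at a boundary point off the edges, in cylindrical coordinates
  wall : ∀ p : Q, p.u = 0 → p.fold ∈ W → ¬ p.IsEdge → ∃ η : ℝ, (η = 1 ∨ η = -1) ∧
    ((F.zc p.fold = 0 ∧ θ = Real.pi) ∨ (F.zc p.fold ≠ 0 ∧ (F.zc p.fold).arg = η * (θ / 2))) ∧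
    ∀ x, mink (p.S x) F.T = mink x F.T ∧ mink (p.S x) F.A = mink x F.A ∧
      F.zc (p.S x) = Complex.exp ((η * θ : ℝ) * Complex.I) * (starRingEnd ℂ) (F.zc x)
  flex : ∀ x ∈ W, ∀ x' ∈ W, ∀ v, Kx x v - Kx x' v =
    (c * (θ / Real.pi) * (Real.sign (yc x k) - Real.sign (yc x' k))) • F.rot v

/-- The right half-plane as a quotient of the plane by a reflection. -/
def halfFold (w : ℂ) : ℂ := ⟨|w.re|, w.im⟩

theorem continuous_halfFold : Continuous halfFold := by
  have : halfFold = fun w : ℂ => ((|w.re| : ℝ) : ℂ) + (w.im : ℝ) * Complex.I := by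
    funext w; apply Complex.ext <;> simp [halfFold]
  rw [this]; fun_prop

theorem halfFold_of_nonneg {w : ℂ} (h : 0 ≤ w.re) : halfFold w = w := by
  apply Complex.ext
  · exact abs_of_nonneg h
  · rfl

theorem halfFold_neg_conj {w : ℂ} (h : 0 ≤ w.re) : halfFold (-(starRingEnd ℂ) w) = w := by
  apply Complex.ext
  · simp [halfFold, abs_of_nonneg h]
  · simp [halfFold]

theorem halfFold_of_neg {w : ℂ} (h : w.re ≤ 0) : halfFold w = -(starRingEnd ℂ) w := by
  apply Complex.ext
  · simp [halfFold, abs_of_nonpos h]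
  · simp [halfFold]

theorem pw_polar {κ r ψ : ℝ} (hr : 0 ≤ r) (hψ : ψ ∈ Set.Ioc (-Real.pi) Real.pi) :
    pw κ (r * Complex.exp (ψ * Complex.I)) = r * Complex.exp ((κ * ψ : ℝ) * Complex.I) := by
  rcases hr.eq_or_lt with rfl | hr
  · simp [pw_zero]
  · have h1 : (r * Complex.exp (ψ * Complex.I)).arg = ψ := by
      rw [Complex.exp_mul_I, Complex.arg_mul_cos_add_sin_mul_I hr hψ]
    have h2 : ‖(r : ℂ) * Complex.exp (ψ * Complex.I)‖ = r := by
      rw [norm_mul, Complex.norm_exp_ofReal_mul_I, mul_one, Complex.norm_real,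
        Real.norm_of_nonneg hr.le]
    rw [pw, h1, h2]

theorem wedge_arg {θ : ℝ} (h0 : 0 < θ) {z : ℂ} (hz : |z.arg| ≤ θ / 2) :
    |Real.pi / θ * z.arg| ≤ Real.pi / 2 := by
  have hpi := Real.pi_pos
  rw [abs_mul, abs_of_pos (by positivity)]
  calc Real.pi / θ * |z.arg| ≤ Real.pi / θ * (θ / 2) := by gcongr
    _ = Real.pi / 2 := by field_simp

theorem wedge_mem_Ioc {θ : ℝ} (h0 : 0 < θ) {z : ℂ} (hz : |z.arg| ≤ θ / 2) :
    Real.pi / θ * z.arg ∈ Set.Ioc (-Real.pi) Real.pi := by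
  have hpi := Real.pi_pos
  have := abs_le.mp (wedge_arg h0 hz)
  exact ⟨by linarith, by linarith⟩

theorem wedge_re_nonneg {θ : ℝ} (h0 : 0 < θ) {z : ℂ} (hz : |z.arg| ≤ θ / 2) : 0 ≤
    (pw (Real.pi / θ) z).re := by
  have := abs_le.mp (wedge_arg h0 hz)
  rw [pw_re]
  exact mul_nonneg (norm_nonneg _) (Real.cos_nonneg_of_mem_Icc ⟨by linarith, this.2⟩)

theorem wedge_re_eq_zero {θ : ℝ} (h0 : 0 < θ) {z : ℂ} (hz : |z.arg| ≤ θ / 2) :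
    (pw (Real.pi / θ) z).re = 0 ↔ z = 0 ∨ |z.arg| = θ / 2 := by
  have hpi := Real.pi_pos
  have h3 := wedge_arg h0 hz
  rw [pw_re, mul_eq_zero, norm_eq_zero]
  refine or_congr Iff.rfl ?_
  have h4 : |Real.pi / θ * z.arg| = Real.pi / θ * |z.arg| := by
    rw [abs_mul, abs_of_pos (by positivity : 0 < Real.pi / θ)]
  have h5 : |z.arg| = θ / 2 ↔ |Real.pi / θ * z.arg| = Real.pi / 2 := by
    rw [h4]
    constructor
    · intro h; rw [h]; field_simp
    · intro h
      have : |z.arg| = θ / Real.pi * (Real.pi / θ * |z.arg|) := by field_simp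
      rw [this, h]; field_simp
  rw [h5, ← Real.cos_abs]
  constructor
  · intro h
    by_contra hne
    have := Real.cos_pos_of_mem_Ioo (x := |Real.pi / θ * z.arg|)
      ⟨by linarith [abs_nonneg (Real.pi / θ * z.arg)], lt_of_le_of_ne h3 hne⟩
    linarith
  · intro h; rw [h, Real.cos_pi_div_two]

theorem wedge_inv {θ : ℝ} (h0 : 0 < θ) {z : ℂ} (hz : |z.arg| ≤ θ / 2) : pw (θ / Real.pi)
    (pw (Real.pi / θ) z) = z :=
  pw_pw (by have := Real.pi_pos; field_simp) (wedge_mem_Ioc h0 hz)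

theorem half_mem_Ioc {θ : ℝ} (h0 : 0 < θ) (h2 : θ < 2 * Real.pi) {w : ℂ} (hw : 0 ≤ w.re) :
    θ / Real.pi * w.arg ∈ Set.Ioc (-Real.pi) Real.pi ∧ |θ / Real.pi * w.arg| ≤ θ / 2 := by
  have hpi := Real.pi_pos
  have h3 := Complex.abs_arg_le_pi_div_two_iff.mpr hw
  have h4 : |θ / Real.pi * w.arg| ≤ θ / 2 := by
    rw [abs_mul, abs_of_pos (by positivity)]
    calc θ / Real.pi * |w.arg| ≤ θ / Real.pi * (Real.pi / 2) := by gcongr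
      _ = θ / 2 := by field_simp
  have := abs_le.mp h4
  exact ⟨⟨by linarith, by linarith⟩, h4⟩

theorem half_arg {θ : ℝ} (h0 : 0 < θ) (h2 : θ < 2 * Real.pi) {w : ℂ} (hw : 0 ≤ w.re) :
    |(pw (θ / Real.pi) w).arg| ≤ θ / 2 := by
  rcases eq_or_ne w 0 with rfl | hne
  · rw [pw_zero, Complex.arg_zero, abs_zero]; linarith
  · rw [arg_pw hne (half_mem_Ioc h0 h2 hw).1]
    exact (half_mem_Ioc h0 h2 hw).2

theorem half_inv {θ : ℝ} (h0 : 0 < θ) (h2 : θ < 2 * Real.pi) {w : ℂ} (hw : 0 ≤ w.re) : pw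
    (Real.pi / θ) (pw (θ / Real.pi) w) = w :=
  pw_pw (by have := Real.pi_pos; field_simp) (half_mem_Ioc h0 h2 hw).1

theorem halfFold_re (w : ℂ) : 0 ≤ (halfFold w).re := abs_nonneg _

theorem arg_ne_pi_of_re {w : ℂ} (hw : 0 ≤ w.re) : w.arg ≠ Real.pi := by
  have hpi := Real.pi_pos
  have h3 := abs_le.mp (Complex.abs_arg_le_pi_div_two_iff.mpr hw)
  intro h; linarith

theorem continuous_pw_halfFold (κ : ℝ) : Continuous fun w => pw κ (halfFold w) := by
  rw [continuous_iff_continuousAt]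
  intro w
  exact ContinuousAt.comp (f := halfFold)
    (continuousAt_pw κ (Or.inr (arg_ne_pi_of_re (halfFold_re w))))
    continuous_halfFold.continuousAt

namespace Wedge

variable (w : Wedge) (s₀ : ℝ)

/-- The coordinate on the plane orthogonal to the axis. The wedge is opened to a half-plane, and
the second copy of the wedge is mapped to the opposite half-plane. -/
def wm (a : Q) : ℂ :=
  if 0 ≤ a.u then pw (Real.pi / w.θ) (w.F.zc a.fold)
  else -(starRingEnd ℂ) (pw (Real.pi / w.θ) (w.F.zc a.fold))

/-- The coordinates of a point of the double of the wedge. -/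
def co (a : Q) : ℝ × ℂ := ((w.F.co a.fold).1 - s₀, w.wm a)

/-- The point of the wedge over a point of the model space. -/
def pt (p : ℝ × ℂ) : V4 := w.F.pt (p.1 + s₀, pw (w.θ / Real.pi) (halfFold p.2))

open Classical in
/-- The inverse of `co`. -/
def inv (q₀ : Q) (p : ℝ × ℂ) : Q :=
  if h : |if 0 ≤ p.2.re then c0 (w.pt s₀ p) else -c0 (w.pt s₀ p)| = c0 (w.pt s₀ p) ∧
      ∀ b k, mink (w.pt s₀ p) (vx b k) < 1 / 100 then
    Q.mk _ (w.pt s₀ p) h.1 (w.F.pt_inH _) h.2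
  else q₀

theorem continuous_pt : Continuous (w.pt s₀) := by
  have h := continuous_pw_halfFold (w.θ / Real.pi)
  have h2 : Continuous fun p : ℝ × ℂ => pw (w.θ / Real.pi) (halfFold p.2) := h.comp continuous_snd
  unfold pt
  fun_prop

theorem arg_le {a : Q} (ha : a.fold ∈ w.W) : |(w.F.zc a.fold).arg| ≤ w.θ / 2 :=
  (w.nonneg_iff _ ha).mp a.c0_nonneg

theorem re_nonneg {a : Q} (ha : a.fold ∈ w.W) :
    0 ≤ (pw (Real.pi / w.θ) (w.F.zc a.fold)).re := wedge_re_nonneg w.pos (w.arg_le ha)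

theorem re_eq_zero {a : Q} (ha : a.fold ∈ w.W) :
    (pw (Real.pi / w.θ) (w.F.zc a.fold)).re = 0 ↔ a.u = 0 := by
  rw [wedge_re_eq_zero w.pos (w.arg_le ha), ← w.zero_iff _ ha, Q.c0_fold, abs_eq_zero]

theorem halfFold_wm {a : Q} (ha : a.fold ∈ w.W) :
    halfFold (w.wm a) = pw (Real.pi / w.θ) (w.F.zc a.fold) := by
  unfold wm
  split_ifs
  · exact halfFold_of_nonneg (w.re_nonneg ha)
  · exact halfFold_neg_conj (w.re_nonneg ha)

theorem pt_co {a : Q} (ha : a.fold ∈ w.W) : w.pt s₀ (w.co s₀ a) = a.fold := by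
  rw [pt, co]
  simp only [sub_add_cancel]
  rw [w.halfFold_wm ha, wedge_inv w.pos (w.arg_le ha)]
  exact w.F.pt_co a.inH

theorem zc_pt (p : ℝ × ℂ) : w.F.zc (w.pt s₀ p) = pw (w.θ / Real.pi) (halfFold p.2) :=
  w.F.zc_pt _

theorem pt_nonneg {p : ℝ × ℂ} (hp : w.pt s₀ p ∈ w.W) : 0 ≤ c0 (w.pt s₀ p) := by
  rw [w.nonneg_iff _ hp, zc_pt]
  exact half_arg w.pos w.lt (halfFold_re _)

theorem pt_eq_zero {p : ℝ × ℂ} (hp : w.pt s₀ p ∈ w.W) : c0 (w.pt s₀ p) = 0 ↔ p.2.re = 0 := by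
  rw [w.zero_iff _ hp, zc_pt, ← wedge_re_eq_zero w.pos (half_arg w.pos w.lt (halfFold_re _)),
    half_inv w.pos w.lt (halfFold_re _)]
  exact abs_eq_zero

/-- The target of the chart of a wedge. -/
def target : Set (ℝ × ℂ) := {p | w.pt s₀ p ∈ w.W ∧ ∀ b k, mink (w.pt s₀ p) (vx b k) < 1 / 100}

theorem inv_spec {q₀ : Q} {p : ℝ × ℂ} (hp : p ∈ w.target s₀) :
    (w.inv s₀ q₀ p).u = (if 0 ≤ p.2.re then c0 (w.pt s₀ p) else -c0 (w.pt s₀ p)) ∧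
      (w.inv s₀ q₀ p).fold = w.pt s₀ p := by
  have h0 := w.pt_nonneg s₀ hp.1
  have h1 : |if 0 ≤ p.2.re then c0 (w.pt s₀ p) else -c0 (w.pt s₀ p)| = c0 (w.pt s₀ p) := by
    split_ifs
    · exact abs_of_nonneg h0
    · rw [abs_neg, abs_of_nonneg h0]
  rw [inv, dif_pos ⟨h1, hp.2⟩]
  exact ⟨Q.mk_u _ _ _, Q.mk_fold _ _ _⟩

theorem continuousOn_wm : ContinuousOn w.wm {a | a.fold ∈ w.W} := by
  have hpi := Real.pi_pos
  have hc : ContinuousOn (fun a : Q => pw (Real.pi / w.θ) (w.F.zc a.fold)) {a | a.fold ∈ w.W} := by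
    intro a ha
    refine ContinuousAt.continuousWithinAt ?_
    refine ContinuousAt.comp (f := fun a : Q => w.F.zc a.fold) (continuousAt_pw _ (Or.inr ?_))
      (by fun_prop)
    intro h
    have := w.arg_le ha
    rw [h, abs_of_pos hpi] at this
    linarith [w.lt]
  unfold wm
  refine ContinuousOn.if ?_ (hc.mono Set.inter_subset_left)
    ((Complex.continuous_conj.comp_continuousOn hc).neg.mono Set.inter_subset_left)
  rintro a ⟨ha, hf⟩
  have hu : a.u = 0 := (frontier_le_subset_eq continuous_const Q.continuous_u hf).symm
  have h0 := (w.re_eq_zero ha).mpr hu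
  apply Complex.ext
  · simp [h0]
  · simp

/-- The chart of a wedge. -/
def chart (q₀ : Q) : OpenPartialHomeomorph Q (ℝ × ℂ) where
  toFun := w.co s₀
  invFun := w.inv s₀ q₀
  source := {a | a.fold ∈ w.W}
  target := w.target s₀
  map_source' := by
    intro a ha
    rw [target, Set.mem_ofPred_eq, w.pt_co s₀ ha]
    exact ⟨ha, a.lt⟩
  map_target' := by
    intro p hp
    rw [Set.mem_ofPred_eq, (w.inv_spec s₀ hp).2]
    exact hp.1
  left_inv' := by
    intro a ha
    have ha' : w.co s₀ a ∈ w.target s₀ := by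
      rw [target, Set.mem_ofPred_eq, w.pt_co s₀ ha]
      exact ⟨ha, a.lt⟩
    obtain ⟨h1, h2⟩ := w.inv_spec s₀ (q₀ := q₀) ha'
    rw [w.pt_co s₀ ha] at h1 h2
    refine Q.ext_fold ?_ h2
    rw [h1, Q.c0_fold]
    have h3 := w.re_nonneg ha
    have h4 := w.re_eq_zero ha
    rcases lt_or_ge a.u 0 with hu | hu
    · have h5 : (w.co s₀ a).2.re = -(pw (Real.pi / w.θ) (w.F.zc a.fold)).re := by
        simp [co, wm, hu.not_ge]
      have h6 : 0 < (pw (Real.pi / w.θ) (w.F.zc a.fold)).re :=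
        lt_of_le_of_ne h3 fun h => hu.ne (h4.mp h.symm)
      rw [if_neg (by rw [h5]; linarith), abs_of_neg hu, neg_neg]
    · have h5 : (w.co s₀ a).2.re = (pw (Real.pi / w.θ) (w.F.zc a.fold)).re := by
        simp [co, wm, hu]
      rw [if_pos (by rw [h5]; exact h3), abs_of_nonneg hu]
  right_inv' := by
    intro p hp
    obtain ⟨h1, h2⟩ := w.inv_spec s₀ (q₀ := q₀) hp
    have h3 := w.pt_nonneg s₀ hp.1
    have h4 := w.pt_eq_zero s₀ hp.1
    have h5 : pw (Real.pi / w.θ) (w.F.zc (w.pt s₀ p)) = halfFold p.2 := by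
      rw [zc_pt, half_inv w.pos w.lt (halfFold_re _)]
    have h6 : (w.F.co (w.pt s₀ p)).1 = p.1 + s₀ := by rw [pt, w.F.co_pt]
    refine Prod.ext ?_ ?_
    · simp only [co, h2, h6, add_sub_cancel_right]
    · simp only [co, wm, h1, h2, h5]
      rcases lt_or_ge p.2.re 0 with hu | hu
      · rw [if_neg hu.not_ge, if_neg, halfFold_of_neg hu.le]
        · simp
        · have : 0 < c0 (w.pt s₀ p) := lt_of_le_of_ne h3 fun h => hu.ne (h4.mp h.symm)
          linarith
      · rw [if_pos hu, if_pos h3, halfFold_of_nonneg hu]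
  open_source := w.isOpen.preimage Q.continuous_fold
  open_target := by
    have hc := w.continuous_pt s₀
    simp only [target, Set.ofPred_and, Set.ofPred_forall]
    exact (w.isOpen.preimage hc).inter (isOpen_iInter_of_finite fun b =>
      isOpen_iInter_of_finite fun k => isOpen_lt (by fun_prop) continuous_const)
  continuousOn_toFun := by
    refine ContinuousOn.prodMk (Continuous.continuousOn ?_) w.continuousOn_wm
    exact (continuous_fst.comp (w.F.continuous_co.comp Q.continuous_fold)).sub continuous_const
  continuousOn_invFun := by
    have hc := w.continuous_pt s₀
    rw [Topology.IsEmbedding.subtypeVal.continuousOn_iff]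
    have hu : ContinuousOn (fun p : ℝ × ℂ =>
        if 0 ≤ p.2.re then c0 (w.pt s₀ p) else -c0 (w.pt s₀ p)) (w.target s₀) := by
      refine ContinuousOn.if ?_ (Continuous.continuousOn (by fun_prop))
        (Continuous.continuousOn (by fun_prop))
      rintro p ⟨hp, hf⟩
      have h0 : (0 : ℝ) = p.2.re := frontier_le_subset_eq
        (f := fun _ : ℝ × ℂ => (0 : ℝ)) (g := fun p => p.2.re) continuous_const (by fun_prop) hf
      rw [(w.pt_eq_zero s₀ hp.1).mpr h0.symm, neg_zero]
    refine (hu.prodMk (f := _) (g := fun p => yc (w.pt s₀ p))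
      (Continuous.continuousOn (by fun_prop))).congr fun p hp => ?_
    obtain ⟨h1, h2⟩ := w.inv_spec s₀ (q₀ := q₀) hp
    refine Prod.ext h1 ?_
    change (w.inv s₀ q₀ p).y = _
    rw [← Q.yc_fold, h2]

theorem chart_apply (q₀ a : Q) : w.chart s₀ q₀ a = w.co s₀ a := rfl

/-- The variation of the chart of a wedge that is given by the flex. The two triangles at the axis
rotate about it in opposite directions, and the second copy of a triangle moves with the first. -/
def field (a : Q) : ℝ × ℂ := (0, (w.c * Real.sign (a.y w.k) : ℝ) * Complex.I * w.wm a)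

end Wedge

theorem Q.wt_of_nonneg {p : Q} (h : 0 ≤ p.u) : p.wt = 1 := if_neg h.not_gt

theorem Q.wt_of_neg {p : Q} (h : p.u < 0) : p.wt = -1 := if_pos h

theorem Q.dev_of_ne {p : Q} (h : p.u ≠ 0) (a : Q) : p.dev a = a.fold := by
  rw [Q.dev, if_neg]; exact fun h' => h h'.1

theorem Q.dev_of_nonneg (p : Q) {a : Q} (h : 0 ≤ a.u) : p.dev a = a.fold := by
  rw [Q.dev, if_neg]; exact fun h' => h'.2.not_ge h

theorem Q.dev_of_neg {p a : Q} (hp : p.u = 0) (h : a.u < 0) : p.dev a = p.S a.fold := by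
  rw [Q.dev, if_pos ⟨hp, h⟩]

/-- The signs of the coordinates are locally constant away from the edges. -/
theorem Q.eventually_sign {p : Q} {k : Fin 3} (h : p.y k ≠ 0) :
    ∀ᶠ a : Q in 𝓝 p, Real.sign (a.y k) = Real.sign (p.y k) := by
  have hc : Continuous fun a : Q => a.y k := by fun_prop
  rcases lt_or_gt_of_ne h with h | h
  · filter_upwards [(isOpen_Iio.preimage hc).mem_nhds h] with a ha
    rw [Real.sign_of_neg h, Real.sign_of_neg ha]
  · filter_upwards [(isOpen_Ioi.preimage hc).mem_nhds h] with a ha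
    rw [Real.sign_of_pos h, Real.sign_of_pos ha]

namespace Wedge

variable (w : Wedge) (s₀ : ℝ)

theorem slit_of_arg {z : ℂ} (hz : z ≠ 0) (h : |z.arg| ≤ Real.pi / 2) : z ∈ Complex.slitPlane := by
  refine Complex.mem_slitPlane_iff_arg.mpr ⟨fun h' => ?_, hz⟩
  have := Real.pi_pos
  rw [h', abs_of_pos this] at h
  linarith

theorem Dv_pos {a : Q} (ha : a.fold ∈ w.W) :
    w.F.Dv s₀ (w.θ / Real.pi) ((w.F.co a.fold).1 - s₀, pw (Real.pi / w.θ) (w.F.zc a.fold))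
      = a.fold := by
  rw [Frame.Dv]
  simp only [sub_add_cancel]
  rw [wedge_inv w.pos (w.arg_le ha)]
  exact w.F.pt_co a.inH

theorem wm_of_nonneg {a : Q} (h : 0 ≤ a.u) : w.wm a = pw (Real.pi / w.θ) (w.F.zc a.fold) :=
  if_pos h

theorem wm_of_neg {a : Q} (h : a.u < 0) :
    w.wm a = -(starRingEnd ℂ) (pw (Real.pi / w.θ) (w.F.zc a.fold)) := if_neg h.not_ge

theorem eventually_mem {p : Q} (hp : p.fold ∈ w.W) : ∀ᶠ a : Q in 𝓝 p, a.fold ∈ w.W :=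
  (w.isOpen.preimage Q.continuous_fold).mem_nhds hp

theorem continuousAt_wm {p : Q} (hp : p.fold ∈ w.W) : ContinuousAt w.wm p :=
  w.continuousOn_wm.continuousAt ((w.isOpen.preimage Q.continuous_fold).mem_nhds hp)

theorem zc_ne_zero {p : Q} (hp : p.fold ∈ w.W) (hu : p.u ≠ 0) : w.F.zc p.fold ≠ 0 := by
  intro h
  have := (w.zero_iff _ hp).mpr (Or.inl h)
  rw [Q.c0_fold, abs_eq_zero] at this
  exact hu this

theorem pw_arg_le {p : Q} (hp : p.fold ∈ w.W) (hz : w.F.zc p.fold ≠ 0) :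
    |(pw (Real.pi / w.θ) (w.F.zc p.fold)).arg| ≤ Real.pi / 2 := by
  rw [arg_pw hz (wedge_mem_Ioc w.pos (w.arg_le hp))]
  exact wedge_arg w.pos (w.arg_le hp)

theorem locDev_pos {p : Q} (hp : p.fold ∈ w.W) (hz : w.F.zc p.fold ≠ 0) (s : ℝ) :
    LocDev (2 * w.θ) (w.F.Dv s₀ (w.θ / Real.pi)) (s, pw (Real.pi / w.θ) (w.F.zc p.fold))
      (det4 w.F.T w.F.A w.F.N w.F.B) :=
  w.F.locDev_pow s₀ w.pos w.lt (pw_ne_zero hz) (w.pw_arg_le hp hz)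

theorem flex_apply {p a : Q} (hp : p.fold ∈ w.W) (ha : a.fold ∈ w.W) (v : V4) :
    Kx a.fold v = Kx p.fold v +
      (w.c * (w.θ / Real.pi) * (Real.sign (a.y w.k) - Real.sign (p.y w.k))) • w.F.rot v := by
  rw [← Q.yc_fold, ← Q.yc_fold, ← w.flex _ ha _ hp]; abel

/-- In the first copy of the wedge, the developing map opens the half-plane to the wedge, and the
rotation of the chart is the motion of the triangle, relative to the motion at `p`. -/
theorem devAt_of_pos {p : Q} (hp : p.fold ∈ w.W) (hu : 0 < p.u) :
    DevAt (2 * w.θ) (w.co s₀) w.field p (det4 w.F.T w.F.A w.F.N w.F.B) := by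
  have hz := w.zc_ne_zero hp hu.ne'
  refine ⟨w.F.Dv s₀ (w.θ / Real.pi), (w.c * Real.sign (p.y w.k) * (w.θ / Real.pi)) • w.F.rot
    + (-1 : ℝ) • Kx p.fold, ?_, (w.F.rot_skew.smul _).add ((Kx_skew _).smul _), ?_⟩
  · rw [Q.wt_of_nonneg hu.le, mul_one, co, w.wm_of_nonneg hu.le]
    exact w.locDev_pos s₀ hp hz _
  · have hslit : w.wm p ∈ Complex.slitPlane := by
      rw [w.wm_of_nonneg hu.le]
      exact slit_of_arg (pw_ne_zero hz) (w.pw_arg_le hp hz)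
    filter_upwards [w.eventually_mem hp, (isOpen_Ioi.preimage Q.continuous_u).mem_nhds hu,
      (w.continuousAt_wm hp).preimage_mem_nhds (Complex.isOpen_slitPlane.mem_nhds hslit)]
      with a ha hau has
    have hau : 0 < a.u := hau
    have h1 : w.F.Dv s₀ (w.θ / Real.pi) (w.co s₀ a) = a.fold := by
      rw [co, w.wm_of_nonneg hau.le]; exact w.Dv_pos s₀ ha
    rw [Q.dev_of_ne hu.ne']
    refine ⟨h1, ?_⟩
    have h2 := w.F.fderiv_Dv_rot s₀ (w.θ / Real.pi) (p := w.co s₀ a) (Or.inr has)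
      (w.c * Real.sign (a.y w.k))
    rw [h1] at h2
    rw [field, Q.vel, Real.sign_of_pos hu, w.flex_apply hp ha]
    refine h2.trans ?_
    simp only [LinearMap.add_apply, LinearMap.smul_apply]
    module

theorem co_of_neg {a : Q} (h : a.u < 0) : w.co s₀ a
    = mir ((w.F.co a.fold).1 - s₀, pw (Real.pi / w.θ) (w.F.zc a.fold)) := by
  rw [co, w.wm_of_neg h]; rfl

/-- In the second copy of the wedge, the developing map is composed with the reflection `mir`, which
reverses both the orientation and the sense of rotation, in accordance with `Q.wt` and `Q.vel`. -/
theorem devAt_of_neg {p : Q} (hp : p.fold ∈ w.W) (hu : p.u < 0) :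
    DevAt (2 * w.θ) (w.co s₀) w.field p (det4 w.F.T w.F.A w.F.N w.F.B) := by
  have hz := w.zc_ne_zero hp hu.ne
  refine ⟨fun x => w.F.Dv s₀ (w.θ / Real.pi) (mir x),
    (-(w.c * Real.sign (p.y w.k) * (w.θ / Real.pi))) • w.F.rot + (1 : ℝ) • Kx p.fold, ?_,
    (w.F.rot_skew.smul _).add ((Kx_skew _).smul _), ?_⟩
  · rw [Q.wt_of_neg hu, mul_neg_one]
    refine LocDev.mirror ?_
    rw [w.co_of_neg s₀ hu, mir_mir]
    exact w.locDev_pos s₀ hp hz _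
  · have hslit : (mir (w.co s₀ p)).2 ∈ Complex.slitPlane := by
      rw [w.co_of_neg s₀ hu, mir_mir]
      exact slit_of_arg (pw_ne_zero hz) (w.pw_arg_le hp hz)
    have hcont : ContinuousAt (fun a => (mir (w.co s₀ a)).2) p :=
      (Complex.continuous_conj.continuousAt.comp (w.continuousAt_wm hp)).neg
    filter_upwards [w.eventually_mem hp, (isOpen_Iio.preimage Q.continuous_u).mem_nhds hu,
      hcont.preimage_mem_nhds (Complex.isOpen_slitPlane.mem_nhds hslit)] with a ha hau has
    have hau : a.u < 0 := hau
    have h1 : w.F.Dv s₀ (w.θ / Real.pi) (mir (w.co s₀ a)) = a.fold := by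
      rw [w.co_of_neg s₀ hau, mir_mir]; exact w.Dv_pos s₀ ha
    rw [Q.dev_of_ne hu.ne]
    refine ⟨h1, ?_⟩
    have h2 := w.F.fderiv_Dv_rot s₀ (w.θ / Real.pi) (p := mir (w.co s₀ a)) (Or.inr has)
      (-(w.c * Real.sign (a.y w.k)))
    rw [h1] at h2
    have hdiff : DifferentiableAt ℝ (w.F.Dv s₀ (w.θ / Real.pi)) (mir (w.co s₀ a)) := by
      obtain ⟨D, hD, -⟩ := w.F.hasFDerivAt_Dv s₀ (w.θ / Real.pi) has
      exact hD.differentiableAt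
    have h3 : fderiv ℝ (fun x => w.F.Dv s₀ (w.θ / Real.pi) (mir x)) (w.co s₀ a)
        = (fderiv ℝ (w.F.Dv s₀ (w.θ / Real.pi)) (mir (w.co s₀ a))).comp mirL :=
      (HasFDerivAt.comp _ hdiff.hasFDerivAt (hasFDerivAt_mir _)).fderiv
    have h4 : mirL (w.field a) = (0, (-(w.c * Real.sign (a.y w.k)) : ℝ) * Complex.I
        * (mir (w.co s₀ a)).2) := by
      refine Prod.ext rfl ?_
      simp [mirL_apply, mir, field, co]
    rw [h3, ContinuousLinearMap.comp_apply, h4, h2, Q.vel, Real.sign_of_neg hu,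
      w.flex_apply hp ha]
    simp only [LinearMap.add_apply, LinearMap.smul_apply]
    module

/-- Opening the wedge turns the reflection in a wall into the reflection in the boundary of the
half-plane. -/
theorem pw_mirror {η : ℝ} (hη : η = 1 ∨ η = -1) {z : ℂ} (hz : |z.arg| ≤ w.θ / 2)
    (hs : 0 < η * z.arg ∨ w.θ = Real.pi) :
    pw (w.θ / Real.pi) (-(starRingEnd ℂ) (pw (Real.pi / w.θ) z))
      = Complex.exp ((η * w.θ : ℝ) * Complex.I) * (starRingEnd ℂ) z := by
  have hpi := Real.pi_pos
  have hθ := w.pos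
  have hexp : Complex.exp ((η * Real.pi : ℝ) * Complex.I) = -1 := by
    rcases hη with rfl | rfl
    · simp [Complex.exp_pi_mul_I]
    · simp [Complex.exp_neg, Complex.exp_pi_mul_I]
  rcases hs with hs | hs
  · have hpolar : -(starRingEnd ℂ) (pw (Real.pi / w.θ) z)
        = ‖z‖ * Complex.exp ((η * Real.pi - Real.pi / w.θ * z.arg : ℝ) * Complex.I) := by
      rw [pw, map_mul, Complex.conj_ofReal, ← Complex.exp_conj, Complex.ofReal_sub, sub_mul,
        Complex.exp_sub, hexp, map_mul, Complex.conj_ofReal, Complex.conj_I, mul_neg,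
        Complex.exp_neg]
      ring
    have h3 := abs_le.mp (wedge_arg w.pos hz)
    have h4 : 0 < Real.pi / w.θ * (η * z.arg) := by positivity
    rw [hpolar, pw_polar (norm_nonneg _)]
    · have h5 : w.θ / Real.pi * (η * Real.pi - Real.pi / w.θ * z.arg) = η * w.θ - z.arg := by
        field_simp
      conv_rhs => rw [← Complex.norm_mul_exp_arg_mul_I z]
      rw [h5, Complex.ofReal_sub, sub_mul, Complex.exp_sub, map_mul, Complex.conj_ofReal,
        ← Complex.exp_conj, map_mul, Complex.conj_ofReal, Complex.conj_I, mul_neg,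
        Complex.exp_neg]
      ring
    · rcases hη with rfl | rfl
      · constructor <;> linarith
      · constructor <;> linarith
  · rw [hs, div_self hpi.ne', pw_one, pw_one, hexp, neg_one_mul]

/-- On a triangle, the developing map of the first copy extends to the second copy, which it maps to
the reflected wedge. The motion of the chart is the rotation that belongs to this triangle, on both
sides. -/
theorem devAt_of_zero {p : Q} (hp : p.fold ∈ w.W) (hu : p.u = 0) (he : ¬ p.IsEdge) :
    DevAt (2 * w.θ) (w.co s₀) w.field p (det4 w.F.T w.F.A w.F.N w.F.B) := by
  have hpi := Real.pi_pos
  obtain ⟨η, hη, hcase, hS⟩ := w.wall p hu hp he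
  have hy : p.y w.k ≠ 0 := fun h => he ⟨hu, _, h⟩
  have hslit : w.F.zc p.fold ≠ 0 → w.wm p ∈ Complex.slitPlane := fun hz => by
    rw [w.wm_of_nonneg hu.ge]
    exact slit_of_arg (pw_ne_zero hz) (w.pw_arg_le hp hz)
  have hnice : ∀ᶠ a : Q in 𝓝 p, (w.θ / Real.pi = 1 ∨ w.wm a ∈ Complex.slitPlane) ∧
      (0 < η * (w.F.zc a.fold).arg ∨ w.θ = Real.pi) := by
    rcases hcase with ⟨-, h⟩ | ⟨hz, harg⟩
    · exact Eventually.of_forall fun a => ⟨Or.inl (by rw [h, div_self hpi.ne']), Or.inr h⟩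
    · have hzs : w.F.zc p.fold ∈ Complex.slitPlane := by
        refine Complex.mem_slitPlane_iff_arg.mpr ⟨fun h => ?_, hz⟩
        have := w.arg_le hp
        rw [h, abs_of_pos hpi] at this
        linarith [w.lt]
      have hc : ContinuousAt (fun a : Q => η * (w.F.zc a.fold).arg) p :=
        continuousAt_const.mul (ContinuousAt.comp (f := fun a : Q => w.F.zc a.fold)
          (Complex.continuousAt_arg hzs) (by fun_prop))
      have hpos : 0 < η * (w.F.zc p.fold).arg := by
        rw [harg]
        have := w.pos
        rcases hη with rfl | rfl <;> linarith
      filter_upwards [(w.continuousAt_wm hp).preimage_mem_nhds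
        (Complex.isOpen_slitPlane.mem_nhds (hslit hz)),
        hc.preimage_mem_nhds (isOpen_Ioi.mem_nhds hpos)] with a h1 h2
      exact ⟨Or.inr h1, Or.inl h2⟩
  refine ⟨w.F.Dv s₀ (w.θ / Real.pi),
    (w.c * Real.sign (p.y w.k) * (w.θ / Real.pi)) • w.F.rot, ?_, w.F.rot_skew.smul _, ?_⟩
  · rw [Q.wt_of_nonneg hu.ge, mul_one]
    rcases hcase with ⟨hz, h⟩ | ⟨hz, -⟩
    · rw [h, div_self hpi.ne']
      exact w.F.locDev_one s₀ _
    · rw [co, w.wm_of_nonneg hu.ge]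
      exact w.locDev_pos s₀ hp hz _
  · filter_upwards [w.eventually_mem hp, hnice, Q.eventually_sign hy] with a ha hna hsa
    have h1 : w.F.Dv s₀ (w.θ / Real.pi) (w.co s₀ a) = p.dev a := by
      rcases lt_or_ge a.u 0 with hau | hau
      · rw [Q.dev_of_neg hu hau, co, w.wm_of_neg hau, Frame.Dv]
        simp only [sub_add_cancel]
        rw [w.pw_mirror hη (w.arg_le ha) hna.2]
        obtain ⟨hT, hA, hz⟩ := hS a.fold
        have hco : w.F.pt (w.F.co a.fold) = a.fold := w.F.pt_co a.inH
        have hcn : Frame.cn (Complex.exp ((η * w.θ : ℝ) * Complex.I)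
            * (starRingEnd ℂ) (w.F.zc a.fold)) = Frame.cn (w.F.co a.fold).2 := by
          simp only [Frame.cn, norm_mul, Complex.norm_exp_ofReal_mul_I, one_mul, Complex.norm_conj]
          rfl
        have hzc : ∀ v, mink v w.F.N = (w.F.zc v).re ∧ mink v w.F.B = (w.F.zc v).im :=
          fun v => ⟨rfl, rfl⟩
        apply w.F.ext_mink
        · rw [hT, w.F.mink_pt_T]
          simp only
          rw [hcn, ← w.F.mink_pt_T, hco]
        · rw [hA, w.F.mink_pt_A]
          simp only
          rw [hcn, ← w.F.mink_pt_A, hco]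
        · rw [(hzc _).1, (hzc _).1, w.F.zc_pt, hz]
        · rw [(hzc _).2, (hzc _).2, w.F.zc_pt, hz]
      · rw [p.dev_of_nonneg hau, co, w.wm_of_nonneg hau]
        exact w.Dv_pos s₀ ha
    refine ⟨h1, ?_⟩
    have h2 := w.F.fderiv_Dv_rot s₀ (w.θ / Real.pi) (p := w.co s₀ a) hna.1
      (w.c * Real.sign (a.y w.k))
    rw [h1] at h2
    rw [field, Q.vel, hu, Real.sign_zero, zero_smul, zero_add, LinearMap.smul_apply, ← hsa]
    exact h2

/-- A chart of a wedge is isometric off the edges, and its variation lifts the flex. -/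
theorem devAt {p : Q} (hp : p.fold ∈ w.W) (he : ¬ p.IsEdge) :
    DevAt (2 * w.θ) (w.co s₀) w.field p (det4 w.F.T w.F.A w.F.N w.F.B) := by
  rcases lt_trichotomy p.u 0 with h | h | h
  · exact w.devAt_of_neg s₀ hp h
  · exact w.devAt_of_zero s₀ hp h he
  · exact w.devAt_of_pos s₀ hp h

end Wedge

/-! ### Charts at interior points of the octahedron -/

namespace Q

open Classical in
/-- The chart of one of the two copies of the octahedron. -/
def chartInt (F : Frame) (ε : ℝ) (hε : ε = 1 ∨ ε = -1) (q₀ : Q) :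
    OpenPartialHomeomorph Q (ℝ × ℂ) where
  toFun a := F.co a.fold
  invFun p := if h : |ε * c0 (F.pt p)| = c0 (F.pt p) ∧ ∀ b k, mink (F.pt p) (vx b k) < 1 / 100 then
    Q.mk _ (F.pt p) h.1 (F.pt_inH _) h.2 else q₀
  source := {a | 0 < ε * a.u}
  target := {p | 0 < c0 (F.pt p) ∧ ∀ b k, mink (F.pt p) (vx b k) < 1 / 100}
  map_source' := by
    intro a ha
    rw [Set.mem_ofPred_eq, F.pt_co a.inH, c0_fold]
    refine ⟨abs_pos.mpr fun h => ?_, a.lt⟩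
    rw [Set.mem_ofPred_eq, h, mul_zero] at ha
    exact ha.false
  map_target' := by
    intro p hp
    have h0 : |ε * c0 (F.pt p)| = c0 (F.pt p) := by
      rcases hε with rfl | rfl
      · rw [one_mul, abs_of_pos hp.1]
      · rw [neg_one_mul, abs_neg, abs_of_pos hp.1]
    rw [Set.mem_ofPred_eq, dif_pos ⟨h0, hp.2⟩, mk_u]
    have h1 := hp.1
    rcases hε with rfl | rfl <;> linarith
  left_inv' := by
    intro a ha
    have ha : 0 < ε * a.u := ha
    have h0 : |ε * abs a.u| = |a.u| := by
      rcases hε with rfl | rfl <;> simp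
    have h1 : |ε * c0 (F.pt (F.co a.fold))| = c0 (F.pt (F.co a.fold)) ∧
        ∀ b k, mink (F.pt (F.co a.fold)) (vx b k) < 1 / 100 := by
      rw [F.pt_co a.inH, c0_fold]
      exact ⟨h0, a.lt⟩
    rw [dif_pos h1]
    refine ext_fold ?_ ?_
    · rw [mk_u, F.pt_co a.inH, c0_fold]
      rcases hε with rfl | rfl
      · rw [one_mul] at ha ⊢
        exact abs_of_pos ha
      · rw [abs_of_neg (by linarith)]; ring
    · rw [mk_fold, F.pt_co a.inH]
  right_inv' := by
    intro p hp
    have h0 : |ε * c0 (F.pt p)| = c0 (F.pt p) := by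
      rcases hε with rfl | rfl
      · rw [one_mul, abs_of_pos hp.1]
      · rw [neg_one_mul, abs_neg, abs_of_pos hp.1]
    rw [dif_pos ⟨h0, hp.2⟩, mk_fold, F.co_pt]
  open_source := isOpen_lt continuous_const (by fun_prop)
  open_target := by
    simp only [Set.ofPred_and, Set.ofPred_forall]
    exact (isOpen_lt continuous_const (by fun_prop)).inter (isOpen_iInter_of_finite fun b =>
      isOpen_iInter_of_finite fun k => isOpen_lt (by fun_prop) continuous_const)
  continuousOn_toFun := (F.continuous_co.comp continuous_fold).continuousOn
  continuousOn_invFun := by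
    rw [Topology.IsEmbedding.subtypeVal.continuousOn_iff]
    have hc : Continuous fun p => (ε * c0 (F.pt p), yc (F.pt p)) := by fun_prop
    refine hc.continuousOn.congr fun p hp => ?_
    have h0 : |ε * c0 (F.pt p)| = c0 (F.pt p) := by
      rcases hε with rfl | rfl
      · rw [one_mul, abs_of_pos hp.1]
      · rw [neg_one_mul, abs_neg, abs_of_pos hp.1]
    simp only [Function.comp_apply]
    rw [dif_pos ⟨h0, hp.2⟩]
    rfl

theorem exists_fieldInt (F : Frame) (ε : ℝ) (a : Q) :
    ∃ v, F.dpt (F.co a.fold) v = ε • Kx a.fold a.fold := by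
  refine F.exists_dpt ?_
  rw [F.pt_co a.inH, mink_smul_left]
  have := Kx_skew a.fold a.fold a.fold
  rw [mink_comm a.fold] at this
  have h : mink (Kx a.fold a.fold) a.fold = 0 := by linarith
  rw [h, mul_zero]

/-- The velocities of the flex, in the chart of one of the two copies of the octahedron. -/
def fieldInt (F : Frame) (ε : ℝ) (a : Q) : ℝ × ℂ := (exists_fieldInt F ε a).choose

/-- A chart at an interior point is isometric, and its variation lifts the flex. -/
theorem devAtInt (F : Frame) {ε : ℝ} (hε : ε = 1 ∨ ε = -1) {p : Q} (hp : 0 < ε * p.u) :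
    DevAt (2 * Real.pi) (fun a => F.co a.fold) (fieldInt F ε) p (ε * det4 F.T F.A F.N F.B) := by
  have hne : p.u ≠ 0 := fun h => by rw [h, mul_zero] at hp; exact hp.false
  have hw : ε * p.wt = 1 ∧ Real.sign p.u = ε := by
    rcases hε with rfl | rfl
    · rw [one_mul] at hp
      rw [wt_of_nonneg hp.le, one_mul, Real.sign_of_pos hp]; exact ⟨rfl, rfl⟩
    · rw [wt_of_neg (by linarith), Real.sign_of_neg (by linarith)]; norm_num
  refine ⟨F.Dv 0 1, 0, ?_, isSkew_zero, Eventually.of_forall fun a => ?_⟩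
  · have h1 : ε * det4 F.T F.A F.N F.B * p.wt = det4 F.T F.A F.N F.B := by
      linear_combination det4 F.T F.A F.N F.B * hw.1
    rw [h1]
    exact F.locDev_one 0 _
  · obtain ⟨D, hD, hDv⟩ := F.hasFDerivAt_Dv_one 0 (F.co a.fold)
    rw [dev_of_ne hne, vel, hw.2, hD.fderiv, hDv, Frame.Dv, pw_one]
    simp only [add_zero, LinearMap.zero_apply]
    exact ⟨F.pt_co a.inH, (exists_fieldInt F ε a).choose_spec⟩

end Q

/-! ### Triangles of the octahedron -/

theorem mink_faceNormal (σ : Fin 3 → Bool) (j : Fin 3) :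
    mink (faceNormal σ) (vx (σ j) j) = 0 := by
  rw [faceNormal, mink_smul_left]
  refine mul_eq_zero_of_right _ ?_
  fin_cases j
  · exact mink_cross_1 _ _ _
  · exact mink_cross_2 _ _ _
  · exact mink_cross_3 _ _ _

theorem mink_faceNormal_e0 (σ : Fin 3 → Bool) : 0 < mink (faceNormal σ) e0 := by
  have h1 := sqrt3_sq
  have h2 := sqrt3_lb
  have h3 := sqrt3_ub
  rw [faceNormal, mink_smul_left, mink_cross]
  cases σ 0 <;> cases σ 1 <;> cases σ 2 <;>
    simp [vx_false, vx_true, det4, cs, sn, e0, sg] <;> nlinarith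

/-- The points of the cone over a triangle, without its boundary. -/
def faceW (σ : Fin 3 → Bool) : Set V4 := {x | ∀ k, 0 < sg (σ k) * yc x k}

theorem isOpen_faceW (σ : Fin 3 → Bool) : IsOpen (faceW σ) := by
  simp only [faceW, Set.ofPred_forall]
  exact isOpen_iInter_of_finite fun k => isOpen_lt continuous_const (by fun_prop)

theorem pp_of_pos {b : Bool} {t : ℝ} (h : 0 ≤ sg b * t) :
    pp false t • vx false k + pp true t • vx true k = (sg b * t) • vx b k := by
  cases b
  · simp only [sg, Bool.false_eq_true, if_false, one_mul] at h ⊢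
    simp only [pp, sg, Bool.false_eq_true, if_false, if_true, one_mul]
    rw [max_eq_left h, max_eq_right (by linarith), zero_smul, add_zero]
  · simp only [sg, if_true] at h ⊢
    simp only [pp, sg, Bool.false_eq_true, if_false, if_true, one_mul]
    rw [max_eq_left h, max_eq_right (by linarith), zero_smul, zero_add]

theorem faceW_expand {σ : Fin 3 → Bool} {x : V4} (hx : x ∈ faceW σ) :
    x = c0 x • e0 + ∑ k, (sg (σ k) * yc x k) • vx (σ k) k := by
  conv_lhs => rw [← Th_c0_yc x, Th_eq]
  congr 1
  exact Finset.sum_congr rfl fun k _ => pp_of_pos (hx k).le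

theorem faceW_mink {σ : Fin 3 → Bool} {x : V4} (hx : x ∈ faceW σ) :
    mink x (faceNormal σ) = c0 x * mink (faceNormal σ) e0 := by
  rw [mink_comm]
  conv_lhs => rw [faceW_expand hx]
  rw [Fin.sum_univ_three]
  simp only [mink_add_right, mink_smul_right, mink_faceNormal]
  ring

theorem faceW_bs {σ : Fin 3 → Bool} {x : V4} (hx : x ∈ faceW σ) :
    (fun k => bs (yc x k)) = σ := funext fun k => bs_of_pos (hx k)

/-- Completion of three orthonormal vectors to a frame. -/
def Frame.ofThree (T A N : V4) (hT : InH T) (AA : mink A A = 1) (NN : mink N N = 1)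
    (TA : mink T A = 0) (TN : mink T N = 0) (AN : mink A N = 0) : Frame where
  T := T
  A := A
  N := N
  B := cross T A N
  TT := hT.1
  AA := AA
  NN := NN
  BB := by rw [mink_cross_self, hT.1, AA, NN, TA, AN, TN]; norm_num
  TA := TA
  TN := TN
  TB := by rw [mink_comm, mink_cross_1]
  AN := AN
  AB := by rw [mink_comm, mink_cross_2]
  NB := by rw [mink_comm, mink_cross_3]
  hT := hT.2

/-- Every point of `ℍ³` is the origin of a frame of which the second coordinate hyperplane is
a given hyperplane through the point. -/
theorem exists_frame {x n : V4} (hx : InH x) (hn : n ≠ 0) (hxn : mink x n = 0)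
    (v : V4) (hv : 0 ≤ mink v v) (hv0 : v ≠ 0) (hvn : mink v n = 0) :
    ∃ (F : Frame) (c : ℝ), 0 < c ∧ F.T = x ∧ F.N = c • n := by
  have hnn := mink_pos_of_orth (by rw [hx.1]; norm_num) hxn hn
  -- the projection of `v` to the orthogonal complement of `x` is the second vector of the frame
  set P := v + mink v x • x with hP
  have hPx : mink x P = 0 := by
    rw [hP, mink_add_right, mink_smul_right, hx.1, mink_comm v x]; ring
  have hP0 : P ≠ 0 := by
    intro h
    have h1 : v = (-mink v x) • x := by
      rw [neg_smul]; exact eq_neg_of_add_eq_zero_left (hP.symm.trans h)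
    have h2 : mink v v = -(mink v x) ^ 2 := by
      conv_lhs => rw [h1]
      rw [mink_smul_left, mink_smul_right, hx.1]; ring
    have h3 : mink v x = 0 := by nlinarith [sq_nonneg (mink v x)]
    exact hv0 (by rw [h1, h3, neg_zero, zero_smul])
  have hPP := mink_pos_of_orth (by rw [hx.1]; norm_num) hPx hP0
  have hPn : mink P n = 0 := by
    rw [hP, mink_add_left, mink_smul_left, hvn, hxn]; ring
  have hs : ∀ y : V4, 0 < mink y y → mink ((1 / √(mink y y)) • y) ((1 / √(mink y y)) • y) = 1 := by
    intro y hy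
    rw [mink_smul_left, mink_smul_right]
    have := Real.mul_self_sqrt hy.le
    have := Real.sqrt_pos.mpr hy
    field_simp
    linarith
  refine ⟨Frame.ofThree x ((1 / √(mink P P)) • P) ((1 / √(mink n n)) • n) hx (hs P hPP) (hs n hnn)
    ?_ ?_ ?_, 1 / √(mink n n), by positivity, rfl, rfl⟩
  · rw [mink_smul_right, hPx, mul_zero]
  · rw [mink_smul_right, hxn, mul_zero]
  · rw [mink_smul_right, mink_smul_left, hPn, mul_zero, mul_zero]

theorem vx_ne_zero (b : Bool) (k : Fin 3) : vx b k ≠ 0 := fun h => by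
  have := vx_zero b k
  rw [h] at this
  simp at this

/-- A wedge for the interior of a triangle. -/
theorem exists_faceWedge {q : Q} (hu : q.u = 0) (hy : ∀ k, q.y k ≠ 0) :
    ∃ w : Wedge, w.θ = Real.pi ∧ q.fold ∈ w.W ∧ w.F.T = q.fold ∧
      ∀ p : Q, p.fold ∈ w.W → ¬ p.IsEdge := by
  have hpi := Real.pi_pos
  set σ : Fin 3 → Bool := fun k => bs (q.y k) with hσ
  have hq : q.fold ∈ faceW σ := fun k => by
    rw [Q.yc_fold]; exact sg_bs (hy k)
  set n := faceNormal σ with hn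
  have hne := mink_faceNormal_e0 σ
  have hn0 : n ≠ 0 := fun h => by
    rw [← hn, h, mink_zero_left] at hne; exact hne.false
  have hqn : mink q.fold n = 0 := by
    rw [faceW_mink hq, Q.c0_fold, hu, abs_zero, zero_mul]
  obtain ⟨F, c, hc, hT, hN⟩ := exists_frame q.inH hn0 hqn (vx (σ 0) 0)
    (by rw [mink_vx_self]; norm_num) (vx_ne_zero _ _) (by rw [mink_comm]; exact mink_faceNormal σ 0)
  have hre : ∀ x ∈ faceW σ, (F.zc x).re = c * mink n e0 * c0 x := by
    intro x hx
    change mink x F.N = _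
    rw [hN, mink_smul_right, faceW_mink hx]; ring
  have hpos : 0 < c * mink n e0 := mul_pos hc hne
  have hnonedge : ∀ p : Q, p.fold ∈ faceW σ → ¬ p.IsEdge := by
    rintro p hp ⟨-, k, hk⟩
    have := hp k
    rw [Q.yc_fold, hk, mul_zero] at this
    exact this.false
  refine ⟨⟨F, Real.pi, 0, 0, faceW σ, hpi, by linarith, isOpen_faceW σ, fun x hx => ?_,
    fun x hx => ?_, fun p hpu hp _ => ?_, fun x hx x' hx' v => ?_⟩, rfl, hq, hT, hnonedge⟩
  · rw [Complex.abs_arg_le_pi_div_two_iff, hre x hx, mul_nonneg_iff_of_pos_left hpos]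
  · have h1 : c0 x = 0 ↔ (F.zc x).re = 0 := by
      rw [hre x hx, mul_eq_zero, or_iff_right hpos.ne']
    rw [h1]
    constructor
    · intro h
      by_cases hz : F.zc x = 0
      · exact Or.inl hz
      · right
        have h2 := Complex.abs_arg_le_pi_div_two_iff.mpr h.ge
        refine le_antisymm h2 (not_lt.mp fun h3 => ?_)
        have := (Complex.abs_arg_lt_pi_div_two_iff.mp h3).resolve_right hz
        exact this.ne' h
    · rintro (h | h)
      · rw [h]; rfl
      · refine le_antisymm (not_lt.mp fun h3 => ?_) (Complex.abs_arg_le_pi_div_two_iff.mp h.le)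
        have := Complex.abs_arg_lt_pi_div_two_iff.mpr (Or.inl h3)
        exact this.ne h
  · have hS : p.S = refl n := by
      rw [Q.S, hn, ← faceW_bs hp, Q.yc_fold]
    have hmain : ∀ x, mink (p.S x) F.T = mink x F.T ∧ mink (p.S x) F.A = mink x F.A ∧
        F.zc (p.S x) = -(starRingEnd ℂ) (F.zc x) := by
      intro x
      have hSN : p.S x = x - (2 * mink x F.N) • F.N := by
        rw [hS, ← refl_smul hc.ne', ← hN, refl_apply, F.NN, div_one]
      rw [hSN]
      refine ⟨?_, ?_, ?_⟩
      · rw [mink_sub_left, mink_smul_left, mink_comm F.N, F.TN]; ring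
      · rw [mink_sub_left, mink_smul_left, mink_comm F.N, F.AN]; ring
      · apply Complex.ext
        · simp only [Frame.zc, mink_sub_left, mink_smul_left, F.NN, Complex.neg_re, Complex.conj_re]
          ring
        · simp only [Frame.zc, mink_sub_left, mink_smul_left, F.NB, Complex.neg_im, Complex.conj_im]
          ring
    have hp0 : (F.zc p.fold).re = 0 := by rw [hre _ hp, Q.c0_fold, hpu, abs_zero, mul_zero]
    have key : ∃ η : ℝ, (η = 1 ∨ η = -1) ∧ ((F.zc p.fold = 0 ∧ Real.pi = Real.pi) ∨
        (F.zc p.fold ≠ 0 ∧ (F.zc p.fold).arg = η * (Real.pi / 2))) := by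
      by_cases hz : F.zc p.fold = 0
      · exact ⟨1, Or.inl rfl, Or.inl ⟨hz, rfl⟩⟩
      · have him : (F.zc p.fold).im ≠ 0 := fun h => hz (Complex.ext hp0 h)
        rcases lt_or_gt_of_ne him with h | h
        · exact ⟨-1, Or.inr rfl, Or.inr ⟨hz, by
            rw [Complex.arg_eq_neg_pi_div_two_iff.mpr ⟨hp0, h⟩]; ring⟩⟩
        · exact ⟨1, Or.inl rfl, Or.inr ⟨hz, by
            rw [Complex.arg_eq_pi_div_two_iff.mpr ⟨hp0, h⟩]; ring⟩⟩
    obtain ⟨η, hη, hcase⟩ := key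
    refine ⟨η, hη, hcase, fun x => ⟨(hmain x).1, (hmain x).2.1, ?_⟩⟩
    have hexp : Complex.exp ((η * Real.pi : ℝ) * Complex.I) = -1 := by
      rcases hη with rfl | rfl
      · simp [Complex.exp_pi_mul_I]
      · simp [Complex.exp_neg, Complex.exp_pi_mul_I]
    rw [hexp, (hmain x).2.2, neg_one_mul]
  · have hK : Kx x = Kx x' := by
      unfold Kx
      congr 1
      funext k
      rw [sign_of_pos (hx k), sign_of_pos (hx' k)]
    rw [hK]
    simp

/-! ### Edges of the octahedron -/

section edge

variable (V V' : V4)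

/-- The midpoint of an edge. -/
def eT : V4 := (1 / √(-mink (V + V') (V + V'))) • (V + V')

/-- The direction of an edge. -/
def eA : V4 := (1 / √(mink (V - V') (V - V'))) • (V - V')

/-- The projection to the plane orthogonal to an edge. -/
def eP (x : V4) : V4 := x + mink x (eT V V') • eT V V' - mink x (eA V V') • eA V V'

/-- The direction of the projection to the plane orthogonal to an edge. -/
def en (x : V4) : V4 := (1 / √(mink (eP V V' x) (eP V V' x))) • eP V V' x

variable (ε : ℝ) (U U' : V4)

/-- The bisector of the dihedral angle at an edge. The sign `ε` is `-1` if this angle is larger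
than `π`, as the sum of the directions of the two triangles then points out of the polyhedron. -/
def eN : V4 := (ε / √(mink (en V V' U + en V V' U') (en V V' U + en V V' U'))) •
  (en V V' U + en V V' U')

/-- The direction orthogonal to an edge and to the bisector of the dihedral angle. -/
def eB : V4 := (1 / √(mink (en V V' U - en V V' U') (en V V' U - en V V' U'))) •
  (en V V' U - en V V' U')

variable {V V' U U' : V4}

theorem eT_swap : eT V' V = eT V V' := by rw [eT, eT, add_comm]

theorem eA_swap : eA V' V = -eA V V' := by
  have h : V' - V = -(V - V') := by abel
  rw [eA, eA, h, mink_neg_left, mink_neg_right, neg_neg, smul_neg]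

theorem eP_swap (x : V4) : eP V' V x = eP V V' x := by
  rw [eP, eP, eT_swap, eA_swap, mink_neg_right]; module

theorem en_swap (x : V4) : en V' V x = en V V' x := by rw [en, en, eP_swap]

theorem eN_swap : eN V' V ε U' U = eN V V' ε U U' := by
  rw [eN, eN, en_swap U, en_swap U', add_comm]

theorem eB_swap : eB V' V U' U = -eB V V' U U' := by
  have h : en V V' U' - en V V' U = -(en V V' U - en V V' U') := by abel
  rw [eB, eB, en_swap U, en_swap U', h, mink_neg_left, mink_neg_right, neg_neg, smul_neg]

theorem eT_map {g : V4 →ₗ[ℝ] V4} (hg : IsIso g) : eT (g V) (g V') = g (eT V V') := by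
  rw [eT, eT, map_smul, map_add, ← map_add, hg]

theorem eA_map {g : V4 →ₗ[ℝ] V4} (hg : IsIso g) : eA (g V) (g V') = g (eA V V') := by
  rw [eA, eA, map_smul, ← map_sub, hg]

theorem eP_map {g : V4 →ₗ[ℝ] V4} (hg : IsIso g) (x : V4) :
    eP (g V) (g V') (g x) = g (eP V V' x) := by
  simp only [eP, eT_map hg, eA_map hg, hg x, map_add, map_sub, map_smul]

theorem en_map {g : V4 →ₗ[ℝ] V4} (hg : IsIso g) (x : V4) :
    en (g V) (g V') (g x) = g (en V V' x) := by
  simp only [en, eP_map hg, hg (eP V V' x), map_smul]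

theorem eN_map {g : V4 →ₗ[ℝ] V4} (hg : IsIso g) :
    eN (g V) (g V') ε (g U) (g U') = g (eN V V' ε U U') := by
  simp only [eN, en_map hg, ← map_add, hg _ _, map_smul]

theorem eB_map {g : V4 →ₗ[ℝ] V4} (hg : IsIso g) :
    eB (g V) (g V') (g U) (g U') = g (eB V V' U U') := by
  simp only [eB, en_map hg, ← map_sub, hg _ _, map_smul]

end edge

/-- The conditions under which an edge `V V'` meets `ℍ³` and the triangles `V V' U` and `V V' U'` at
it are not coplanar. -/
structure EdgeOk (V V' U U' : V4) : Prop where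
  hT : mink (V + V') (V + V') < 0
  hA : 0 < mink (V - V') (V - V')
  hVV : mink V V = mink V' V'
  h0 : 0 < (V + V') 0
  hdet : det4 V V' U U' ≠ 0

theorem normalize_self {y : V4} (hy : 0 < mink y y) :
    mink ((1 / √(mink y y)) • y) ((1 / √(mink y y)) • y) = 1 := by
  rw [mink_smul_left, mink_smul_right]
  have := Real.mul_self_sqrt hy.le
  have := Real.sqrt_pos.mpr hy
  field_simp
  linarith

namespace EdgeOk

variable {V V' U U' : V4}

theorem TT (h : EdgeOk V V' U U') : mink (eT V V') (eT V V') = -1 := by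
  have h1 : 0 < -mink (V + V') (V + V') := by linarith [h.hT]
  rw [eT, mink_smul_left, mink_smul_right]
  have := Real.mul_self_sqrt h1.le
  have := Real.sqrt_pos.mpr h1
  field_simp
  linarith

theorem inH (h : EdgeOk V V' U U') : InH (eT V V') := by
  refine ⟨h.TT, ?_⟩
  have h1 : 0 < -mink (V + V') (V + V') := by linarith [h.hT]
  have h2 := Real.sqrt_pos.mpr h1
  have h3 := h.h0
  rw [eT, Pi.smul_apply, smul_eq_mul]
  positivity

theorem AA (h : EdgeOk V V' U U') : mink (eA V V') (eA V V') = 1 := normalize_self h.hA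

theorem TA (h : EdgeOk V V' U U') : mink (eT V V') (eA V V') = 0 := by
  rw [eT, eA, mink_smul_left, mink_smul_right]
  have : mink (V + V') (V - V') = 0 := by
    rw [mink_add_left, mink_sub_right, mink_sub_right, h.hVV, mink_comm V' V]; ring
  rw [this]; ring

theorem P_T (h : EdgeOk V V' U U') (x : V4) : mink (eP V V' x) (eT V V') = 0 := by
  rw [eP, mink_sub_left, mink_add_left, mink_smul_left, mink_smul_left, h.TT,
    mink_comm (eA V V'), h.TA]; ring

theorem P_A (h : EdgeOk V V' U U') (x : V4) : mink (eP V V' x) (eA V V') = 0 := by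
  rw [eP, mink_sub_left, mink_add_left, mink_smul_left, mink_smul_left, h.AA, h.TA]; ring

theorem V_eq (h : EdgeOk V V' U U') : ∃ a b : ℝ, V = a • eT V V' + b • eA V V' ∧
    V' = a • eT V V' - b • eA V V' := by
  have h1 : 0 < -mink (V + V') (V + V') := by linarith [h.hT]
  have h2 := Real.sqrt_pos.mpr h1
  have h3 := Real.sqrt_pos.mpr h.hA
  refine ⟨√(-mink (V + V') (V + V')) / 2, √(mink (V - V') (V - V')) / 2, ?_, ?_⟩
  · rw [eT, eA, smul_smul, smul_smul]
    have e1 : √(-mink (V + V') (V + V')) / 2 * (1 / √(-mink (V + V') (V + V'))) = 1 / 2 := by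
      field_simp
    have e2 : √(mink (V - V') (V - V')) / 2 * (1 / √(mink (V - V') (V - V'))) = 1 / 2 := by
      field_simp
    rw [e1, e2]; module
  · rw [eT, eA, smul_smul, smul_smul]
    have e1 : √(-mink (V + V') (V + V')) / 2 * (1 / √(-mink (V + V') (V + V'))) = 1 / 2 := by
      field_simp
    have e2 : √(mink (V - V') (V - V')) / 2 * (1 / √(mink (V - V') (V - V'))) = 1 / 2 := by
      field_simp
    rw [e1, e2]; module

/-- The projections of `U` and `U'` to the plane orthogonal to the edge are independent. -/
theorem indep (h : EdgeOk V V' U U') {a b : ℝ} (hab : a • eP V V' U + b • eP V V' U' = 0) : a = 0 ∧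
    b = 0 := by
  set t := a * mink U (eT V V') + b * mink U' (eT V V')
  set s := a * mink U (eA V V') + b * mink U' (eA V V')
  have h1 : a • U + b • U' = (-t) • eT V V' + s • eA V V' := by
    simp only [eP] at hab
    rw [← sub_eq_zero, ← hab]
    simp only [t, s]
    module
  rw [eT, eA, smul_smul, smul_smul] at h1
  set p := -t * (1 / √(-mink (V + V') (V + V')))
  set q := s * (1 / √(mink (V - V') (V - V')))
  have h2 : det4 V V' (a • U + b • U') U' = 0 := by
    rw [h1]
    simp only [det4, Pi.add_apply, Pi.sub_apply, Pi.smul_apply, smul_eq_mul]; ring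
  have h3 : det4 V V' U (a • U + b • U') = 0 := by
    rw [h1]
    simp only [det4, Pi.add_apply, Pi.sub_apply, Pi.smul_apply, smul_eq_mul]; ring
  have h4 : det4 V V' (a • U + b • U') U' = a * det4 V V' U U' := by
    simp only [det4, Pi.add_apply, Pi.smul_apply, smul_eq_mul]; ring
  have h5 : det4 V V' U (a • U + b • U') = b * det4 V V' U U' := by
    simp only [det4, Pi.add_apply, Pi.smul_apply, smul_eq_mul]; ring
  rw [h4] at h2
  rw [h5] at h3
  exact ⟨(mul_eq_zero.mp h2).resolve_right h.hdet, (mul_eq_zero.mp h3).resolve_right h.hdet⟩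

theorem comb_pos (h : EdgeOk V V' U U') {a b : ℝ} (hab : a ≠ 0) :
    0 < mink (a • eP V V' U + b • eP V V' U') (a • eP V V' U + b • eP V V' U') := by
  refine mink_pos_of_orth (x := eT V V') (by rw [h.TT]; norm_num) ?_ fun h0 => hab (h.indep h0).1
  rw [mink_comm, mink_add_left, mink_smul_left, mink_smul_left, h.P_T, h.P_T]; ring

theorem PU_pos (h : EdgeOk V V' U U') : 0 < mink (eP V V' U) (eP V V' U) := by
  have := h.comb_pos (a := 1) (b := 0) one_ne_zero
  rwa [one_smul, zero_smul, add_zero] at this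

theorem swap (h : EdgeOk V V' U U') : EdgeOk V V' U' U := ⟨h.hT, h.hA, h.hVV, h.h0, by
  rw [det4_swap34]; exact neg_ne_zero.mpr h.hdet⟩

theorem PU'_pos (h : EdgeOk V V' U U') : 0 < mink (eP V V' U') (eP V V' U') := h.swap.PU_pos

theorem nn (h : EdgeOk V V' U U') : mink (en V V' U) (en V V' U) = 1 := normalize_self h.PU_pos

theorem nn' (h : EdgeOk V V' U U') : mink (en V V' U') (en V V' U') = 1 := h.swap.nn

theorem add_pos (h : EdgeOk V V' U U') : 0 < mink (en V V' U + en V V' U')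
    (en V V' U + en V V' U') :=
  h.comb_pos (one_div_ne_zero (Real.sqrt_pos.mpr h.PU_pos).ne')

theorem sub_pos (h : EdgeOk V V' U U') : 0 < mink (en V V' U - en V V' U')
    (en V V' U - en V V' U') := by
  have := h.comb_pos (b := -(1 / √(mink (eP V V' U') (eP V V' U'))))
    (one_div_ne_zero (Real.sqrt_pos.mpr h.PU_pos).ne')
  rwa [neg_smul, ← sub_eq_add_neg] at this

theorem n_T (h : EdgeOk V V' U U') (x : V4) : mink (eT V V') (en V V' x) = 0 := by
  rw [en, mink_smul_right, mink_comm (eT V V'), h.P_T, mul_zero]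

theorem n_A (h : EdgeOk V V' U U') (x : V4) : mink (eA V V') (en V V' x) = 0 := by
  rw [en, mink_smul_right, mink_comm (eA V V'), h.P_A, mul_zero]

theorem NN (h : EdgeOk V V' U U') {ε : ℝ} (hε : ε = 1 ∨ ε = -1) : mink (eN V V' ε U U')
    (eN V V' ε U U') = 1 := by
  have h1 : eN V V' ε U U' = ε • ((1 / √(mink (en V V' U + en V V' U') (en V V' U + en V V' U'))) •
      (en V V' U + en V V' U')) := by rw [eN, smul_smul]; congr 1; ring
  rw [h1, mink_smul_left, mink_smul_right, normalize_self h.add_pos]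
  rcases hε with rfl | rfl <;> norm_num

/-- The frame of an edge. -/
def frame (h : EdgeOk V V' U U') {ε : ℝ} (hε : ε = 1 ∨ ε = -1) : Frame where
  T := eT V V'
  A := eA V V'
  N := eN V V' ε U U'
  B := eB V V' U U'
  TT := h.TT
  AA := h.AA
  NN := h.NN hε
  BB := normalize_self h.sub_pos
  TA := h.TA
  TN := by rw [eN, mink_smul_right, mink_add_right (eT V V'), h.n_T, h.n_T]; ring
  TB := by rw [eB, mink_smul_right, mink_sub_right (eT V V'), h.n_T, h.n_T]; ring
  AN := by rw [eN, mink_smul_right, mink_add_right (eA V V'), h.n_A, h.n_A]; ring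
  AB := by rw [eB, mink_smul_right, mink_sub_right (eA V V'), h.n_A, h.n_A]; ring
  NB := by
    rw [eN, eB, mink_smul_left, mink_smul_right]
    have : mink (en V V' U + en V V' U') (en V V' U - en V V' U') = 0 := by
      rw [mink_add_left, mink_sub_right, mink_sub_right, h.nn, h.nn',
        mink_comm (en V V' U') (en V V' U)]; ring
    rw [this]; ring
  hT := h.inH.2

theorem zc_V (h : EdgeOk V V' U U') {ε : ℝ} (hε : ε = 1 ∨ ε = -1) :
    (h.frame hε).zc V = 0 ∧ (h.frame hε).zc V' = 0 := by
  set F := h.frame hε with hF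
  have hT : F.zc (eT V V') = 0 := by
    apply Complex.ext
    · exact F.TN
    · exact F.TB
  have hA : F.zc (eA V V') = 0 := by
    apply Complex.ext
    · exact F.AN
    · exact F.AB
  obtain ⟨a, b, h1, h2⟩ := h.V_eq
  constructor
  · rw [h1, F.zc_add, F.zc_smul, F.zc_smul, hT, hA]; simp
  · rw [h2, sub_eq_add_neg, ← neg_smul, F.zc_add, F.zc_smul, F.zc_smul, hT, hA]; simp

/-- The two triangles at an edge, in the coordinates of its frame: they lie in directions conjugate
to each other, and the argument of the direction of `U` is half of the dihedral angle. -/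
theorem exists_polar (h : EdgeOk V V' U U') {ε : ℝ} (hε : ε = 1 ∨ ε = -1) :
    0 < ((h.frame hε).zc (en V V' U)).im ∧ 0 < ε * ((h.frame hε).zc (en V V' U)).re ∧
    ‖(h.frame hε).zc (en V V' U)‖ = 1 ∧
    (h.frame hε).zc (en V V' U') = (starRingEnd ℂ) ((h.frame hε).zc (en V V' U)) ∧
    ∃ r r' : ℝ, 0 < r ∧ 0 < r' ∧ (h.frame hε).zc U = r * (h.frame hε).zc (en V V' U) ∧
      (h.frame hε).zc U' = r' * (starRingEnd ℂ) ((h.frame hε).zc (en V V' U)) := by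
  set F := h.frame hε with hF
  have hp := h.add_pos
  have hm := h.sub_pos
  have hsp := Real.sqrt_pos.mpr hp
  have hsm := Real.sqrt_pos.mpr hm
  have hpe : mink (en V V' U + en V V' U') (en V V' U + en V V' U')
      = 2 * (1 + mink (en V V' U) (en V V' U')) := by
    rw [mink_add_left, mink_add_right, mink_add_right, h.nn, h.nn',
      mink_comm (en V V' U') (en V V' U)]; ring
  have hme : mink (en V V' U - en V V' U') (en V V' U - en V V' U')
      = 2 * (1 - mink (en V V' U) (en V V' U')) := by
    rw [mink_sub_left, mink_sub_right, mink_sub_right, h.nn, h.nn',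
      mink_comm (en V V' U') (en V V' U)]; ring
  have hre : (F.zc (en V V' U)).re = ε / √(mink (en V V' U + en V V' U') (en V V' U + en V V' U'))
      * (1 + mink (en V V' U) (en V V' U')) := by
    change mink (en V V' U) (eN V V' ε U U') = _
    rw [eN, mink_smul_right, mink_add_right (en V V' U), h.nn]
  have him : (F.zc (en V V' U)).im = 1 / √(mink (en V V' U - en V V' U') (en V V' U - en V V' U'))
      * (1 - mink (en V V' U) (en V V' U')) := by
    change mink (en V V' U) (eB V V' U U') = _
    rw [eB, mink_smul_right, mink_sub_right (en V V' U), h.nn]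
  have hconj : F.zc (en V V' U') = (starRingEnd ℂ) (F.zc (en V V' U)) := by
    apply Complex.ext
    · rw [Complex.conj_re, hre]
      change mink (en V V' U') (eN V V' ε U U') = _
      rw [eN, mink_smul_right, mink_add_right (en V V' U'), h.nn',
        mink_comm (en V V' U') (en V V' U)]; ring
    · rw [Complex.conj_im, him]
      change mink (en V V' U') (eB V V' U U') = _
      rw [eB, mink_smul_right, mink_sub_right (en V V' U'), h.nn',
        mink_comm (en V V' U') (en V V' U)]; ring
  have hzP : ∀ x, F.zc x = F.zc (eP V V' x) := by
    intro x
    have hT : F.zc (eT V V') = 0 := by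
      apply Complex.ext
      · exact F.TN
      · exact F.TB
    have hA : F.zc (eA V V') = 0 := by
      apply Complex.ext
      · exact F.AN
      · exact F.AB
    rw [eP, sub_eq_add_neg, ← neg_smul, F.zc_add, F.zc_add, F.zc_smul, F.zc_smul, hT, hA]
    simp
  have hzn : ∀ x, 0 < mink (eP V V' x) (eP V V' x) →
      F.zc x = (√(mink (eP V V' x) (eP V V' x)) : ℝ) * F.zc (en V V' x) := by
    intro x hx
    have h1 := Real.sqrt_pos.mpr hx
    rw [hzP x, en, F.zc_smul, ← mul_assoc, ← Complex.ofReal_mul, mul_one_div_cancel h1.ne',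
      Complex.ofReal_one, one_mul]
  refine ⟨?_, ?_, ?_, hconj, _, _, Real.sqrt_pos.mpr h.PU_pos, Real.sqrt_pos.mpr h.PU'_pos,
    hzn U h.PU_pos, ?_⟩
  · rw [him]
    have : 0 < 1 - mink (en V V' U) (en V V' U') := by linarith
    positivity
  · rw [hre]
    have : 0 < 1 + mink (en V V' U) (en V V' U') := by linarith
    have h2 : ε * ε = 1 := by rcases hε with rfl | rfl <;> norm_num
    have h3 : ε * (ε / √(mink (en V V' U + en V V' U') (en V V' U + en V V' U'))
      * (1 + mink (en V V' U) (en V V' U'))) = ε * ε *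
        (1 / √(mink (en V V' U + en V V' U') (en V V' U + en V V' U'))
      * (1 + mink (en V V' U) (en V V' U'))) := by ring
    rw [h3, h2]
    positivity
  · have h4 : ‖F.zc (en V V' U)‖ ^ 2 = 1 := by
      have h5 := F.mink_eq (en V V' U) (en V V' U)
      rw [Complex.mul_conj, Complex.ofReal_re, Complex.normSq_eq_norm_sq, h.nn] at h5
      have e1 : mink (en V V' U) F.T = 0 := by rw [mink_comm]; exact h.n_T U
      have e2 : mink (en V V' U) F.A = 0 := by rw [mink_comm]; exact h.n_A U
      rw [e1, e2] at h5
      linarith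
    exact (pow_eq_one_iff_of_nonneg (norm_nonneg _) two_ne_zero).mp h4
  · rw [hzn U' h.PU'_pos, hconj]

end EdgeOk

/-- The point with coordinates `c` on the centre and `y`, `y'` on the third vertices of the two
triangles, of which one vanishes, lies in the direction `ψ ≥ 0`; the two triangles lie in the
directions `φ` and `-φ`. Two linear forms that vanish on the triangles evaluate to `sin (φ + ψ)` and
`sin (φ - ψ)`, up to the factors `R`, `R'`. The sign `ε` is that of the coefficients `p`, `q` of the
centre, and it tells whether `φ` is smaller or larger than `π / 2`. -/
theorem sector_aux {ε φ ψ c p q y y' R R' : ℝ} (hε : ε = 1 ∨ ε = -1) (hφ0 : 0 < φ)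
    (hφ : φ < Real.pi) (hφε : 0 < ε * (Real.pi / 2 - φ)) (hψ0 : 0 ≤ ψ) (hψ : ψ ≤ Real.pi)
    (hp : 0 < ε * p) (hq : 0 < ε * q) (hy : 0 ≤ y) (hy' : 0 ≤ y') (hyy : y = 0 ∨ y' = 0)
    (hR : 0 < ε * R) (hR' : 0 < ε * R') (hα : (c * p + y) * R = Real.sin (φ + ψ))
    (hβ : (c * q + y') * R' = Real.sin (φ - ψ)) :
    (ψ < φ → 0 < c) ∧ (ψ = φ → c = 0) ∧ (φ < ψ → c < 0) := by
  rcases hε with rfl | rfl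
  · rw [one_mul] at *
    refine ⟨fun h => ?_, fun h => ?_, fun h => ?_⟩
    · have h1 := Real.sin_pos_of_pos_of_lt_pi (x := φ + ψ) (by linarith) (by linarith)
      have h2 := Real.sin_pos_of_pos_of_lt_pi (x := φ - ψ) (by linarith) (by linarith)
      rw [← hα] at h1
      rw [← hβ] at h2
      have h3 := pos_of_mul_pos_left h1 hR.le
      have h4 := pos_of_mul_pos_left h2 hR'.le
      rcases hyy with rfl | rfl
      · exact pos_of_mul_pos_left (by linarith) hp.le
      · exact pos_of_mul_pos_left (by linarith) hq.le
    · subst h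
      have h1 := Real.sin_pos_of_pos_of_lt_pi (x := ψ + ψ) (by linarith) (by linarith)
      rw [← hα] at h1
      have h3 := pos_of_mul_pos_left h1 hR.le
      rw [sub_self, Real.sin_zero] at hβ
      have h4 := (mul_eq_zero.mp hβ).resolve_right hR'.ne'
      rcases hyy with rfl | rfl
      · have : 0 < c := pos_of_mul_pos_left (by linarith) hp.le
        nlinarith
      · rw [add_zero] at h4
        exact (mul_eq_zero.mp h4).resolve_right hq.ne'
    · have h2 := Real.sin_neg_of_neg_of_neg_pi_lt (x := φ - ψ) (by linarith) (by linarith)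
      rw [← hβ] at h2
      have h3 : c * q + y' < 0 := neg_of_mul_neg_left h2 hR'.le
      exact neg_of_mul_neg_left (by linarith) hq.le
  · rw [neg_one_mul] at *
    have hRn : R < 0 := by linarith
    have hRn' : R' < 0 := by linarith
    have hsin : ∀ x, Real.pi < x → x < 2 * Real.pi → Real.sin x < 0 := by
      intro x h1 h2
      have := Real.sin_pos_of_pos_of_lt_pi (x := x - Real.pi) (by linarith) (by linarith)
      rw [Real.sin_sub_pi] at this
      linarith
    refine ⟨fun h => ?_, fun h => ?_, fun h => ?_⟩
    · have h2 := Real.sin_pos_of_pos_of_lt_pi (x := φ - ψ) (by linarith) (by linarith)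
      rw [← hβ] at h2
      have h3 : c * q + y' < 0 := by nlinarith
      have h4 : c * q < 0 := by linarith
      nlinarith
    · subst h
      have h1 := hsin (ψ + ψ) (by linarith) (by linarith)
      rw [← hα] at h1
      have h3 : 0 < c * p + y := by nlinarith
      rw [sub_self, Real.sin_zero] at hβ
      have h4 := (mul_eq_zero.mp hβ).resolve_right hRn'.ne
      rcases hyy with rfl | rfl
      · have : c < 0 := by nlinarith
        nlinarith
      · rw [add_zero] at h4
        exact (mul_eq_zero.mp h4).resolve_right (by linarith : q < 0).ne
    · have h2 := Real.sin_neg_of_neg_of_neg_pi_lt (x := φ - ψ) (by linarith) (by linarith)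
      have h1 := hsin (φ + ψ) (by linarith) (by linarith)
      rw [← hα] at h1
      rw [← hβ] at h2
      have h3 : 0 < c * p + y := by nlinarith
      have h4 : 0 < c * q + y' := by nlinarith
      rcases hyy with rfl | rfl
      · nlinarith
      · nlinarith

/-- In the plane orthogonal to an edge, the position relative to the two triangles at the edge is
detected by the argument, whether the dihedral angle is convex or concave. -/
theorem sector {ζ z : ℂ} {ε r r' p q c y y' : ℝ} (hζ : ‖ζ‖ = 1) (him : 0 < ζ.im)
    (hε : ε = 1 ∨ ε = -1) (hre : 0 < ε * ζ.re) (hr : 0 < r) (hr' : 0 < r')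
    (hp : 0 < ε * p) (hq : 0 < ε * q) (hy : 0 ≤ y) (hy' : 0 ≤ y') (hyy : y = 0 ∨ y' = 0)
    (hz : z = ((c * p + y) * r : ℝ) * ζ + ((c * q + y') * r' : ℝ) * (starRingEnd ℂ) ζ) :
    (0 ≤ c ↔ |z.arg| ≤ ζ.arg) ∧ (c = 0 ↔ z = 0 ∨ |z.arg| = ζ.arg) := by
  have hpi := Real.pi_pos
  have hζre : ζ.re = Real.cos ζ.arg := by
    conv_lhs => rw [← Complex.norm_mul_exp_arg_mul_I ζ]
    rw [hζ, Complex.ofReal_one, one_mul, Complex.exp_ofReal_mul_I_re]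
  have hζim : ζ.im = Real.sin ζ.arg := by
    conv_lhs => rw [← Complex.norm_mul_exp_arg_mul_I ζ]
    rw [hζ, Complex.ofReal_one, one_mul, Complex.exp_ofReal_mul_I_im]
  have hzre : z.re = ‖z‖ * Real.cos z.arg := by
    conv_lhs => rw [← Complex.norm_mul_exp_arg_mul_I z]
    rw [Complex.re_ofReal_mul, Complex.exp_ofReal_mul_I_re]
  have hzim : z.im = ‖z‖ * Real.sin z.arg := by
    conv_lhs => rw [← Complex.norm_mul_exp_arg_mul_I z]
    rw [Complex.im_ofReal_mul, Complex.exp_ofReal_mul_I_im]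
  have hφ0 : 0 < ζ.arg := by
    refine lt_of_le_of_ne (Complex.arg_nonneg_iff.mpr him.le) fun h => ?_
    rw [← h, Real.sin_zero] at hζim
    linarith
  have hφ : ζ.arg < Real.pi := Complex.arg_lt_pi_iff.mpr (Or.inr him.ne')
  have hS : ζ.re ^ 2 + ζ.im ^ 2 = 1 := by rw [← norm_sq_eq, hζ, one_pow]
  have hreal : z.re = (c * p + y) * r * ζ.re + (c * q + y') * r' * ζ.re := by
    rw [hz]; simp
  have himag : z.im = (c * p + y) * r * ζ.im - (c * q + y') * r' * ζ.im := by
    rw [hz]; simp; ring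
  have hA : (c * p + y) * (r * (2 * ζ.re * ζ.im)) = ‖z‖ * Real.sin (ζ.arg + z.arg) := by
    rw [Real.sin_add, ← hζre, ← hζim]
    linear_combination ζ.re * (hzim - himag) + ζ.im * (hzre - hreal)
  have hB : (c * q + y') * (r' * (2 * ζ.re * ζ.im)) = ‖z‖ * Real.sin (ζ.arg - z.arg) := by
    rw [Real.sin_sub, ← hζre, ← hζim]
    linear_combination -ζ.re * (hzim - himag) + ζ.im * (hzre - hreal)
  have hεS : 0 < ε * (2 * ζ.re * ζ.im) := by
    have := mul_pos hre him; linarith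
  by_cases hz0 : z = 0
  · have hc : c = 0 := by
      rw [hz0, norm_zero, zero_mul] at hA hB
      have hS0 : 2 * ζ.re * ζ.im ≠ 0 := fun h => by rw [h, mul_zero] at hεS; exact hεS.false
      have hA' := (mul_eq_zero.mp hA).resolve_right (mul_ne_zero hr.ne' hS0)
      have hB' := (mul_eq_zero.mp hB).resolve_right (mul_ne_zero hr'.ne' hS0)
      rcases hyy with rfl | rfl
      · rw [add_zero] at hA'
        exact (mul_eq_zero.mp hA').resolve_right fun h => by simp [h] at hp
      · rw [add_zero] at hB'
        exact (mul_eq_zero.mp hB').resolve_right fun h => by simp [h] at hq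
    rw [hc, hz0]
    simp [hφ0.le]
  have hn := norm_pos_iff.mpr hz0
  have hφε : 0 < ε * (Real.pi / 2 - ζ.arg) := by
    rcases hε with rfl | rfl
    · have := Complex.abs_arg_lt_pi_div_two_iff.mpr (Or.inl (by linarith : 0 < ζ.re))
      linarith [(abs_lt.mp this).2]
    · have h1 : ¬ |ζ.arg| ≤ Real.pi / 2 := fun h => by
        have := Complex.abs_arg_le_pi_div_two_iff.mp h; linarith
      rw [abs_of_pos hφ0] at h1
      linarith
  have key : (|z.arg| < ζ.arg → 0 < c) ∧ (|z.arg| = ζ.arg → c = 0) ∧ (ζ.arg < |z.arg| → c < 0) := by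
    have hR : 0 < ε * (r * (2 * ζ.re * ζ.im) / ‖z‖) := by
      have : ε * (r * (2 * ζ.re * ζ.im) / ‖z‖) = ε * (2 * ζ.re * ζ.im) * r / ‖z‖ := by ring
      rw [this]; positivity
    have hR' : 0 < ε * (r' * (2 * ζ.re * ζ.im) / ‖z‖) := by
      have : ε * (r' * (2 * ζ.re * ζ.im) / ‖z‖) = ε * (2 * ζ.re * ζ.im) * r' / ‖z‖ := by ring
      rw [this]; positivity
    have hA' : (c * p + y) * (r * (2 * ζ.re * ζ.im) / ‖z‖) = Real.sin (ζ.arg + z.arg) := by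
      rw [← mul_div_assoc, hA]; field_simp
    have hB' : (c * q + y') * (r' * (2 * ζ.re * ζ.im) / ‖z‖) = Real.sin (ζ.arg - z.arg) := by
      rw [← mul_div_assoc, hB]; field_simp
    rcases le_total 0 z.arg with h | h
    · rw [abs_of_nonneg h]
      exact sector_aux hε hφ0 hφ hφε h (Complex.arg_le_pi z) hp hq hy hy' hyy hR hR' hA' hB'
    · rw [abs_of_nonpos h]
      refine sector_aux hε hφ0 hφ hφε (by linarith) (by linarith [Complex.neg_pi_lt_arg z]) hq hp
        hy' hy hyy.symm hR' hR ?_ ?_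
      · rw [hB', sub_eq_add_neg]
      · rw [hA', sub_neg_eq_add]
  obtain ⟨k1, k2, k3⟩ := key
  refine ⟨⟨fun h => not_lt.mp fun h' => (k3 h').not_ge h, fun h => ?_⟩,
    ⟨fun h => Or.inr ?_, fun h => k2 (h.resolve_left hz0)⟩⟩
  · rcases h.lt_or_eq with h | h
    · exact (k1 h).le
    · exact (k2 h).ge
  · rcases lt_trichotomy |z.arg| ζ.arg with h' | h' | h'
    · exact absurd h (k1 h').ne'
    · exact h'
    · exact absurd h (k3 h').ne

/-- The sign of the bisector at an edge: the dihedral angles at the edges from a vertex of `ABC` to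
the next vertex of `A'B'C'` are larger than `π`. -/
def esg (β β' : Bool) : ℝ := if β = false ∧ β' = true then -1 else 1

theorem esg_sq (β β' : Bool) : esg β β' = 1 ∨ esg β β' = -1 := by
  unfold esg; split_ifs <;> simp

theorem edgeOk (k : Fin 3) (β β' : Bool) :
    EdgeOk (vx β (k + 1)) (vx β' (k + 2)) (vx false k) (vx true k) := by
  have h1 := sqrt3_sq
  have h2 := sqrt3_lb
  have h3 := sqrt3_ub
  have hne : ((β, k + 1) : Bool × Fin 3) ≠ (β', k + 2) := by
    intro h
    have := (Prod.mk.inj h).2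
    simp at this
  have hb := mink_vx_bounds hne
  refine ⟨?_, ?_, by rw [mink_vx_self, mink_vx_self], ?_, ?_⟩
  · rw [mink_add_left, mink_add_right, mink_add_right, mink_vx_self, mink_vx_self,
      mink_comm (vx β' (k + 2))]
    linarith
  · rw [mink_sub_left, mink_sub_right, mink_sub_right, mink_vx_self, mink_vx_self,
      mink_comm (vx β' (k + 2))]
    linarith
  · rw [Pi.add_apply, vx_zero, vx_zero]; norm_num
  · cases β <;> cases β' <;> fin_cases k <;>
      simp [vx_false, vx_true, det4, cs, sn] <;> intro h <;> nlinarith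

/-- The coefficients of the centre with respect to the vertices of the two triangles at an edge. The
dihedral angle is smaller than `π` if the centre has positive coefficients on the third vertices of
both triangles, and larger than `π` if it has negative coefficients. -/
theorem edge_expand (k : Fin 3) (β β' : Bool) : ∃ p q a b : ℝ, 0 < esg β β' * p ∧
    0 < esg β β' * q ∧
    e0 = p • vx false k + q • vx true k + a • vx β (k + 1) + b • vx β' (k + 2) := by
  have h1 := sqrt3_sq
  cases β <;> cases β'
  · refine ⟨1 / 6, 1 / 2, (1 - √3) / 6, (1 + √3) / 6, by simp [esg], by simp [esg], ?_⟩
    fin_cases k <;> funext i <;> fin_cases i <;>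
      simp [vx_false, vx_true, cs, sn, e0] <;> linarith
  · refine ⟨-√3 / 6, -√3 / 6, 1 / 2 + √3 / 6, 1 / 2 + √3 / 6, by simp [esg]; linarith [sqrt3_lb],
      by simp [esg]; linarith [sqrt3_lb], ?_⟩
    fin_cases k <;> funext i <;> fin_cases i <;>
      simp [vx_false, vx_true, cs, sn, e0] <;> linarith
  · refine ⟨√3 / 6, √3 / 6, 1 / 2 - √3 / 6, 1 / 2 - √3 / 6, by simp [esg], by simp [esg], ?_⟩
    fin_cases k <;> funext i <;> fin_cases i <;>
      simp [vx_false, vx_true, cs, sn, e0] <;> linarith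
  · refine ⟨1 / 2, 1 / 6, (1 + √3) / 6, (1 - √3) / 6, by simp [esg], by simp [esg], ?_⟩
    fin_cases k <;> funext i <;> fin_cases i <;>
      simp [vx_false, vx_true, cs, sn, e0] <;> linarith

/-- A skew map that annihilates the axis of a frame is a multiple of the rotation about it. -/
theorem skew_eq_rot {D : V4 →ₗ[ℝ] V4} (hD : IsSkew D) (F : Frame) (hT : D F.T = 0)
    (hA : D F.A = 0) (x : V4) : D x = mink (D F.N) F.B • F.rot x := by
  have hNN : mink (D F.N) F.N = 0 := by
    have := hD F.N F.N; rw [mink_comm F.N] at this; linarith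
  have hBB : mink (D F.B) F.B = 0 := by
    have := hD F.B F.B; rw [mink_comm F.B] at this; linarith
  have hBN : mink (D F.B) F.N = -mink (D F.N) F.B := by
    rw [hD, mink_comm]
  have hz : ∀ y, mink y F.T = 0 → mink y F.A = 0 →
      y = mink y F.N • F.N + mink y F.B • F.B := by
    intro y h1 h2
    conv_lhs => rw [F.expand y, h1, h2]
    module
  have hDT : ∀ y, mink (D y) F.T = 0 := fun y => by rw [hD, hT, mink_zero_right, neg_zero]
  have hDA : ∀ y, mink (D y) F.A = 0 := fun y => by rw [hD, hA, mink_zero_right, neg_zero]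
  obtain ⟨δ, hδ⟩ : ∃ δ, mink (D F.N) F.B = δ := ⟨_, rfl⟩
  rw [hδ] at hBN ⊢
  have hDN : D F.N = δ • F.B := by
    rw [hz _ (hDT F.N) (hDA _), hNN, hδ]
    module
  have hDB : D F.B = -δ • F.N := by
    rw [hz _ (hDT F.B) (hDA _), hBB, hBN]
    module
  conv_lhs => rw [F.expand x]
  simp only [map_add, map_smul, hT, hA]
  rw [hDB, hDN, F.rot_apply]
  module

/-- The formula for the flex is affine in each of the signs. -/
theorem Kf_sub {s s' : Fin 3 → ℝ} (k : Fin 3) (h1 : s (k + 1) = s' (k + 1))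
    (h2 : s (k + 2) = s' (k + 2)) (x : V4) :
    Kf s x - Kf s' x = ((s k - s' k) / 2) •
      (Kf (Function.update s k 1) x - Kf (Function.update s k (-1)) x) := by
  fin_cases k <;> simp only [Fin.zero_eta, Fin.mk_one, Fin.reduceFinMk, Fin.reduceAdd, zero_add]
    at h1 h2 <;> funext i <;> fin_cases i <;>
    simp [Kf, flexBoost, flexRot, Function.update, h1, h2] <;> ring

/-- The edges of the octahedron: `(k, β, β')` is the edge from the vertex `(β, k + 1)` to the vertex
`(β', k + 2)`. The two triangles at this edge have the third vertices `(false, k)`, `(true, k)`. -/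
abbrev Edge := Fin 3 × Bool × Bool

namespace Edge

variable (e : Edge)

/-- The frame of an edge. -/
def frame : Frame := (edgeOk e.1 e.2.1 e.2.2).frame (esg_sq e.2.1 e.2.2)

/-- The unit complex number of which the argument is half of the dihedral angle. -/
def zeta : ℂ := (frame e).zc (en (vx e.2.1 (e.1 + 1)) (vx e.2.2 (e.1 + 2)) (vx false e.1))

/-- The dihedral angle at an edge. -/
def theta : ℝ := 2 * (zeta e).arg

/-- The points of the cones over the two triangles at an edge, and over the edge. -/
def W : Set V4 := {x | 0 < sg e.2.1 * yc x (e.1 + 1) ∧ 0 < sg e.2.2 * yc x (e.1 + 2)}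

/-- The relative infinitesimal motion of the two triangles at an edge. -/
def relMotion : V4 →ₗ[ℝ] V4 :=
  Kf (Function.update (fun j => if j = e.1 + 1 then sg e.2.1 else sg e.2.2) e.1 1) -
    Kf (Function.update (fun j => if j = e.1 + 1 then sg e.2.1 else sg e.2.2) e.1 (-1))

/-- The coefficient of the rotation in the flex at an edge, in the coordinates of the model. -/
def coef : ℝ := mink (relMotion e (frame e).N) (frame e).B * Real.pi / (2 * theta e)

theorem polar : 0 < (zeta e).im ∧ 0 < esg e.2.1 e.2.2 * (zeta e).re ∧ ‖zeta e‖ = 1 ∧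
    (frame e).zc (en (vx e.2.1 (e.1 + 1)) (vx e.2.2 (e.1 + 2)) (vx true e.1))
      = (starRingEnd ℂ) (zeta e) ∧
    ∃ r r' : ℝ, 0 < r ∧ 0 < r' ∧ (frame e).zc (vx false e.1) = r * zeta e ∧
      (frame e).zc (vx true e.1) = r' * (starRingEnd ℂ) (zeta e) :=
  (edgeOk e.1 e.2.1 e.2.2).exists_polar (esg_sq e.2.1 e.2.2)

theorem zc_vx : (frame e).zc (vx e.2.1 (e.1 + 1)) = 0 ∧ (frame e).zc (vx e.2.2 (e.1 + 2)) = 0 :=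
  (edgeOk e.1 e.2.1 e.2.2).zc_V (esg_sq e.2.1 e.2.2)

theorem theta_pos : 0 < theta e := by
  have h := (polar e).1
  refine mul_pos two_pos (lt_of_le_of_ne (Complex.arg_nonneg_iff.mpr h.le) fun h0 => ?_)
  have := Complex.arg_eq_zero_iff.mp h0.symm
  exact h.ne' this.2

theorem theta_lt : theta e < 2 * Real.pi := by
  have := Complex.arg_lt_pi_iff.mpr (Or.inr (polar e).1.ne')
  rw [theta]; linarith

/-- The dihedral angles are never `π`, so that all edges are singular in the cone-manifold. -/
theorem theta_lt_pi_iff : (theta e < Real.pi ↔ esg e.2.1 e.2.2 = 1) ∧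
    (Real.pi < theta e ↔ esg e.2.1 e.2.2 = -1) ∧ theta e ≠ Real.pi := by
  obtain ⟨h1, h2, -⟩ := polar e
  have h0 := theta_pos e
  rw [theta] at h0 ⊢
  have h0' : 0 < (zeta e).arg := by linarith
  rcases esg_sq e.2.1 e.2.2 with h | h
  · rw [h, one_mul] at h2
    have := Complex.abs_arg_lt_pi_div_two_iff.mpr (Or.inl h2)
    rw [abs_of_pos h0'] at this
    rw [h]
    refine ⟨⟨fun _ => rfl, fun _ => by linarith⟩, ⟨fun _ => by linarith, fun h => ?_⟩, by linarith⟩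
    norm_num at h
  · have h3 : ¬ |(zeta e).arg| ≤ Real.pi / 2 := fun h' => by
      have := Complex.abs_arg_le_pi_div_two_iff.mp h'
      rw [h] at h2; linarith
    rw [abs_of_pos h0', not_le] at h3
    rw [h]
    refine ⟨⟨fun _ => by linarith, fun h => ?_⟩, ⟨fun _ => rfl, fun _ => by linarith⟩, by linarith⟩
    norm_num at h

theorem sum_cyc {M : Type*} [AddCommMonoid M] (f : Fin 3 → M) (k : Fin 3) :
    ∑ j, f j = f k + f (k + 1) + f (k + 2) := by
  rw [Fin.sum_univ_three]
  fin_cases k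
  · rfl
  · change f 0 + f 1 + f 2 = f 1 + f 2 + f 0
    abel
  · change f 0 + f 1 + f 2 = f 2 + f 0 + f 1
    abel

theorem expand {x : V4} (hx : x ∈ W e) : x = c0 x • e0
    + (pp false (yc x e.1) • vx false e.1 + pp true (yc x e.1) • vx true e.1)
    + (sg e.2.1 * yc x (e.1 + 1)) • vx e.2.1 (e.1 + 1)
    + (sg e.2.2 * yc x (e.1 + 2)) • vx e.2.2 (e.1 + 2) := by
  conv_lhs => rw [← Th_c0_yc x, Th_eq, sum_cyc _ e.1]
  rw [pp_of_pos hx.1.le, pp_of_pos hx.2.le]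
  module

theorem pp_zero (t : ℝ) : pp false t = 0 ∨ pp true t = 0 := by
  simp only [pp, sg, Bool.false_eq_true, if_false, if_true]
  rcases le_total 0 t with h | h
  · right; exact max_eq_right (by linarith)
  · left; exact max_eq_right (by linarith)

theorem zc_expand : ∃ p q r r' : ℝ, 0 < esg e.2.1 e.2.2 * p ∧ 0 < esg e.2.1 e.2.2 * q ∧
    0 < r ∧ 0 < r' ∧ ∀ x ∈ W e, (frame e).zc x =
      ((c0 x * p + pp false (yc x e.1)) * r : ℝ) * zeta e +
      ((c0 x * q + pp true (yc x e.1)) * r' : ℝ) * (starRingEnd ℂ) (zeta e) := by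
  obtain ⟨p, q, a, b, hp, hq, he⟩ := edge_expand e.1 e.2.1 e.2.2
  obtain ⟨-, -, -, -, r, r', hr, hr', h1, h2⟩ := polar e
  obtain ⟨h3, h4⟩ := zc_vx e
  refine ⟨p, q, r, r', hp, hq, hr, hr', fun x hx => ?_⟩
  have h0 : (frame e).zc e0 = p * (r * zeta e) + q * (r' * (starRingEnd ℂ) (zeta e)) := by
    rw [he]
    simp only [Frame.zc_add, Frame.zc_smul, h1, h2, h3, h4]
    ring
  conv_lhs => rw [expand e hx]
  simp only [Frame.zc_add, Frame.zc_smul, h0, h1, h2, h3, h4]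
  push_cast
  ring

/-- Near an edge, the octahedron is a wedge with dihedral angle `theta e`. -/
theorem sector_iff {x : V4} (hx : x ∈ W e) : (0 ≤ c0 x ↔ |((frame e).zc x).arg| ≤ theta e / 2) ∧
    (c0 x = 0 ↔ (frame e).zc x = 0 ∨ |((frame e).zc x).arg| = theta e / 2) := by
  obtain ⟨h1, h2, h3, -⟩ := polar e
  obtain ⟨p, q, r, r', hp, hq, hr, hr', hz⟩ := zc_expand e
  have h4 : theta e / 2 = (zeta e).arg := by rw [theta]; ring
  rw [h4]
  exact sector h3 h1 (esg_sq _ _) h2 hr hr' hp hq (pp_nonneg _ _) (pp_nonneg _ _) (pp_zero _)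
    (hz x hx)

theorem isOpen_W : IsOpen (W e) := by
  rw [W, Set.ofPred_and]
  exact (isOpen_lt continuous_const (by fun_prop)).inter (isOpen_lt continuous_const (by fun_prop))

theorem relMotion_skew : IsSkew (relMotion e) := by
  intro x y
  rw [relMotion, LinearMap.sub_apply, LinearMap.sub_apply, mink_sub_left, mink_sub_right,
    Kf_skew _ x, Kf_skew _ x]
  ring

theorem add_ne (k : Fin 3) : k + 1 ≠ k ∧ k + 2 ≠ k ∧ k + 2 ≠ k + 1 := by
  fin_cases k <;> decide

/-- Both triangles at an edge move the endpoints of this edge in the same way. -/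
theorem relMotion_vx : relMotion e (vx e.2.1 (e.1 + 1)) = 0 ∧
    relMotion e (vx e.2.2 (e.1 + 2)) = 0 := by
  obtain ⟨n1, n2, n3⟩ := add_ne e.1
  constructor
  · rw [relMotion, LinearMap.sub_apply, Kf_vx (b := e.2.1), Kf_vx (b := e.2.1), sub_self] <;>
      simp
  · rw [relMotion, LinearMap.sub_apply, Kf_vx (b := e.2.2), Kf_vx (b := e.2.2), sub_self] <;>
      simp [n3]

/-- The two triangles at an edge move relative to each other by a rotation about the edge. -/
theorem relMotion_apply (x : V4) : relMotion e x =
    mink (relMotion e (frame e).N) (frame e).B • (frame e).rot x := by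
  obtain ⟨h1, h2⟩ := relMotion_vx e
  refine skew_eq_rot (relMotion_skew e) (frame e) ?_ ?_ x
  · change relMotion e (eT _ _) = 0
    rw [eT, map_smul, map_add, h1, h2, add_zero, smul_zero]
  · change relMotion e (eA _ _) = 0
    rw [eA, map_smul, map_sub, h1, h2, sub_zero, smul_zero]

theorem Kx_sub {x x' : V4} (hx : x ∈ W e) (hx' : x' ∈ W e) (v : V4) : Kx x v - Kx x' v =
    ((Real.sign (yc x e.1) - Real.sign (yc x' e.1)) / 2) • relMotion e v := by
  obtain ⟨n1, n2, n3⟩ := add_ne e.1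
  have hup : ∀ t : ℝ, Function.update (fun k => Real.sign (yc x k)) e.1 t
      = Function.update (fun j => if j = e.1 + 1 then sg e.2.1 else sg e.2.2) e.1 t := by
    intro t
    funext j
    by_cases h0 : j = e.1
    · rw [h0, Function.update_self, Function.update_self]
    · rw [Function.update_of_ne h0, Function.update_of_ne h0]
      by_cases h1 : j = e.1 + 1
      · rw [if_pos h1, h1, sign_of_pos hx.1]
      · have h2 : j = e.1 + 2 := by
          revert h0 h1; generalize e.1 = k; revert j k; decide
        rw [if_neg h1, h2, sign_of_pos hx.2]
  have := Kf_sub (s := fun k => Real.sign (yc x k)) (s' := fun k => Real.sign (yc x' k)) e.1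
    (by rw [sign_of_pos hx.1, sign_of_pos hx'.1]) (by rw [sign_of_pos hx.2, sign_of_pos hx'.2]) v
  rw [hup, hup] at this
  exact this

/-- The reflection in a plane through the axis of a frame, in the coordinates of the frame; the
plane lies in the direction `c`. -/
theorem refl_of_perp {F : Frame} {n x : V4} {c : ℂ} {ρ : ℝ} (hρ : ρ ≠ 0) (hc : ‖c‖ = 1)
    (hT : mink n F.T = 0) (hA : mink n F.A = 0) (hz : F.zc n = ρ * (Complex.I * c)) :
    mink (refl n x) F.T = mink x F.T ∧ mink (refl n x) F.A = mink x F.A ∧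
      F.zc (refl n x) = c ^ 2 * (starRingEnd ℂ) (F.zc x) := by
  have hcc : c * (starRingEnd ℂ) c = 1 := by
    rw [Complex.mul_conj, Complex.normSq_eq_norm_sq, hc]; simp
  have hnn : mink n n = ρ ^ 2 := by
    have h1 := F.mink_eq n n
    rw [hT, hA, Complex.mul_conj, Complex.ofReal_re, Complex.normSq_eq_norm_sq, hz, norm_mul,
      norm_mul, hc, Complex.norm_I, Complex.norm_real, Real.norm_eq_abs] at h1
    rw [h1]; simp
  have hxn : ((2 * mink x n : ℝ) : ℂ) = F.zc x * (starRingEnd ℂ) (F.zc n)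
      + (starRingEnd ℂ) (F.zc x) * F.zc n := by
    have h1 := F.mink_eq x n
    rw [hT, hA, mul_zero, mul_zero, neg_zero, zero_add, zero_add] at h1
    rw [h1]
    apply Complex.ext
    · simp; ring
    · simp; ring
  refine ⟨?_, ?_, ?_⟩
  · rw [refl_apply, mink_sub_left, mink_smul_left, hT]; ring
  · rw [refl_apply, mink_sub_left, mink_smul_left, hA]; ring
  · have hρ' : (ρ : ℂ) ≠ 0 := Complex.ofReal_ne_zero.mpr hρ
    rw [refl_apply, sub_eq_add_neg, ← neg_smul, F.zc_add, F.zc_smul, hnn, Complex.ofReal_neg,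
      Complex.ofReal_div, hxn, hz]
    simp only [map_mul, Complex.conj_ofReal, Complex.conj_I, Complex.ofReal_pow]
    field_simp
    have hI := Complex.I_sq
    linear_combination (F.zc x * (c * (starRingEnd ℂ) c) - c ^ 2 * (starRingEnd ℂ) (F.zc x)) * hI
      - F.zc x * hcc

/-- The reflection in a triangle at an edge, in the coordinates of the frame of the edge. The
alternative `theta e = π` in this statement, which is that of the corresponding field of `Wedge`,
concerns the triangles and does not occur for edges. -/
theorem wall {p : Q} (hu : p.u = 0) (hp : p.fold ∈ W e) (hne : ¬ p.IsEdge) :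
    ∃ η : ℝ, (η = 1 ∨ η = -1) ∧ (((frame e).zc p.fold = 0 ∧ theta e = Real.pi) ∨
      ((frame e).zc p.fold ≠ 0 ∧ ((frame e).zc p.fold).arg = η * (theta e / 2))) ∧
    ∀ x, mink (p.S x) (frame e).T = mink x (frame e).T ∧
      mink (p.S x) (frame e).A = mink x (frame e).A ∧ (frame e).zc (p.S x) =
        Complex.exp ((η * theta e : ℝ) * Complex.I) * (starRingEnd ℂ) ((frame e).zc x) := by
  set F := frame e with hF
  obtain ⟨h1, h2, h3, h4, r, r', hr, hr', hU, hU'⟩ := polar e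
  rw [← hF] at h4 hU hU'
  obtain ⟨hV, hV'⟩ := zc_vx e
  rw [← hF] at hV hV'
  have hy : p.y e.1 ≠ 0 := fun h => hne ⟨hu, _, h⟩
  have hζexp : zeta e = Complex.exp (((zeta e).arg : ℝ) * Complex.I) := by
    conv_lhs => rw [← Complex.norm_mul_exp_arg_mul_I (zeta e), h3]
    simp
  have hargpi : (zeta e).arg ≠ Real.pi := by
    have := theta_lt e
    rw [theta] at this
    intro h; linarith
  have hζ0 : zeta e ≠ 0 := fun h => by rw [h] at h1; simp at h1
  -- the third vertex of the triangle over which the point lies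
  obtain ⟨η, ρ, c, hη, hρ, hc, hc2, harg, hvert⟩ : ∃ (η ρ : ℝ) (c : ℂ), (η = 1 ∨ η = -1) ∧ 0 < ρ ∧
      ‖c‖ = 1 ∧ c ^ 2 = Complex.exp ((η * theta e : ℝ) * Complex.I) ∧ c.arg = η * (theta e / 2) ∧
      F.zc (vx (bs (p.y e.1)) e.1) = ρ * c := by
    rcases lt_or_gt_of_ne hy with h | h
    · refine ⟨-1, r', (starRingEnd ℂ) (zeta e), Or.inr rfl, hr', by rw [Complex.norm_conj, h3], ?_,
        ?_, ?_⟩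
      · conv_lhs => rw [hζexp]
        rw [← Complex.exp_conj, ← Complex.exp_nat_mul, theta]
        congr 1
        simp only [map_mul, Complex.conj_ofReal, Complex.conj_I]
        push_cast; ring
      · rw [Complex.arg_conj, if_neg hargpi, theta]; ring
      · have : bs (p.y e.1) = true := by simp [bs, h]
        rw [this, hU']
    · refine ⟨1, r, zeta e, Or.inl rfl, hr, h3, ?_, ?_, ?_⟩
      · conv_lhs => rw [hζexp]
        rw [← Complex.exp_nat_mul, theta]
        congr 1
        push_cast; ring
      · rw [theta]; ring
      · have : bs (p.y e.1) = false := by simp [bs, h.le]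
        rw [this, hU]
  have hypos := sg_bs hy
  have hzp : F.zc p.fold = ((sg (bs (p.y e.1)) * p.y e.1 * ρ : ℝ) : ℂ) * c := by
    conv_lhs => rw [expand e hp, Q.c0_fold, hu, Q.yc_fold, pp_of_pos hypos.le]
    simp only [Frame.zc_add, Frame.zc_smul, hV, hV', hvert, abs_zero]
    push_cast; ring
  have hzp0 : F.zc p.fold ≠ 0 := by
    rw [hzp]
    refine mul_ne_zero (Complex.ofReal_ne_zero.mpr (by positivity)) fun h => ?_
    rw [h, norm_zero] at hc; norm_num at hc
  refine ⟨η, hη, Or.inr ⟨hzp0, ?_⟩, fun x => ?_⟩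
  · rw [hzp, Complex.arg_real_mul _ (by positivity), harg]
  · set n := faceNormal fun k => bs (p.y k) with hn
    have hperp : ∀ k, mink n (vx (bs (p.y k)) k) = 0 := fun k => mink_faceNormal _ k
    have hb1 : bs (p.y (e.1 + 1)) = e.2.1 := bs_of_pos (by have := hp.1; rwa [Q.yc_fold] at this)
    have hb2 : bs (p.y (e.1 + 2)) = e.2.2 := bs_of_pos (by have := hp.2; rwa [Q.yc_fold] at this)
    have hp1 := hperp (e.1 + 1)
    have hp2 := hperp (e.1 + 2)
    rw [hb1] at hp1
    rw [hb2] at hp2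
    have hT : mink n F.T = 0 := by
      change mink n (eT _ _) = 0
      rw [eT, mink_smul_right, mink_add_right n, hp1, hp2]; ring
    have hA : mink n F.A = 0 := by
      change mink n (eA _ _) = 0
      rw [eA, mink_smul_right, mink_sub_right n, hp1, hp2]; ring
    have hn0 : F.zc n ≠ 0 := by
      intro h
      have h5 : n = 0 := F.ext_mink (by rw [hT, mink_zero_left]) (by rw [hA, mink_zero_left])
        (by rw [mink_zero_left]; exact congrArg Complex.re h)
        (by rw [mink_zero_left]; exact congrArg Complex.im h)
      have h6 := mink_faceNormal_e0 fun k => bs (p.y k)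
      rw [← hn, h5, mink_zero_left] at h6
      exact h6.false
    have hcc : c * (starRingEnd ℂ) c = 1 := by
      rw [Complex.mul_conj, Complex.normSq_eq_norm_sq, hc]; simp
    have hre : (F.zc n * (starRingEnd ℂ) c).re = 0 := by
      have h5 := F.mink_eq n (vx (bs (p.y e.1)) e.1)
      rw [hperp, hT, hA, hvert, map_mul, Complex.conj_ofReal, mul_left_comm,
        Complex.re_ofReal_mul] at h5
      have h6 : ρ * (F.zc n * (starRingEnd ℂ) c).re = 0 := by linarith
      exact (mul_eq_zero.mp h6).resolve_left hρ.ne'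
    have hzn : F.zc n = ((F.zc n * (starRingEnd ℂ) c).im : ℝ) * (Complex.I * c) := by
      have h5 : F.zc n * (starRingEnd ℂ) c = ((F.zc n * (starRingEnd ℂ) c).im : ℝ) * Complex.I := by
        apply Complex.ext
        · rw [hre]; simp
        · simp
      rw [← mul_assoc, ← h5, mul_assoc, mul_comm _ c, hcc, mul_one]
    have hρ0 : (F.zc n * (starRingEnd ℂ) c).im ≠ 0 := by
      intro h
      rw [h] at hzn
      apply hn0
      rw [hzn]; simp
    have := refl_of_perp (x := x) hρ0 hc hT hA hzn
    rw [hc2] at this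
    exact this

/-- The wedge at an edge of the octahedron. -/
def wedge : Wedge where
  F := frame e
  θ := theta e
  c := coef e
  k := e.1
  W := W e
  pos := theta_pos e
  lt := theta_lt e
  isOpen := isOpen_W e
  nonneg_iff _ hx := (sector_iff e hx).1
  zero_iff _ hx := (sector_iff e hx).2
  wall _ hu hp hne := wall e hu hp hne
  flex x hx x' hx' v := by
    have hpi := Real.pi_pos
    have hθ := theta_pos e
    rw [Kx_sub e hx hx', relMotion_apply, smul_smul, coef]
    congr 1
    field_simp

end Edge

/-! ### The gluing maps in coordinates -/

theorem tau_add (j k : Fin 3) : tau j (k + 1) = tau j k + 2 ∧ tau j (k + 2) = tau j k + 1 := by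
  revert j k; decide

theorem Q.GlueBy.pos_left {b : Bool} {k : Fin 3} {p q : Q} (h : Q.GlueBy b k p q) :
    0 < sg b * p.y k := by
  have h1 := h.collar_left
  rw [Q.Collar, abs_lt] at h1
  have := pp_of_collar p.inH p.c0_nonneg h1.1
  rw [Q.yc_fold] at this
  linarith

theorem Q.GlueBy.y_eq {b : Bool} {k : Fin 3} {p q : Q} (h : Q.GlueBy b k p q) {m : Fin 3}
    (hm : m ≠ k) : q.y (tau k m) = -p.y m := by
  have h1 := (gl_coords p.inH p.c0_nonneg h.collar_left).2.1 (tau k m) fun h' => hm (by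
    rw [← tau_tau k m, h', tau_self])
  rwa [← h.2, Q.yc_fold, Q.yc_fold, tau_tau] at h1

/-- The gluing maps reverse the signs of the coordinates on the pairs of opposite vertices. -/
theorem Q.GlueBy.pos {b c : Bool} {k m : Fin 3} {p q : Q} (h : Q.GlueBy b k p q)
    (hc : 0 < sg c * p.y m) : 0 < sg (!c) * q.y (tau k m) := by
  by_cases hm : m = k
  · subst hm
    have hbc : c = b := by rw [← bs_of_pos hc, bs_of_pos h.pos_left]
    have := h.symm.pos_left
    rwa [hbc, tau_self]
  · rw [h.y_eq hm, sg_not, neg_mul_neg]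
    exact hc

theorem Q.GlueBy.zero {b : Bool} {k m : Fin 3} {p q : Q} (h : Q.GlueBy b k p q)
    (hc : p.y m = 0) : q.y (tau k m) = 0 := by
  have hm : m ≠ k := fun hm => by
    have := h.pos_left
    rw [← hm, hc, mul_zero] at this
    exact this.false
  rw [h.y_eq hm, hc, neg_zero]

theorem Q.GlueBy.sign {b : Bool} {k : Fin 3} {p q : Q} (h : Q.GlueBy b k p q) (m : Fin 3) :
    Real.sign (q.y (tau k m)) = -Real.sign (p.y m) := by
  by_cases h0 : p.y m = 0
  · rw [h.zero h0, h0, Real.sign_zero, neg_zero]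
  · rw [sign_of_pos (h.pos (sg_bs h0)), sign_of_pos (sg_bs h0), sg_not]

theorem Q.GlueBy.isEdge {b : Bool} {k : Fin 3} {p q : Q} (h : Q.GlueBy b k p q) :
    p.IsEdge → q.IsEdge := fun ⟨hu, m, hm⟩ => ⟨h.1.trans hu, tau k m, h.zero hm⟩

theorem Q.eventually_glueBy {b : Bool} {k : Fin 3} {p q : Q} (h : Q.GlueBy b k p q) :
    ∀ᶠ a in 𝓝 p, Q.GlueBy b k a (Q.glue b k a) := by
  filter_upwards [(Q.isOpen_collar b k).mem_nhds h.collar_left] with a ha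
  exact Q.glueBy_glue ha

theorem Q.continuousAt_glue {b : Bool} {k : Fin 3} {p q : Q} (h : Q.GlueBy b k p q) :
    ContinuousAt (Q.glue b k) p :=
  (Q.continuousOn_glue b k).continuousAt ((Q.isOpen_collar b k).mem_nhds h.collar_left)

theorem Q.tendsto_glue {b : Bool} {k : Fin 3} {p q : Q} (h : Q.GlueBy b k p q) :
    Tendsto (Q.glue b k) (𝓝 p) (𝓝 q) := by
  have := (Q.continuousAt_glue h).tendsto
  rwa [← h.eq_glue] at this

theorem Q.GlueBy.wt {b : Bool} {k : Fin 3} {p q : Q} (h : Q.GlueBy b k p q) : q.wt = p.wt := by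
  rw [Q.wt, Q.wt, h.1]

/-- A vector orthogonal to the vertices of a triangle is a multiple of its normal. -/
theorem eq_smul_faceNormal {σ : Fin 3 → Bool} {x : V4} (h : ∀ k, mink x (vx (σ k) k) = 0) :
    ∃ c : ℝ, x = c • faceNormal σ := by
  have h0 := mink_faceNormal_e0 σ
  refine ⟨mink x e0 / mink (faceNormal σ) e0, ?_⟩
  rw [← sub_eq_zero]
  refine mink_nondeg fun y => ?_
  rw [mink_sub_left, mink_smul_left]
  have key : ∀ a b c d : V4, det4 a b c d * mink x y = mink x a * det4 y b c d
      + mink x b * det4 a y c d + mink x c * det4 a b y d + mink x d * det4 a b c y := by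
    intro a b c d
    simp only [mink, det4]; ring
  have h1 := key (vx (σ 0) 0) (vx (σ 1) 1) (vx (σ 2) 2) e0
  rw [h 0, h 1, h 2] at h1
  have h2 : ∀ z, mink (faceNormal σ) z = (sg (σ 0) * sg (σ 1) * sg (σ 2)) *
      det4 (vx (σ 0) 0) (vx (σ 1) 1) (vx (σ 2) 2) z := fun z => by
    rw [faceNormal, mink_smul_left, mink_cross]
  have h3 : mink (faceNormal σ) e0 * mink x y = mink x e0 * mink (faceNormal σ) y := by
    rw [h2, h2]
    linear_combination (sg (σ 0) * sg (σ 1) * sg (σ 2)) * h1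
  field_simp
  linarith

theorem gl_tj (b : Bool) (k : Fin 3) (x : V4) : gl b k x = refl (vx (!b) k) (tj k x) := by
  rw [gl_apply, ← tj_vx_self, refl_conj (tj_isIso k)]

/-- The gluing maps respect the reflections in the triangles. -/
theorem Q.GlueBy.S_gl {b : Bool} {k : Fin 3} {p q : Q} (h : Q.GlueBy b k p q)
    (hp : ∀ m, p.y m ≠ 0) (x : V4) : q.S (gl b k x) = gl b k (p.S x) := by
  set n := faceNormal fun m => bs (p.y m) with hn
  have hb : bs (p.y k) = b := bs_of_pos h.pos_left
  have hnk : mink n (vx b k) = 0 := by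
    have := mink_faceNormal (fun m => bs (p.y m)) k
    rwa [hb] at this
  have hgn : gl b k n = tj k n := gl_of_orth hnk
  have hort : ∀ m, mink (gl b k n) (vx (bs (q.y m)) m) = 0 := by
    intro m
    have h1 : bs (q.y m) = !(bs (p.y (tau k m))) := by
      have h2 := h.pos (sg_bs (hp (tau k m)))
      rw [tau_tau] at h2
      exact bs_of_pos h2
    have h3 : vx (bs (q.y m)) m = tj k (vx (bs (p.y (tau k m))) (tau k m)) := by
      rw [tj_vx, tau_tau, h1]
    rw [hgn, h3, tj_isIso]
    exact mink_faceNormal (fun m => bs (p.y m)) (tau k m)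
  obtain ⟨c, hc⟩ := eq_smul_faceNormal hort
  have hn0 : n ≠ 0 := fun h0 => by
    have := mink_faceNormal_e0 fun m => bs (p.y m)
    rw [← hn, h0, mink_zero_left] at this
    exact this.false
  have hc0 : c ≠ 0 := fun h0 => by
    rw [h0, zero_smul] at hc
    exact hn0 ((gl_isIso b k).injective (by rw [hc, map_zero]))
  rw [Q.S, Q.S, ← refl_smul hc0, ← hc, refl_conj (gl_isIso b k)]

/-- Gluing maps commute with unfolding the double along a triangle. -/
theorem Q.GlueBy.dev {b : Bool} {k : Fin 3} {p q a : Q} (h : Q.GlueBy b k p q)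
    (hp : ¬ p.IsEdge) (ha : Q.GlueBy b k a (Q.glue b k a)) :
    q.dev (Q.glue b k a) = gl b k (p.dev a) := by
  by_cases hc : p.u = 0 ∧ a.u < 0
  · have hy : ∀ m, p.y m ≠ 0 := fun m hm => hp ⟨hc.1, m, hm⟩
    rw [Q.dev_of_neg hc.1 hc.2, Q.dev_of_neg (h.1.trans hc.1) (by rw [ha.1]; exact hc.2), ha.2,
      h.S_gl hy]
  · rw [Q.dev, Q.dev, h.1, ha.1, if_neg hc, if_neg hc, ha.2]

/-- The motion of the glued copy in the collar of a vertex is that of the original copy, conjugated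
by the reflection in the polar plane of the vertex. -/
theorem Q.GlueBy.Kx {b : Bool} {k : Fin 3} {a a' : Q} (h : Q.GlueBy b k a a') (x : V4) :
    gl (!b) k (TwOct.Kx a'.fold (gl b k x)) =
      refl (vx b k) (TwOct.Kx a.fold (refl (vx b k) x)) := by
  have h1 : (fun m => Real.sign (yc a'.fold m)) = fun m => -Real.sign (yc a.fold (tau k m)) := by
    funext m
    rw [Q.yc_fold, Q.yc_fold, ← h.sign, tau_tau]
  rw [TwOct.Kx, h1, gl_apply b k x,
    Kf_tj k (fun m => Real.sign (yc a.fold m)), gl_tj, Bool.not_not, tj_tj, TwOct.Kx]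

/-- The two sides of a truncation face differ in the flex by an infinitesimal isometry, which does
not depend on the point: along the collar, `Kx` changes only by skew maps that annihilate the
vertex, and these commute with the reflection. -/
theorem Kx_refl_sub {b : Bool} {k : Fin 3} {a p : Q} (ha : 0 < sg b * a.y k)
    (hp : 0 < sg b * p.y k) (x : V4) :
    refl (vx b k) (Kx a.fold (refl (vx b k) x)) - Kx a.fold x =
      refl (vx b k) (Kx p.fold (refl (vx b k) x)) - Kx p.fold x := by
  have hv := mink_vx_ne b k
  have hs : ∀ c : Q, 0 < sg b * c.y k → Kx c.fold (vx b k) = -sg b • kap (vx b k) :=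
    fun c hc => Kf_vx (by rw [Q.yc_fold]; exact sign_of_pos hc)
  have hD : ∀ y, Kx a.fold (refl (vx b k) y) - Kx p.fold (refl (vx b k) y)
      = Kx a.fold y - Kx p.fold y := by
    intro y
    rw [refl_apply, map_sub, map_sub, map_smul, map_smul, hs a ha, hs p hp]
    abel
  have hperp : mink (Kx a.fold x - Kx p.fold x) (vx b k) = 0 := by
    rw [mink_sub_left, Kx_skew, Kx_skew, hs a ha, hs p hp, sub_self]
  have h1 := hD x
  have h2 : refl (vx b k) (Kx a.fold (refl (vx b k) x)) - refl (vx b k)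
      (Kx p.fold (refl (vx b k) x)) = Kx a.fold x - Kx p.fold x := by
    rw [← map_sub, h1, refl_of_orth hperp]
  rw [sub_eq_sub_iff_sub_eq_sub]
  exact h2

theorem LocDev.differentiableAt {α : ℝ} {Φ : ℝ × ℂ → V4} {x₀ : ℝ × ℂ} {o : ℝ}
    (h : LocDev α Φ x₀ o) : DifferentiableAt ℝ Φ x₀ := by
  obtain ⟨Ψ, O, -, hx, h, -⟩ := h
  exact (h x₀ hx).1

/-- Gluing preserves the developing maps and the flex, and it reverses the orientation of the
double. -/
theorem DevAt.glue {α o : ℝ} {φ ξ : Q → ℝ × ℂ} {b : Bool} {k : Fin 3} {p q : Q}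
    (h : Q.GlueBy b k p q) (hp : ¬ p.IsEdge) (hφ : ContinuousAt φ q) (hd : DevAt α φ ξ q o) :
    DevAt α (φ ∘ Q.glue b k) (ξ ∘ Q.glue b k) p (-o) := by
  obtain ⟨Φ, J, hΦ, hJ, he⟩ := hd
  have hgi := gl_isIso (!b) k
  have hgg : ∀ x, gl (!b) k (gl b k x) = x := gl_gl b k
  have hskew : ∀ {K : V4 →ₗ[ℝ] V4}, IsSkew K → ∀ {g g' : V4 →ₗ[ℝ] V4}, IsIso g' →
      (∀ x, g' (g x) = x) → IsSkew (g' ∘ₗ K ∘ₗ g) := by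
    intro K hK g g' hg' hgg x y
    simp only [LinearMap.comp_apply]
    conv_lhs => rw [← hgg y, hg', hK]
    conv_rhs => rw [← hgg x, hg']
  refine ⟨fun x => gl (!b) k (Φ x), gl (!b) k ∘ₗ J ∘ₗ gl b k + Real.sign p.u •
    (refl (vx b k) ∘ₗ Kx p.fold ∘ₗ refl (vx b k) + (-1 : ℝ) • Kx p.fold), ?_, ?_, ?_⟩
  · rw [Function.comp_apply, ← h.eq_glue]
    have := hΦ.iso hgi (gl_hasDet (!b) k) (Or.inr rfl)
    rw [h.wt] at this
    convert this using 1; ring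
  · exact (hskew hJ hgi hgg).add (((hskew (Kx_skew _) (refl_isIso (mink_vx_ne b k))
      (refl_refl (mink_vx_ne b k))).add ((Kx_skew _).smul _)).smul _)
  · filter_upwards [Q.eventually_glueBy h, (Q.tendsto_glue h).eventually he,
      (Q.tendsto_glue h).eventually (hφ.eventually hΦ.eventually)] with a ha hea hdiff
    simp only [Function.comp_apply]
    have hda := hdiff.differentiableAt
    have hfd : fderiv ℝ (fun x => gl (!b) k (Φ x)) (φ (Q.glue b k a))
        = (LinearMap.toContinuousLinearMap (gl (!b) k)).comp
          (fderiv ℝ Φ (φ (Q.glue b k a))) :=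
      ((LinearMap.toContinuousLinearMap (gl (!b) k)).hasFDerivAt.comp _ hda.hasFDerivAt).fderiv
    have hKa : gl (!b) k (Kx (Q.glue b k a).fold (Q.glue b k a).fold) =
        refl (vx b k) (Kx a.fold (refl (vx b k) a.fold)) := by
      rw [← ha.Kx a.fold, ← ha.2]
    rw [hfd, ContinuousLinearMap.comp_apply, hea.1, hea.2, h.dev hp ha, hgg]
    refine ⟨rfl, ?_⟩
    rw [LinearMap.coe_toContinuousLinearMap', map_add, Q.vel, Q.vel, h.1, map_smul, hKa]
    rcases eq_or_ne p.u 0 with h0 | h0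
    · simp [h0, Real.sign_zero]
    · have := Kx_refl_sub ha.pos_left h.pos_left a.fold
      simp only [LinearMap.add_apply, LinearMap.comp_apply, LinearMap.smul_apply,
        Q.dev_of_ne h0]
      have h2 : refl (vx b k) (Kx a.fold (refl (vx b k) a.fold)) = Kx a.fold a.fold +
          (refl (vx b k) (Kx p.fold (refl (vx b k) a.fold)) - Kx p.fold a.fold) := by
        rw [← this]; abel
      rw [h2]
      module

/-! ### Edges and gluing maps -/

namespace Edge

/-- The image of an edge under the half-turn `tj j`. -/
def map (j : Fin 3) (e : Edge) : Edge := (tau j e.1, !e.2.2, !e.2.1)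

theorem esg_map (β β' : Bool) : esg (!β') (!β) = esg β β' := by
  cases β <;> cases β' <;> rfl

theorem vx_map (j : Fin 3) (e : Edge) :
    vx (map j e).2.1 ((map j e).1 + 1) = tj j (vx e.2.2 (e.1 + 2)) ∧
    vx (map j e).2.2 ((map j e).1 + 2) = tj j (vx e.2.1 (e.1 + 1)) ∧
    vx false (map j e).1 = tj j (vx true e.1) ∧ vx true (map j e).1 = tj j (vx false e.1) := by
  obtain ⟨h1, h2⟩ := tau_add j e.1
  simp only [map, tj_vx, h1, h2, Bool.not_true, Bool.not_false, and_self]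

theorem frame_map (j : Fin 3) (e : Edge) :
    (frame (map j e)).T = tj j (frame e).T ∧ (frame (map j e)).A = -tj j (frame e).A ∧
    (frame (map j e)).N = tj j (frame e).N ∧ (frame (map j e)).B = -tj j (frame e).B := by
  obtain ⟨h1, h2, h3, h4⟩ := vx_map j e
  refine ⟨?_, ?_, ?_, ?_⟩
  · change eT _ _ = tj j (eT _ _)
    rw [h1, h2, eT_map (tj_isIso j), eT_swap]
  · change eA _ _ = -tj j (eA _ _)
    rw [h1, h2, eA_map (tj_isIso j), eA_swap, map_neg]
  · change eN _ _ (esg _ _) _ _ = tj j (eN _ _ (esg _ _) _ _)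
    rw [h1, h2, h3, h4, eN_map _ (tj_isIso j), eN_swap]
    exact congrArg (fun ε => tj j (eN _ _ ε _ _)) (esg_map e.2.1 e.2.2)
  · change eB _ _ _ _ = -tj j (eB _ _ _ _)
    rw [h1, h2, h3, h4, eB_map (tj_isIso j), eB_swap, map_neg]

theorem zeta_map (j : Fin 3) (e : Edge) : zeta (map j e) = zeta e := by
  obtain ⟨h1, h2, h3, h4⟩ := vx_map j e
  obtain ⟨-, -, f1, f2⟩ := frame_map j e
  obtain ⟨-, -, -, hc, -⟩ := polar e
  have hz := congrArg (starRingEnd ℂ) hc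
  rw [Complex.conj_conj] at hz
  rw [← hz, zeta, h1, h2, h3, en_map (tj_isIso j), en_swap]
  apply Complex.ext
  · change mink _ (frame (map j e)).N = mink _ _
    rw [f1, tj_isIso]
  · change mink _ (frame (map j e)).B = -mink _ _
    rw [f2, mink_neg_right, tj_isIso]

/-- The half-turns preserve the dihedral angles. -/
theorem theta_map (j : Fin 3) (e : Edge) : theta (map j e) = theta e := by
  rw [theta, theta, zeta_map]

/-- A half-turn exchanges the two triangles at an edge, as it reverses all signs; hence it reverses
their relative motion. -/
theorem relMotion_map (j : Fin 3) (e : Edge) (x : V4) :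
    relMotion (map j e) (tj j x) = -tj j (relMotion e x) := by
  have hs : ∀ t : ℝ, (Function.update (fun i => if i = (map j e).1 + 1 then sg (map j e).2.1
        else sg (map j e).2.2) (map j e).1 t : Fin 3 → ℝ) =
      fun m => -(Function.update (fun i => if i = e.1 + 1 then sg e.2.1 else sg e.2.2) e.1 (-t) :
        Fin 3 → ℝ) (tau j m) := by
    intro t
    funext m
    obtain ⟨h1, h2⟩ := tau_add j e.1
    obtain ⟨n1, n2, n3⟩ := add_ne e.1
    obtain ⟨n4, n5, n6⟩ := add_ne (tau j e.1)
    have hm : m = tau j e.1 ∨ m = tau j e.1 + 1 ∨ m = tau j e.1 + 2 := by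
      generalize tau j e.1 = i; revert m i; decide
    rcases hm with rfl | rfl | rfl
    · simp [map, tau_tau]
    · have h3 : tau j (tau j e.1 + 1) = e.1 + 2 := by rw [← h2, tau_tau]
      simp [map, h3, n2, n3, n4, sg_not]
    · have h3 : tau j (tau j e.1 + 2) = e.1 + 1 := by rw [← h1, tau_tau]
      simp [map, h3, n1, n5, n6, sg_not]
  rw [relMotion, LinearMap.sub_apply, hs, hs, Kf_tj, Kf_tj, relMotion, LinearMap.sub_apply,
    map_sub, neg_neg]
  abel

theorem coef_map (j : Fin 3) (e : Edge) : coef (map j e) = coef e := by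
  obtain ⟨-, -, f1, f2⟩ := frame_map j e
  rw [coef, coef, theta_map, f1, f2, relMotion_map, mink_neg_left, mink_neg_right, neg_neg,
    tj_isIso]

/-- The orientation of the frame of an edge. -/
def or (e : Edge) : ℝ := det4 (frame e).T (frame e).A (frame e).N (frame e).B

theorem or_sq (e : Edge) : or e = 1 ∨ or e = -1 := (frame e).det4_sq

theorem or_map (j : Fin 3) (e : Edge) : or (map j e) = or e := by
  obtain ⟨f1, f2, f3, f4⟩ := frame_map j e
  have := tj_hasDet j (frame e).T (frame e).A (frame e).N (frame e).B
  rw [or, or, f1, f2, f3, f4, ← one_mul (det4 (frame e).T _ _ _), ← this]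
  simp only [det4, Pi.neg_apply]
  ring

/-- The vertex `(b, j)` is an endpoint of the edge. -/
def Endpoint (e : Edge) (b : Bool) (j : Fin 3) : Prop :=
  (b, j) = (e.2.1, e.1 + 1) ∨ (b, j) = (e.2.2, e.1 + 2)

/-- A gluing map moves the coordinate along the edge by a translation, and it is a reflection in the
planes orthogonal to the edge. -/
theorem co_gl {e : Edge} {b : Bool} {j : Fin 3} (h : Endpoint e b j) :
    ∃ c : ℝ, ∀ x, InH x → InH (gl b j x) →
      (frame (map j e)).co (gl b j x) = (((frame e).co x).1 + c,
        (starRingEnd ℂ) ((frame e).co x).2) := by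
  set F := frame e with hF
  set F' := frame (map j e) with hF'
  obtain ⟨f1, f2, f3, f4⟩ := frame_map j e
  rw [← hF, ← hF'] at f1 f2 f3 f4
  obtain ⟨a, d, hV, hV'⟩ := (edgeOk e.1 e.2.1 e.2.2).V_eq
  obtain ⟨a, d, hv⟩ : ∃ a d : ℝ, vx b j = a • F.T + d • F.A := by
    rcases h with h | h
    · obtain ⟨rfl, rfl⟩ := Prod.mk.inj h
      exact ⟨a, d, hV⟩
    · obtain ⟨rfl, rfl⟩ := Prod.mk.inj h
      exact ⟨a, -d, by rw [neg_smul, ← sub_eq_add_neg]; exact hV'⟩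
  clear hV hV'
  have hAT : mink F.A F.T = 0 := by rw [mink_comm, F.TA]
  have hvv : -a ^ 2 + d ^ 2 = 1 / 4 := by
    have := mink_vx_self b j
    rw [hv] at this
    simp only [mink_add_left, mink_add_right, mink_smul_left, mink_smul_right, F.TT, F.TA, F.AA,
      hAT] at this
    linarith
  have hr : ∀ x y, mink (refl (vx b j) x) y = mink x y - 8 * mink x (vx b j) * mink (vx b j) y := by
    intro x y
    rw [refl_apply, mink_sub_left, mink_smul_left, mink_vx_self]; ring
  have hxv : ∀ x, mink x (vx b j) = a * mink x F.T + d * mink x F.A := fun x => by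
    rw [hv, mink_add_right, mink_smul_right, mink_smul_right]
  have hvT : mink (vx b j) F.T = -a := by
    rw [mink_comm, hxv, F.TT, F.TA]; ring
  have hvA : mink (vx b j) F.A = d := by
    rw [mink_comm, hxv, F.AA, hAT]; ring
  have hvN : mink (vx b j) F.N = 0 := by
    rw [mink_comm, hxv, mink_comm F.N, mink_comm F.N, F.TN, F.AN]; ring
  have hvB : mink (vx b j) F.B = 0 := by
    rw [mink_comm, hxv, mink_comm F.B, mink_comm F.B, F.TB, F.AB]; ring
  have hz : ∀ x, F'.zc (gl b j x) = (starRingEnd ℂ) (F.zc x) := by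
    intro x
    apply Complex.ext
    · change mink (gl b j x) F'.N = mink x F.N
      rw [f3, gl_apply, tj_isIso, hr, hvN]; ring
    · change mink (gl b j x) F'.B = -mink x F.B
      rw [f4, gl_apply, mink_neg_right, tj_isIso, hr, hvB]; ring
  set c := Real.arsinh (8 * a * d) with hc
  have hsinh : Real.sinh c = 8 * a * d := Real.sinh_arsinh _
  have hcosh : Real.cosh c = 1 + 8 * a ^ 2 := by
    rw [hc, Real.cosh_arsinh, Real.sqrt_eq_iff_mul_self_eq (by positivity) (by positivity)]
    have : d ^ 2 = 1 / 4 + a ^ 2 := by linarith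
    linear_combination (64 * a ^ 2) * this
  refine ⟨-c, fun x hx hx' => ?_⟩
  set p := F.co x with hp
  have hxp : F.pt p = x := F.pt_co hx
  have h2 : p.2 = F.zc x := rfl
  have hpt : F'.pt (p.1 - c, (starRingEnd ℂ) p.2) = gl b j x := by
    have hcn : Frame.cn ((starRingEnd ℂ) p.2) = Frame.cn p.2 := by
      rw [Frame.cn, Frame.cn, Complex.norm_conj]
    have hT := F.mink_pt_T p
    have hA := F.mink_pt_A p
    rw [hxp] at hT hA
    refine F'.ext_mink ?_ ?_ ?_ ?_
    · rw [F'.mink_pt_T, f1, gl_apply, tj_isIso, hr, hvT, hxv, hT, hA]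
      simp only [hcn]
      rw [Real.cosh_sub, hsinh, hcosh]; ring
    · rw [F'.mink_pt_A, f2, gl_apply, mink_neg_right, tj_isIso, hr, hvA, hxv, hT, hA]
      simp only [hcn]
      rw [Real.sinh_sub, hsinh, hcosh]
      linear_combination (-8 * Frame.cn p.2 * Real.sinh p.1) * hvv
    · rw [F'.mink_pt_N]
      exact (congrArg Complex.re ((hz x).trans (by rw [h2]))).symm
    · rw [F'.mink_pt_B]
      exact (congrArg Complex.im ((hz x).trans (by rw [h2]))).symm
  rw [← hpt, F'.co_pt, sub_eq_add_neg]

end Edge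

/-! ### Coordinates at the edges -/

/-- The isometries of the model spaces that are needed to compare the charts at an edge:
translations along the axis, composed with a reflection if `δ` is true. -/
def sym (c : ℝ) (δ : Bool) (p : ℝ × ℂ) : ℝ × ℂ :=
  (p.1 + c, if δ then (starRingEnd ℂ) p.2 else p.2)

/-- The derivative of `sym c δ`. -/
def symL (δ : Bool) : ℝ × ℂ →L[ℝ] ℝ × ℂ :=
  (ContinuousLinearMap.id ℝ ℝ).prodMap
    (if δ then (Complex.conjCLE : ℂ →L[ℝ] ℂ) else ContinuousLinearMap.id ℝ ℂ)

theorem symL_apply (δ : Bool) (p : ℝ × ℂ) :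
    symL δ p = (p.1, if δ then (starRingEnd ℂ) p.2 else p.2) := by
  cases δ <;> rfl

theorem sym_eq (c : ℝ) (δ : Bool) (p : ℝ × ℂ) : sym c δ p = symL δ p + (c, 0) := by
  rw [symL_apply, sym]; simp

theorem hasFDerivAt_sym (c : ℝ) (δ : Bool) (p : ℝ × ℂ) : HasFDerivAt (sym c δ) (symL δ) p := by
  have : sym c δ = fun p => symL δ p + (c, 0) := funext fun p => sym_eq c δ p
  rw [this]
  exact (symL δ).hasFDerivAt.add_const _

theorem symL_symL (δ δ' : Bool) (p : ℝ × ℂ) : symL δ (symL δ' p) = symL (δ ^^ δ') p := by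
  cases δ <;> cases δ' <;> simp [symL_apply]

theorem sym_sym (c c' : ℝ) (δ δ' : Bool) (p : ℝ × ℂ) :
    sym c δ (sym c' δ' p) = sym (c + c') (δ ^^ δ') p := by
  cases δ <;> cases δ' <;> simp [sym] <;> ring

theorem coneCosh_sym (α c : ℝ) (δ : Bool) (p q : ℝ × ℂ) :
    coneCosh α (sym c δ p) (sym c δ q) = coneCosh α p q := by
  cases δ
  · simp [coneCosh, sym]
  · have : InnerProductGeometry.angle ((starRingEnd ℂ) p.2) ((starRingEnd ℂ) q.2)
        = InnerProductGeometry.angle p.2 q.2 := Complex.conjLIE.toLinearIsometry.angle_map p.2 q.2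
    simp [coneCosh, sym, this]

theorem det_symL (δ : Bool) : (symL δ).det = if δ then -1 else 1 := by
  have h0 : ∀ L : ℝ × ℂ →L[ℝ] ℝ × ℂ, L.det = (LinearMap.toMatrix stdB stdB L).det := fun L =>
    (LinearMap.det_toMatrix stdB (L : ℝ × ℂ →ₗ[ℝ] ℝ × ℂ)).symm
  obtain ⟨h1, h2, h3⟩ := stdB_apply
  rw [h0, Matrix.det_fin_three]
  simp only [LinearMap.toMatrix_apply, h1, h2, h3, ContinuousLinearMap.coe_coe, symL_apply,
    (stdB_repr _).1, (stdB_repr _).2.1, (stdB_repr _).2.2]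
  cases δ <;> simp

/-- A point of the double lies on the edge `e`. -/
def OnEdge (e : Edge) (q : Q) : Prop := q.u = 0 ∧ q.y e.1 = 0 ∧ q.fold ∈ e.W

theorem OnEdge.isEdge {e : Edge} {q : Q} (h : OnEdge e q) : q.IsEdge := ⟨h.1, e.1, h.2.1⟩

theorem Edge.mem_W {e : Edge} {q : Q} : q.fold ∈ e.W ↔
    0 < sg e.2.1 * q.y (e.1 + 1) ∧ 0 < sg e.2.2 * q.y (e.1 + 2) := by
  rw [Edge.W, Set.mem_ofPred_eq, Q.yc_fold]

theorem Fin.eq_cyc (k m : Fin 3) : m = k ∨ m = k + 1 ∨ m = k + 2 := by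
  revert k m; decide

theorem OnEdge.eq_of_zero {e : Edge} {q : Q} (h : q.fold ∈ e.W) {m : Fin 3} (hm : q.y m = 0) :
    m = e.1 := by
  rw [Edge.mem_W] at h
  rcases Fin.eq_cyc e.1 m with h1 | rfl | rfl
  · exact h1
  · rw [hm, mul_zero] at h; exact absurd h.1 (lt_irrefl _)
  · rw [hm, mul_zero] at h; exact absurd h.2 (lt_irrefl _)

theorem OnEdge.of_isEdge {e : Edge} {q : Q} (h : q.fold ∈ e.W) (hq : q.IsEdge) : OnEdge e q := by
  obtain ⟨hu, m, hm⟩ := hq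
  exact ⟨hu, by rw [← OnEdge.eq_of_zero h hm]; exact hm, h⟩

theorem OnEdge.unique {e e' : Edge} {q : Q} (h : OnEdge e q) (h' : OnEdge e' q) : e = e' := by
  have h1 := OnEdge.eq_of_zero h.2.2 h'.2.1
  have h2 := Edge.mem_W.mp h.2.2
  have h3 := Edge.mem_W.mp h'.2.2
  rw [h1] at h3
  refine Prod.ext h1.symm (Prod.ext ?_ ?_)
  · rw [← bs_of_pos h2.1, ← bs_of_pos h3.1]
  · rw [← bs_of_pos h2.2, ← bs_of_pos h3.2]

theorem exists_onEdge {q : Q} (h : q.IsEdge) : ∃ e, OnEdge e q := by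
  obtain ⟨hu, k, hk⟩ := h
  have key : ∀ m m' : Fin 3, (∀ i, i = k ∨ i = m ∨ i = m') → m ≠ k → m' ≠ k → m ≠ m' →
      q.y m' = 0 → False := by
    intro m m' hall hmk hmk' hmm h0
    obtain ⟨b, hb⟩ : ∃ b, 0 ≤ sg b * q.y m := by
      by_cases h : q.y m = 0
      · exact ⟨false, by rw [h, mul_zero]⟩
      · exact ⟨_, (sg_bs h).le⟩
    have hx : q.fold = (sg b * q.y m) • vx b m := by
      rw [Q.fold, Th_eq, hu, abs_zero, zero_smul, zero_add, ← pp_of_pos hb]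
      refine Finset.sum_eq_single m (fun i _ hi => ?_) (by simp)
      have : q.y i = 0 := by
        rcases hall i with rfl | rfl | rfl
        · exact hk
        · exact absurd rfl hi
        · exact h0
      simp [this, pp]
    have h1 := q.inH.1
    rw [hx, mink_smul_left, mink_smul_right, mink_vx_self] at h1
    nlinarith [sq_nonneg (sg b * q.y m)]
  obtain ⟨n1, n2, n3⟩ := Edge.add_ne k
  have h1 : q.y (k + 1) ≠ 0 := key (k + 2) (k + 1) (fun i => by
    rcases Fin.eq_cyc k i with h | h | h <;> simp [h]) n2 n1 n3
  have h2 : q.y (k + 2) ≠ 0 := key (k + 1) (k + 2) (Fin.eq_cyc k) n1 n2 n3.symm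
  exact ⟨(k, bs (q.y (k + 1)), bs (q.y (k + 2))), hu, hk, Edge.mem_W.mpr ⟨sg_bs h1, sg_bs h2⟩⟩

/-- An edge that ends at a truncation face is continued by an edge of the glued copy. -/
theorem OnEdge.glue {e : Edge} {b : Bool} {j : Fin 3} {p q : Q} (h : Q.GlueBy b j p q)
    (hp : OnEdge e p) : OnEdge (e.map j) q ∧ e.Endpoint b j := by
  have hW := Edge.mem_W.mp hp.2.2
  obtain ⟨t1, t2⟩ := tau_add j e.1
  refine ⟨⟨h.1.trans hp.1, h.zero hp.2.1, Edge.mem_W.mpr ⟨?_, ?_⟩⟩, ?_⟩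
  · have := h.pos hW.2
    rwa [t2] at this
  · have := h.pos hW.1
    rwa [t1] at this
  · have hb := h.pos_left
    rcases Fin.eq_cyc e.1 j with rfl | rfl | rfl
    · rw [hp.2.1, mul_zero] at hb; exact absurd hb (lt_irrefl _)
    · exact Or.inl (by rw [← bs_of_pos hb, ← bs_of_pos hW.1])
    · exact Or.inr (by rw [← bs_of_pos hb, ← bs_of_pos hW.2])

/-- The edge `e.map j` is glued to `e` by a gluing map at an endpoint of `e`. -/
theorem Edge.wm_glue {e : Edge} {b : Bool} {j : Fin 3} {a a' : Q} (h : Q.GlueBy b j a a')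
    (ha : a.fold ∈ e.W) (he : e.Endpoint b j) :
    (e.map j).wedge.wm a' = (starRingEnd ℂ) (e.wedge.wm a) := by
  obtain ⟨c, hc⟩ := Edge.co_gl he
  have h1 := congrArg Prod.snd (hc a.fold a.inH (by rw [← h.2]; exact a'.inH))
  rw [← h.2] at h1
  have hpi := Real.pi_pos
  have harg : (e.frame.zc a.fold).arg ≠ Real.pi := fun hh => by
    have := e.wedge.arg_le ha
    change |(e.frame.zc a.fold).arg| ≤ e.theta / 2 at this
    rw [hh, abs_of_pos hpi] at this
    linarith [e.theta_lt]
  have h2 : pw (Real.pi / (e.map j).wedge.θ) ((e.map j).wedge.F.zc a'.fold)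
      = (starRingEnd ℂ) (pw (Real.pi / e.wedge.θ) (e.wedge.F.zc a.fold)) := by
    change pw (Real.pi / (e.map j).theta) ((e.map j).frame.co a'.fold).2 = _
    rw [h1, Edge.theta_map]
    exact pw_conj _ harg
  rw [Wedge.wm, Wedge.wm, h.1, h2]
  split_ifs <;> simp

/-- Near the point `p` of an edge, the coordinates `φ` agree with the standard coordinates of the
edge, up to an isometry of the model space, and `ξ` agrees with the standard variation. -/
def EdgeAt (α : ℝ) (φ ξ : Q → ℝ × ℂ) (p : Q) (o : ℝ) : Prop :=
  ∃ (e : Edge) (c : ℝ) (δ : Bool), OnEdge e p ∧ α = 2 * e.theta ∧ o = (symL δ).det * e.or ∧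
    ∀ᶠ a in 𝓝 p, φ a = sym c δ (e.wedge.co 0 a) ∧ ξ a = symL δ (e.wedge.field a)

/-- Gluing preserves the coordinates at the edges, up to the isometries `sym`, and it reverses the
orientation. -/
theorem EdgeAt.glue {α o : ℝ} {φ ξ : Q → ℝ × ℂ} {b : Bool} {j : Fin 3} {p q : Q}
    (h : Q.GlueBy b j p q) (hd : EdgeAt α φ ξ q o) :
    EdgeAt α (φ ∘ Q.glue b j) (ξ ∘ Q.glue b j) p (-o) := by
  obtain ⟨e', c, δ, he', hα, ho, hev⟩ := hd
  obtain ⟨e, he⟩ := exists_onEdge (h.symm.isEdge he'.isEdge)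
  obtain ⟨h1, h2⟩ := he.glue h
  obtain rfl := he'.unique h1
  obtain ⟨c', hc'⟩ := Edge.co_gl h2
  refine ⟨e, c + c', δ ^^ true, he, by rw [hα, Edge.theta_map], ?_, ?_⟩
  · rw [ho, Edge.or_map, det_symL, det_symL]
    cases δ <;> simp
  · filter_upwards [Q.eventually_glueBy h, (Q.tendsto_glue h).eventually hev,
      e.wedge.eventually_mem he.2.2] with a ha hea hm
    have hm : a.fold ∈ e.W := hm
    have hwm := Edge.wm_glue ha hm h2
    have hco := congrArg Prod.fst (hc' a.fold a.inH (by rw [← ha.2]; exact (Q.glue b j a).inH))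
    rw [← ha.2] at hco
    rw [Function.comp_apply, Function.comp_apply, hea.1, hea.2, ← sym_sym, ← symL_symL]
    have hs : Real.sign ((Q.glue b j a).y (tau j e.1)) = -Real.sign (a.y e.1) := ha.sign e.1
    constructor
    · congr 1
      refine Prod.ext ?_ ?_
      · change ((e.map j).frame.co (Q.glue b j a).fold).1 - 0 = (e.frame.co a.fold).1 - 0 + c'
        rw [hco]; ring
      · rw [Wedge.co, hwm]; simp [sym, Wedge.co]
    · congr 1
      rw [symL_apply, Wedge.field, hwm]
      change (0, ((((e.map j).coef * Real.sign ((Q.glue b j a).y (tau j e.1))) : ℝ) : ℂ) *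
        Complex.I * _) = (0, (starRingEnd ℂ) ((((e.coef * Real.sign (a.y e.1)) : ℝ) : ℂ) *
        Complex.I * e.wedge.wm a))
      rw [hs, Edge.coef_map, map_mul, map_mul, Complex.conj_ofReal, Complex.conj_I]
      push_cast
      congr 1
      ring

/-! ### Charts of the double -/

/-- A chart of the double that is centred at `q`, with a variation. -/
structure QChart (q : Q) where
  chart : OpenPartialHomeomorph Q (ℝ × ℂ)
  ξ : Q → ℝ × ℂ
  α : ℝ
  o : ℝ
  mem : q ∈ chart.source
  center : chart q = 0
  o_sq : o = 1 ∨ o = -1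
  α_pos : 0 < α
  α_eq : ¬ q.IsEdge → α = 2 * Real.pi
  dev : ∀ p ∈ chart.source, ¬ p.IsEdge → DevAt α chart ξ p o
  edge : ∀ p ∈ chart.source, p.IsEdge → EdgeAt α chart ξ p o

theorem Frame.co_T (F : Frame) : F.co F.T = 0 := by
  have hz : F.zc F.T = 0 := Complex.ext F.TN F.TB
  rw [Frame.co, hz, F.TA]; simp

theorem exists_frame_at {x : V4} (hx : InH x) : ∃ F : Frame, F.T = x := by
  set n := cross x ![0, 1, 0, 0] ![0, 0, 1, 0] with hn
  have h3 : mink n ![0, 0, 0, 1] = x 0 := by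
    rw [hn, mink_cross]
    simp [det4]
  have hn0 : n ≠ 0 := fun h => by
    rw [h, mink_zero_left] at h3
    exact hx.2.ne h3
  obtain ⟨F, -, -, hF, -⟩ := exists_frame hx hn0 (by rw [mink_comm]; exact mink_cross_1 _ _ _)
    ![0, 1, 0, 0] (by simp [mink]) (fun h => by simpa using congrFun h 1)
    (by rw [mink_comm]; exact mink_cross_2 _ _ _)
  exact ⟨F, hF⟩

/-- There are three kinds of charts: those at points of triangles, those at edges, and those at
interior points of one of the two copies of the octahedron. -/
theorem nonempty_qchart (q : Q) : Nonempty (QChart q) := by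
  by_cases hu : q.u = 0
  · by_cases hy : ∀ k, q.y k ≠ 0
    · obtain ⟨w, hθ, hq, hT, hW⟩ := exists_faceWedge hu hy
      refine ⟨w.chart 0 q, w.field, 2 * w.θ, det4 w.F.T w.F.A w.F.N w.F.B, hq, ?_, w.F.det4_sq,
        mul_pos two_pos w.pos, fun _ => by rw [hθ], fun p hp he => w.devAt 0 hp he,
        fun p hp he => absurd he (hW p hp)⟩
      rw [Wedge.chart_apply, Wedge.co, Wedge.wm, ← hT]
      have hz : w.F.zc w.F.T = 0 := Complex.ext w.F.TN w.F.TB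
      rw [w.F.co_T, hz, pw_zero]
      simp
    · push Not at hy
      have hE : q.IsEdge := ⟨hu, hy⟩
      obtain ⟨e, he⟩ := exists_onEdge hE
      refine ⟨e.wedge.chart (e.frame.co q.fold).1 q, e.wedge.field, 2 * e.theta, e.or, he.2.2, ?_,
        e.or_sq, mul_pos two_pos e.theta_pos, fun h => absurd hE h,
        fun p hp hne => e.wedge.devAt _ hp hne, fun p hp hpe => ?_⟩
      · have hz : e.frame.zc q.fold = 0 := by
          obtain ⟨z1, z2⟩ := e.zc_vx
          rw [e.expand he.2.2, Q.c0_fold, Q.yc_fold, he.1, he.2.1]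
          simp only [Frame.zc_add, Frame.zc_smul, z1, z2, abs_zero]
          simp [pp]
        rw [Wedge.chart_apply, Wedge.co, Wedge.wm]
        change ((e.frame.co q.fold).1 - (e.frame.co q.fold).1, if 0 ≤ q.u then
          pw (Real.pi / e.theta) (e.frame.zc q.fold) else
          -(starRingEnd ℂ) (pw (Real.pi / e.theta) (e.frame.zc q.fold))) = 0
        rw [hz, pw_zero]
        simp
      · refine ⟨e, -(e.frame.co q.fold).1, false, OnEdge.of_isEdge hp hpe, rfl, ?_,
          Eventually.of_forall fun a => ⟨?_, ?_⟩⟩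
        · simp [det_symL]
        · rw [Wedge.chart_apply, Wedge.co, sym, Wedge.co]
          simp only [Bool.false_eq_true, if_false, sub_zero]
          rfl
        · rw [symL_apply]; simp
  · obtain ⟨F, hF⟩ := exists_frame_at q.inH
    obtain ⟨ε, hε, hεq⟩ : ∃ ε : ℝ, (ε = 1 ∨ ε = -1) ∧ 0 < ε * q.u := by
      rcases lt_or_gt_of_ne hu with h | h
      · exact ⟨-1, Or.inr rfl, by linarith⟩
      · exact ⟨1, Or.inl rfl, by linarith⟩
    refine ⟨Q.chartInt F ε hε q, Q.fieldInt F ε, 2 * Real.pi, ε * det4 F.T F.A F.N F.B, hεq, ?_, ?_,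
      by positivity, fun _ => rfl, fun p hp _ => Q.devAtInt F hε hp, fun p hp he => ?_⟩
    · change F.co q.fold = 0
      rw [← hF, F.co_T]
    · rcases hε with rfl | rfl <;> rcases F.det4_sq with h | h <;> rw [h] <;> norm_num
    · have hp : 0 < ε * p.u := hp
      rw [he.1, mul_zero] at hp
      exact absurd hp (lt_irrefl _)

/-! ### The cone structure -/

theorem DevAt.congr {α o : ℝ} {φ ξ φ' ξ' : Q → ℝ × ℂ} {p : Q} (h : DevAt α φ ξ p o)
    (hc : ∀ᶠ a in 𝓝 p, φ' a = φ a ∧ ξ' a = ξ a) : DevAt α φ' ξ' p o := by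
  obtain ⟨Φ, J, h1, h2, h3⟩ := h
  refine ⟨Φ, J, by rwa [hc.self_of_nhds.1], h2, ?_⟩
  filter_upwards [hc, h3] with a ha h
  rwa [ha.1, ha.2]

theorem EdgeAt.congr {α o : ℝ} {φ ξ φ' ξ' : Q → ℝ × ℂ} {p : Q} (h : EdgeAt α φ ξ p o)
    (hc : ∀ᶠ a in 𝓝 p, φ' a = φ a ∧ ξ' a = ξ a) : EdgeAt α φ' ξ' p o := by
  obtain ⟨e, c, δ, h1, h2, h3, h4⟩ := h
  refine ⟨e, c, δ, h1, h2, h3, ?_⟩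
  filter_upwards [hc, h4] with a ha h
  rwa [ha.1, ha.2]

variable {n : ℕ}

/-- A sheet over a point of the cone-manifold. -/
def sheet (m : Mfd n) : Fin n := (pr_surj m).choose

/-- A point of the double over a point of the cone-manifold. -/
def rep (m : Mfd n) : Q := (pr_surj m).choose_spec.choose

theorem pr_rep (m : Mfd n) : pr (sheet m) (rep m) = m := (pr_surj m).choose_spec.choose_spec

/-- A local inverse of the projection of a sheet. -/
def lift (m : Mfd n) : OpenPartialHomeomorph Q (Mfd n) :=
  (isLocalHomeomorph_pr (sheet m) (rep m)).choose

theorem lift_mem (m : Mfd n) : rep m ∈ (lift m).source :=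
  (isLocalHomeomorph_pr (sheet m) (rep m)).choose_spec.1

theorem lift_coe (m : Mfd n) : ⇑(lift m) = pr (sheet m) :=
  (isLocalHomeomorph_pr (sheet m) (rep m)).choose_spec.2.symm

/-- The chart of the double from which the chart centred at `m` is obtained. -/
def qchart (m : Mfd n) : QChart (rep m) := (nonempty_qchart (rep m)).some

/-- The chart centred at `m`. -/
def chartM (m : Mfd n) : OpenPartialHomeomorph (Mfd n) (ℝ × ℂ) :=
  (lift m).symm.trans (qchart m).chart

/-- The flex, in the chart centred at `m`. -/
def fieldM (m a : Mfd n) : ℝ × ℂ := (qchart m).ξ ((lift m).symm a)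

theorem chartM_apply (m a : Mfd n) : chartM m a = (qchart m).chart ((lift m).symm a) := rfl

theorem lift_symm_self (m : Mfd n) : (lift m).symm m = rep m := by
  have := (lift m).left_inv (lift_mem m)
  rwa [lift_coe, pr_rep] at this

theorem mem_chartM (m : Mfd n) : m ∈ (chartM m).source := by
  rw [chartM, OpenPartialHomeomorph.trans_source]
  refine ⟨?_, ?_⟩
  · have := (lift m).map_source (lift_mem m)
    rw [lift_coe, pr_rep] at this
    exact this
  · rw [Set.mem_preimage, lift_symm_self]
    exact (qchart m).mem

theorem chartM_self (m : Mfd n) : chartM m m = 0 := by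
  rw [chartM_apply, lift_symm_self, (qchart m).center]

/-- Over the domain of a chart, two sheets are related by the identity or by a gluing map. -/
theorem exists_link {m : Mfd n} {j : Fin n} {q : Q} (h : pr j q ∈ (chartM m).source) :
    (lift m).symm (pr j q) ∈ (qchart m).chart.source ∧
    ((sheet m = j ∧ (lift m).symm (pr j q) = q ∧ ∀ᶠ a in 𝓝 q, (lift m).symm (pr j a) = a) ∨
      ∃ b k, sheet m = j.rev ∧ Q.GlueBy b k q ((lift m).symm (pr j q)) ∧
        ∀ᶠ a in 𝓝 q, (lift m).symm (pr j a) = Q.glue b k a) := by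
  rw [chartM, OpenPartialHomeomorph.trans_source] at h
  obtain ⟨h1, h2⟩ := h
  have h1 : pr j q ∈ (lift m).target := h1
  have h2 : (lift m).symm (pr j q) ∈ (qchart m).chart.source := h2
  refine ⟨h2, ?_⟩
  have h3 := (lift m).right_inv h1
  have h4 := (lift m).map_target h1
  rw [lift_coe] at h3
  have hl : ∀ a ∈ (lift m).source, (lift m).symm (pr (sheet m) a) = a := fun a ha => by
    have := (lift m).left_inv ha
    rwa [lift_coe] at this
  rcases pr_eq_iff.mp h3.symm with ⟨rfl, h5⟩ | ⟨b, k, h5, h6⟩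
  · left
    refine ⟨rfl, h5.symm, ?_⟩
    rw [← h5] at h4
    filter_upwards [(lift m).open_source.mem_nhds h4] with a ha
    exact hl a ha
  · right
    refine ⟨b, k, h5, h6, ?_⟩
    filter_upwards [Q.eventually_glueBy h6,
      Q.tendsto_glue h6 ((lift m).open_source.mem_nhds h4)] with a ha hs
    have h7 : pr j a = pr (sheet m) (Q.glue b k a) := pr_eq_iff.mpr (Or.inr ⟨b, k, h5, ha⟩)
    rw [h7]
    exact hl _ hs

theorem continuousAt_qchart {m : Mfd n} {q : Q} (h : q ∈ (qchart m).chart.source) :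
    ContinuousAt (qchart m).chart q := (qchart m).chart.continuousAt h

/-- The sign by which a chart relates the orientation of the model and that of a sheet. -/
def IsSign (m : Mfd n) (j : Fin n) (ρ : ℝ) : Prop :=
  (sheet m = j ∧ ρ = (qchart m).o) ∨ (sheet m = j.rev ∧ ρ = -(qchart m).o)

theorem exists_devAt {m : Mfd n} {j : Fin n} {q : Q} (h : pr j q ∈ (chartM m).source)
    (hq : ¬ q.IsEdge) : ∃ ρ, IsSign m j ρ ∧
      DevAt (qchart m).α (chartM m ∘ pr j) (fieldM m ∘ pr j) q ρ := by
  obtain ⟨h1, ⟨h2, h3, h4⟩ | ⟨b, k, h2, h3, h4⟩⟩ := exists_link h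
  · refine ⟨_, Or.inl ⟨h2, rfl⟩, ?_⟩
    rw [h3] at h1
    refine ((qchart m).dev q h1 hq).congr (h4.mono fun a ha => ?_)
    simp only [Function.comp_apply, chartM_apply, fieldM, ha, and_self]
  · refine ⟨_, Or.inr ⟨h2, rfl⟩, ?_⟩
    refine (((qchart m).dev _ h1 fun he => hq (h3.symm.isEdge he)).glue h3 hq
      (continuousAt_qchart h1)).congr (h4.mono fun a ha => ?_)
    simp only [Function.comp_apply, chartM_apply, fieldM, ha, and_self]

theorem exists_edgeAt {m : Mfd n} {j : Fin n} {q : Q} (h : pr j q ∈ (chartM m).source)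
    (hq : q.IsEdge) : ∃ ρ, IsSign m j ρ ∧
      EdgeAt (qchart m).α (chartM m ∘ pr j) (fieldM m ∘ pr j) q ρ := by
  obtain ⟨h1, ⟨h2, h3, h4⟩ | ⟨b, k, h2, h3, h4⟩⟩ := exists_link h
  · refine ⟨_, Or.inl ⟨h2, rfl⟩, ?_⟩
    rw [h3] at h1
    refine ((qchart m).edge q h1 hq).congr (h4.mono fun a ha => ?_)
    simp only [Function.comp_apply, chartM_apply, fieldM, ha, and_self]
  · refine ⟨_, Or.inr ⟨h2, rfl⟩, ?_⟩
    refine (((qchart m).edge _ h1 (h3.isEdge hq)).glue h3).congr (h4.mono fun a ha => ?_)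
    simp only [Function.comp_apply, chartM_apply, fieldM, ha, and_self]

theorem map_nhds_pr (j : Fin n) (q : Q) : map (pr j) (𝓝 q) = 𝓝 (pr j q) :=
  (isLocalHomeomorph_pr j).map_nhds_eq q

theorem eventually_pr {j : Fin n} {q : Q} {P : Mfd n → Prop} :
    (∀ᶠ a in 𝓝 (pr j q), P a) ↔ ∀ᶠ a in 𝓝 q, P (pr j a) := by
  rw [← map_nhds_pr, eventually_map]

theorem eventually_pr_prod {j : Fin n} {q : Q} {P : Mfd n × Mfd n → Prop} :
    (∀ᶠ ab in 𝓝 (pr j q, pr j q), P ab) ↔ ∀ᶠ ab in 𝓝 (q, q), P (pr j ab.1, pr j ab.2) := by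
  rw [nhds_prod_eq, ← map_nhds_pr, Filter.prod_map_map_eq, eventually_map, nhds_prod_eq]

/-- Near a point that is not on an edge, the distances are those of the developed points. -/
theorem DevAt.coneCosh_eq {α o : ℝ} {φ ξ : Q → ℝ × ℂ} {p : Q} (h : DevAt α φ ξ p o)
    (hφ : ContinuousAt φ p) : ∀ᶠ ab in 𝓝 (p, p),
      coneCosh α (φ ab.1) (φ ab.2) = -mink (p.dev ab.1) (p.dev ab.2) := by
  obtain ⟨Φ, J, ⟨Ψ, O, hO, hx, -, h2⟩, -, he⟩ := h
  have h1 : ∀ᶠ a in 𝓝 p, φ a ∈ O ∧ Φ (φ a) = p.dev a :=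
    (hφ.eventually (hO.mem_nhds hx)).and (he.mono fun a ha => ha.1)
  rw [nhds_prod_eq]
  filter_upwards [h1.prod_mk h1] with ab hab
  rw [← hab.1.2, ← hab.2.2]
  exact h2 _ hab.1.1 _ hab.2.1

theorem continuousAt_chartM {m : Mfd n} {j : Fin n} {q : Q} (h : pr j q ∈ (chartM m).source) :
    ContinuousAt (chartM m ∘ pr j) q :=
  ((chartM m).continuousAt h).comp (continuous_pr j).continuousAt

theorem eventually_both {p : Q} {P : Q → Prop} (h : ∀ᶠ a in 𝓝 p, P a) :
    ∀ᶠ ab in 𝓝 (p, p), P ab.1 ∧ P ab.2 := by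
  rw [nhds_prod_eq]; exact h.prod_mk h

/-- The cone structure of the cone-manifold. Two charts are related by an isometry of the model
space at points of edges, and off the edges the distances in both charts are those in `ℍ³` of the
developed points, which do not depend on the chart. -/
def coneStr (n : ℕ) : HypConeStructure (Mfd n) where
  angle m := (qchart m).α
  angle_pos m := (qchart m).α_pos
  chart := chartM
  mem_source := mem_chartM
  chart_self := chartM_self
  isometric x y p hx hy := by
    obtain ⟨j, q, rfl⟩ := pr_surj p
    rw [eventually_pr_prod]
    by_cases hq : q.IsEdge
    · obtain ⟨-, -, e, c, δ, h1, h2, -, h3⟩ := exists_edgeAt hx hq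
      obtain ⟨-, -, e', c', δ', h1', h2', -, h3'⟩ := exists_edgeAt hy hq
      obtain rfl := h1.unique h1'
      filter_upwards [eventually_both h3, eventually_both h3'] with ab hab hab'
      simp only [Function.comp_apply] at hab hab'
      rw [h2, h2', hab.1.1, hab.2.1, hab'.1.1, hab'.2.1, coneCosh_sym, coneCosh_sym]
    · obtain ⟨_, -, h⟩ := exists_devAt hx hq
      obtain ⟨_, -, h'⟩ := exists_devAt hy hq
      filter_upwards [h.coneCosh_eq (continuousAt_chartM hx),
        h'.coneCosh_eq (continuousAt_chartM hy)] with ab hab hab'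
      exact hab.trans hab'.symm

theorem angle_pr_of_not_isEdge {j : Fin n} {q : Q} (hq : ¬ q.IsEdge) :
    (coneStr n).angle (pr j q) = 2 * Real.pi := by
  refine (qchart (pr j q)).α_eq fun he => hq ?_
  obtain ⟨-, ⟨-, h3, -⟩ | ⟨b, k, -, h3, -⟩⟩ := exists_link (mem_chartM (pr j q))
  · rw [lift_symm_self] at h3
    rwa [h3] at he
  · rw [lift_symm_self] at h3
    exact h3.symm.isEdge he

theorem angle_pr {j : Fin n} {q : Q} {e : Edge} (he : OnEdge e q) :
    (coneStr n).angle (pr j q) = 2 * e.theta := by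
  obtain ⟨-, -, e', c, δ, h1, h2, -⟩ := exists_edgeAt (mem_chartM (pr j q)) he.isEdge
  rw [he.unique h1]
  exact h2

/-! ### Paths in the double -/

theorem Th_smul {t : ℝ} (ht : 0 ≤ t) (p : ℝ × (Fin 3 → ℝ)) : Th (t • p) = t • Th p := by
  have hpp : ∀ b s, pp b (t * s) = t * pp b s := fun b s => by
    rw [pp, pp, mul_max_of_nonneg _ _ ht, mul_zero, mul_left_comm]
  rw [Th_eq, Th_eq, smul_add, Finset.smul_sum]
  simp only [Prod.smul_fst, Prod.smul_snd, Pi.smul_apply, smul_eq_mul, hpp, smul_add, smul_smul]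

theorem pp_comb (b : Bool) {x y s t : ℝ} (hs : 0 ≤ s) (ht : 0 ≤ t) (h : 0 ≤ x * y) :
    pp b (s * x + t * y) = s * pp b x + t * pp b y := by
  have key : ∀ x y : ℝ, 0 ≤ x → 0 ≤ y →
      pp b (s * x + t * y) = s * pp b x + t * pp b y ∧
      pp b (s * -x + t * -y) = s * pp b (-x) + t * pp b (-y) := by
    intro x y hx hy
    have h1 := mul_nonneg hs hx
    have h2 := mul_nonneg ht hy
    cases b <;> simp only [pp, sg, Bool.false_eq_true, if_false, if_true, one_mul, neg_mul,
      neg_neg, mul_neg]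
    · rw [max_eq_left (by linarith), max_eq_left hx, max_eq_left hy, max_eq_right (by linarith),
        max_eq_right (by linarith), max_eq_right (by linarith)]
      simp
    · rw [max_eq_right (by linarith), max_eq_right (by linarith), max_eq_right (by linarith),
        max_eq_left (by linarith), max_eq_left hx, max_eq_left hy]
      constructor <;> ring
  rcases mul_nonneg_iff.mp h with ⟨hx, hy⟩ | ⟨hx, hy⟩
  · exact (key x y hx hy).1
  · have := (key (-x) (-y) (by linarith) (by linarith)).2
    rwa [neg_neg, neg_neg] at this

namespace Q

/-- The centre of a copy of the octahedron. -/
def center (ε : ℝ) (hε : ε = 1 ∨ ε = -1) : Q :=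
  ⟨(ε, 0), by
    have h1 : |ε| = 1 := by rcases hε with rfl | rfl <;> simp
    have h2 : Th (|ε|, 0) = e0 := by rw [Th_eq, h1]; simp [pp]
    rw [Qset, Set.mem_ofPred_eq, h2]
    refine ⟨⟨mink_e0_e0, one_pos⟩, fun b k => ?_⟩
    rw [mink_e0, vx_zero]
    norm_num⟩

theorem center_fold {ε : ℝ} (hε : ε = 1 ∨ ε = -1) : (center ε hε).fold = e0 := by
  have h1 : |ε| = 1 := by rcases hε with rfl | rfl <;> simp
  change Th (|ε|, 0) = e0
  rw [Th_eq, h1]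
  simp [pp]

/-- The points `q` and `r` lie in one simplicial cone over a triangle of the octahedron, and `r` is
not cut off by the truncation. -/
structure Visible (q r : Q) : Prop where
  u : 0 ≤ q.u * r.u
  y : ∀ k, 0 ≤ q.y k * r.y k
  core : ∀ b k, mink r.fold (vx b k) ≤ 0

theorem visible_center {q : Q} {ε : ℝ} (hε : ε = 1 ∨ ε = -1) (hq : 0 ≤ ε * q.u) :
    Visible q (center ε hε) where
  u := by rwa [mul_comm]
  y k := (mul_zero _).ge
  core b k := by rw [center_fold, mink_e0, vx_zero]; norm_num

/-- A segment in Minkowski space. -/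
def seg (q r : Q) (t : ℝ) : V4 := (1 - t) • q.fold + t • r.fold

/-- The coordinates of a segment in Minkowski space. -/
def segCo (q r : Q) (t : ℝ) : ℝ × (Fin 3 → ℝ) := (1 - t) • q.1 + t • r.1

theorem Visible.seg_eq {q r : Q} (h : Visible q r) {t : ℝ} (ht : 0 ≤ t) (ht1 : t ≤ 1) :
    Th (|(q.segCo r t).1|, (q.segCo r t).2) = q.seg r t := by
  have h1 : 0 ≤ 1 - t := by linarith
  have h2 : |(q.segCo r t).1| = (1 - t) * |q.u| + t * |r.u| := by
    rw [← pp_add_pp, ← pp_add_pp, ← pp_add_pp]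
    change pp false ((1 - t) * q.u + t * r.u) + pp true ((1 - t) * q.u + t * r.u) = _
    rw [pp_comb _ h1 ht h.u, pp_comb _ h1 ht h.u]
    ring
  have h3 : ∀ b k, pp b ((q.segCo r t).2 k) = (1 - t) * pp b (q.y k) + t * pp b (r.y k) :=
    fun b k => pp_comb b h1 ht (h.y k)
  rw [Th_eq, seg, fold, fold, Th_eq, Th_eq, Fin.sum_univ_three, Fin.sum_univ_three,
    Fin.sum_univ_three]
  simp only [h2, h3]
  module

theorem seg_norm (q r : Q) {t : ℝ} (ht : 0 ≤ t) (ht1 : t ≤ 1) :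
    1 ≤ -mink (q.seg r t) (q.seg r t) := by
  have h1 := q.inH.1
  have h2 := q.inH.mink_le r.inH
  have h3 := r.inH.1
  simp only [seg, mink_add_left, mink_add_right, mink_smul_left, mink_smul_right, h1, h3,
    mink_comm r.fold q.fold]
  nlinarith [mul_nonneg ht (sub_nonneg.mpr ht1)]

/-- The factor by which a point of a segment is normalized. -/
def segNorm (q r : Q) (t : ℝ) : ℝ := 1 / √(-mink (q.seg r t) (q.seg r t))

theorem segNorm_pos (q r : Q) {t : ℝ} (ht : 0 ≤ t) (ht1 : t ≤ 1) : 0 < q.segNorm r t := by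
  have := seg_norm q r ht ht1
  exact one_div_pos.mpr (Real.sqrt_pos.mpr (by linarith))

/-- A geodesic path in a simplicial cone over a triangle. -/
def Visible.path {q r : Q} (h : Visible q r) (t : unitInterval) : Q :=
  ⟨q.segNorm r t • q.segCo r t, by
    obtain ⟨t, ht, ht1⟩ := t
    have h1 := q.seg_norm r ht ht1
    have h2 := q.segNorm_pos r ht ht1
    have h3 : q.segNorm r t ≤ 1 := by
      rw [segNorm, div_le_one (Real.sqrt_pos.mpr (by linarith))]
      exact Real.one_le_sqrt.mpr h1
    have h4 : Th (|(q.segNorm r t • q.segCo r t).1|, (q.segNorm r t • q.segCo r t).2)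
        = q.segNorm r t • q.seg r t := by
      rw [← h.seg_eq ht ht1, ← Th_smul h2.le]
      congr 1
      refine Prod.ext ?_ rfl
      change |q.segNorm r t * _| = q.segNorm r t * |_|
      rw [abs_mul, abs_of_pos h2]
    rw [Qset, Set.mem_ofPred_eq, h4]
    refine ⟨⟨?_, ?_⟩, fun b k => ?_⟩
    · rw [mink_smul_left, mink_smul_right, segNorm]
      have h5 := Real.mul_self_sqrt (by linarith : 0 ≤ -mink (q.seg r t) (q.seg r t))
      have h6 := Real.sqrt_pos.mpr (by linarith : 0 < -mink (q.seg r t) (q.seg r t))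
      field_simp
      linarith
    · have h7 : q.seg r t 0 = (1 - t) * q.fold 0 + t * r.fold 0 := by simp [seg]
      rw [Pi.smul_apply, smul_eq_mul, h7]
      have := q.inH.one_le
      have := r.inH.one_le
      have : 0 < (1 - t) * q.fold 0 + t * r.fold 0 := by nlinarith
      positivity
    · rw [mink_smul_left, seg, mink_add_left, mink_smul_left, mink_smul_left]
      have := q.lt b k
      have h5 : (1 - t) * mink q.fold (vx b k) + t * mink r.fold (vx b k) < 1 / 100 := by
        have h6 := mul_nonneg ht (neg_nonneg.mpr (h.core b k))
        have h7 := mul_nonneg (sub_nonneg.mpr ht1) (sub_nonneg.mpr this.le)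
        rcases ht.eq_or_lt with rfl | h
        · linarith
        · linarith
      nlinarith⟩

namespace Visible

variable {q r : Q} (h : Visible q r)

theorem path_u (t : unitInterval) : (h.path t).u = q.segNorm r t * ((1 - t) * q.u + t * r.u) := rfl

theorem path_y (t : unitInterval) (k : Fin 3) :
    (h.path t).y k = q.segNorm r t * ((1 - t) * q.y k + t * r.y k) := rfl

theorem continuous_path : Continuous h.path := by
  refine Continuous.subtype_mk ?_ _
  have h : Continuous fun t : unitInterval => q.segNorm r t := by
    unfold segNorm
    refine continuous_const.div (by unfold seg; fun_prop) fun t => ?_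
    have := q.seg_norm r t.2.1 t.2.2
    exact (Real.sqrt_pos.mpr (by linarith)).ne'
  unfold segCo
  fun_prop

theorem path_zero : h.path 0 = q := by
  refine Subtype.ext ?_
  change q.segNorm r 0 • ((1 - (0 : ℝ)) • q.1 + (0 : ℝ) • r.1) = q.1
  have h : q.segNorm r 0 = 1 := by
    rw [segNorm, seg, zero_smul, add_zero, sub_zero, one_smul, q.inH.1]; simp
  rw [h]
  simp

theorem path_one : h.path 1 = r := by
  refine Subtype.ext ?_
  change q.segNorm r 1 • ((1 - (1 : ℝ)) • q.1 + (1 : ℝ) • r.1) = r.1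
  have h : q.segNorm r 1 = 1 := by
    rw [segNorm, seg, one_smul, sub_self, zero_smul, zero_add, r.inH.1]; simp
  rw [h]
  simp

theorem path_pos {l : ℝ × (Fin 3 → ℝ) →ₗ[ℝ] ℝ} {t : unitInterval} (hq : 0 ≤ l q.1)
    (hr : 0 < l r.1) (ht : 0 < l q.1 ∨ 0 < (t : ℝ)) : 0 < l (h.path t).1 := by
  change 0 < l (q.segNorm r t • ((1 - (t : ℝ)) • q.1 + (t : ℝ) • r.1))
  rw [map_smul, map_add, map_smul, map_smul]
  simp only [smul_eq_mul]
  refine mul_pos (q.segNorm_pos r t.2.1 t.2.2) ?_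
  have h4 := t.2.1
  have h5 : 0 ≤ 1 - (t : ℝ) := sub_nonneg.mpr t.2.2
  rcases h4.eq_or_lt with h6 | h6
  · rw [← h6] at ht ⊢
    simpa using ht
  · have := mul_pos h6 hr
    have := mul_nonneg h5 hq
    linarith

end Visible

/-- A set of points of the double is connected if it is star-shaped. -/
theorem isPreconnected_of_visible {s : Set Q} (r : Q)
    (h : ∀ q ∈ s, ∃ hv : Visible q r, ∀ t, hv.path t ∈ s) : IsPreconnected s := by
  refine isPreconnected_of_forall r fun q hq => ?_
  obtain ⟨hv, ht⟩ := h q hq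
  exact ⟨Set.range hv.path, Set.range_subset_iff.mpr ht, ⟨1, hv.path_one⟩, ⟨0, hv.path_zero⟩,
    isPreconnected_range hv.continuous_path⟩

/-- The points of a triangle are limits of interior points of both copies. -/
theorem mem_closure_sign (q : Q) {ε : ℝ} (hε : ε = 1 ∨ ε = -1) (hq : 0 ≤ ε * q.u) :
    q ∈ closure {a : Q | 0 < ε * a.u} := by
  set hv := visible_center hε hq
  have h1 : Tendsto hv.path (𝓝 0) (𝓝 q) := by
    have := hv.continuous_path.tendsto 0
    rwa [hv.path_zero] at this
  have hm : ∀ m : ℕ, 1 / ((m : ℝ) + 1) ∈ unitInterval := fun m =>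
    ⟨by positivity, by rw [div_le_one (by positivity)]; linarith [Nat.cast_nonneg (α := ℝ) m]⟩
  have h2 : Tendsto (fun m : ℕ => (⟨1 / ((m : ℝ) + 1), hm m⟩ : unitInterval)) atTop (𝓝 0) := by
    rw [tendsto_subtype_rng]
    exact tendsto_one_div_add_atTop_nhds_zero_nat
  have h3 : 0 < (ε • LinearMap.fst ℝ ℝ (Fin 3 → ℝ)) (center ε hε).1 := by
    change 0 < ε * ε
    rcases hε with rfl | rfl <;> norm_num
  exact mem_closure_of_tendsto (h1.comp h2) (Eventually.of_forall fun m =>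
    hv.path_pos (l := ε • LinearMap.fst ℝ ℝ (Fin 3 → ℝ)) hq h3 (Or.inr (by
      change (0 : ℝ) < 1 / ((m : ℝ) + 1); positivity)))

theorem isPreconnected_sign {ε : ℝ} (hε : ε = 1 ∨ ε = -1) :
    IsPreconnected {a : Q | 0 < ε * a.u} := by
  have h3 : 0 < (ε • LinearMap.fst ℝ ℝ (Fin 3 → ℝ)) (center ε hε).1 := by
    change 0 < ε * ε
    rcases hε with rfl | rfl <;> norm_num
  refine isPreconnected_of_visible (center ε hε) fun q hq => ?_
  have hq : 0 < ε * q.u := hq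
  exact ⟨visible_center hε hq.le, fun t => (visible_center hε hq.le).path_pos
    (l := ε • LinearMap.fst ℝ ℝ (Fin 3 → ℝ)) hq.le h3 (Or.inl hq)⟩

end Q

/-! ### Orientability -/

/-- The derivative of a change of charts, and its orientation, from developing maps of the two
charts that agree near a point. -/
theorem devAt_change {x y : Mfd n} {j : Fin n} {q : Q} {Φ Φ' : ℝ × ℂ → V4} {o o' : ℝ}
    (hx : pr j q ∈ (chartM x).source) (hy : pr j q ∈ (chartM y).source)
    (h : LocDev (qchart x).α Φ (chartM x (pr j q)) o)
    (h' : LocDev (qchart y).α Φ' (chartM y (pr j q)) o')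
    (hc : ∀ᶠ a in 𝓝 q, Φ' (chartM y (pr j a)) = Φ (chartM x (pr j a))) :
    DifferentiableAt ℝ ((coneStr n).change x y) (chartM x (pr j q)) ∧
    (fderiv ℝ Φ' (chartM y (pr j q))).comp
      (fderiv ℝ ((coneStr n).change x y) (chartM x (pr j q))) = fderiv ℝ Φ (chartM x (pr j q)) ∧
    0 < o * o' * (fderiv ℝ ((coneStr n).change x y) (chartM x (pr j q))).det := by
  have hself : (coneStr n).change x y (chartM x (pr j q)) = chartM y (pr j q) := by
    change chartM y ((chartM x).symm (chartM x (pr j q))) = _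
    rw [(chartM x).left_inv hx]
  rw [← hself] at h'
  have := h.change (f := (coneStr n).change x y) h' ?_ ?_
  · rwa [hself] at this
  · refine ContinuousAt.comp (f := (chartM x).symm) ?_
      ((chartM x).continuousAt_symm ((chartM x).map_source hx))
    rw [(chartM x).left_inv hx]
    exact (chartM y).continuousAt hy
  · rw [← (chartM x).map_nhds_eq hx, eventually_map, eventually_pr]
    filter_upwards [hc, (continuous_pr j).continuousAt.eventually
      ((chartM x).open_source.mem_nhds hx)] with a ha hs
    rw [← ha]
    change Φ' (chartM y ((chartM x).symm (chartM x (pr j a)))) = _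
    rw [(chartM x).left_inv hs]

theorem DevAt.orient_change {x y : Mfd n} {j : Fin n} {q : Q} {ξ ξ' : Q → ℝ × ℂ} {o o' : ℝ}
    (hx : pr j q ∈ (chartM x).source) (hy : pr j q ∈ (chartM y).source)
    (h : DevAt (qchart x).α (chartM x ∘ pr j) ξ q o)
    (h' : DevAt (qchart y).α (chartM y ∘ pr j) ξ' q o') :
    0 < o * o' * (fderiv ℝ ((coneStr n).change x y) (chartM x (pr j q))).det := by
  obtain ⟨Φ, J, h1, -, h2⟩ := h
  obtain ⟨Φ', J', h1', -, h2'⟩ := h'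
  have := (devAt_change hx hy h1 h1' (by
    filter_upwards [h2, h2'] with a ha ha'
    exact ha'.1.trans ha.1.symm)).2.2
  have hw : q.wt * q.wt = 1 := by
    rw [Q.wt]; split_ifs <;> norm_num
  calc (0 : ℝ) < _ := this
    _ = _ := by linear_combination (o * o' *
      (fderiv ℝ ((coneStr n).change x y) (chartM x (pr j q))).det) * hw

/-- At an edge, a change of charts is an isometry of the model space. -/
theorem EdgeAt.orient_change {x y : Mfd n} {j : Fin n} {q : Q} {ξ ξ' : Q → ℝ × ℂ} {α α' o o' : ℝ}
    (hx : pr j q ∈ (chartM x).source)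
    (h : EdgeAt α (chartM x ∘ pr j) ξ q o) (h' : EdgeAt α' (chartM y ∘ pr j) ξ' q o') :
    0 < o * o' * (fderiv ℝ ((coneStr n).change x y) (chartM x (pr j q))).det := by
  obtain ⟨e, c, δ, h1, -, ho, h2⟩ := h
  obtain ⟨e', c', δ', h1', -, ho', h2'⟩ := h'
  obtain rfl := h1.unique h1'
  have hev : (coneStr n).change x y =ᶠ[𝓝 (chartM x (pr j q))] sym (c' - c) (δ' ^^ δ) := by
    rw [EventuallyEq, ← (chartM x).map_nhds_eq hx, eventually_map, eventually_pr]
    filter_upwards [h2, h2', (continuous_pr j).continuousAt.eventually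
      ((chartM x).open_source.mem_nhds hx)] with a ha ha' hs
    change chartM y ((chartM x).symm (chartM x (pr j a))) = _
    rw [(chartM x).left_inv hs]
    simp only [Function.comp_apply] at ha ha'
    rw [ha.1, ha'.1, sym_sym]
    cases δ <;> cases δ' <;> simp
  rw [hev.fderiv_eq, (hasFDerivAt_sym _ _ _).fderiv, ho, ho', det_symL, det_symL, det_symL]
  rcases e.or_sq with h | h <;> rw [h] <;> cases δ <;> cases δ' <;> norm_num

/-- The orientation of a change of charts, in terms of the signs of the charts relative to a sheet.
-/
theorem orient_change {x y : Mfd n} {j : Fin n} {q : Q} (hx : pr j q ∈ (chartM x).source)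
    (hy : pr j q ∈ (chartM y).source) : ∃ ρ ρ', IsSign x j ρ ∧ IsSign y j ρ' ∧
      0 < ρ * ρ' * (fderiv ℝ ((coneStr n).change x y) (chartM x (pr j q))).det := by
  by_cases hq : q.IsEdge
  · obtain ⟨ρ, h1, h2⟩ := exists_edgeAt hx hq
    obtain ⟨ρ', h1', h2'⟩ := exists_edgeAt hy hq
    exact ⟨ρ, ρ', h1, h1', h2.orient_change hx h2'⟩
  · obtain ⟨ρ, h1, h2⟩ := exists_devAt hx hq
    obtain ⟨ρ', h1', h2'⟩ := exists_devAt hy hq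
    exact ⟨ρ, ρ', h1, h1', h2.orient_change hx hy h2'⟩

/-- Every gluing map exchanges the two sheets and reverses the orientation of the double, so that
opposite orientations of the two sheets fit together. -/
theorem orientable_two : (coneStr 2).Orientable := by
  let s : Fin 2 → ℝ := fun i => if i = 0 then 1 else -1
  have hs : ∀ i, s i * s i = 1 := fun i => by simp only [s]; split_ifs <;> norm_num
  have hr : ∀ i, s i.rev = -s i := fun i => by fin_cases i <;> simp [s]
  have key : ∀ (x : Mfd 2) (j : Fin 2) (ρ : ℝ), IsSign x j ρ →
      s (sheet x) * (qchart x).o = s j * ρ := by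
    rintro x j ρ (⟨h, rfl⟩ | ⟨h, rfl⟩)
    · rw [h]
    · rw [h, hr]; ring
  refine ⟨fun x => s (sheet x) * (qchart x).o, fun x => ?_, fun x => ?_⟩
  · rcases (qchart x).o_sq with h | h <;> simp only [h, s] <;> split_ifs <;> norm_num
  · filter_upwards [(chartM x).open_source.mem_nhds (mem_chartM x)] with y hy
    obtain ⟨j, q, rfl⟩ := pr_surj y
    obtain ⟨ρ, ρ', h1, h2, h3⟩ := orient_change hy (mem_chartM _)
    rw [key x j ρ h1, key _ j ρ' h2]
    change 0 < s j * ρ * (s j * ρ') *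
      (fderiv ℝ ((coneStr 2).change x (pr j q)) (chartM x (pr j q))).det
    calc (0 : ℝ) < _ := h3
      _ = _ := by linear_combination (-(ρ * ρ' *
        (fderiv ℝ ((coneStr 2).change x (pr j q)) (chartM x (pr j q))).det)) * hs j

/-- In the interior of a copy of the octahedron, the developing map of a point also serves its
neighbours. -/
theorem DevAt.eventually {α o : ℝ} {φ ξ : Q → ℝ × ℂ} {p : Q} (h : DevAt α φ ξ p o) (hp : p.u ≠ 0)
    (hφ : ContinuousAt φ p) : ∀ᶠ q in 𝓝 p, q.u ≠ 0 ∧ DevAt α φ ξ q o := by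
  obtain ⟨Φ, J, h1, h2, h3⟩ := h
  have hs : ∀ᶠ q : Q in 𝓝 p, Real.sign q.u = Real.sign p.u ∧ q.wt = p.wt ∧ q.u ≠ 0 := by
    rcases lt_or_gt_of_ne hp with h | h
    · filter_upwards [(isOpen_lt Q.continuous_u continuous_const).mem_nhds h] with q hq
      have hq : q.u < 0 := hq
      rw [Real.sign_of_neg hq, Real.sign_of_neg h, Q.wt_of_neg hq, Q.wt_of_neg h]
      exact ⟨rfl, rfl, hq.ne⟩
    · filter_upwards [(isOpen_lt continuous_const Q.continuous_u).mem_nhds h] with q hq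
      have hq : 0 < q.u := hq
      rw [Real.sign_of_pos hq, Real.sign_of_pos h, Q.wt_of_nonneg hq.le, Q.wt_of_nonneg h.le]
      exact ⟨rfl, rfl, hq.ne'⟩
  filter_upwards [hs, h3.eventually_nhds, hφ.eventually h1.eventually] with q hq h3q h1q
  refine ⟨hq.2.2, Φ, J, by rwa [hq.2.1], h2, ?_⟩
  filter_upwards [h3q] with a ha
  rw [Q.dev_of_ne hp] at ha
  rw [Q.dev_of_ne hq.2.2, Q.vel, hq.1]
  exact ha

/-- The orientation of a chart is well defined. -/
theorem DevAt.sign_unique {α α' o o' : ℝ} {φ ξ ξ' : Q → ℝ × ℂ} {p : Q} (h : DevAt α φ ξ p o)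
    (h' : DevAt α' φ ξ' p o') (hφ : map φ (𝓝 p) = 𝓝 (φ p)) : 0 < o * o' := by
  obtain ⟨Φ, J, h1, -, h2⟩ := h
  obtain ⟨Φ', J', h1', -, h2'⟩ := h'
  have := (h1.change (f := id) h1' continuousAt_id (by
    rw [← hφ, eventually_map]
    filter_upwards [h2, h2'] with a ha ha'
    exact ha'.1.trans ha.1.symm)).2.2
  have hw : p.wt * p.wt = 1 := by
    rw [Q.wt]; split_ifs <;> norm_num
  rw [fderiv_id] at this
  have hd : (ContinuousLinearMap.id ℝ (ℝ × ℂ)).det = 1 := LinearMap.det_id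
  rw [hd] at this
  calc (0 : ℝ) < _ := this
    _ = _ := by linear_combination (o * o') * hw

/-- A timelike ray that is not cut off by the truncation contains a point of the double. -/
theorem Q.exists_ray {p : ℝ × (Fin 3 → ℝ)} {x : V4} (hx : Th (|p.1|, p.2) = x) (h0 : 0 < x 0)
    (hneg : mink x x < 0) (hcore : ∀ b k, mink x (vx b k) ≤ 0) :
    ∃ (q : Q) (t : ℝ), 0 < t ∧ q.u = t * p.1 ∧ (∀ k, q.y k = t * p.2 k) ∧ q.fold = t • x := by
  set t := 1 / √(-mink x x) with ht
  have hs : 0 < √(-mink x x) := Real.sqrt_pos.mpr (by linarith)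
  have ht0 : 0 < t := one_div_pos.mpr hs
  have hTh : Th (|(t • p).1|, (t • p).2) = t • x := by
    rw [← hx, ← Th_smul ht0.le]
    congr 1
    refine Prod.ext ?_ rfl
    change |t * p.1| = t * |p.1|
    rw [abs_mul, abs_of_pos ht0]
  refine ⟨⟨t • p, ?_⟩, t, ht0, rfl, fun _ => rfl, hTh⟩
  rw [Qset, Set.mem_ofPred_eq, hTh]
  refine ⟨⟨?_, mul_pos ht0 h0⟩, fun b k => ?_⟩
  · rw [mink_smul_left, mink_smul_right, ht]
    have := Real.mul_self_sqrt (by linarith : 0 ≤ -mink x x)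
    field_simp
    linarith
  · rw [mink_smul_left]
    have := mul_nonneg ht0.le (neg_nonneg.mpr (hcore b k))
    linarith

theorem exists_glueBy : ∃ p q : Q, Q.GlueBy false 0 p q ∧ 0 < p.u := by
  -- the ray from the centre to the vertex meets the polar plane here, since `mink (vx b k) (vx b
  -- k)` is `1 / 4`
  set x : V4 := e0 + (4 : ℝ) • vx false 0 with hx
  have hTh : Th (|(1 : ℝ)|, fun k : Fin 3 => if k = 0 then (4 : ℝ) else 0) = x := by
    rw [hx, Th_eq, Fin.sum_univ_three]
    simp [pp, sg]
  have hv : ∀ b k, mink x (vx b k) = -1 + 4 * mink (vx false 0) (vx b k) := by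
    intro b k
    rw [hx, mink_add_left, mink_smul_left, mink_e0, vx_zero]
  have hv0 : mink x (vx false 0) = 0 := by rw [hv, mink_vx_self]; ring
  have h00 : e0 0 = 1 := rfl
  have h0 : x 0 = 5 := by
    rw [hx, Pi.add_apply, Pi.smul_apply, vx_zero, h00, smul_eq_mul]; norm_num
  obtain ⟨q, t, ht, hu, -, hf⟩ := Q.exists_ray (p := (1, _)) hTh (by rw [h0]; norm_num) (by
    conv_lhs => enter [2]; rw [hx]
    rw [mink_add_right x, mink_smul_right, hv0, mink_comm, mink_e0, h0]; norm_num) fun b k => by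
      by_cases h : (false, (0 : Fin 3)) = (b, k)
      · obtain ⟨rfl, rfl⟩ := Prod.mk.inj h
        exact hv0.le
      · have := (mink_vx_bounds h).1
        rw [hv]
        linarith
  refine ⟨q, _, Q.glueBy_glue ?_, ?_⟩
  · rw [Q.Collar, hf, mink_smul_left, hv0]; norm_num
  · rw [hu]; linarith

/-- For one copy of the double, the gluing maps identify points of the same copy of the octahedron,
and they reverse the orientation. -/
theorem not_orientable_one : ¬ (coneStr 1).Orientable := by
  rintro ⟨o, ho, hor⟩
  have hex : ∀ q : Q, ∃ ρ : ℝ, q.u ≠ 0 → DevAt (qchart (pr (0 : Fin 1) q)).α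
      (chartM (pr (0 : Fin 1) q) ∘ pr 0) (fieldM (pr (0 : Fin 1) q) ∘ pr 0) q ρ := by
    intro q
    by_cases h : q.u = 0
    · exact ⟨0, fun h' => absurd h h'⟩
    · obtain ⟨ρ, -, h2⟩ := exists_devAt (mem_chartM (pr (0 : Fin 1) q)) fun he => h he.1
      exact ⟨ρ, fun _ => h2⟩
  choose ρ hρ using hex
  -- an orientation would give an orientation of the double, here relative to its folding map
  set s : Q → ℝ := fun q => o (pr 0 q) * ρ q with hs
  have hloc : ∀ q : Q, q.u ≠ 0 → ∀ᶠ q' in 𝓝 q, 0 < s q * s q' := by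
    intro q hq
    have h1 := eventually_pr.mp (hor (pr 0 q))
    have h2 := (continuous_pr (0 : Fin 1)).continuousAt.eventually
      ((chartM (pr 0 q)).open_source.mem_nhds (mem_chartM (pr (0 : Fin 1) q)))
    filter_upwards [h1, h2, (hρ q hq).eventually hq (continuousAt_chartM (mem_chartM _))]
      with q' h1 h2 h3
    have h4 := h3.2.orient_change h2 (mem_chartM _) (hρ q' h3.1)
    have h1 : 0 < o (pr 0 q) * o (pr 0 q') *
      (fderiv ℝ ((coneStr 1).change (pr 0 q) (pr 0 q')) (chartM (pr 0 q) (pr 0 q'))).det := h1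
    have h5 := mul_pos h1 h4
    set D := (fderiv ℝ ((coneStr 1).change (pr 0 q) (pr 0 q'))
      (chartM (pr (0 : Fin 1) q) (pr 0 q'))).det
    have h6 : 0 < s q * s q' * D ^ 2 := by
      calc (0 : ℝ) < _ := h5
        _ = _ := by simp only [hs]; ring
    by_contra hcon
    push Not at hcon
    nlinarith [sq_nonneg D]
  obtain ⟨p, q, hg, hp⟩ := exists_glueBy
  have hq : 0 < q.u := by rw [hg.1]; exact hp
  -- the sign is constant along the copy of the octahedron
  have hpos : 0 < s p * s q := by
    have hsub : {a : Q | 0 < 1 * a.u} ⊆ {a | 0 < s p * s a ∧ a.u ≠ 0} := by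
      have hne : ∀ {a : Q}, 0 < 1 * a.u → a.u ≠ 0 := fun h => by rw [one_mul] at h; exact h.ne'
      have htr : ∀ {x y z : ℝ}, 0 < x * y → 0 < y * z → 0 < x * z := fun {x y z} h h' => by
        have h1 : 0 < (x * z) * y ^ 2 := by
          calc (0 : ℝ) < _ := mul_pos h h'
            _ = _ := by ring
        by_contra hcon
        push Not at hcon
        nlinarith [sq_nonneg y]
      have hopen : ∀ {a : Q}, a.u ≠ 0 → ∀ᶠ b : Q in 𝓝 a, b.u ≠ 0 := fun h =>
        Q.continuous_u.continuousAt.eventually_ne h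
      refine (Q.isPreconnected_sign (Or.inl rfl)).subset_of_closure_inter_subset ?_ ?_ ?_
      · rw [isOpen_iff_mem_nhds]
        rintro a ⟨ha, hau⟩
        filter_upwards [hloc a hau, hopen hau] with b hb hbu
        exact ⟨htr ha hb, hbu⟩
      · have := (hloc p hp.ne').self_of_nhds
        exact ⟨p, by simpa using hp, this, hp.ne'⟩
      · rintro a ⟨ha, hau⟩
        obtain ⟨b, hb, hb2⟩ := mem_closure_iff_frequently.mp ha |>.and_eventually
          (hloc a (hne hau)) |>.exists
        refine ⟨htr hb.1 ?_, hne hau⟩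
        rwa [mul_comm]
    exact (hsub (by simpa using hq : (0 : ℝ) < 1 * q.u)).1
  -- the two points are identified, but the gluing map reverses the orientation of the double
  have hpq : pr (0 : Fin 1) p = pr (0 : Fin 1) q := pr_eq_iff.mpr (Or.inr ⟨false, 0, rfl, hg⟩)
  have hdq := hρ q hq.ne'
  have hdp := hρ p hp.ne'
  rw [hpq] at hdp
  have hmem : pr (0 : Fin 1) q ∈ (chartM (pr (0 : Fin 1) q)).source := mem_chartM _
  have hmem' : pr (0 : Fin 1) p ∈ (chartM (pr (0 : Fin 1) q)).source := by rw [hpq]; exact hmem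
  have hgl := (hdq.glue hg (fun he => hp.ne' he.1) (continuousAt_chartM hmem)).congr
    (φ' := chartM (pr (0 : Fin 1) q) ∘ pr 0) (ξ' := fieldM (pr (0 : Fin 1) q) ∘ pr 0) (by
      filter_upwards [Q.eventually_glueBy hg] with a ha
      have : pr (0 : Fin 1) a = pr (0 : Fin 1) (Q.glue false 0 a) :=
        pr_eq_iff.mpr (Or.inr ⟨false, 0, rfl, ha⟩)
      simp only [Function.comp_apply, this, and_self])
  have hneg := hdp.sign_unique hgl (by
    rw [← Filter.map_map, map_nhds_pr, (chartM _).map_nhds_eq hmem', Function.comp_apply])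
  simp only [hs, hpq] at hpos
  nlinarith [sq_nonneg (o (pr 0 q))]

/-! ### The infinitesimal deformation -/

/-- Off the edges, the rates of change of the distances are those of the developed points moving
with the velocities of the flex; the term `J` does not contribute, because it is skew. -/
theorem DevAt.hasRate {α o : ℝ} {φ ξ : Q → ℝ × ℂ} {p : Q} (h : DevAt α φ ξ p o)
    (hφ : ContinuousAt φ p) : ∀ᶠ ab in 𝓝 (p, p),
      HasDerivAt (fun t : ℝ => coneCosh α (φ ab.1 + t • ξ ab.1) (φ ab.2 + t • ξ ab.2))
        (-(mink (p.vel ab.1) (p.dev ab.2) + mink (p.dev ab.1) (p.vel ab.2))) 0 := by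
  obtain ⟨Φ, J, h1, hJ, h2⟩ := h
  have hc : Tendsto (fun ab : Q × Q => (φ ab.1, φ ab.2)) (𝓝 (p, p)) (𝓝 (φ p, φ p)) := by
    rw [nhds_prod_eq, nhds_prod_eq]
    exact Filter.Tendsto.prodMap hφ hφ
  filter_upwards [hc.eventually h1.hasRate, eventually_both h2] with ab h3 h4
  have h5 := h3 (ξ ab.1) (ξ ab.2)
  simp only [h4.1.1, h4.1.2, h4.2.1, h4.2.2] at h5
  convert h5 using 1
  rw [mink_add_left, mink_add_right (p.dev ab.1), hJ]
  ring

/-- `cos` of an angle, with angles larger than `π` replaced by `π`, is differentiable. -/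
theorem differentiable_cosMin : Differentiable ℝ fun x : ℝ => Real.cos (min Real.pi |x|) := by
  have hpi := Real.pi_pos
  have key : ∀ x : ℝ, 0 < x → DifferentiableAt ℝ (fun x : ℝ => Real.cos (min Real.pi |x|)) x := by
    intro x hx
    rcases lt_trichotomy x Real.pi with h | h | h
    · refine Real.differentiable_cos.differentiableAt.congr_of_eventuallyEq ?_
      filter_upwards [Ioo_mem_nhds hx h] with y hy
      rw [abs_of_pos hy.1, min_eq_right hy.2.le]
    · subst h
      have hl : HasDerivWithinAt (fun x : ℝ => Real.cos (min Real.pi |x|)) 0 (Set.Iic Real.pi)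
          Real.pi := by
        have h1 : HasDerivWithinAt Real.cos 0 (Set.Iic Real.pi) Real.pi := by
          have := (Real.hasDerivAt_cos Real.pi).hasDerivWithinAt (s := Set.Iic Real.pi)
          rwa [Real.sin_pi, neg_zero] at this
        refine h1.congr_of_eventuallyEq ?_ (by simp [abs_of_pos hpi])
        filter_upwards [self_mem_nhdsWithin,
          mem_nhdsWithin_of_mem_nhds (lt_mem_nhds hpi)] with y h2 h3
        rw [abs_of_pos h3, min_eq_right h2]
      have hr : HasDerivWithinAt (fun x : ℝ => Real.cos (min Real.pi |x|)) 0 (Set.Ici Real.pi)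
          Real.pi := by
        refine (hasDerivWithinAt_const Real.pi (Set.Ici Real.pi) (-1 : ℝ)).congr ?_ ?_
        · intro y hy
          rw [min_eq_left (le_trans hy (le_abs_self y)), Real.cos_pi]
        · rw [min_eq_left (le_abs_self _), Real.cos_pi]
      have := hl.union hr
      rw [Set.Iic_union_Ici, hasDerivWithinAt_univ] at this
      exact this.differentiableAt
    · refine (differentiableAt_const (-1 : ℝ)).congr_of_eventuallyEq ?_
      filter_upwards [lt_mem_nhds h] with y hy
      rw [min_eq_left (le_trans hy.le (le_abs_self y)), Real.cos_pi]
  intro x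
  rcases lt_trichotomy x 0 with h | h | h
  · have := (key (-x) (by linarith)).comp x differentiable_neg.differentiableAt
    refine this.congr_of_eventuallyEq (Eventually.of_forall fun y => ?_)
    simp
  · subst h
    refine Real.differentiable_cos.differentiableAt.congr_of_eventuallyEq ?_
    filter_upwards [Ioo_mem_nhds (neg_lt_zero.mpr hpi) hpi] with y hy
    rw [min_eq_right (abs_lt.mpr hy).le, Real.cos_abs]
  · exact key x h

/-- The rates of change of distances under infinitesimal rotations about the axis exist, except for
points opposite to each other. -/
theorem exists_rate {α : ℝ} (hα : 0 < α) (s s' l l' : ℝ) {w w' : ℂ} (h :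
    InnerProductGeometry.angle w w' ≠ Real.pi) :
    ∃ c, HasDerivAt (fun t : ℝ => coneCosh α ((s, w) + t • ((0, l * Complex.I * w) : ℝ × ℂ))
      ((s', w') + t • ((0, l' * Complex.I * w') : ℝ × ℂ))) c 0 := by
  have hline : ∀ (l : ℝ) (w : ℂ) (t : ℝ), w + t • (l * Complex.I * w)
      = (1 + ((t * l : ℝ) : ℂ) * Complex.I) * w := by
    intro l w t
    rw [Complex.real_smul]; push_cast; ring
  have hsq : ∀ (l : ℝ) (t : ℝ), ‖1 + ((t * l : ℝ) : ℂ) * Complex.I‖ ^ 2 = 1 + (t * l) ^ 2 := by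
    intro l t
    rw [← Complex.normSq_eq_norm_sq, Complex.normSq_apply]
    simp
    ring
  have hpos : ∀ l t : ℝ, 0 < 1 + (t * l) ^ 2 := fun l t => by positivity
  have hne : ∀ (l : ℝ) (t : ℝ), 1 + ((t * l : ℝ) : ℂ) * Complex.I ≠ 0 := by
    intro l t h0
    have := hsq l t
    rw [h0, norm_zero] at this
    have := hpos l t
    linarith
  have hnorm : ∀ (l : ℝ) (w : ℂ) (t :
    ℝ), ‖w + t • (l * Complex.I * w)‖ = √(1 + (t * l) ^ 2) * ‖w‖ := by
    intro l w t
    rw [hline, norm_mul, ← hsq, Real.sqrt_sq (norm_nonneg _)]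
  have hd1 : ∀ l : ℝ, DifferentiableAt ℝ (fun t : ℝ => √(1 + (t * l) ^ 2)) 0 := fun l =>
    DifferentiableAt.sqrt (by fun_prop) (hpos l 0).ne'
  have hd2 : ∀ (l : ℝ) (w : ℂ), DifferentiableAt ℝ
      (fun t : ℝ => √(1 + (√(1 + (t * l) ^ 2) * ‖w‖) ^ 2)) 0 := fun l w => by
    have := hd1 l
    exact DifferentiableAt.sqrt (by fun_prop) (by positivity)
  have hA : DifferentiableAt ℝ (fun t : ℝ => √(1 + (√(1 + (t * l) ^ 2) * ‖w‖) ^ 2) *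
      √(1 + (√(1 + (t * l') ^ 2) * ‖w'‖) ^ 2) * Real.cosh (s - s')) 0 :=
    ((hd2 l w).mul (hd2 l' w')).mul_const _
  suffices hB : DifferentiableAt ℝ (fun t : ℝ => √(1 + (t * l) ^ 2) * ‖w‖ *
      (√(1 + (t * l') ^ 2) * ‖w'‖) * Real.cos (min Real.pi (α / (2 * Real.pi) *
        InnerProductGeometry.angle (w + t • (l * Complex.I * w)) (w' + t • (l' * Complex.I * w')))))
          0 by
    refine ⟨_, ((hA.sub hB).congr_of_eventuallyEq (Eventually.of_forall fun t => ?_)).hasDerivAt⟩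
    simp only [coneCosh, Prod.snd_add, Prod.smul_snd, Prod.fst_add, Prod.smul_fst, smul_zero,
      add_zero, hnorm, Pi.sub_apply]
  rcases eq_or_ne w 0 with rfl | hw
  · simp
  rcases eq_or_ne w' 0 with rfl | hw'
  · simp
  have hang : ∀ t : ℝ, InnerProductGeometry.angle (w + t • (l * Complex.I * w))
      (w' + t • (l' * Complex.I * w')) =
      |(((1 + ((t * l : ℝ) : ℂ) * Complex.I) * w) / ((1 + ((t * l' : ℝ) :
        ℂ) * Complex.I) * w')).arg| := by
    intro t
    rw [hline, hline, Complex.angle_eq_abs_arg (mul_ne_zero (hne l t) hw)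
      (mul_ne_zero (hne l' t) hw')]
  have hquot : DifferentiableAt ℝ (fun t : ℝ => ((1 + ((t * l : ℝ) : ℂ) * Complex.I) * w) /
      ((1 + ((t * l' : ℝ) : ℂ) * Complex.I) * w')) 0 := by
    have hof : ∀ l : ℝ, DifferentiableAt ℝ (fun t : ℝ => ((t * l : ℝ) : ℂ)) 0 := fun l =>
      (Complex.ofRealCLM.differentiableAt (x := (0 : ℝ) * l)).comp (0 : ℝ)
        (differentiableAt_id.mul_const l)
    have h1 := hof l
    have h2 := hof l'
    exact DifferentiableAt.fun_div (by fun_prop) (by fun_prop) (mul_ne_zero (hne l' 0) hw')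
  have harg : DifferentiableAt ℝ (fun t : ℝ => (((1 + ((t * l : ℝ) : ℂ) * Complex.I) * w) /
      ((1 + ((t * l' : ℝ) : ℂ) * Complex.I) * w')).arg) 0 := by
    have hslit : ((1 + (((0 : ℝ) * l : ℝ) : ℂ) * Complex.I) * w) /
        ((1 + (((0 : ℝ) * l' : ℝ) : ℂ) * Complex.I) * w') ∈ Complex.slitPlane := by
      simp only [zero_mul, Complex.ofReal_zero, add_zero, one_mul]
      rw [Complex.mem_slitPlane_iff_arg]
      refine ⟨fun hpi => h ?_, div_ne_zero hw hw'⟩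
      rw [Complex.angle_eq_abs_arg hw hw', hpi, abs_of_pos Real.pi_pos]
    have hlog := (Complex.hasStrictDerivAt_log hslit).hasDerivAt.differentiableAt
    have h3 := (hlog.restrictScalars ℝ).comp (0 : ℝ) hquot
    have h4 := Complex.imCLM.differentiableAt.comp (0 : ℝ) h3
    exact h4.congr_of_eventuallyEq (Eventually.of_forall fun t => (Complex.log_im _).symm)
  have hcos : DifferentiableAt ℝ (fun t : ℝ => Real.cos (min Real.pi (α / (2 * Real.pi) *
        InnerProductGeometry.angle (w + t • (l * Complex.I * w)) (w' + t • (l' * Complex.I * w')))))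
          0 := by
    have h1 := (differentiable_cosMin _).comp (0 : ℝ) (harg.const_mul (α / (2 * Real.pi)))
    refine h1.congr_of_eventuallyEq (Eventually.of_forall fun t => ?_)
    have h2 : 0 < α / (2 * Real.pi) := div_pos hα (by positivity)
    simp only [hang, Function.comp_apply, abs_mul, abs_of_pos h2]
  have := hd1 l
  have := hd1 l'
  fun_prop

theorem angle_sym (c : ℝ) (δ : Bool) (p q : ℝ × ℂ) :
    InnerProductGeometry.angle (sym c δ p).2 (sym c δ q).2 = InnerProductGeometry.angle p.2 q.2 :=
      by
  cases δ
  · rfl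
  · exact Complex.conjLIE.toLinearIsometry.angle_map p.2 q.2

theorem sym_add_smul (c t : ℝ) (δ : Bool) (p v : ℝ × ℂ) :
    sym c δ p + t • symL δ v = sym c δ (p + t • v) := by
  rw [sym_eq, sym_eq, map_add, map_smul]; abel

/-- The flex is an infinitesimal deformation that preserves the cone angles. -/
theorem isInfDeformation (n : ℕ) : (coneStr n).IsInfDeformation fieldM := by
  intro x
  filter_upwards [(chartM x).open_source.mem_nhds (mem_chartM x)] with y hx
  have hy := mem_chartM y
  obtain ⟨j, q, rfl⟩ := pr_surj y
  rw [HypConeStructure.SameRatesNear, eventually_pr_prod]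
  -- at an edge, the two variations agree up to an isometry of the model space; elsewhere, both give
  -- the rates of change of the distances of the developed points
  by_cases hq : q.IsEdge
  · obtain ⟨-, -, e, c, δ, h1, h2, -, h3⟩ := exists_edgeAt hx hq
    obtain ⟨-, -, e', c', δ', h1', h2', -, h3'⟩ := exists_edgeAt hy hq
    obtain rfl := h1.unique h1'
    filter_upwards [eventually_both h3, eventually_both h3'] with ab hab hab' hang
    simp only [Function.comp_apply] at hab hab'
    have hang : InnerProductGeometry.angle (chartM (pr j q) (pr j ab.1)).2
      (chartM (pr j q) (pr j ab.2)).2 ≠ Real.pi := hang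
    rw [hab'.1.1, hab'.2.1, angle_sym] at hang
    obtain ⟨r, hr⟩ := exists_rate (α := 2 * e.theta) (mul_pos two_pos e.theta_pos)
      ((e.frame.co ab.1.fold).1 - 0) ((e.frame.co ab.2.fold).1 - 0)
      (e.coef * Real.sign (ab.1.y e.1)) (e.coef * Real.sign (ab.2.y e.1)) hang
    refine ⟨r, ?_, ?_⟩
    · change HasDerivAt (fun t : ℝ => coneCosh (qchart x).α
        (chartM x (pr j ab.1) + t • fieldM x (pr j ab.1))
        (chartM x (pr j ab.2) + t • fieldM x (pr j ab.2))) r 0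
      simp only [hab.1.1, hab.1.2, hab.2.1, hab.2.2, sym_add_smul, coneCosh_sym, h2]
      exact hr
    · change HasDerivAt (fun t : ℝ => coneCosh (qchart (pr j q)).α
        (chartM (pr j q) (pr j ab.1) + t • fieldM (pr j q) (pr j ab.1))
        (chartM (pr j q) (pr j ab.2) + t • fieldM (pr j q) (pr j ab.2))) r 0
      simp only [hab'.1.1, hab'.1.2, hab'.2.1, hab'.2.2, sym_add_smul, coneCosh_sym, h2']
      exact hr
  · obtain ⟨_, -, h⟩ := exists_devAt hx hq
    obtain ⟨_, -, h'⟩ := exists_devAt hy hq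
    filter_upwards [h.hasRate (continuousAt_chartM hx), h'.hasRate (continuousAt_chartM hy)]
      with ab hab hab' _
    exact ⟨_, hab, hab'⟩

/-! ### Non-triviality of the deformation -/

theorem exists_mink_eq (f : V4 →ₗ[ℝ] ℝ) : ∃ y, ∀ x, f x = mink y x := by
  refine ⟨![-f (Pi.single 0 1), f (Pi.single 1 1), f (Pi.single 2 1), f (Pi.single 3 1)],
    fun x => ?_⟩
  have hx : x = ∑ i, x i • (Pi.single i 1 : V4) := by
    funext j; simp [Finset.sum_apply, Pi.single_apply]
  conv_lhs => rw [hx]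
  simp [mink, Fin.sum_univ_four]
  ring

/-- An infinitesimal deformation of a spanning set of vectors that preserves the scalar products is
given by a skew map. -/
theorem exists_skew {ι : Type*} (f W : ι → V4) (hspan : ∀ y, (∀ i, mink (f i) y = 0) → y = 0)
    (h : ∀ i j, mink (W i) (f j) + mink (f i) (W j) = 0) :
    ∃ J : V4 →ₗ[ℝ] V4, IsSkew J ∧
      ∀ x w, (∀ i, mink w (f i) + mink x (W i) = 0) → w = J x := by
  have htop : ⊤ ≤ Submodule.span ℝ (Set.range f) := by
    by_contra hne
    obtain ⟨φ, hφ, hle⟩ := Submodule.exists_le_ker_of_lt_top (Submodule.span ℝ (Set.range f))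
      (lt_top_iff_ne_top.mpr fun h => hne h.ge)
    obtain ⟨y, hy⟩ := exists_mink_eq φ
    have hy0 : y = 0 := hspan y fun i => by
      rw [mink_comm, ← hy]
      exact hle (Submodule.subset_span ⟨i, rfl⟩)
    exact hφ (LinearMap.ext fun x => by rw [hy, hy0, mink_zero_left]; rfl)
  have ind : ∀ {P : V4 → Prop}, (∀ i, P (f i)) → P 0 → (∀ x y, P x → P y → P (x + y)) →
      (∀ (c : ℝ) x, P x → P (c • x)) → ∀ x, P x := by
    intro P h1 h2 h3 h4 x
    refine Submodule.span_induction (p := fun x _ => P x) ?_ h2 (fun x y _ _ => h3 x y)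
      (fun c x _ => h4 c x) (htop (Submodule.mem_top (x := x)))
    rintro _ ⟨i, rfl⟩
    exact h1 i
  set b := Module.Basis.ofSpan htop with hb
  have hg : ∀ i, ∃ k, f k = b i := fun i => Module.Basis.ofSpan_subset htop ⟨i, rfl⟩
  choose g hg using hg
  set J : V4 →ₗ[ℝ] V4 := b.constr ℝ fun i => W (g i) with hJ
  have hJb : ∀ i, J (b i) = W (g i) := fun i => b.constr_basis ℝ _ i
  have indb : ∀ {P : V4 → Prop}, (∀ i, P (b i)) → P 0 → (∀ x y, P x → P y → P (x + y)) →
      (∀ (c : ℝ) x, P x → P (c • x)) → ∀ x, P x := by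
    intro P h1 h2 h3 h4 x
    refine Submodule.span_induction (p := fun x _ => P x) ?_ h2 (fun x y _ _ => h3 x y)
      (fun c x _ => h4 c x) (by rw [b.span_eq]; exact Submodule.mem_top (x := x))
    rintro _ ⟨i, rfl⟩
    exact h1 i
  have hskew : IsSkew J := by
    intro x y
    revert x
    refine indb (fun i => ?_) ?_ ?_ ?_
    · revert y
      refine indb (fun j => ?_) ?_ ?_ ?_
      · rw [hJb, hJb, ← hg, ← hg]
        linarith [h (g i) (g j)]
      · rw [map_zero, mink_zero_right, mink_zero_right, neg_zero]
      · intro x y hx hy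
        rw [map_add, mink_add_right, mink_add_right, hx, hy]; ring
      · intro c x hx
        rw [map_smul, mink_smul_right, mink_smul_right, hx]; ring
    · rw [map_zero, mink_zero_left, mink_zero_left, neg_zero]
    · intro x y hx hy
      rw [map_add, mink_add_left, mink_add_left, hx, hy]; ring
    · intro c x hx
      rw [map_smul, mink_smul_left, mink_smul_left, hx]; ring
  refine ⟨J, hskew, fun x w hw => ?_⟩
  rw [← sub_eq_zero]
  refine mink_nondeg (indb (fun i => ?_) (mink_zero_right _) ?_ ?_)
  · rw [mink_sub_left, hskew, hJb, ← hg, sub_neg_eq_add]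
    exact hw (g i)
  · intro x y hx hy
    rw [mink_add_right, hx, hy, add_zero]
  · intro c x hx
    rw [mink_smul_right, hx, mul_zero]

/-- The image of a local isometry spans Minkowski space. -/
theorem LocDev.span {α : ℝ} {Φ : ℝ × ℂ → V4} {x₀ : ℝ × ℂ} {o : ℝ} (h : LocDev α Φ x₀ o) {y : V4}
    (hy : ∀ᶠ x in 𝓝 x₀, mink (Φ x) y = 0) : y = 0 := by
  obtain ⟨Ψ, O, hO, hx, h1, -⟩ := h
  obtain ⟨hd, -, -, hv⟩ := h1 x₀ hx
  have hD : ∀ v, mink (fderiv ℝ Φ x₀ v) y = 0 := by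
    intro v
    have h2 : HasFDerivAt (fun x => mink (Φ x) y)
        ((LinearMap.toContinuousLinearMap (minkL y)).comp (fderiv ℝ Φ x₀)) x₀ := by
      have := (LinearMap.toContinuousLinearMap (minkL y)).hasFDerivAt.comp x₀ hd.hasFDerivAt
      refine this.congr_of_eventuallyEq (Eventually.of_forall fun x => ?_)
      simp [minkL, mink_comm]
    have h3 : HasFDerivAt (fun x => mink (Φ x) y) (0 : ℝ × ℂ →L[ℝ] ℝ) x₀ :=
      (hasFDerivAt_const (0 : ℝ) x₀).congr_of_eventuallyEq hy
    have h4 := congrArg (fun L => L v) (h2.unique h3)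
    simpa [minkL, mink_comm] using h4
  have h0 := hy.self_of_nhds
  have hdet : vol (Φ x₀) (fderiv ℝ Φ x₀) ≠ 0 := fun h => by rw [h, mul_zero] at hv; exact hv.false
  refine mink_nondeg fun z => ?_
  have key : ∀ a b c d : V4, det4 a b c d * mink y z = mink a y * det4 z b c d
      + mink b y * det4 a z c d + mink c y * det4 a b z d + mink d y * det4 a b c z := by
    intro a b c d
    simp only [mink, det4]; ring
  have h5 := key (Φ x₀) (fderiv ℝ Φ x₀ (1, 0)) (fderiv ℝ Φ x₀ (0, 1)) (fderiv ℝ Φ x₀ (0, Complex.I))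
  rw [h0, hD, hD, hD] at h5
  simp only [zero_mul, add_zero] at h5
  exact (mul_eq_zero.mp h5).resolve_left hdet

/-- The sector of a quarter turn in the direction of `ζ`. -/
def quarter (ζ : ℂ) : Set ℂ := {w | |(w * (starRingEnd ℂ) ζ).im| < (w * (starRingEnd ℂ) ζ).re}

theorem isOpen_quarter (ζ : ℂ) : IsOpen (quarter ζ) := by
  unfold quarter
  have := Complex.continuous_re
  have := Complex.continuous_im
  exact isOpen_lt (by fun_prop) (by fun_prop)

theorem angle_pi_quarter {ζ w w' : ℂ} (h : w ∈ quarter ζ)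
    (hpi : InnerProductGeometry.angle w' w = Real.pi) :
    |(w' * (starRingEnd ℂ) ζ).im| < -(w' * (starRingEnd ℂ) ζ).re := by
  obtain ⟨h0, r, hr, rfl⟩ := InnerProductGeometry.angle_eq_pi_iff.mp hpi
  have h : |((r • w') * (starRingEnd ℂ) ζ).im| < ((r • w') * (starRingEnd ℂ) ζ).re := h
  rw [smul_mul_assoc, Complex.smul_im, Complex.smul_re, smul_eq_mul, smul_eq_mul, abs_mul,
    abs_of_neg hr] at h
  have h2 : -r * |(w' * (starRingEnd ℂ) ζ).im| < -r * -(w' * (starRingEnd ℂ) ζ).re := by linarith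
  exact lt_of_mul_lt_mul_left h2 (by linarith)

theorem quarter_I {w : ℂ} : w ∈ quarter Complex.I ↔ |w.re| < w.im := by simp [quarter]

theorem angle_quarter_self {ζ w w' : ℂ} (h : w ∈ quarter ζ) (h' : w' ∈ quarter ζ) :
    InnerProductGeometry.angle w w' ≠ Real.pi := fun hpi => by
  have h1 := angle_pi_quarter h' hpi
  have h2 : |(w * (starRingEnd ℂ) ζ).im| < (w * (starRingEnd ℂ) ζ).re := h
  linarith [abs_nonneg (w * (starRingEnd ℂ) ζ).im]

theorem angle_quarter_I_one {w w' : ℂ} (h : w ∈ quarter Complex.I) (h' : w' ∈ quarter 1) :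
    InnerProductGeometry.angle w w' ≠ Real.pi := fun hpi => by
  have h1 := angle_pi_quarter h' hpi
  rw [quarter_I] at h
  simp only [map_one, mul_one] at h1
  linarith [neg_abs_le w.re, le_abs_self w.im]

/-- No direction is opposite both to a direction in the sector about `1` and to one in the sector
about `I`. -/
theorem angle_quarter_or (w : ℂ) : (∀ w' ∈ quarter 1, InnerProductGeometry.angle w w' ≠ Real.pi) ∨
    ∀ w' ∈ quarter Complex.I, InnerProductGeometry.angle w w' ≠ Real.pi := by
  by_contra hcon
  push Not at hcon
  obtain ⟨⟨w1, h1, e1⟩, w2, h2, e2⟩ := hcon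
  have h3 := angle_pi_quarter h1 e1
  have h4 := angle_pi_quarter h2 e2
  simp only [map_one, mul_one, Complex.conj_I, mul_neg, Complex.neg_im, Complex.neg_re,
    Complex.mul_I_im, Complex.mul_I_re, abs_neg, neg_neg] at h3 h4
  linarith [neg_abs_le w.re, neg_abs_le w.im]

/-- If the flex is induced by a vector field near a point, then the difference of this field and the
flex is a local infinitesimal isometry. -/
theorem local_killing {v : Mfd n → ℝ × ℂ} {j : Fin n} {q : Q} (hq : ¬ q.IsEdge)
    {Φ : ℝ × ℂ → V4} {o : ℝ}
    (hΦ : LocDev (qchart (pr j q)).α Φ (chartM (pr j q) (pr j q)) o)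
    (hdev : ∀ᶠ a in 𝓝 q, Φ (chartM (pr j q) (pr j a)) = q.dev a)
    (hv : (coneStr n).SameRatesNear (pr j q) (fieldM (pr j q)) (pr j q)
      ((coneStr n).fieldInChart v (pr j q))) :
    ∃ J, IsSkew J ∧ ∀ᶠ a in 𝓝 q, fderiv ℝ Φ (chartM (pr j q) (pr j a))
      ((coneStr n).fieldInChart v (pr j q) (pr j a)) = q.vel a + J (q.dev a) := by
  set x := pr j q with hx
  set φ : Q → ℝ × ℂ := fun a => chartM x (pr j a) with hφ
  set F : Q → ℝ × ℂ := fun a => (coneStr n).fieldInChart v x (pr j a) with hF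
  have hmem : pr j q ∈ (chartM x).source := mem_chartM x
  have hφc : ContinuousAt φ q := continuousAt_chartM hmem
  have hφm : map φ (𝓝 q) = 𝓝 (φ q) := by
    change map (chartM x ∘ pr j) (𝓝 q) = _
    rw [← Filter.map_map, map_nhds_pr, (chartM x).map_nhds_eq hmem]
  have hφ0 : φ q = 0 := chartM_self x
  obtain ⟨_, -, hD⟩ := exists_devAt hmem hq
  set W : Q → V4 := fun a => fderiv ℝ Φ (φ a) (F a) - q.vel a with hW
  have hφφ : Tendsto (fun ab : Q × Q => (φ ab.1, φ ab.2)) (𝓝 (q, q)) (𝓝 (φ q, φ q)) := by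
    rw [nhds_prod_eq, nhds_prod_eq]
    exact Filter.Tendsto.prodMap hφc hφc
  have hR : ∀ᶠ ab in 𝓝 (q, q), InnerProductGeometry.angle (φ ab.1).2 (φ ab.2).2 ≠ Real.pi →
      mink (W ab.1) (q.dev ab.2) + mink (q.dev ab.1) (W ab.2) = 0 := by
    rw [HypConeStructure.SameRatesNear, hx, eventually_pr_prod, ← hx] at hv
    filter_upwards [hv, hD.hasRate hφc, hφφ.eventually hΦ.hasRate, eventually_both hdev]
      with ab h1 h2 h3 h4 hang
    obtain ⟨c, hc, hc'⟩ := h1 hang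
    have e1 := HasDerivAt.unique hc h2
    have e2 := HasDerivAt.unique hc' (h3 (F ab.1) (F ab.2))
    have h41 : Φ (φ ab.1) = q.dev ab.1 := h4.1
    have h42 : Φ (φ ab.2) = q.dev ab.2 := h4.2
    simp only [h41, h42] at e2
    simp only [hW, mink_sub_left, mink_sub_right]
    linarith
  -- the distances of points with directions opposite to each other are not compared; hence `J` is
  -- found from the points in one sector of a quarter turn, then verified on a second sector, and
  -- finally on all points, none of which is opposite to points of both sectors
  rw [nhds_prod_eq] at hR
  obtain ⟨N, hN, hNR⟩ := Filter.eventually_prod_self_iff'.mp hR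
  have hgood : ∀ᶠ p in 𝓝 (0 : ℝ × ℂ), (∃ a ∈ {a | a ∈ N ∧ Φ (φ a) = q.dev a}, φ a = p) ∧
      LocDev (qchart x).α Φ p o := by
    rw [← hφ0]
    refine Eventually.and ?_ hΦ.eventually
    rw [← hφm]
    exact image_mem_map (Filter.inter_mem hN hdev)
  -- points with coordinates in a sector are sufficiently many
  have hspan : ∀ ζ : ℂ, ζ ≠ 0 → ∀ y, (∀ a ∈ N, (φ a).2 ∈ quarter ζ → mink (q.dev a) y = 0) →
      y = 0 := by
    intro ζ hζ y hy
    have ht : Tendsto (fun t : ℝ => ((0, t • ζ) : ℝ × ℂ)) (𝓝[>] 0) (𝓝 0) := by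
      have : Continuous fun t : ℝ => ((0, t • ζ) : ℝ × ℂ) := by fun_prop
      have := this.tendsto 0
      rw [zero_smul] at this
      exact this.mono_left nhdsWithin_le_nhds
    obtain ⟨t, ht1, ht0⟩ := ((ht.eventually hgood.eventually_nhds).and self_mem_nhdsWithin).exists
    have ht0 : 0 < t := ht0
    have hmemq : t • ζ ∈ quarter ζ := by
      have : (t • ζ) * (starRingEnd ℂ) ζ = ((t * ‖ζ‖ ^ 2 : ℝ) : ℂ) := by
        rw [smul_mul_assoc, Complex.mul_conj, Complex.normSq_eq_norm_sq, Complex.real_smul]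
        push_cast; ring
      have h0 := norm_pos_iff.mpr hζ
      rw [quarter, Set.mem_ofPred_eq, this, Complex.ofReal_im, Complex.ofReal_re, abs_zero]
      positivity
    refine ht1.self_of_nhds.2.span ?_
    filter_upwards [ht1, (continuous_snd.tendsto (0, t • ζ)).eventually
      ((isOpen_quarter ζ).mem_nhds hmemq)] with p hp hpq
    obtain ⟨⟨a, ⟨ha, hda⟩, rfl⟩, -⟩ := hp
    rw [hda]
    exact hy a ha hpq
  let ι : Set Q := {a | a ∈ N ∧ (φ a).2 ∈ quarter 1}
  obtain ⟨J, hJ, hJW⟩ := exists_skew (ι := ι) (fun a => q.dev a) (fun a => W a)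
    (fun y hy => hspan 1 one_ne_zero y fun a ha h => hy ⟨a, ha, h⟩)
    (fun a b => hNR a a.2.1 b b.2.1 (angle_quarter_self a.2.2 b.2.2))
  refine ⟨J, hJ, ?_⟩
  have h2 : ∀ a ∈ N, (φ a).2 ∈ quarter Complex.I → W a = J (q.dev a) := fun a ha h =>
    hJW _ _ fun i => hNR a ha i i.2.1 (angle_quarter_I_one h i.2.2)
  have h3 : ∀ a ∈ N, W a = J (q.dev a) := by
    intro a ha
    rcases angle_quarter_or (φ a).2 with h | h
    · exact hJW _ _ fun i => hNR a ha i i.2.1 (h _ i.2.2)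
    · rw [← sub_eq_zero]
      refine hspan Complex.I Complex.I_ne_zero _ fun b hb hbI => ?_
      have h4 := hNR a ha b hb (h _ hbI)
      rw [h2 b hb hbI] at h4
      rw [mink_comm, mink_sub_left, hJ]
      linarith
  filter_upwards [hN] with a ha
  have := h3 a ha
  simp only [hW] at this
  rw [← this]; abel

theorem exists_devMap (j : Fin n) (q : Q) : ∃ Φ : ℝ × ℂ → V4, q.u ≠ 0 →
    (∃ o, LocDev (qchart (pr j q)).α Φ (chartM (pr j q) (pr j q)) o) ∧
    ∀ᶠ a in 𝓝 q, Φ (chartM (pr j q) (pr j a)) = a.fold := by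
  by_cases h : q.u = 0
  · exact ⟨0, fun h' => absurd h h'⟩
  · obtain ⟨_, -, Φ, J, h1, -, h2⟩ := exists_devAt (mem_chartM (pr j q)) fun he => h he.1
    refine ⟨Φ, fun _ => ⟨⟨_, h1⟩, h2.mono fun a ha => ?_⟩⟩
    rw [← Q.dev_of_ne h]
    exact ha.1

/-- A developing map on the model space of the chart centred at an interior point of a copy of the
octahedron. -/
def devMap (j : Fin n) (q : Q) : ℝ × ℂ → V4 := (exists_devMap j q).choose

/-- The vector field `v` on the interior of the copies of the octahedron, in Minkowski space. -/
def vecM (v : Mfd n → ℝ × ℂ) (j : Fin n) (q : Q) : V4 :=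
  fderiv ℝ (devMap j q) (chartM (pr j q) (pr j q)) (v (pr j q))

theorem Q.S_isIso {q : Q} (hu : q.u = 0) (hq : ¬ q.IsEdge) :
    IsIso q.S ∧ HasDet q.S (-1) ∧ (∀ k, q.S (vx (bs (q.y k)) k) = vx (bs (q.y k)) k) ∧
      ∀ z, q.S (q.S z) = z := by
  have hf : q.fold ∈ faceW fun k => bs (q.y k) := fun k => by
    rw [Q.yc_fold]; exact sg_bs fun h => hq ⟨hu, k, h⟩
  have h1 := faceW_mink hf
  rw [Q.c0_fold, hu, abs_zero, zero_mul] at h1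
  have hn : faceNormal (fun k => bs (q.y k)) ≠ 0 := fun h => by
    have := mink_faceNormal_e0 fun k => bs (q.y k)
    rw [h, mink_zero_left] at this
    exact this.false
  have h2 := (mink_pos_of_orth (by rw [q.inH.1]; norm_num) h1 hn).ne'
  exact ⟨refl_isIso h2, refl_hasDet h2, fun k => refl_of_orth (by
    rw [mink_comm]; exact mink_faceNormal (fun k => bs (q.y k)) k), fun z => refl_refl h2 z⟩

theorem LocDev.fderiv_iso {α : ℝ} {Φ : ℝ × ℂ → V4} {x₀ : ℝ × ℂ} {o : ℝ} (h : LocDev α Φ x₀ o)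
    (g : V4 →ₗ[ℝ] V4) (v : ℝ × ℂ) : fderiv ℝ (fun x => g (Φ x)) x₀ v = g (fderiv ℝ Φ x₀ v) := by
  have : fderiv ℝ (fun x => g (Φ x)) x₀
      = (LinearMap.toContinuousLinearMap g).comp (fderiv ℝ Φ x₀) :=
    ((LinearMap.toContinuousLinearMap g).hasFDerivAt.comp _ h.differentiableAt.hasFDerivAt).fderiv
  rw [this]; rfl

/-- The vector field that trivializes the flex, near a point that is not on an edge. -/
theorem local_motion {v : Mfd n → ℝ × ℂ} {j : Fin n} {q : Q} (hq : ¬ q.IsEdge)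
    (hv : (coneStr n).SameRatesNear (pr j q) (fieldM (pr j q)) (pr j q)
      ((coneStr n).fieldInChart v (pr j q))) :
    ∃ J, IsSkew J ∧ ∀ᶠ a in 𝓝 q, a.u ≠ 0 →
      (if q.u = 0 ∧ a.u < 0 then q.S else LinearMap.id) (vecM v j a) = q.vel a + J (q.dev a) := by
  have hmem := mem_chartM (pr j q)
  obtain ⟨_, -, Φ, J₀, hΦ, -, hdev⟩ := exists_devAt hmem hq
  obtain ⟨J, hJ, hJev⟩ := local_killing hq hΦ (hdev.mono fun a ha => ha.1) hv
  refine ⟨J, hJ, ?_⟩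
  filter_upwards [hJev, hdev.eventually_nhds, (continuousAt_chartM hmem).eventually hΦ.eventually,
    (continuous_pr j).continuousAt.eventually ((chartM _).open_source.mem_nhds hmem)]
    with a ha hda hLa hma hu
  rw [← ha]
  obtain ⟨⟨o, h1⟩, h2⟩ := (exists_devMap j a).choose_spec hu
  change (if q.u = 0 ∧ a.u < 0 then q.S else LinearMap.id) (fderiv ℝ (devMap j a)
    (chartM (pr j a) (pr j a)) (v (pr j a))) = _
  have h1 : LocDev (qchart (pr j a)).α (devMap j a) (chartM (pr j a) (pr j a)) o := h1
  have h2 : ∀ᶠ b in 𝓝 a, devMap j a (chartM (pr j a) (pr j b)) = b.fold := h2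
  split_ifs with hc
  · obtain ⟨g1, g2, -⟩ := Q.S_isIso hc.1 hq
    rw [← h1.fderiv_iso, ← (devAt_change (mem_chartM (pr j a)) hma (h1.iso g1 g2 (Or.inr rfl)) hLa
      ?_).2.1]
    · rfl
    · filter_upwards [h2, hda, (isOpen_lt Q.continuous_u continuous_const).mem_nhds hc.2]
        with b hb hb' hbu
      have hb' := hb'.1
      rw [Q.dev_of_neg hc.1 hbu] at hb'
      rw [hb]
      exact hb'
  · rw [LinearMap.id_apply, ← (devAt_change (mem_chartM (pr j a)) hma h1 hLa ?_).2.1]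
    · rfl
    · have hpos : q.u = 0 → 0 < a.u := fun h =>
        lt_of_le_of_ne (not_lt.mp fun h' => hc ⟨h, h'⟩) hu.symm
      have hdv : ∀ᶠ b in 𝓝 a, q.dev b = b.fold := by
        by_cases h0 : q.u = 0
        · filter_upwards [(isOpen_lt continuous_const Q.continuous_u).mem_nhds (hpos h0)] with b hb
          exact Q.dev_of_nonneg q (le_of_lt hb)
        · exact Eventually.of_forall fun b => Q.dev_of_ne h0 b
      filter_upwards [h2, hda, hdv] with b hb hb' hbd
      rw [hb, ← hbd]
      exact hb'.1

/-- The points near an interior point of the octahedron span Minkowski space. -/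
theorem fold_span {q : Q} (hu : q.u ≠ 0) {y : V4} (h : ∀ᶠ a : Q in 𝓝 q, mink a.fold y = 0) :
    y = 0 := by
  obtain ⟨⟨o, h1⟩, h2⟩ := (exists_devMap (0 : Fin 1) q).choose_spec hu
  refine h1.span ?_
  rw [← (chartM _).map_nhds_eq (mem_chartM _), eventually_map, eventually_pr]
  filter_upwards [h, h2] with a ha ha'
  rw [ha', ha]

theorem linearMap_eq_of_fold {q : Q} (hu : q.u ≠ 0) {L L' : V4 →ₗ[ℝ] V4} (hL : IsSkew L)
    (hL' : IsSkew L') (h : ∀ᶠ a : Q in 𝓝 q, L a.fold = L' a.fold) : L = L' := by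
  refine LinearMap.ext fun z => ?_
  rw [← sub_eq_zero]
  refine fold_span hu ?_
  filter_upwards [h] with a ha
  have h1 := hL a.fold z
  have h2 := hL' a.fold z
  rw [ha] at h1
  rw [mink_sub_right a.fold]
  linarith

/-- On each copy of the octahedron, a vector field that trivializes the flex differs from it by a
global infinitesimal isometry. -/
theorem global_motion {v : Mfd n → ℝ × ℂ} (j : Fin n)
    (hv : ∀ x, (coneStr n).SameRatesNear x (fieldM x) x ((coneStr n).fieldInChart v x))
    {ε : ℝ} (hε : ε = 1 ∨ ε = -1) : ∃ J, IsSkew J ∧ ∀ q : Q, 0 < ε * q.u →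
      vecM v j q = ε • Kx q.fold q.fold + J q.fold := by
  have hne : ∀ {a : Q}, 0 < ε * a.u → a.u ≠ 0 := fun {a} h h0 => by
    rw [h0, mul_zero] at h; exact h.false
  have hsg : ∀ {a : Q}, 0 < ε * a.u → Real.sign a.u = ε := fun {a} h => by
    rcases hε with rfl | rfl
    · exact Real.sign_of_pos (by linarith)
    · exact Real.sign_of_neg (by linarith)
  have hopen : ∀ {a : Q}, 0 < ε * a.u → ∀ᶠ b : Q in 𝓝 a, 0 < ε * b.u := fun {a} h =>
    (isOpen_lt continuous_const (by fun_prop : Continuous fun b : Q => ε * b.u)).mem_nhds h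
  have hloc : ∀ q : Q, 0 < ε * q.u → ∃ J, IsSkew J ∧ ∀ᶠ a in 𝓝 q,
      vecM v j a = ε • Kx a.fold a.fold + J a.fold := by
    intro q hq
    obtain ⟨J, hJ, h⟩ := local_motion (fun he => hne hq he.1) (hv (pr j q))
    refine ⟨J, hJ, ?_⟩
    filter_upwards [h, hopen hq] with a ha hau
    have := ha (hne hau)
    rw [if_neg fun hc => hne hq hc.1, Q.vel, Q.dev_of_ne (hne hq), hsg hq] at this
    exact this
  rcases Set.eq_empty_or_nonempty {a : Q | 0 < ε * a.u} with h0 | ⟨q₀, hq₀⟩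
  · exact ⟨0, isSkew_zero, fun q hq => absurd hq (Set.eq_empty_iff_forall_notMem.mp h0 q)⟩
  obtain ⟨J, hJ, hJ0⟩ := hloc q₀ hq₀
  refine ⟨J, hJ, ?_⟩
  have hsub : {a : Q | 0 < ε * a.u} ⊆ {q | ∀ᶠ a in 𝓝 q,
      vecM v j a = ε • Kx a.fold a.fold + J a.fold} := by
    refine (Q.isPreconnected_sign hε).subset_of_closure_inter_subset ?_ ⟨q₀, hq₀, hJ0⟩ ?_
    · rw [isOpen_iff_mem_nhds]
      intro a ha
      exact Filter.Eventually.eventually_nhds ha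
    · rintro q ⟨hq, hqu⟩
      obtain ⟨J', hJ', h'⟩ := hloc q hqu
      obtain ⟨a, ha, hau, ha'⟩ := (mem_closure_iff_frequently.mp hq).and_eventually
        ((hopen hqu).and h'.eventually_nhds) |>.exists
      have : J = J' := linearMap_eq_of_fold (hne hau) hJ hJ' (by
        filter_upwards [ha, ha'] with b hb hb'
        exact add_left_cancel (hb.symm.trans hb'))
      rw [this]
      exact h'
  exact fun q hq => (hsub hq).self_of_nhds

/-- Every triangle of the octahedron contains points of the double. -/
theorem exists_face (σ : Fin 3 → Bool) : ∃ q : Q, q.u = 0 ∧ ∀ k, 0 < sg (σ k) * q.y k := by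
  set x : V4 := ∑ k, vx (σ k) k with hx
  have hb : ∀ k k', k ≠ k' → mink (vx (σ k) k) (vx (σ k') k') ≤ -3 / 8 := fun k k' h =>
    (mink_vx_bounds (by simp [h])).1
  have h01 := hb 0 1 (by decide)
  have h02 := hb 0 2 (by decide)
  have h12 := hb 1 2 (by decide)
  have hv : ∀ b k, mink x (vx b k) < 0 := by
    intro b k
    have h1 : ∀ k', k' ≠ k → mink (vx (σ k') k') (vx b k) ≤ -3 / 8 := fun k' h =>
      (mink_vx_bounds (by simp [h])).1
    have h2 : mink (vx (σ k) k) (vx b k) ≤ 1 / 4 := by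
      by_cases h : σ k = b
      · rw [h, mink_vx_self]
      · have := (mink_vx_bounds (b := σ k) (b' := b) (k := k) (k' := k) (by simp [h])).1
        linarith
    obtain ⟨n1, n2, -⟩ := Edge.add_ne k
    have h3 := h1 _ n1
    have h4 := h1 _ n2
    rw [hx, Edge.sum_cyc _ k]
    simp only [mink_add_left]
    linarith
  have hxx : mink x x < 0 := by
    have e : mink x x = mink x (vx (σ 0) 0) + mink x (vx (σ 1) 1) + mink x (vx (σ 2) 2) := by
      conv_lhs => enter [2]; rw [hx, Fin.sum_univ_three]
      rw [mink_add_right x, mink_add_right x]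
    rw [e]
    linarith [hv (σ 0) 0, hv (σ 1) 1, hv (σ 2) 2]
  have hTh : Th ((0 : ℝ), fun k => sg (σ k)) = x := by
    rw [Th_eq, hx, zero_smul, zero_add]
    refine Finset.sum_congr rfl fun k _ => ?_
    rw [pp_of_pos (b := σ k) (by rw [sg_mul_self]; norm_num), sg_mul_self, one_smul]
  have h0 : 0 < x 0 := by
    rw [hx, Fin.sum_univ_three]
    simp only [Pi.add_apply, vx_zero]
    norm_num
  obtain ⟨q, t, ht, hu, hy, -⟩ := Q.exists_ray (p := (0, fun k => sg (σ k)))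
    (by rw [abs_zero]; exact hTh) h0 hxx fun b k => (hv b k).le
  refine ⟨q, by rw [hu, mul_zero], fun k => ?_⟩
  rw [hy, mul_left_comm, sg_mul_self, mul_one]
  exact ht

theorem not_isEdge_of_face {q : Q} {σ : Fin 3 → Bool} (h : ∀ k, 0 < sg (σ k) * q.y k) :
    ¬ q.IsEdge := by
  rintro ⟨-, k, hk⟩
  have := h k
  rw [hk, mul_zero] at this
  exact this.false

/-- The vertices of the octahedron other than `(false, 0)` and `(true, 0)` span Minkowski space. -/
theorem vx_span {y : V4} (h : ∀ b (k : Fin 3), k ≠ 0 → mink y (vx b k) = 0) : y = 0 := by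
  have h1 := h false 1 (by decide)
  have h2 := h false 2 (by decide)
  have h3 := h true 1 (by decide)
  have h4 := h true 2 (by decide)
  have hr := sqrt3_sq
  simp [mink, vx_false, vx_true, cs, sn] at h1 h2 h3 h4
  have hr0 : √3 ≠ 0 := by positivity
  have e2 : y 2 = 0 := by
    have : √3 * y 2 = 0 := by linarith
    simpa [hr0] using this
  have e1 : y 1 = 0 := by
    have : √3 * y 1 = 0 := by linarith
    simpa [hr0] using this
  rw [e1, e2] at h1 h3
  funext i
  fin_cases i
  · change y 0 = 0; linarith
  · exact e1
  · exact e2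
  · change y 3 = 0; linarith

/-- The flex is not induced by a vector field. -/
theorem not_isTrivialDeformation (n : ℕ) [NeZero n] :
    ¬ (coneStr n).IsTrivialDeformation fieldM := by
  rintro ⟨v, hv⟩
  obtain ⟨Jp, hJp, hp⟩ := global_motion (0 : Fin n) hv (ε := 1) (Or.inl rfl)
  obtain ⟨Jm, hJm, hm⟩ := global_motion (0 : Fin n) hv (ε := -1) (Or.inr rfl)
  -- the relative motion of two copies of the octahedron along a common triangle
  have key : ∀ (σ : Fin 3 → Bool) (k k' : Fin 3), mink ((Jm - Jp) (vx (σ k) k)) (vx (σ k') k')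
      = -2 * sg (σ k) * mink (kap (vx (σ k) k)) (vx (σ k') k') := by
    intro σ k k'
    obtain ⟨q, hu, hy⟩ := exists_face σ
    have hne := not_isEdge_of_face hy
    obtain ⟨J, hJ, hJev⟩ := local_motion hne (hv (pr 0 q))
    set K := Kx q.fold with hK
    have hKs : IsSkew K := Kx_skew _
    obtain ⟨hS, -, hSv, hSS⟩ := Q.S_isIso hu hne
    have hσ : ∀ k, bs (q.y k) = σ k := fun k => bs_of_pos (hy k)
    simp only [hσ] at hSv
    have hKa : ∀ᶠ a : Q in 𝓝 q, Kx a.fold = K := by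
      have h1 : ∀ᶠ a : Q in 𝓝 q, ∀ k, Real.sign (a.y k) = Real.sign (q.y k) := by
        rw [eventually_all]
        exact fun k => Q.eventually_sign fun h => hne ⟨hu, k, h⟩
      filter_upwards [h1] with a ha
      rw [hK, Kx, Kx, Q.yc_fold, Q.yc_fold]
      simp only [ha]
    have hvel : ∀ a, q.vel a = 0 := fun a => by rw [Q.vel, hu, Real.sign_zero, zero_smul]
    -- near a point of the triangle, `J` is the motion of the vector field as seen from the first
    -- copy
    have e1 : J = K + Jp := by
      obtain ⟨a, hau, ha⟩ := (mem_closure_iff_frequently.mp (q.mem_closure_sign (ε := 1)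
        (Or.inl rfl) (by rw [hu,
          mul_zero]))).and_eventually (hJev.and hKa).eventually_nhds |>.exists
      have hau : 0 < 1 * a.u := hau
      refine linearMap_eq_of_fold (q := a) (fun h => by rw [h, mul_zero] at hau; exact hau.false)
        hJ (hKs.add hJp) ?_
      filter_upwards [ha, (isOpen_lt continuous_const
        (by fun_prop : Continuous fun b : Q => 1 * b.u)).mem_nhds hau] with b hb hbu
      have hbu' : 0 < b.u := by have : 0 < 1 * b.u := hbu; linarith
      have h2 := hb.1 hbu'.ne'
      rw [if_neg fun hc => hc.2.not_gt hbu', LinearMap.id_apply, hp b hbu, hvel, zero_add, hb.2,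
        Q.dev_of_nonneg q hbu'.le, one_smul] at h2
      exact h2.symm
    -- the motion as seen from the second copy, which is unfolded by the reflection in the triangle
    have e2 : ∀ z, J (q.S z) = q.S ((Jm - K) z) := by
      obtain ⟨a, hau, ha⟩ := (mem_closure_iff_frequently.mp (q.mem_closure_sign (ε := -1)
        (Or.inr rfl) (by rw [hu,
          mul_zero]))).and_eventually (hJev.and hKa).eventually_nhds |>.exists
      have hau : 0 < -1 * a.u := hau
      have hsk : IsSkew (q.S ∘ₗ J ∘ₗ q.S) := fun x y => by
        simp only [LinearMap.comp_apply]
        rw [← hSS y, hS, hJ, hSS y, ← hS, hSS]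
      have h3 : q.S ∘ₗ J ∘ₗ q.S = Jm + (-1 : ℝ) • K := by
        refine linearMap_eq_of_fold (q := a) (fun h => by rw [h, mul_zero] at hau; exact hau.false)
          hsk (hJm.add (hKs.smul _)) ?_
        filter_upwards [ha, (isOpen_lt continuous_const
          (by fun_prop : Continuous fun b : Q => -1 * b.u)).mem_nhds hau] with b hb hbu
        have hbu' : b.u < 0 := by have : 0 < -1 * b.u := hbu; linarith
        have h2 := hb.1 hbu'.ne
        rw [if_pos ⟨hu, hbu'⟩, hm b hbu, hvel, zero_add, hb.2, Q.dev_of_neg hu hbu'] at h2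
        simp only [LinearMap.comp_apply, LinearMap.add_apply, LinearMap.smul_apply]
        rw [← h2, hSS]
        abel
      intro z
      have h4 := congrArg (fun L : V4 →ₗ[ℝ] V4 => q.S (L z)) h3
      simp only [LinearMap.comp_apply, hSS] at h4
      rw [h4]
      congr 1
      simp [sub_eq_add_neg]
    -- the reflection fixes the vertices of the triangle
    have e3 : mink (J (q.S (vx (σ k) k))) (vx (σ k') k')
        = mink (q.S ((Jm - K) (vx (σ k) k))) (vx (σ k') k') := by rw [e2]
    rw [hSv, ← hSv k', hS, hSv k', e1] at e3
    have e4 : K (vx (σ k) k) = -sg (σ k) • kap (vx (σ k) k) :=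
      Kf_vx (by rw [Q.yc_fold]; exact sign_of_pos (hy k))
    simp only [LinearMap.add_apply, LinearMap.sub_apply, mink_add_left, mink_sub_left, e4,
      mink_smul_left] at e3 ⊢
    linarith
  set D := Jm - Jp with hD
  have hDs : IsSkew D := fun x y => by
    rw [hD, LinearMap.sub_apply, LinearMap.sub_apply, mink_sub_left, mink_sub_right, hJm, hJp]
    ring
  -- the triangles at a vertex determine the relative motion of this vertex, because their other
  -- vertices span Minkowski space
  have hDv : ∀ b, D (vx b 0) = (-2 * sg b) • kap (vx b 0) := by
    intro b
    rw [← sub_eq_zero]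
    refine vx_span fun b' k hk => ?_
    have := key (fun i => if i = 0 then b else b') 0 k
    simp only [if_true, hk, if_false] at this
    rw [mink_sub_left, this, mink_smul_left]
    ring
  -- a skew map preserves the scalar product of the two opposite vertices to first order, but the
  -- flex changes it
  have h1 := hDs (vx false 0) (vx true 0)
  have h2 := kap_skew (vx false 0) (vx true 0)
  rw [hDv, hDv, mink_smul_left, mink_smul_right, h2, mink_kap_vx_zero] at h1
  simp [sg] at h1
  norm_num at h1

/-! ### The components of the singular locus -/

/-- The endpoint `(e.2.1, e.1 + 1)` of an edge is truncated at a point of the edge. -/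
theorem exists_edge_end (e : Edge) : ∃ r : Q, OnEdge e r ∧ (∀ b k, mink r.fold (vx b k) ≤ 0) ∧
    mink r.fold (vx e.2.1 (e.1 + 1)) = 0 := by
  obtain ⟨k, β, β'⟩ := e
  obtain ⟨n1, n2, n3⟩ := Edge.add_ne k
  have hb : ∀ {b b' : Bool} {m m' : Fin 3}, m ≠ m' → mink (vx b m) (vx b' m') ≤ -3 / 8 :=
    fun h => (mink_vx_bounds (by simp [h])).1
  set g := mink (vx β (k + 1)) (vx β' (k + 2)) with hg
  have hg1 : g ≤ -3 / 8 := hb n3.symm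
  set x : V4 := (-4 * g) • vx β (k + 1) + vx β' (k + 2) with hx
  have hv : ∀ b m, mink x (vx b m)
      = -4 * g * mink (vx β (k + 1)) (vx b m) + mink (vx β' (k + 2)) (vx b m) := fun b m => by
    rw [hx, mink_add_left, mink_smul_left]
  have hv0 : mink x (vx β (k + 1)) = 0 := by
    rw [hv, mink_vx_self, mink_comm (vx β' (k + 2)), ← hg]; ring
  have hv1 : mink x (vx β' (k + 2)) = 1 / 4 - 4 * g ^ 2 := by
    rw [hv, mink_vx_self, ← hg]; ring
  have hg2 : 1 / 4 - 4 * g ^ 2 < 0 := by nlinarith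
  have hcore : ∀ b m, mink x (vx b m) ≤ 0 := by
    intro b m
    by_cases h1 : (b, m) = (β, k + 1)
    · obtain ⟨rfl, rfl⟩ := Prod.mk.inj h1
      exact hv0.le
    by_cases h2 : (b, m) = (β', k + 2)
    · obtain ⟨rfl, rfl⟩ := Prod.mk.inj h2
      rw [hv1]; exact hg2.le
    · have h3 := (mink_vx_bounds (Ne.symm h1)).1
      have h4 := (mink_vx_bounds (Ne.symm h2)).1
      rw [hv]
      nlinarith
  obtain ⟨y, y0, y1, y2⟩ : ∃ y : Fin 3 → ℝ, y k = 0 ∧ y (k + 1) = sg β * (-4 * g) ∧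
      y (k + 2) = sg β' :=
    ⟨fun m => if m = k + 1 then sg β * (-4 * g) else if m = k + 2 then sg β' else 0,
      by simp [n1.symm, n2.symm], by simp, by simp [n3]⟩
  have hTh : Th (|(0 : ℝ)|, y) = x := by
    have h1 : ∀ b, pp b (sg β * (-4 * g)) = if b = β then -4 * g else 0 := by
      intro b
      cases b <;> cases β <;> simp [pp, sg] <;> linarith
    have h2 : ∀ b, pp b (sg β') = if b = β' then 1 else 0 := by
      intro b
      cases b <;> cases β' <;> simp [pp, sg]
    have h3 : ∀ b, pp b 0 = 0 := fun b => by simp [pp]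
    rw [Th_eq, Edge.sum_cyc _ k]
    simp only [y0, y1, y2, h1, h2, h3, abs_zero]
    rw [hx]
    cases β <;> cases β' <;> simp
  have h0 : 0 < x 0 := by
    rw [hx, Pi.add_apply, Pi.smul_apply, vx_zero, vx_zero, smul_eq_mul]; linarith
  obtain ⟨q, t, ht, hu, hy, hf⟩ := Q.exists_ray (p := (0, y)) hTh h0 (by
    conv_lhs => enter [2]; rw [hx]
    rw [mink_add_right x, mink_smul_right, hv0, hv1]
    linarith) hcore
  have hy : ∀ m, q.y m = t * y m := hy
  refine ⟨q, ⟨by rw [hu, mul_zero], ?_, Edge.mem_W.mpr ⟨?_, ?_⟩⟩, fun b m => ?_, ?_⟩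
  · change q.y k = 0
    rw [hy, y0, mul_zero]
  · change 0 < sg β * q.y (k + 1)
    rw [hy, y1, mul_left_comm, ← mul_assoc (sg β), sg_mul_self, one_mul]
    exact mul_pos ht (by linarith)
  · change 0 < sg β' * q.y (k + 2)
    rw [hy, y2, mul_left_comm, sg_mul_self, mul_one]
    exact ht
  · rw [hf, mink_smul_left]
    exact mul_nonpos_of_nonneg_of_nonpos ht.le (hcore b m)
  · rw [hf, mink_smul_left, hv0, mul_zero]

theorem OnEdge.visible {e : Edge} {q r : Q} (hq : OnEdge e q) (hr : OnEdge e r)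
    (hc : ∀ b k, mink r.fold (vx b k) ≤ 0) : Q.Visible q r where
  u := by rw [hq.1, zero_mul]
  y m := by
    have h1 := Edge.mem_W.mp hq.2.2
    have h2 := Edge.mem_W.mp hr.2.2
    have key : ∀ {b : Bool} {s t : ℝ}, 0 < sg b * s → 0 < sg b * t → 0 ≤ s * t := by
      intro b s t hs ht
      have := mul_pos hs ht
      rw [mul_mul_mul_comm, sg_mul_self, one_mul] at this
      exact this.le
    rcases Fin.eq_cyc e.1 m with rfl | rfl | rfl
    · rw [hq.2.1, zero_mul]
    · exact key h1.1 h2.1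
    · exact key h1.2 h2.2
  core := hc

theorem isPreconnected_onEdge (e : Edge) : IsPreconnected {q | OnEdge e q} := by
  obtain ⟨r, hr, hc, -⟩ := exists_edge_end e
  refine Q.isPreconnected_of_visible r fun q hq => ⟨OnEdge.visible hq hr hc, fun t => ?_⟩
  have hq : OnEdge e q := hq
  have hv := OnEdge.visible hq hr hc
  have h1 := Edge.mem_W.mp hq.2.2
  have h2 := Edge.mem_W.mp hr.2.2
  refine ⟨?_, ?_, Edge.mem_W.mpr ⟨?_, ?_⟩⟩
  · rw [hv.path_u, hq.1, hr.1]; ring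
  · rw [hv.path_y, hq.2.1, hr.2.1]; ring
  · exact hv.path_pos (l := sg e.2.1 • LinearMap.proj (e.1 + 1) ∘ₗ LinearMap.snd ℝ ℝ _) h1.1.le h2.1
      (Or.inl h1.1)
  · exact hv.path_pos (l := sg e.2.2 • LinearMap.proj (e.1 + 2) ∘ₗ LinearMap.snd ℝ ℝ _) h1.2.le h2.2
      (Or.inl h1.2)

/-- The points of the cone-manifold on an edge of one of the doubles. -/
def edgeSet (p : Fin n × Edge) : Set (Mfd n) := pr p.1 '' {q | OnEdge p.2 q}

/-- The continuation of an edge of one of the doubles beyond its first endpoint. By iteration the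
component of the singular locus is traversed in one direction, because the half-turn exchanges the
first and the second endpoint. -/
def next (p : Fin n × Edge) : Fin n × Edge := (p.1.rev, p.2.map (p.2.1 + 1))

theorem edgeSet_inter_next (p : Fin n × Edge) : (edgeSet p ∩ edgeSet (next p)).Nonempty := by
  obtain ⟨r, hr, -, h0⟩ := exists_edge_end p.2
  have hg := Q.glueBy_glue (q := r) (b := p.2.2.1) (k := p.2.1 + 1)
    (by rw [Q.Collar, h0]; norm_num)
  exact ⟨pr p.1 r, ⟨r, hr, rfl⟩, _, (hr.glue hg).1, (pr_eq_iff.mpr (Or.inr ⟨_, _, rfl, hg⟩)).symm⟩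

theorem mem_singularLocus {m : Mfd n} :
    m ∈ (coneStr n).singularLocus ↔ ∃ p : Fin n × Edge, m ∈ edgeSet p := by
  constructor
  · obtain ⟨i, q, rfl⟩ := pr_surj m
    intro h
    by_cases hq : q.IsEdge
    · obtain ⟨e, he⟩ := exists_onEdge hq
      exact ⟨(i, e), q, he, rfl⟩
    · exact absurd (angle_pr_of_not_isEdge hq) h
  · rintro ⟨⟨i, e⟩, q, hq, rfl⟩
    change (coneStr n).angle (pr i q) ≠ 2 * Real.pi
    rw [angle_pr hq]
    exact fun h => e.theta_lt_pi_iff.2.2 (by linarith)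

/-- At a point of two edges, one of the edges is glued to the other. -/
theorem edgeSet_eq {p p' : Fin n × Edge} {m : Mfd n} (h : m ∈ edgeSet p) (h' : m ∈ edgeSet p') :
    p = p' ∨ ∃ j, p' = (p.1.rev, p.2.map j) := by
  obtain ⟨q, hq, rfl⟩ := h
  obtain ⟨q', hq', he⟩ := h'
  rcases pr_eq_iff.mp he.symm with ⟨h1, rfl⟩ | ⟨b, k, h1, hg⟩
  · exact Or.inl (Prod.ext h1 (hq.unique hq'))
  · exact Or.inr ⟨k, Prod.ext h1 (hq'.unique (OnEdge.glue hg hq).1)⟩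

theorem eventually_edgeSet {p : Fin n × Edge} {m : Mfd n} (h : m ∈ edgeSet p) :
    ∀ᶠ a in 𝓝 m, a ∈ (coneStr n).singularLocus → a ∈ edgeSet p := by
  obtain ⟨q, hq, rfl⟩ := h
  rw [eventually_pr]
  filter_upwards [p.2.wedge.eventually_mem hq.2.2] with a ha has
  refine ⟨a, OnEdge.of_isEdge ha ?_, rfl⟩
  by_contra hne
  exact has (angle_pr_of_not_isEdge hne)

theorem mk_eq_of_edgeSet {p : Fin n × Edge} {x y : (coneStr n).singularLocus}
    (hx : x.1 ∈ edgeSet p) (hy : y.1 ∈ edgeSet p) :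
    (x : ConnectedComponents (coneStr n).singularLocus) = y := by
  have h1 : IsPreconnected (edgeSet p) :=
    (isPreconnected_onEdge p.2).image _ (continuous_pr p.1).continuousOn
  have h2 : IsPreconnected ((↑) ⁻¹' edgeSet p : Set (coneStr n).singularLocus) := by
    rw [← Topology.IsInducing.subtypeVal.isPreconnected_image, Subtype.image_preimage_coe,
      Set.inter_eq_right.mpr fun m hm => mem_singularLocus.mpr ⟨p, hm⟩]
    exact h1
  exact ConnectedComponents.coe_eq_coe'.mpr (h2.subset_connectedComponent hy hx)

/-- The components of the singular locus correspond to the labels of the edges, if continued edges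
have the same label, and edges of the same label continue each other. -/
theorem exists_components {L : Type} (lab : Fin n × Edge → L) (hs : Function.Surjective lab)
    (hmap : ∀ i e j, lab (i.rev, Edge.map j e) = lab (i, e))
    (hnext : ∀ p p', lab p = lab p' → ∃ k : Fin 6, next^[k] p = p') :
    ∃ φ : ConnectedComponents (coneStr n).singularLocus ≃ L,
      ∀ (x : (coneStr n).singularLocus) (p), x.1 ∈ edgeSet p → φ x = lab p := by
  let _ : TopologicalSpace L := ⊥
  have : DiscreteTopology L := ⟨rfl⟩
  have hex : ∀ x : (coneStr n).singularLocus, ∃ p, x.1 ∈ edgeSet p := fun x =>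
    mem_singularLocus.mp x.2
  choose P hP using hex
  have hlab : ∀ (x : (coneStr n).singularLocus) (p), x.1 ∈ edgeSet p → lab (P x) = lab p := by
    intro x p hp
    rcases edgeSet_eq (hP x) hp with h | ⟨j, h⟩
    · rw [h]
    · rw [h]; exact (hmap _ _ j).symm
  have hc : Continuous (lab ∘ P) := by
    refine ((IsLocallyConstant.iff_eventually_eq _).mpr fun x => ?_).continuous
    have := continuous_subtype_val.continuousAt.eventually (eventually_edgeSet (hP x))
    filter_upwards [this] with a ha
    exact hlab a _ (ha a.2)
  have hnon : ∀ p : Fin n × Edge, ∃ x : (coneStr n).singularLocus, x.1 ∈ edgeSet p := fun p => by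
    obtain ⟨m, hm, -⟩ := edgeSet_inter_next p
    exact ⟨⟨m, mem_singularLocus.mpr ⟨p, hm⟩⟩, hm⟩
  have hiter : ∀ (k : ℕ) (p : Fin n × Edge) (x y : (coneStr n).singularLocus), x.1 ∈ edgeSet p →
      y.1 ∈ edgeSet (next^[k] p) → (x : ConnectedComponents (coneStr n).singularLocus) = y := by
    intro k
    induction k with
    | zero => exact fun p x y hx hy => mk_eq_of_edgeSet hx hy
    | succ k ih =>
      intro p x y hx hy
      obtain ⟨m, hm, hm'⟩ := edgeSet_inter_next p
      set z : (coneStr n).singularLocus := ⟨m, mem_singularLocus.mpr ⟨p, hm⟩⟩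
      exact (mk_eq_of_edgeSet (y := z) hx hm).trans (ih (next p) z y hm' hy)
  have hlift : ∀ x : (coneStr n).singularLocus, hc.connectedComponentsLift x = lab (P x) :=
    fun x => hc.connectedComponentsLift_apply_coe x
  refine ⟨Equiv.ofBijective hc.connectedComponentsLift ⟨?_, fun l => ?_⟩, fun x p hp => ?_⟩
  · intro c c' h
    obtain ⟨x, rfl⟩ := ConnectedComponents.surjective_coe c
    obtain ⟨y, rfl⟩ := ConnectedComponents.surjective_coe c'
    rw [hlift, hlift] at h
    obtain ⟨k, hk⟩ := hnext _ _ h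
    exact hiter k (P x) x y (hP x) (by rw [hk]; exact hP y)
  · obtain ⟨p, rfl⟩ := hs l
    obtain ⟨x, hx⟩ := hnon p
    exact ⟨x, by rw [hlift]; exact hlab x p hx⟩
  · exact (hlift x).trans (hlab x p hp)

/-- The cone angle at an edge is twice the dihedral angle, and the dihedral angle is larger than `π`
exactly for the edges of type `(false, true)`. -/
theorem exactlyOneLargeComponent {L : Type} {lab : Fin n × Edge → L}
    (φ : ConnectedComponents (coneStr n).singularLocus ≃ L)
    (hφ : ∀ (x : (coneStr n).singularLocus) (p), x.1 ∈ edgeSet p → φ x = lab p) (l : L)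
    (hl : ∀ p, lab p = l ↔ p.2.2 = (false, true)) : (coneStr n).ExactlyOneLargeComponent := by
  refine ⟨φ.symm l, fun x => ?_⟩
  obtain ⟨p, hp⟩ := mem_singularLocus.mp x.2
  have h1 : (coneStr n).angle x = 2 * p.2.theta := by
    obtain ⟨q, hq, hqx⟩ := hp
    rw [← hqx]; exact angle_pr hq
  have h2 : Real.pi < p.2.theta ↔ p.2.2 = (false, true) := by
    rw [p.2.theta_lt_pi_iff.2.1]
    obtain ⟨-, k, β, β'⟩ := p
    cases β <;> cases β' <;> norm_num [esg]
  rw [Equiv.eq_symm_apply, hφ x p hp, hl, h1, ← h2]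
  constructor <;> intro h <;> linarith

/-- The labels of the edges for one copy of the double: edges that join vertices of the same
triangle `ABC` or `A'B'C'`, concave edges, and the other edges. -/
def labOne (p : Fin 1 × Edge) : Fin 3 :=
  if p.2.2.1 = p.2.2.2 then 0 else if p.2.2.2 then 1 else 2

/-- The labels of the edges for two copies of the double. The edges that join vertices of the same
triangle form two classes, because the gluing maps exchange both the sheets and the triangles `ABC`
and `A'B'C'`. -/
def labTwo (p : Fin 2 × Edge) : Fin 4 :=
  if p.2.2.1 = p.2.2.2 then (if p.2.2.1 = (p.1 = 0) then 0 else 3) else if p.2.2.2 then 1 else 2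

theorem singular_one : Nat.card (ConnectedComponents (coneStr 1).singularLocus) = 3 ∧
    (coneStr 1).ExactlyOneLargeComponent := by
  obtain ⟨φ, hφ⟩ := exists_components labOne (by decide) (by decide) (by decide)
  exact ⟨by rw [Nat.card_congr φ, Nat.card_fin], exactlyOneLargeComponent φ hφ 1 (by decide)⟩

theorem singular_two : Nat.card (ConnectedComponents (coneStr 2).singularLocus) = 4 ∧
    (coneStr 2).ExactlyOneLargeComponent := by
  obtain ⟨φ, hφ⟩ := exists_components labTwo (by decide) (by decide) (by decide)
  exact ⟨by rw [Nat.card_congr φ, Nat.card_fin], exactlyOneLargeComponent φ hφ 1 (by decide)⟩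

/-! ### Connectedness -/

theorem isPreconnected_half {ε : ℝ} (hε : ε = 1 ∨ ε = -1) : IsPreconnected {a : Q | 0 ≤ ε * a.u} :=
    by
  refine Q.isPreconnected_of_visible (Q.center ε hε) fun q hq => ?_
  have hq : 0 ≤ ε * q.u := hq
  refine ⟨Q.visible_center hε hq, fun t => ?_⟩
  rcases eq_or_ne t 0 with rfl | ht
  · rw [Q.Visible.path_zero]; exact hq
  · refine ((Q.visible_center hε hq).path_pos (l := ε • LinearMap.fst ℝ ℝ (Fin 3 → ℝ)) hq ?_
      (Or.inr (lt_of_le_of_ne t.2.1 fun h => ht (Subtype.ext h.symm)))).le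
    change 0 < ε * ε
    rcases hε with rfl | rfl <;> norm_num

instance : PreconnectedSpace Q := by
  refine ⟨?_⟩
  obtain ⟨q, hq, -⟩ := exists_face fun _ => false
  have h := (isPreconnected_half (Or.inl rfl)).union q (by simp [hq]) (by simp [hq])
    (isPreconnected_half (Or.inr rfl))
  convert h using 1
  ext a
  simpa using le_total 0 a.u

theorem connectedSpace_of_rev [NeZero n] (h : ∀ i : Fin n, i = 0 ∨ i = (0 : Fin n).rev) :
    ConnectedSpace (Mfd n) := by
  obtain ⟨p, q, hg, -⟩ := exists_glueBy
  have hr : ∀ i : Fin n, IsPreconnected (Set.range (pr i)) := fun i =>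
    isPreconnected_range (continuous_pr i)
  have hpq : pr (0 : Fin n) p ∈ Set.range (pr (0 : Fin n).rev) :=
    ⟨q, (pr_eq_iff.mpr (Or.inr ⟨_, _, rfl, hg⟩)).symm⟩
  have h1 := (hr 0).union (pr 0 p) (Set.mem_range_self p) hpq (hr (0 : Fin n).rev)
  have h2 : Set.range (pr (0 : Fin n)) ∪ Set.range (pr (0 : Fin n).rev) = Set.univ := by
    refine Set.eq_univ_of_forall fun m => ?_
    obtain ⟨i, a, rfl⟩ := pr_surj m
    rcases h i with rfl | rfl
    · exact Or.inl ⟨a, rfl⟩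
    · exact Or.inr ⟨a, rfl⟩
  rw [h2] at h1
  exact { isPreconnected_univ := h1, toNonempty := ⟨pr 0 p⟩ }

/-! ### The decomposition into truncated octahedra -/

theorem Th_sg (c : ℝ) (σ : Fin 3 → Bool) {d : Fin 3 → ℝ} (hd : ∀ k, 0 ≤ d k) :
    Th (c, fun k => sg (σ k) * d k) = c • e0 + ∑ k, d k • vx (σ k) k := by
  have h1 : ∀ k b, pp b (sg (σ k) * d k) = if b = σ k then d k else 0 := by
    intro k b
    have := hd k
    cases b <;> cases σ k <;> simp [pp, sg, this]
  rw [Th_eq]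
  simp only [h1]
  congr 1
  refine Finset.sum_congr rfl fun k _ => ?_
  cases σ k <;> simp

/-- Every point lies in the simplicial cone over a triangle, extended beyond the triangle. -/
theorem eq_cone (x : V4) : ∃ σ : Fin 3 → Bool, (∀ k, 0 ≤ sg (σ k) * yc x k) ∧
    x = c0 x • e0 + ∑ k, (sg (σ k) * yc x k) • vx (σ k) k := by
  have h : ∀ k, ∃ b, 0 ≤ sg b * yc x k := fun k => by
    rcases le_total 0 (yc x k) with h | h
    · exact ⟨false, by simpa [sg] using h⟩
    · exact ⟨true, by simpa [sg] using h⟩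
  choose σ hσ using h
  refine ⟨σ, hσ, ?_⟩
  rw [← Th_sg _ _ hσ]
  simp only [← mul_assoc, sg_mul_self, one_mul]
  exact (Th_c0_yc x).symm

theorem mem_truncOct {x : V4} : x ∈ truncOct 1 (1 / 2) ↔
    InH x ∧ 0 ≤ c0 x ∧ ∀ b k, mink x (vx b k) ≤ 0 := by
  constructor
  · rintro ⟨h1, h2, ⟨σ, c, d, hc, hd, hx⟩, h3⟩
    have hx : x = Th (c, fun k => sg (σ k) * d k) := hx.trans (Th_sg c σ hd).symm
    refine ⟨⟨h1, h2⟩, ?_, h3⟩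
    rw [hx, c0_Th]
    exact hc
  · rintro ⟨h1, h2, h3⟩
    obtain ⟨σ, hσ, hx⟩ := eq_cone x
    exact ⟨h1.1, h1.2, ⟨σ, _, _, h2, hσ, hx⟩, h3⟩

theorem c0_of_face {x : V4} {σ : Fin 3 → Bool} (hx : x ∈ truncOctFace 1 (1 / 2) (Sum.inl σ)) :
    c0 x = 0 := by
  obtain ⟨-, d, hd, hx⟩ := hx
  have hx : x = Th (0, fun k => sg (σ k) * d k) := by
    rw [Th_sg 0 σ hd, zero_smul, zero_add]
    exact hx
  rw [hx, c0_Th]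

theorem of_mem_interior {x : V4} (hx : x ∈ truncOctInterior 1 (1 / 2)) :
    0 < c0 x ∧ ∀ b k, mink x (vx b k) < 0 := by
  obtain ⟨h1, h2⟩ := hx
  rw [Set.mem_iUnion, not_exists] at h2
  obtain ⟨-, h4, h5⟩ := mem_truncOct.mp h1
  refine ⟨lt_of_le_of_ne h4 fun h => ?_, fun b k => lt_of_le_of_ne (h5 b k) fun h =>
    h2 (Sum.inr (b, k)) ⟨h1, h⟩⟩
  obtain ⟨σ, hσ, hx⟩ := eq_cone x
  rw [← h, zero_smul, zero_add] at hx
  exact h2 (Sum.inl σ) ⟨h1, _, hσ, hx⟩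

theorem octHyperideal : OctHyperideal 1 (1 / 2) := by
  refine ⟨one_pos, by norm_num, fun b k => ?_, fun b k b' k' h => ?_⟩
  · change 0 < mink (vx b k) (vx b k)
    rw [mink_vx_self]; norm_num
  · refine ⟨midpoint ℝ (vx b k) (vx b' k'), midpoint_mem_segment _ _, ?_⟩
    have h1 := (mink_vx_bounds (b := b) (b' := b') (k := k) (k' := k') (by simp [h])).1
    rw [midpoint_eq_smul_add]
    simp only [mink_smul_left, mink_smul_right, mink_add_left, mink_add_right, mink_vx_self,
      mink_comm (vx b' k') (vx b k)]
    norm_num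
    linarith

open Classical in
/-- The point of the double over a point of the octahedron, in the copy given by `β`. -/
def toQ (β : Bool) (x : V4) : Q :=
  if h : x ∈ truncOct 1 (1 / 2) then
    Q.mk (sg β * c0 x) x (by
      have h1 : |sg β| = 1 := by cases β <;> simp [sg]
      rw [abs_mul, h1, one_mul, abs_of_nonneg (mem_truncOct.mp h).2.1]) (mem_truncOct.mp h).1
      fun b k => ((mem_truncOct.mp h).2.2 b k).trans_lt (by norm_num)
  else Q.center 1 (Or.inl rfl)

theorem toQ_u (β : Bool) {x : V4} (hx : x ∈ truncOct 1 (1 / 2)) : (toQ β x).u = sg β * c0 x := by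
  rw [toQ, dif_pos hx, Q.mk_u]

theorem toQ_fold (β : Bool) {x : V4} (hx : x ∈ truncOct 1 (1 / 2)) : (toQ β x).fold = x := by
  rw [toQ, dif_pos hx, Q.mk_fold]

theorem continuousOn_toQ (β : Bool) : ContinuousOn (toQ β) (truncOct 1 (1 / 2)) := by
  rw [Topology.IsEmbedding.subtypeVal.continuousOn_iff]
  have hc : Continuous fun x : V4 => (sg β * c0 x, yc x) := by fun_prop
  refine hc.continuousOn.congr fun x hx => ?_
  simp only [Function.comp_apply, toQ, dif_pos hx]
  rfl

theorem exists_toQ {q : Q} (hq : q ∈ Qcore) : q.fold ∈ truncOct 1 (1 / 2) ∧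
    ∃ β, toQ β q.fold = q := by
  have hm : q.fold ∈ truncOct 1 (1 / 2) := mem_truncOct.mpr ⟨q.inH, q.c0_nonneg, hq⟩
  refine ⟨hm, ?_⟩
  obtain ⟨β, hβ⟩ : ∃ β, sg β * |q.u| = q.u := by
    rcases le_total 0 q.u with h | h
    · exact ⟨false, by simp [sg, abs_of_nonneg h]⟩
    · exact ⟨true, by simp [sg, abs_of_nonpos h]⟩
  exact ⟨β, Q.ext_fold (by rw [toQ_u β hm, q.c0_fold, hβ]) (toQ_fold β hm)⟩

theorem toQ_injective {i j : Fin n} {β γ : Bool} {x y : V4}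
    (hx : x ∈ truncOctInterior 1 (1 / 2)) (hy : y ∈ truncOctInterior 1 (1 / 2))
    (h : pr i (toQ β x) = pr j (toQ γ y)) : (i, β) = (j, γ) ∧ x = y := by
  obtain ⟨hx0, hxv⟩ := of_mem_interior hx
  obtain ⟨hy0, hyv⟩ := of_mem_interior hy
  rcases pr_eq_iff.mp h with ⟨rfl, h1⟩ | ⟨b, k, -, hg⟩
  · have h2 := congrArg Q.u h1
    have h3 := congrArg Q.fold h1
    rw [toQ_u β hx.1, toQ_u γ hy.1] at h2
    rw [toQ_fold β hx.1, toQ_fold γ hy.1] at h3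
    refine ⟨?_, h3⟩
    cases β <;> cases γ <;>
      first
      | rfl
      | exfalso
        simp only [sg, if_true, Bool.false_eq_true, if_false] at h2
        linarith
  · have h1 := mink_gl b k (toQ β x).fold
    rw [← hg.2, toQ_fold β hx.1, toQ_fold γ hy.1] at h1
    linarith [hxv b k, hyv (!b) k]

/-- The copies of the truncated octahedron are embedded isometrically. -/
theorem coneCosh_toQ (i : Fin n) (β : Bool) {x : V4} (hx : x ∈ truncOctInterior 1 (1 / 2)) :
    ∃ U ∈ 𝓝 x, ∀ y ∈ U ∩ truncOctInterior 1 (1 / 2), ∀ z ∈ U ∩ truncOctInterior 1 (1 / 2),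
      coneCosh ((coneStr n).angle (pr i (toQ β x)))
        ((coneStr n).chart (pr i (toQ β x)) (pr i (toQ β y)))
        ((coneStr n).chart (pr i (toQ β x)) (pr i (toQ β z))) = -mink y z := by
  set q := toQ β x with hq
  have hu : q.u ≠ 0 := by
    rw [hq, toQ_u β hx.1]
    have := (of_mem_interior hx).1.ne'
    cases β <;> simp [sg, this]
  obtain ⟨_, -, h⟩ := exists_devAt (mem_chartM (pr i q)) fun he => hu he.1
  have h1 := h.coneCosh_eq (continuousAt_chartM (mem_chartM (pr i q)))
  rw [nhds_prod_eq, Filter.eventually_prod_self_iff'] at h1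
  obtain ⟨V, hV, h2⟩ := h1
  obtain ⟨U, hU, hUV⟩ := mem_nhdsWithin_iff_exists_mem_nhds_inter.mp
    ((continuousOn_toQ β x hx.1).preimage_mem_nhdsWithin hV)
  refine ⟨U, hU, fun y hy z hz => ?_⟩
  have h3 := h2 _ (hUV ⟨hy.1, hy.2.1⟩) _ (hUV ⟨hz.1, hz.2.1⟩)
  rw [Q.dev_of_ne hu, Q.dev_of_ne hu, toQ_fold β hy.2.1, toQ_fold β hz.2.1] at h3
  exact h3

theorem tj_mem_truncOct (k : Fin 3) {x : V4} (hx : x ∈ truncOct 1 (1 / 2)) :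
    tj k x ∈ truncOct 1 (1 / 2) := by
  obtain ⟨h1, h2, h3⟩ := mem_truncOct.mp hx
  refine mem_truncOct.mpr ⟨⟨by rw [tj_isIso k, h1.1], by rw [tj_apply]; exact h1.2⟩, ?_,
    fun b m => ?_⟩
  · rw [← Th_c0_yc x, tj_Th, c0_Th]
    exact h2
  · have := h3 (!b) (tau k m)
    rw [← tj_isIso k, tj_vx, Bool.not_not, tau_tau] at this
    exact this

theorem tj_image_face (b : Bool) (k : Fin 3) : tj k '' truncOctFace 1 (1 / 2) (Sum.inr (b, k))
    = truncOctFace 1 (1 / 2) (Sum.inr (!b, k)) := by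
  have key : ∀ (b : Bool) (x : V4), x ∈ truncOctFace 1 (1 / 2) (Sum.inr (b, k)) →
      tj k x ∈ truncOctFace 1 (1 / 2) (Sum.inr (!b, k)) := by
    rintro b x ⟨h1, h2⟩
    refine ⟨tj_mem_truncOct k h1, ?_⟩
    change mink (tj k x) (vx (!b) k) = 0
    rw [← tj_vx_self, tj_isIso]
    exact h2
  refine Set.Subset.antisymm (Set.image_subset_iff.mpr (key b)) fun x hx => ?_
  refine ⟨tj k x, ?_, tj_tj k x⟩
  have := key _ x hx
  rwa [Bool.not_not] at this

/-- The triangles are glued to those of the other copy in the double by the identity, and the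
truncation faces of opposite vertices are glued by half-turns. -/
theorem isGluedFromTruncOct (n : ℕ) : (coneStr n).IsGluedFromTruncOct := by
  set E : Fin (Fintype.card (Fin n × Bool)) ≃ Fin n × Bool := (Fintype.equivFin _).symm
  refine ⟨1, 1 / 2, _, fun a x => pr (E a).1 (toQ (E a).2 x), octHyperideal, fun a => ?_, ?_, ?_,
    fun a x hx => coneCosh_toQ (E a).1 (E a).2 hx, ?_⟩
  · exact (continuous_pr _).comp_continuousOn (continuousOn_toQ _)
  · refine Set.eq_univ_of_forall fun m => ?_
    obtain ⟨i, q, hq, rfl⟩ := exists_core m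
    obtain ⟨h1, β, h2⟩ := exists_toQ hq
    refine Set.mem_iUnion.mpr ⟨E.symm (i, β), q.fold, h1, ?_⟩
    simp only [Equiv.apply_symm_apply, h2]
  · intro a a' x hx y hy h
    obtain ⟨h1, h2⟩ := toQ_injective hx hy h
    exact ⟨E.injective h1, h2⟩
  · rintro a (σ | ⟨b, k⟩)
    · refine ⟨E.symm ((E a).1, !(E a).2), Sum.inl σ, fun h => ?_, LinearMap.id, fun _ _ => rfl,
        Set.image_id _, fun x hx => ?_⟩
      · have h1 := congrArg (fun p => (E p.1).2) h
        simp at h1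
      · simp only [Equiv.apply_symm_apply, LinearMap.id_apply]
        congr 1
        refine Q.ext_fold ?_ ?_
        · rw [toQ_u _ hx.1, toQ_u _ hx.1, c0_of_face hx, mul_zero, mul_zero]
        · rw [toQ_fold _ hx.1, toQ_fold _ hx.1]
    · refine ⟨E.symm ((E a).1.rev, (E a).2), Sum.inr (!b, k), fun h => ?_, tj k, tj_isIso k,
        tj_image_face b k, fun x hx => ?_⟩
      · have h1 := (Prod.mk.inj h).2
        simp at h1
      · simp only [Equiv.apply_symm_apply]
        have hx' := tj_mem_truncOct k hx.1
        refine (pr_eq_iff.mpr (Or.inr ⟨b, k, rfl, ?_, ?_⟩)).symm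
        · rw [toQ_u _ hx.1, toQ_u _ hx']
          congr 1
          conv_lhs => rw [← Th_c0_yc x, tj_Th, c0_Th]
        · rw [toQ_fold _ hx.1, toQ_fold _ hx', gl_of_orth hx.2]

end TwOct
end

theorem theoremB :
    (∃ (M : Type) (_ : TopologicalSpace M) (C : HypConeStructure M),
      CompactSpace M ∧ T2Space M ∧ ConnectedSpace M ∧
      ¬ C.Orientable ∧ C.InfinitesimallyFlexible ∧
      Nat.card (ConnectedComponents C.singularLocus) = 3 ∧
      C.ExactlyOneLargeComponent ∧ C.IsGluedFromTruncOct) ∧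
    (∃ (M : Type) (_ : TopologicalSpace M) (C : HypConeStructure M),
      CompactSpace M ∧ T2Space M ∧ ConnectedSpace M ∧
      C.Orientable ∧ C.InfinitesimallyFlexible ∧
      Nat.card (ConnectedComponents C.singularLocus) = 4 ∧
      C.ExactlyOneLargeComponent ∧ C.IsGluedFromTruncOct) := by
  open TwOct in
  exact ⟨⟨Mfd 1, inferInstance, coneStr 1, inferInstance, inferInstance,
      connectedSpace_of_rev (by decide), not_orientable_one,
      ⟨fieldM, isInfDeformation 1, not_isTrivialDeformation 1⟩, singular_one.1, singular_one.2,
      isGluedFromTruncOct 1⟩,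
    ⟨Mfd 2, inferInstance, coneStr 2, inferInstance, inferInstance,
      connectedSpace_of_rev (by decide), orientable_two,
      ⟨fieldM, isInfDeformation 2, not_isTrivialDeformation 2⟩, singular_two.1, singular_two.2,
      isGluedFromTruncOct 2⟩⟩
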